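/- Let $n,K\in\mathbb N$ with $K\ge 2$, let $f\in C^K(\mathbb R^n;\mathbb R^n)$, $c\in\mathbb R$, and let $\bar u\in C^2(\mathbb R;\mathbb R^n)$ be a nonconstant $1$-periodic solution of $\bar u''+c\bar u'+f(\bar u)=0$, i.e. a standing wave of $u_t-cu_x=u_{xx}+f(u)$. Let $L=\partial_x^2+c\,\partial_x+df(\bar u(x))$ be the linearized operator and let $L_\xi=e^{-i\xi x}Le^{i\xi x}$, $\xi\in[-\pi,\pi]$, be its Bloch operators, acting on $L^2_{\rm per}([0,1];\mathbb C^n)$ with domain $H^2_{\rm per}([0,1];\mathbb C^n)$. Assume: (D1) $0$ is an (algebraically) simple eigenvalue of $L_0$, and every other point of $\sigma(L_0)$ has negative real part; (D2) there is $\theta>0$ with $\operatorname{Re}\sigma(L_\xi)\le-\theta|\xi|^2$ for all $\xi\in[-\pi,\pi]$. Then the Green kernel $G(x,t;y)=e^{Lt}\delta_y(x)$ exists, i.e. there is a kernel $G$, continuous for $t>0$ and with Gaussian bounds $|G(x,t;y)|\le C_Tt^{-1/2}e^{-a_T|x-y|^2/t}$, $a_T>0$, on each $0<t\le T$, with $(\partial_t-L)G(\cdot,\cdot;y)=\delta_{(y,0)}I$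 in the sense of distributions on $\mathbb R^2$ (where $G=0$ for $t<0$); and there is $\varepsilon_0>0$ such that the following holds. There are real-analytic families $\mu(\xi)\in\mathbb C$ and $q(\cdot,\xi),\tilde q(\cdot,\xi)\in C_{\rm per}([0,1];\mathbb C^n)$, $|\xi|<\varepsilon_0$, with $\mu(0)=0$, $q(\cdot,0)=\bar u'$, $L_\xi q(\cdot,\xi)=\mu(\xi)q(\cdot,\xi)$, with $\tilde q(\cdot,\xi)$ a left eigenfunction (row vector) of $L_\xi$ for $\mu(\xi)$, that is $$(\partial_x-i\xi)^2\tilde q-c(\partial_x-i\xi)\tilde q+\tilde q\,df(\bar u)=\mu(\xi)\tilde q ,$$ and with $\int_0^1\tilde q(x,\xi)q(x,\xi)\,dx=1$. For every such $(\mu,q,\tilde q)$, every $0<\varepsilon<\varepsilon_0/2$, every smooth $\phi:\mathbb R\to\mathbb R$ with $\phi=1$ for $|\xi|\le\varepsilon$ and $\phi=0$ for $|\xi|\ge2\varepsilon$, and every smooth $\chi:\mathbb R\to\mathbb R$ with $\chi=0$ on $[0,1]$ and $\chi=1$ on $[2,\infty)$, put $$e(x,t;y)=\chi(t)\,\frac1{2\pi}\int_{\mathbb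 R}e^{i\xi(x-y)}\phi(\xi)e^{\mu(\xi)t}\tilde q(y,\xi)\,d\xi,$$ a $\mathbb C^n$-valued row vector. Then $e$ is $C^{K+1}$ in $y$, its $y$-derivatives of order at most $K+1$ are $C^\infty$ in $(x,t)$, and the Green kernel decomposes for $t>0$ as $$G(x,t;y)=\bar u'(x)e(x,t;y)+\widetilde G(x,t;y),$$ where: (i) there is $C>0$ such that for all $2\le p\le\infty$, $t>0$ and $g\in L^1(\mathbb R;\mathbb C^n)\cap L^2(\mathbb R;\mathbb C^n)$, $$\Big\|\int_{-\infty}^\infty\widetilde G(\cdot,t;y)g(y)\,dy\Big\|_{L^p(\mathbb R)}\le C(1+t)^{-\frac34}\,t^{-\frac12\left(\frac12-\frac1p\right)}\big(\|g\|_{L^1(\mathbb R)}+\|g\|_{L^2(\mathbb R)}\big);$$ (ii) for all integers $j,k,r\ge0$ with $j+r\le K+1$ there is $C>0$ such that for all $2\le p\le\infty$, $t>0$ and $g\in L^1(\mathbb R;\mathbb C^n)$, $$\Big\|\int_{-\infty}^\infty\partial_x^j\partial_t^k\partial_y^re(\cdot,t;y)g(y)\,dy\Big\|_{L^p(\mathbb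 R)}\le C(1+t)^{-\frac12\left(1-\frac1p\right)-\frac{j+k}2}\|g\|_{L^1(\mathbb R)}.$$ All integrals in $y$ converge absolutely. -/

import Mathlib

open MeasureTheory

noncomputable section

/-- The matrix `df(u(x))`: the Jacobian matrix of `f` along the profile `u`. -/
def profileJacobian {n : ℕ} (f : EuclideanSpace ℝ (Fin n) → EuclideanSpace ℝ (Fin n))
    (u : ℝ → EuclideanSpace ℝ (Fin n)) (x : ℝ) : Matrix (Fin n) (Fin n) ℝ :=
  Matrix.of fun i j => fderiv ℝ f (u x) (EuclideanSpace.single j 1) i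

/-- A real matrix acting on `ℂⁿ`. -/
def realMatrixAct {n : ℕ} (M : Matrix (Fin n) (Fin n) ℝ) :
    EuclideanSpace ℂ (Fin n) →L[ℂ] EuclideanSpace ℂ (Fin n) :=
  Matrix.toEuclideanCLM (n := Fin n) (𝕜 := ℂ) (M.map (fun a : ℝ => (a : ℂ)))

/-- A real vector seen in `ℂⁿ`. -/
def complexify {n : ℕ} (v : EuclideanSpace ℝ (Fin n)) : EuclideanSpace ℂ (Fin n) :=
  WithLp.toLp 2 fun i => (v i : ℂ)

/-- The bilinear (not sesquilinear) pairing `∑ᵢ aᵢ bᵢ` on `ℂⁿ`: row vector times column vector. -/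
def bilinPair {n : ℕ} (a b : EuclideanSpace ℂ (Fin n)) : ℂ := ∑ i, a i * b i

/-- `u` is a `1`-periodic, nonconstant standing wave of `u_t - c u_x = u_xx + f(u)`. -/
structure IsPeriodicProfile {n : ℕ} (f : EuclideanSpace ℝ (Fin n) → EuclideanSpace ℝ (Fin n))
    (c : ℝ) (u : ℝ → EuclideanSpace ℝ (Fin n)) : Prop where
  contDiff : ContDiff ℝ 2 u
  periodic : Function.Periodic u 1
  nonconstant : ∃ x y, u x ≠ u y
  profile_eq : ∀ x, deriv (deriv u) x + c • deriv u x + f (u x) = 0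

/-- Membership in `L²_per([0,1]; ℂⁿ)`, for `1`-periodic functions on the line. -/
def MemL2Per {n : ℕ} (h : ℝ → EuclideanSpace ℂ (Fin n)) : Prop :=
  Function.Periodic h 1 ∧ MemLp h 2 (volume.restrict (Set.Ioc (0 : ℝ) 1))

/-- `BlochMaps M c ξ w h` says that `w` lies in `H²_per([0,1]; ℂⁿ)` and that
`(∂ₓ + iξ)² w + c (∂ₓ + iξ) w + M w = h` almost everywhere, i.e. `w` is in the domain of the Bloch
operator `L_ξ = e^{-iξx} (∂ₓ² + c ∂ₓ + M) e^{iξx}` and `L_ξ w = h`.  An element of `H²_per` is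
represented by its `C¹` version; `w₁ = w'` and `w₂ = w''` (the weak second derivative). -/
def BlochMaps {n : ℕ} (M : ℝ → Matrix (Fin n) (Fin n) ℝ) (c ξ : ℝ)
    (w h : ℝ → EuclideanSpace ℂ (Fin n)) : Prop :=
  Function.Periodic w 1 ∧ ∃ w₁ w₂ : ℝ → EuclideanSpace ℂ (Fin n),
    (∀ x, HasDerivAt w (w₁ x) x) ∧ Function.Periodic w₁ 1 ∧ Continuous w₁ ∧ MemL2Per w₂ ∧
    (∀ x, w₁ x = w₁ 0 + ∫ s in (0 : ℝ)..x, w₂ s) ∧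
    ∀ᵐ x, (w₂ x + (2 * Complex.I * (ξ : ℂ)) • w₁ x - ((ξ : ℂ) ^ 2) • w x)
      + (c : ℂ) • (w₁ x + (Complex.I * (ξ : ℂ)) • w x) + realMatrixAct (M x) (w x) = h x

/-- The spectrum of the closed operator `L_ξ` on `L²_per` with domain `H²_per`: those `lam` for
which `lam - L_ξ : H²_per → L²_per` is not bijective. -/
def blochSpectrum {n : ℕ} (M : ℝ → Matrix (Fin n) (Fin n) ℝ) (c ξ : ℝ) : Set ℂ :=
  {lam | ¬ ∀ h : ℝ → EuclideanSpace ℂ (Fin n), MemL2Per h →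
    ∃! w : ℝ → EuclideanSpace ℂ (Fin n), BlochMaps M c ξ w (fun x => lam • w x - h x)}

/-- `lam` is an (algebraically) simple eigenvalue of `L_ξ`: the eigenspace is spanned by one `w`,
and there is no generalized eigenvector above `w`. -/
def IsSimpleBlochEigenvalue {n : ℕ} (M : ℝ → Matrix (Fin n) (Fin n) ℝ) (c ξ : ℝ) (lam : ℂ) :
    Prop :=
  ∃ w : ℝ → EuclideanSpace ℂ (Fin n), w ≠ 0 ∧ BlochMaps M c ξ w (fun x => lam • w x) ∧
    (∀ v, BlochMaps M c ξ v (fun x => lam • v x) → ∃ a : ℂ, v = fun x => a • w x) ∧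
    ∀ v, ¬ BlochMaps M c ξ v (fun x => lam • v x + w x)

/-- `G(x,t;y)` is the Green kernel `e^{Lt} δ_y (x)` of `L = ∂ₓ² + c ∂ₓ + M(x)`: the fundamental
solution `(∂ₜ - L) G(·,·;y) = δ_{(y,0)} I` in the sense of distributions on `ℝ²`
(with `G = 0` for `t < 0`), continuous for `t > 0` and with Gaussian bounds on bounded time
intervals.  These properties determine `G` uniquely for `t > 0`. -/
structure IsGreenKernel {n : ℕ} (M : ℝ → Matrix (Fin n) (Fin n) ℝ) (c : ℝ)
    (G : ℝ → ℝ → ℝ → Matrix (Fin n) (Fin n) ℝ) : Prop where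
  continuousOn : ∀ i j, ContinuousOn (fun z : ℝ × ℝ × ℝ => G z.1 z.2.1 z.2.2 i j)
    {z | 0 < z.2.1}
  gaussian_bound : ∀ T : ℝ, 0 < T → ∃ C a : ℝ, 0 < a ∧ ∀ x t y : ℝ, 0 < t → t ≤ T → ∀ i j,
    |G x t y i j| ≤ C * t ^ (-(1 / 2) : ℝ) * Real.exp (-a * (x - y) ^ 2 / t)
  fundamental : ∀ (y : ℝ) (Φ : ℝ → ℝ → ℝ),
    ContDiff ℝ (⊤ : ℕ∞) (fun z : ℝ × ℝ => Φ z.1 z.2) →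
    HasCompactSupport (fun z : ℝ × ℝ => Φ z.1 z.2) → ∀ i j,
    ∫ t in Set.Ioi (0 : ℝ), ∫ x : ℝ,
      (G x t y i j * (-(deriv (fun t' => Φ x t') t)
          - deriv (deriv fun x' => Φ x' t) x + c * deriv (fun x' => Φ x' t) x)
        - (M x * G x t y) i j * Φ x t)
      = if i = j then Φ y 0 else 0

/-- The critical spectral branch near `ξ = 0`: real-analytic families `mu(ξ)`, `q(·,ξ)`,
`qt(·,ξ)`, `|ξ| < ε₀`, of eigenvalues, right eigenfunctions and left eigenfunctions of the Bloch
operators `L_ξ`, with `mu(0) = 0`, `q(·,0) = u'` and `∫₀¹ qt(x,ξ) q(x,ξ) dx = 1`.  Left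
eigenfunctions are row vectors and are taken with respect to the bilinear pairing, so they solve
`(∂ₓ - iξ)² qt - c (∂ₓ - iξ) qt + df(u)ᵀ qt = mu qt`. -/
structure IsCriticalBranch {n : ℕ} (f : EuclideanSpace ℝ (Fin n) → EuclideanSpace ℝ (Fin n))
    (c : ℝ) (u : ℝ → EuclideanSpace ℝ (Fin n)) (ε₀ : ℝ) (mu : ℝ → ℂ)
    (q qt : ℝ → C(AddCircle (1 : ℝ), EuclideanSpace ℂ (Fin n))) : Prop where
  mu_analytic : AnalyticOnNhd ℝ mu (Set.Ioo (-ε₀) ε₀)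
  q_analytic : AnalyticOnNhd ℝ q (Set.Ioo (-ε₀) ε₀)
  qt_analytic : AnalyticOnNhd ℝ qt (Set.Ioo (-ε₀) ε₀)
  mu_zero : mu 0 = 0
  q_zero : ∀ x : ℝ, q 0 (x : AddCircle (1 : ℝ)) = complexify (deriv u x)
  right_eigen : ∀ ξ ∈ Set.Ioo (-ε₀) ε₀,
    BlochMaps (profileJacobian f u) c ξ (fun x => q ξ (x : AddCircle (1 : ℝ)))
      (fun x => mu ξ • q ξ (x : AddCircle (1 : ℝ)))
  left_eigen : ∀ ξ ∈ Set.Ioo (-ε₀) ε₀,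
    BlochMaps (fun x => (profileJacobian f u x).transpose) (-c) (-ξ)
      (fun x => qt ξ (x : AddCircle (1 : ℝ)))
      (fun x => mu ξ • qt ξ (x : AddCircle (1 : ℝ)))
  normalized : ∀ ξ ∈ Set.Ioo (-ε₀) ε₀,
    ∫ x in (0 : ℝ)..1,
      bilinPair (qt ξ (x : AddCircle (1 : ℝ))) (q ξ (x : AddCircle (1 : ℝ))) = 1

/-- `φ` is a smooth frequency cutoff: `1` for `|ξ| ≤ ε` and `0` for `|ξ| ≥ 2ε`. -/
def IsFrequencyCutoff (ε : ℝ) (φ : ℝ → ℝ) : Prop :=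
  ContDiff ℝ (⊤ : ℕ∞) φ ∧ (∀ ξ, |ξ| ≤ ε → φ ξ = 1) ∧ ∀ ξ, 2 * ε ≤ |ξ| → φ ξ = 0

/-- `χ` is a smooth time cutoff: `0` for `0 ≤ t ≤ 1` and `1` for `t ≥ 2`. -/
def IsTimeCutoff (χ : ℝ → ℝ) : Prop :=
  ContDiff ℝ (⊤ : ℕ∞) χ ∧ (∀ t, 0 ≤ t → t ≤ 1 → χ t = 0) ∧ ∀ t, 2 ≤ t → χ t = 1

/-- The row vector
`e(x,t;y) = χ(t) (2π)⁻¹ ∫ e^{iξ(x-y)} φ(ξ) e^{mu(ξ)t} qt(y,ξ) dξ`. -/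
def phaseKernel {n : ℕ} (χ φ : ℝ → ℝ) (mu : ℝ → ℂ)
    (qt : ℝ → C(AddCircle (1 : ℝ), EuclideanSpace ℂ (Fin n))) (x t y : ℝ) :
    EuclideanSpace ℂ (Fin n) :=
  ((χ t : ℂ) * (1 / (2 * (Real.pi : ℂ)))) •
    ∫ ξ : ℝ, (Complex.exp (Complex.I * (ξ : ℂ) * ((x : ℂ) - (y : ℂ))) * (φ ξ : ℂ)
      * Complex.exp (mu ξ * (t : ℂ))) • qt ξ (y : AddCircle (1 : ℝ))

/-- The mixed derivative `∂ₓʲ ∂ₜᵏ ∂_yʳ e` at `(x,t;y)`. -/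
def mixedDeriv {n : ℕ} (e : ℝ → ℝ → ℝ → EuclideanSpace ℂ (Fin n)) (j k r : ℕ) (x t y : ℝ) :
    EuclideanSpace ℂ (Fin n) :=
  iteratedDeriv j (fun x' => iteratedDeriv k (fun t' => iteratedDeriv r (fun y' => e x' t' y') y)
    t) x

/-- `h ∈ Lᵖ(ℝ)` with `‖h‖_{Lᵖ} ≤ B`. -/
def HasLpBound {E : Type*} [NormedAddCommGroup E] (h : ℝ → E) (p : ENNReal) (B : ℝ) : Prop :=
  MemLp h p volume ∧ (eLpNorm h p volume).toReal ≤ B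

end

noncomputable section

open MeasureTheory ProbabilityTheory Filter Topology

section

/-! ### The path factor of the evolution generated by `∂² + d ∂ + N` -/

/-! The Bloch transform splits the evolution of L into evolutions on the unit cell, one for each
Floquet frequency ξ in [-π, π]. By (D1) and (D2) they all decay exponentially, except along one
analytic curve of simple eigenvalues μ(ξ) with μ(0) = 0 and Re μ(ξ) ≤ -θξ². Up to an exponentially
small error the Green kernel is therefore the superposition, over small ξ, of the waves e^{iξ(x-y)}
e^{μ(ξ)t} q(x,ξ) q̃(y,ξ). Replacing q(x,ξ) by q(x,0) = u'(x) produces the term u' e. The error of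
the replacement carries a factor ξ, and |ξ| against e^{-θξ²t} is worth t^{-1/2}: this is the extra
decay of the remainder. Derivatives of e in x and t bring down ξ and μ(ξ) = O(ξ) and gain in the
same way.

The evolution is built explicitly, by a Feynman-Kac expansion. The kernel of ∂² + d∂ + N is the heat
kernel times `pathFactor`, a time-ordered series of Brownian bridge expectations. Rotation
invariance of the planar Gaussian gives Duhamel's formula (`evol_eq_heatEvol_add`), and Duhamel's
formula gives both the semigroup law (`evol_evol`) and the weak form of the equation
(`IsSpaceTimeTest.evol_eq`). All of this is applied to the row evolution, generated in the variable
y by ∂² - c∂ + Mᵀ. Its kernel, with the roles of the variables exchanged, is the Green kernel of L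
(`greenKernel_fundamental`).

The spectral analysis takes place on continuous periodic functions. For large γ the resolvents
`resolventOp` of the Bloch operators at γ² are compact and analytic in ξ, and they commute with the
Bloch evolutions. The critical branch comes from a bordered operator and the implicit function
theorem (`exists_analytic_eigenbranch`), with the left null vector supplied by `exists_dual_kernel`.
A spectral mapping argument (`IsDiffusivelyStable.eq_zero_of_blochEvol`) shows that, off the
critical mode, the time-one evolution has no eigenvalue of modulus at least one. Compactness of the
operators and of the set of frequencies turns this into uniform exponential decay
(`exists_norm_pow_le`, `IsSpectralBranch.exists_norm_remainder_le`).

To return to the line, kernels are tested against compactly supported functions b. A bound on the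
Bloch symbol, measured against the L¹ norms over one period of the Bloch transforms of b, yields sup
and L² bounds of the kernel in x (`bounds_of_zak`). These give the L¹ to L^p bounds by
interpolation. For t < 2 no cancellation between the Green kernel and u' e is needed: the former is
bounded by its Gaussian estimate, the latter by its own decay bound. Regularity in y comes from the
differential equation of the left eigenfunctions (`JointlyContDiff.of_ode`), which gains two
derivatives on df(u). -/

theorem continuous_integral_of_bound {X Ω E : Type*} [TopologicalSpace X] [FirstCountableTopology X]
    [NormedAddCommGroup E] [NormedSpace ℝ E] [MeasurableSpace Ω] [TopologicalSpace Ω]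
    [OpensMeasurableSpace Ω] [SecondCountableTopologyEither Ω E]
    (μ : Measure Ω) [IsFiniteMeasure μ]
    {f : X → Ω → E} (hf : Continuous (Function.uncurry f)) {B : X → ℝ} (hB : Continuous B)
    (h : ∀ x r, ‖f x r‖ ≤ B x) : Continuous fun x => ∫ r, f x r ∂μ := by
  rw [continuous_iff_continuousAt]
  intro x
  have hev : ∀ᶠ x' in 𝓝 x, B x' < B x + 1 :=
    hB.continuousAt.eventually_lt continuousAt_const (by linarith)
  refine continuousAt_of_dominated (bound := fun _ => B x + 1) ?_ ?_ (integrable_const _) ?_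
  · exact Eventually.of_forall fun x' =>
      (hf.comp (Continuous.prodMk_right x')).aestronglyMeasurable
  · filter_upwards [hev] with x' hx'
    exact Eventually.of_forall fun r => (h x' r).trans hx'.le
  · exact Eventually.of_forall fun r => (hf.comp (Continuous.prodMk_left r)).continuousAt

variable {F : Type*} [NormedAddCommGroup F] [NormedSpace ℂ F]

/-- Position at time fraction `s` of a Brownian bridge (of variance `2t`) from `y` to `x`, driven
by the standard normal value `r`. -/
def bridge (y x s t r : ℝ) : ℝ := (1 - s) * y + s * x - √(2 * t * s * (1 - s)) * r

theorem continuous_bridge {X : Type*} [TopologicalSpace X] {y x s t r : X → ℝ}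
    (hy : Continuous y) (hx : Continuous x) (hs : Continuous s) (ht : Continuous t)
    (hr : Continuous r) : Continuous fun a => bridge (y a) (x a) (s a) (t a) (r a) := by
  unfold bridge
  fun_prop

/-- The `k`-th term of the path expansion. -/
def pathTerm (N : ℝ → F →L[ℂ] F) : ℕ → ℝ → ℝ → ℝ → (F →L[ℂ] F)
  | 0 => fun _ _ _ => 1
  | k + 1 => fun y t x => t • ∫ s in (0 : ℝ)..1, ∫ r,
      pathTerm N k y (t * s) (bridge y x s t r) * N (bridge y x s t r) ∂(gaussianReal 0 1)

/-- The path factor: the kernel of the evolution generated by `∂² + d ∂ + N` divided by the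
kernel of the evolution generated by `∂² + d ∂`. -/
def pathFactor (N : ℝ → F →L[ℂ] F) (y t x : ℝ) : F →L[ℂ] F := ∑' k, pathTerm N k y t x

variable {N : ℝ → F →L[ℂ] F} {m : ℝ}

/-- Each step of the recursion shortens the time from t to ts, so the induction integrates s^k over
[0, 1] and builds up the factorial. The series therefore converges for all times, uniformly on
bounded ones. -/
theorem norm_pathTerm_le (hm : ∀ z, ‖N z‖ ≤ m) (k : ℕ) :
    ∀ y t x, ‖pathTerm N k y t x‖ ≤ (m * |t|) ^ k / k.factorial := by
  have hm0 : 0 ≤ m := (norm_nonneg _).trans (hm 0)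
  induction k with
  | zero =>
    intro y t x
    have h : ‖(1 : F →L[ℂ] F)‖ ≤ 1 := ContinuousLinearMap.norm_id_le
    simpa [pathTerm] using h
  | succ k ih =>
    intro y t x
    have h1 : ‖∫ s in (0 : ℝ)..1, ∫ r,
        pathTerm N k y (t * s) (bridge y x s t r) * N (bridge y x s t r) ∂(gaussianReal 0 1)‖
        ≤ ∫ s in (0 : ℝ)..1, (m * |t|) ^ k / k.factorial * m * s ^ k := by
      refine intervalIntegral.norm_integral_le_of_norm_le zero_le_one
        (Eventually.of_forall fun s hs => ?_) (Continuous.intervalIntegrable (by fun_prop) _ _)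
      refine (norm_integral_le_of_norm_le_const (C := (m * |t|) ^ k / k.factorial * m * s ^ k)
        (Eventually.of_forall fun r => ?_)).trans (by simp)
      refine (norm_mul_le _ _).trans ?_
      refine (mul_le_mul (ih _ _ _) (hm _) (norm_nonneg _) (by positivity)).trans (le_of_eq ?_)
      rw [abs_mul, abs_of_pos hs.1]
      ring
    simp only [pathTerm]
    rw [norm_smul, Real.norm_eq_abs]
    refine (mul_le_mul_of_nonneg_left h1 (abs_nonneg _)).trans (le_of_eq ?_)
    rw [intervalIntegral.integral_const_mul, integral_pow, Nat.factorial_succ]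
    push_cast
    field_simp
    simp
    ring

theorem continuous_pathTerm (hN : Continuous N) (hm : ∀ z, ‖N z‖ ≤ m) (k : ℕ) :
    Continuous fun p : ℝ × ℝ × ℝ => pathTerm N k p.1 p.2.1 p.2.2 := by
  have hm0 : 0 ≤ m := (norm_nonneg _).trans (hm 0)
  induction k with
  | zero => simpa [pathTerm] using continuous_const
  | succ k ih =>
    simp only [pathTerm]
    refine continuous_snd.fst.smul ?_
    refine intervalIntegral.continuous_parametric_intervalIntegral_of_continuous' (f :=
      fun (p : ℝ × ℝ × ℝ) (s : ℝ) => ∫ r, pathTerm N k p.1 (p.2.1 * s)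
        (bridge p.1 p.2.2 s p.2.1 r) * N (bridge p.1 p.2.2 s p.2.1 r) ∂(gaussianReal 0 1)) ?_ _ _
    refine continuous_integral_of_bound (X := (ℝ × ℝ × ℝ) × ℝ) _ (f := fun p r =>
      pathTerm N k p.1.1 (p.1.2.1 * p.2) (bridge p.1.1 p.1.2.2 p.2 p.1.2.1 r)
        * N (bridge p.1.1 p.1.2.2 p.2 p.1.2.1 r))
      (B := fun p => (m * |p.1.2.1 * p.2|) ^ k / k.factorial * m) ?_ (by fun_prop) ?_
    · have hb : Continuous fun q : ((ℝ × ℝ × ℝ) × ℝ) × ℝ =>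
          bridge q.1.1.1 q.1.1.2.2 q.1.2 q.1.1.2.1 q.2 :=
        continuous_bridge (by fun_prop) (by fun_prop) (by fun_prop) (by fun_prop) (by fun_prop)
      exact (ih.comp (f := fun q : ((ℝ × ℝ × ℝ) × ℝ) × ℝ => (q.1.1.1, q.1.1.2.1 * q.1.2,
        bridge q.1.1.1 q.1.1.2.2 q.1.2 q.1.1.2.1 q.2)) (by fun_prop)).mul (hN.comp hb)
    · intro p r
      exact (norm_mul_le _ _).trans
        (mul_le_mul (norm_pathTerm_le hm k _ _ _) (hm _) (norm_nonneg _) (by positivity))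

theorem summable_pathTerm_bound (a : ℝ) : Summable fun k : ℕ => a ^ k / k.factorial :=
  Real.summable_pow_div_factorial a

theorem hasSum_pathFactor [CompleteSpace F] (hm : ∀ z, ‖N z‖ ≤ m) (y t x : ℝ) :
    HasSum (fun k => pathTerm N k y t x) (pathFactor N y t x) :=
  (Summable.of_norm_bounded (summable_pathTerm_bound (m * |t|))
    fun k => norm_pathTerm_le hm k y t x).hasSum

theorem norm_pathFactor_le (hm : ∀ z, ‖N z‖ ≤ m) (y t x : ℝ) :
    ‖pathFactor N y t x‖ ≤ Real.exp (m * |t|) := by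
  rw [Real.exp_eq_exp_ℝ, NormedSpace.exp_eq_tsum_div]
  exact tsum_of_norm_bounded (summable_pathTerm_bound _).hasSum
    fun k => norm_pathTerm_le hm k y t x

theorem continuous_pathFactor [CompleteSpace F] (hN : Continuous N) (hm : ∀ z, ‖N z‖ ≤ m) :
    Continuous fun p : ℝ × ℝ × ℝ => pathFactor N p.1 p.2.1 p.2.2 := by
  have hm0 : 0 ≤ m := (norm_nonneg _).trans (hm 0)
  have key : ∀ R : ℝ, ContinuousOn (fun p : ℝ × ℝ × ℝ => pathFactor N p.1 p.2.1 p.2.2)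
      {p | |p.2.1| < R} := by
    intro R
    refine continuousOn_tsum (u := fun k : ℕ => (m * R) ^ k / k.factorial)
      (fun k => (continuous_pathTerm hN hm k).continuousOn) (summable_pathTerm_bound _) ?_
    intro k p hp
    refine (norm_pathTerm_le hm k _ _ _).trans ?_
    have : |p.2.1| ≤ R := le_of_lt hp
    gcongr
  rw [continuous_iff_continuousAt]
  intro p
  refine (key (|p.2.1| + 1)).continuousAt (IsOpen.mem_nhds ?_ ?_)
  · exact isOpen_lt (by fun_prop) continuous_const
  · simp

theorem pathTerm_add_one (hper : Function.Periodic N 1) (k : ℕ) :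
    ∀ y t x, pathTerm N k (y + 1) t (x + 1) = pathTerm N k y t x := by
  induction k with
  | zero => intro y t x; rfl
  | succ k ih =>
    intro y t x
    have hb : ∀ s r, bridge (y + 1) (x + 1) s t r = bridge y x s t r + 1 := by
      intro s r; unfold bridge; ring
    simp only [pathTerm, hb, ih, hper _]

theorem pathFactor_add_one (hper : Function.Periodic N 1) (y t x : ℝ) :
    pathFactor N (y + 1) t (x + 1) = pathFactor N y t x := by
  simp only [pathFactor, pathTerm_add_one hper]

@[simp] theorem pathFactor_zero_time (y x : ℝ) : pathFactor N y 0 x = 1 := by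
  rw [pathFactor, tsum_eq_single 0]
  · rfl
  · intro k hk
    obtain ⟨k, rfl⟩ := Nat.exists_eq_succ_of_ne_zero hk
    simp [pathTerm]

/-- The integral equation of the path factor. -/
theorem pathFactor_eq [CompleteSpace F] (hN : Continuous N) (hm : ∀ z, ‖N z‖ ≤ m) (y t x : ℝ) :
    pathFactor N y t x = 1 + t • ∫ s in (0 : ℝ)..1, ∫ r,
      pathFactor N y (t * s) (bridge y x s t r) * N (bridge y x s t r) ∂(gaussianReal 0 1) := by
  have hm0 : 0 ≤ m := (norm_nonneg _).trans (hm 0)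
  have hcont : ∀ k, Continuous (Function.uncurry fun (s r : ℝ) =>
      pathTerm N k y (t * s) (bridge y x s t r) * N (bridge y x s t r)) := by
    intro k
    have hb : Continuous fun q : ℝ × ℝ => bridge y x q.1 t q.2 :=
      continuous_bridge (by fun_prop) (by fun_prop) (by fun_prop) (by fun_prop) (by fun_prop)
    exact ((continuous_pathTerm hN hm k).comp (f := fun q : ℝ × ℝ => (y, t * q.1,
        bridge y x q.1 t q.2)) (by fun_prop)).mul (hN.comp hb)
  have hbd : ∀ k s r, ‖pathTerm N k y (t * s) (bridge y x s t r) * N (bridge y x s t r)‖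
      ≤ (m * |t * s|) ^ k / k.factorial * m := fun k s r => (norm_mul_le _ _).trans
        (mul_le_mul (norm_pathTerm_le hm k _ _ _) (hm _) (norm_nonneg _) (by positivity))
  have hin : ∀ s, HasSum (fun k => ∫ r, pathTerm N k y (t * s) (bridge y x s t r)
        * N (bridge y x s t r) ∂(gaussianReal 0 1))
      (∫ r, pathFactor N y (t * s) (bridge y x s t r) * N (bridge y x s t r)
        ∂(gaussianReal 0 1)) := by
    intro s
    refine hasSum_integral_of_dominated_convergence
      (fun k _ => (m * |t * s|) ^ k / k.factorial * m) ?_ ?_ ?_ ?_ ?_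
    · exact fun k => ((hcont k).comp (Continuous.prodMk_right s)).aestronglyMeasurable
    · exact fun k => Eventually.of_forall fun r => hbd k s r
    · exact Eventually.of_forall fun r => (summable_pathTerm_bound _).mul_right _
    · simp
    · exact Eventually.of_forall fun r => (hasSum_pathFactor hm _ _ _).mul_right _
  have hout : HasSum (fun k => ∫ s in (0 : ℝ)..1, ∫ r, pathTerm N k y (t * s) (bridge y x s t r)
        * N (bridge y x s t r) ∂(gaussianReal 0 1))
      (∫ s in (0 : ℝ)..1, ∫ r, pathFactor N y (t * s) (bridge y x s t r) * N (bridge y x s t r)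
        ∂(gaussianReal 0 1)) := by
    refine intervalIntegral.hasSum_integral_of_dominated_convergence
      (fun k _ => (m * |t|) ^ k / k.factorial * m) ?_ ?_ ?_ ?_ ?_
    · intro k
      refine Continuous.aestronglyMeasurable ?_
      exact continuous_integral_of_bound _ (hcont k)
        (B := fun s => (m * |t * s|) ^ k / k.factorial * m) (by fun_prop) (hbd k)
    · intro k
      refine Eventually.of_forall fun s hs => ?_
      rw [Set.uIoc_of_le zero_le_one] at hs
      refine (norm_integral_le_of_norm_le_const (C := (m * |t|) ^ k / k.factorial * m)
        (Eventually.of_forall fun r => (hbd k s r).trans ?_)).trans (by simp)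
      have : |t * s| ≤ |t| := by
        rw [abs_mul, abs_of_pos hs.1]
        exact mul_le_of_le_one_right (abs_nonneg _) hs.2
      gcongr
    · exact Eventually.of_forall fun s _ => (summable_pathTerm_bound _).mul_right _
    · simp
    · exact Eventually.of_forall fun s _ => hin s
  have h0 := hasSum_pathFactor hm y t x
  -- Once the zeroth term, the identity, is split off, the remaining terms are by definition those
  -- summed in `hout`.
  rw [← hasSum_nat_add_iff' 1] at h0
  have h1 := h0.unique ((hout.const_smul t).congr_fun fun k => rfl)
  simp only [Finset.range_one, Finset.sum_singleton] at h1
  rw [← h1]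
  simp [pathTerm]

end

/-! ### Heat and perturbed evolutions: Duhamel's formula and the semigroup law -/

section

theorem integrable_of_continuous_bound {Ω E : Type*} [NormedAddCommGroup E] [MeasurableSpace Ω]
    [TopologicalSpace Ω] [OpensMeasurableSpace Ω] [SecondCountableTopologyEither Ω E]
    {μ : Measure Ω} [IsFiniteMeasure μ] {f : Ω → E} (hf : Continuous f) (C : ℝ)
    (h : ∀ᵐ x ∂μ, ‖f x‖ ≤ C) : Integrable f μ :=
  Integrable.of_bound hf.aestronglyMeasurable C h

section Gauss

variable {E : Type*} [NormedAddCommGroup E] [NormedSpace ℝ E]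

/-- Invariance of the planar standard Gaussian measure under rotation. -/
theorem integral_gaussian_rotation {c s : ℝ} (hcs : c ^ 2 + s ^ 2 = 1) {f : ℝ × ℝ → E}
    (hf : Continuous f) (C : ℝ) (hC : ∀ p, ‖f p‖ ≤ C) :
    ∫ r, ∫ w, f (c * r + s * w, -s * r + c * w) ∂(gaussianReal 0 1) ∂(gaussianReal 0 1)
      = ∫ r, ∫ w, f (r, w) ∂(gaussianReal 0 1) ∂(gaussianReal 0 1) := by
  obtain ⟨θ, hc, hs⟩ : ∃ θ : ℝ, c = Real.cos θ ∧ s = Real.sin θ := by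
    have hz : ‖(⟨c, s⟩ : ℂ)‖ = 1 := by
      rw [Complex.norm_def, Complex.normSq_mk, ← sq, ← sq, hcs, Real.sqrt_one]
    have hz0 : (⟨c, s⟩ : ℂ) ≠ 0 := by
      intro h; rw [h] at hz; simp at hz
    refine ⟨Complex.arg ⟨c, s⟩, ?_, ?_⟩
    · rw [Complex.cos_arg hz0, hz, div_one]
    · rw [Complex.sin_arg, hz, div_one]
  have hrot := IsGaussian.map_rotation_eq_self_of_forall_strongDual_eq_zero
    (μ := gaussianReal 0 1) (by intro L; rw [integral_continuousLinearMap_gaussianReal]; simp) θ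
  have hg : Continuous fun p : ℝ × ℝ => f (c * p.1 + s * p.2, -s * p.1 + c * p.2) :=
    hf.comp (by fun_prop)
  rw [← integral_prod (fun p : ℝ × ℝ => f (c * p.1 + s * p.2, -s * p.1 + c * p.2))
      (integrable_of_continuous_bound hg C (Eventually.of_forall fun p => hC _)),
    ← integral_prod (fun p : ℝ × ℝ => f p)
      (integrable_of_continuous_bound hf C (Eventually.of_forall fun p => hC _))]
  conv_rhs => rw [← hrot]
  rw [integral_map (by fun_prop) hf.aestronglyMeasurable]
  refine integral_congr_ae (Eventually.of_forall fun p => ?_)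
  simp only [ContinuousLinearMap.rotation_apply, hc, hs, smul_eq_mul]

/-- Exchange of an interval integral and an integral over a finite measure. -/
theorem intervalIntegral_integral_swap {Ω : Type*} [MeasurableSpace Ω] [TopologicalSpace Ω]
    [OpensMeasurableSpace Ω] [SecondCountableTopology Ω] {μ : Measure Ω} [IsFiniteMeasure μ]
    {a b : ℝ} (hab : a ≤ b)
    {f : ℝ → Ω → E} (hf : Continuous (Function.uncurry f)) (C : ℝ)
    (hC : ∀ s ∈ Set.Ioc a b, ∀ r, ‖f s r‖ ≤ C) :
    ∫ r, (∫ s in a..b, f s r) ∂μ = ∫ s in a..b, (∫ r, f s r ∂μ) := by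
  simp only [intervalIntegral.integral_of_le hab]
  symm
  refine integral_integral_swap (integrable_of_continuous_bound hf C ?_)
  have h1 : ∀ᵐ s ∂(volume.restrict (Set.Ioc a b)), ∀ r, ‖f s r‖ ≤ C := by
    filter_upwards [ae_restrict_mem measurableSet_Ioc] with s hs using hC s hs
  have h2 := (Measure.quasiMeasurePreserving_fst
    (μ := volume.restrict (Set.Ioc a b)) (ν := μ)).ae h1
  filter_upwards [h2] with p hp using hp p.2

end Gauss

variable {F : Type*} [NormedAddCommGroup F] [NormedSpace ℂ F]

/-- The evolution generated by `∂² + d ∂`. -/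
def heatEvol (d t : ℝ) (a : ℝ → F) (y : ℝ) : F :=
  ∫ r, a (y + d * t + √(2 * t) * r) ∂(gaussianReal 0 1)

/-- The evolution generated by `∂² + d ∂ + N`. -/
def evol (N : ℝ → F →L[ℂ] F) (d t : ℝ) (a : ℝ → F) (y : ℝ) : F :=
  ∫ r, pathFactor N y t (y + d * t + √(2 * t) * r) (a (y + d * t + √(2 * t) * r))
    ∂(gaussianReal 0 1)

variable {N : ℝ → F →L[ℂ] F} {m d : ℝ}

theorem continuous_heatEvol {X : Type*} [TopologicalSpace X] [FirstCountableTopology X]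
    {a : X → ℝ → F} (ha : Continuous (Function.uncurry a)) {A : X → ℝ} (hA : Continuous A)
    (hb : ∀ p x, ‖a p x‖ ≤ A p) {t y : X → ℝ} (ht : Continuous t) (hy : Continuous y) :
    Continuous fun p => heatEvol d (t p) (a p) (y p) := by
  refine continuous_integral_of_bound _ (f := fun p r => a p (y p + d * t p + √(2 * t p) * r)) ?_
    hA fun p r => hb _ _
  exact ha.comp (f := fun q : X × ℝ => (q.1, y q.1 + d * t q.1 + √(2 * t q.1) * q.2))
    (by fun_prop)

theorem norm_heatEvol_le {a : ℝ → F} {A : ℝ} (hb : ∀ x, ‖a x‖ ≤ A) (t y : ℝ) :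
    ‖heatEvol d t a y‖ ≤ A :=
  (norm_integral_le_of_norm_le_const (C := A) (Eventually.of_forall fun r => hb _)).trans (by simp)

theorem norm_evol_le (hm : ∀ z, ‖N z‖ ≤ m) {a : ℝ → F} {A : ℝ} (hb : ∀ x, ‖a x‖ ≤ A) (t y : ℝ) :
    ‖evol N d t a y‖ ≤ Real.exp (m * |t|) * A :=
  (norm_integral_le_of_norm_le_const (C := Real.exp (m * |t|) * A)
    (Eventually.of_forall fun r => (ContinuousLinearMap.le_opNorm _ _).trans
      (mul_le_mul (norm_pathFactor_le hm _ _ _) (hb _) (norm_nonneg _) (Real.exp_pos _).le))).trans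
    (by simp)

@[simp] theorem heatEvol_zero (a : ℝ → F) (y : ℝ) [CompleteSpace F] : heatEvol d 0 a y = a y := by
  simp [heatEvol]

@[simp] theorem evol_zero (a : ℝ → F) (y : ℝ) [CompleteSpace F] : evol N d 0 a y = a y := by
  simp [evol]

theorem norm_evol_integrand_le (hm : ∀ z, ‖N z‖ ≤ m) {a : ℝ → F} {A : ℝ} (hb : ∀ x, ‖a x‖ ≤ A)
    (t y x : ℝ) : ‖pathFactor N y t x (a x)‖ ≤ Real.exp (m * |t|) * A :=
  (ContinuousLinearMap.le_opNorm _ _).trans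
    (mul_le_mul (norm_pathFactor_le hm _ _ _) (hb _) (norm_nonneg _) (Real.exp_pos _).le)

theorem evol_const_smul (c : ℂ) (a : ℝ → F) (t y : ℝ) :
    evol N d t (fun x => c • a x) y = c • evol N d t a y := by
  unfold evol
  rw [← integral_smul]
  simp

variable [CompleteSpace F]

theorem continuous_evol_integrand (hN : Continuous N) (hm : ∀ z, ‖N z‖ ≤ m)
    {X : Type*} [TopologicalSpace X]
    {a : X → ℝ → F} (ha : Continuous (Function.uncurry a)) {t y : X → ℝ} (ht : Continuous t)
    (hy : Continuous y) :
    Continuous fun q : X × ℝ =>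
      pathFactor N (y q.1) (t q.1) (y q.1 + d * t q.1 + √(2 * t q.1) * q.2)
        (a q.1 (y q.1 + d * t q.1 + √(2 * t q.1) * q.2)) := by
  have h1 : Continuous fun q : X × ℝ =>
      pathFactor N (y q.1) (t q.1) (y q.1 + d * t q.1 + √(2 * t q.1) * q.2) :=
    (continuous_pathFactor hN hm).comp (f := fun q : X × ℝ =>
      (y q.1, t q.1, y q.1 + d * t q.1 + √(2 * t q.1) * q.2)) (by fun_prop)
  have h2 : Continuous fun q : X × ℝ => a q.1 (y q.1 + d * t q.1 + √(2 * t q.1) * q.2) :=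
    ha.comp (f := fun q : X × ℝ => (q.1, y q.1 + d * t q.1 + √(2 * t q.1) * q.2)) (by fun_prop)
  exact h1.clm_apply h2

theorem continuous_evol (hN : Continuous N) (hm : ∀ z, ‖N z‖ ≤ m)
    {X : Type*} [TopologicalSpace X] [FirstCountableTopology X]
    {a : X → ℝ → F} (ha : Continuous (Function.uncurry a)) {A : X → ℝ} (hA : Continuous A)
    (hb : ∀ p x, ‖a p x‖ ≤ A p) {t y : X → ℝ} (ht : Continuous t) (hy : Continuous y) :
    Continuous fun p => evol N d (t p) (a p) (y p) :=
  continuous_integral_of_bound _ (f := fun p r =>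
      pathFactor N (y p) (t p) (y p + d * t p + √(2 * t p) * r)
        (a p (y p + d * t p + √(2 * t p) * r)))
    (continuous_evol_integrand hN hm ha ht hy)
    (B := fun p => Real.exp (m * |t p|) * A p) (by fun_prop)
    fun p r => norm_evol_integrand_le hm (hb p) _ _ _

theorem integrable_evol (hN : Continuous N) (hm : ∀ z, ‖N z‖ ≤ m) {a : ℝ → F} (ha : Continuous a)
    {A : ℝ} (hb : ∀ x, ‖a x‖ ≤ A) (t y : ℝ) :
    Integrable (fun r => pathFactor N y t (y + d * t + √(2 * t) * r)
      (a (y + d * t + √(2 * t) * r))) (gaussianReal 0 1) :=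
  integrable_of_continuous_bound ((continuous_evol_integrand (d := d) hN hm (X := Unit)
      (a := fun _ => a) (t := fun _ => t) (y := fun _ => y) (ha.comp continuous_snd)
      continuous_const continuous_const).comp (Continuous.prodMk_right ())) _
    (Eventually.of_forall fun _ => norm_evol_integrand_le hm hb _ _ _)

theorem evol_add (hN : Continuous N) (hm : ∀ z, ‖N z‖ ≤ m) {a b : ℝ → F} (ha : Continuous a)
    (hb : Continuous b) {A B : ℝ} (hA : ∀ x, ‖a x‖ ≤ A) (hB : ∀ x, ‖b x‖ ≤ B) (t y : ℝ) :
    evol N d t (fun x => a x + b x) y = evol N d t a y + evol N d t b y := by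
  unfold evol
  rw [← integral_add (integrable_evol hN hm ha hA t y) (integrable_evol hN hm hb hB t y)]
  simp

/-- `evol` commutes with interval integrals. -/
theorem evol_intervalIntegral (hN : Continuous N) (hm : ∀ z, ‖N z‖ ≤ m) {a : ℝ → ℝ → F}
    (ha : Continuous (Function.uncurry a)) {T₁ T₂ : ℝ} (hT : T₁ ≤ T₂) {A : ℝ}
    (hA : ∀ s ∈ Set.Ioc T₁ T₂, ∀ x, ‖a s x‖ ≤ A) (t y : ℝ) :
    evol N d t (fun x => ∫ s in T₁..T₂, a s x) y = ∫ s in T₁..T₂, evol N d t (a s) y := by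
  unfold evol
  rw [← intervalIntegral_integral_swap (μ := gaussianReal 0 1) hT (f := fun s r =>
    pathFactor N y t (y + d * t + √(2 * t) * r) (a s (y + d * t + √(2 * t) * r)))
    (continuous_evol_integrand hN hm ha continuous_const continuous_const)
    (Real.exp (m * |t|) * A) (fun s hs r => norm_evol_integrand_le hm (hA s hs) _ _ _)]
  refine integral_congr_ae (Eventually.of_forall fun r => ?_)
  simp only
  rw [ContinuousLinearMap.intervalIntegral_comp_comm]
  exact (ha.comp (Continuous.prodMk_left _)).intervalIntegrable _ _

/-- Duhamel's formula. -/
theorem evol_eq_heatEvol_add (hN : Continuous N) (hm : ∀ z, ‖N z‖ ≤ m) {a : ℝ → F}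
    (ha : Continuous a) {A : ℝ} (hA : ∀ x, ‖a x‖ ≤ A) {t : ℝ} (ht : 0 ≤ t) (y : ℝ) :
    evol N d t a y = heatEvol d t a y
      + ∫ s in (0 : ℝ)..t, evol N d s (fun z => N z (heatEvol d (t - s) a z)) y := by
  have hm0 : 0 ≤ m := (norm_nonneg _).trans (hm 0)
  have hA0 : 0 ≤ A := (norm_nonneg _).trans (hA 0)
  set γ := gaussianReal 0 1 with hγ
  set Y : ℝ → ℝ := fun r => y + d * t + √(2 * t) * r with hY
  have hYc : Continuous Y := by fun_prop
  -- the integrand of the path expansion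
  set f : ℝ → ℝ → ℝ → F := fun s r w =>
    pathFactor N y (t * s) (bridge y (Y r) s t w) (N (bridge y (Y r) s t w) (a (Y r))) with hf
  have hbr : Continuous fun q : (ℝ × ℝ) × ℝ => bridge y (Y q.1.2) q.1.1 t q.2 :=
    continuous_bridge (by fun_prop) (by fun_prop) (by fun_prop) (by fun_prop) (by fun_prop)
  have hfc : Continuous fun q : (ℝ × ℝ) × ℝ => f q.1.1 q.1.2 q.2 := by
    have h1 : Continuous fun q : (ℝ × ℝ) × ℝ => pathFactor N y (t * q.1.1)
        (bridge y (Y q.1.2) q.1.1 t q.2) :=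
      (continuous_pathFactor hN hm).comp (f := fun q : (ℝ × ℝ) × ℝ =>
        (y, t * q.1.1, bridge y (Y q.1.2) q.1.1 t q.2)) (by fun_prop)
    exact h1.clm_apply ((hN.comp hbr).clm_apply (ha.comp (by fun_prop)))
  have hfb : ∀ s r w, ‖f s r w‖ ≤ Real.exp (m * |t * s|) * (m * A) := fun s r w =>
    norm_evol_integrand_le (a := fun z => N z (a (Y r))) hm (fun x =>
      (ContinuousLinearMap.le_opNorm _ _).trans (mul_le_mul (hm _) (hA _) (norm_nonneg _) hm0)) _ _ _
  have hfb1 : ∀ s ∈ Set.Ioc (0 : ℝ) 1, ∀ r w, ‖f s r w‖ ≤ Real.exp (m * t) * (m * A) := by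
    intro s hs r w
    refine (hfb s r w).trans ?_
    have : |t * s| ≤ t := by
      rw [abs_of_nonneg (mul_nonneg ht hs.1.le)]
      exact mul_le_of_le_one_right ht hs.2
    gcongr
  have hE : ∀ r, pathFactor N y t (Y r) (a (Y r)) = a (Y r)
      + t • ∫ s in (0 : ℝ)..1, ∫ w, f s r w ∂γ := by
    intro r
    have hc : Continuous fun q : ℝ × ℝ => pathFactor N y (t * q.1) (bridge y (Y r) q.1 t q.2)
        * N (bridge y (Y r) q.1 t q.2) := by
      have hb : Continuous fun q : ℝ × ℝ => bridge y (Y r) q.1 t q.2 :=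
        continuous_bridge (by fun_prop) (by fun_prop) (by fun_prop) (by fun_prop) (by fun_prop)
      exact ((continuous_pathFactor hN hm).comp (f := fun q : ℝ × ℝ =>
        (y, t * q.1, bridge y (Y r) q.1 t q.2)) (by fun_prop)).mul (hN.comp hb)
    have hcb : ∀ s w, ‖pathFactor N y (t * s) (bridge y (Y r) s t w)
        * N (bridge y (Y r) s t w)‖ ≤ Real.exp (m * |t * s|) * m := fun s w =>
      (norm_mul_le _ _).trans (mul_le_mul (norm_pathFactor_le hm _ _ _) (hm _) (norm_nonneg _)
        (Real.exp_pos _).le)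
    conv_lhs => rw [pathFactor_eq hN hm]
    rw [add_apply, one_apply_eq_self, smul_apply]
    congr 2
    rw [ContinuousLinearMap.intervalIntegral_apply]
    · refine intervalIntegral.integral_congr fun s _ => ?_
      rw [ContinuousLinearMap.integral_apply]
      · rfl
      · exact integrable_of_continuous_bound (hc.comp (Continuous.prodMk_right s)) _
          (Eventually.of_forall fun w => hcb s w)
    · refine Continuous.intervalIntegrable ?_ _ _
      exact continuous_integral_of_bound _ (f := fun s w => pathFactor N y (t * s)
        (bridge y (Y r) s t w) * N (bridge y (Y r) s t w)) hc
        (B := fun s => Real.exp (m * |t * s|) * m) (by fun_prop) hcb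
  have hI : Continuous fun q : ℝ × ℝ => ∫ w, f q.1 q.2 w ∂γ :=
    continuous_integral_of_bound _ (f := fun (q : ℝ × ℝ) w => f q.1 q.2 w) hfc
      (B := fun q => Real.exp (m * |t * q.1|) * (m * A)) (by fun_prop) (fun q w => hfb _ _ _)
  have hIb : ∀ s ∈ Set.Ioc (0 : ℝ) 1, ∀ r, ‖∫ w, f s r w ∂γ‖ ≤ Real.exp (m * t) * (m * A) :=
    fun s hs r => (norm_integral_le_of_norm_le_const
      (Eventually.of_forall fun w => hfb1 s hs r w)).trans (by simp [hγ])
  have hstep : evol N d t a y = heatEvol d t a y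
      + t • ∫ s in (0 : ℝ)..1, ∫ r, ∫ w, f s r w ∂γ ∂γ := by
    unfold evol heatEvol
    rw [← intervalIntegral_integral_swap zero_le_one (f := fun s r => ∫ w, f s r w ∂γ) hI
      (Real.exp (m * t) * (m * A)) hIb, ← integral_smul, ← integral_add]
    · exact integral_congr_ae (Eventually.of_forall fun r => hE r)
    · exact integrable_of_continuous_bound (ha.comp hYc) A (Eventually.of_forall fun r => hA _)
    · refine integrable_of_continuous_bound (Continuous.const_smul ?_ t)
        (t * (Real.exp (m * t) * (m * A))) (Eventually.of_forall fun r => ?_)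
      · exact intervalIntegral.continuous_parametric_intervalIntegral_of_continuous' (f :=
          fun r s => ∫ w, f s r w ∂γ) (hI.comp continuous_swap) _ _
      · rw [norm_smul, Real.norm_eq_abs, abs_of_nonneg ht]
        refine mul_le_mul_of_nonneg_left ?_ ht
        refine (intervalIntegral.norm_integral_le_of_norm_le_const fun s hs => ?_).trans_eq
          (by simp : Real.exp (m * t) * (m * A) * |1 - 0| = _)
        rw [Set.uIoc_of_le zero_le_one] at hs
        exact hIb s hs r
  rw [hstep]
  congr 1
  -- The substitution s ↦ ts moves the Duhamel integral to the unit interval, where the bridge is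
  -- parametrised.
  have hsub := intervalIntegral.smul_integral_comp_mul_left (a := 0) (b := 1)
    (fun s => evol N d s (fun z => N z (heatEvol d (t - s) a z)) y) t
  rw [mul_zero, mul_one] at hsub
  rw [← hsub]
  congr 1
  refine intervalIntegral.integral_congr fun s hs => ?_
  rw [Set.uIcc_of_le zero_le_one] at hs
  obtain ⟨hs0, hs1⟩ := hs
  have hs1' : 0 ≤ 1 - s := by linarith
  -- the rotated integrand
  set g : ℝ × ℝ → F := fun p =>
    pathFactor N y (t * s) (y + d * (t * s) + √(2 * (t * s)) * p.1)
      (N (y + d * (t * s) + √(2 * (t * s)) * p.1)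
        (a (y + d * (t * s) + √(2 * (t * s)) * p.1 + d * (t - t * s)
          + √(2 * (t - t * s)) * p.2))) with hg
  have hgc : Continuous g := by
    have h1 : Continuous fun p : ℝ × ℝ => pathFactor N y (t * s)
        (y + d * (t * s) + √(2 * (t * s)) * p.1) :=
      (continuous_pathFactor hN hm).comp (f := fun p : ℝ × ℝ =>
        (y, t * s, y + d * (t * s) + √(2 * (t * s)) * p.1)) (by fun_prop)
    exact h1.clm_apply ((hN.comp (by fun_prop)).clm_apply (ha.comp (by fun_prop)))
  have hgb : ∀ p, ‖g p‖ ≤ Real.exp (m * |t * s|) * (m * A) := fun p =>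
    norm_evol_integrand_le (a := fun z => N z (a (y + d * (t * s) + √(2 * (t * s)) * p.1
        + d * (t - t * s) + √(2 * (t - t * s)) * p.2))) hm (fun x =>
      (ContinuousLinearMap.le_opNorm _ _).trans (mul_le_mul (hm _) (hA _) (norm_nonneg _) hm0)) _ _ _
  -- Rotation by the angle with cosine √s exchanges the pair (endpoint, bridge noise) for the two
  -- independent increments over [0, ts] and [ts, t]. This is the Markov property behind Duhamel's
  -- formula.
  have hrot := integral_gaussian_rotation (c := √s) (s := -√(1 - s))
    (by rw [neg_sq, Real.sq_sqrt hs0, Real.sq_sqrt hs1']; ring) hgc _ hgb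
  have e1 : √(2 * (t * s)) = √(2 * t) * √s := by
    rw [← Real.sqrt_mul (by positivity)]; ring_nf
  have e2 : √(2 * (t - t * s)) = √(2 * t) * √(1 - s) := by
    rw [← Real.sqrt_mul (by positivity)]; ring_nf
  have e3 : √(2 * t * s * (1 - s)) = √(2 * t) * √s * √(1 - s) := by
    rw [← Real.sqrt_mul (by positivity), ← Real.sqrt_mul (by positivity)]
  have q1 : √s * √s = s := Real.mul_self_sqrt hs0
  have q2 : √(1 - s) * √(1 - s) = 1 - s := Real.mul_self_sqrt hs1'
  calc ∫ r, ∫ w, f s r w ∂γ ∂γ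
      = ∫ r, ∫ w, g (√s * r + -√(1 - s) * w, - -√(1 - s) * r + √s * w) ∂γ ∂γ := by
        refine integral_congr_ae (Eventually.of_forall fun r => ?_)
        refine integral_congr_ae (Eventually.of_forall fun w => ?_)
        have hz : y + d * (t * s) + √(2 * (t * s)) * (√s * r + -√(1 - s) * w)
            = bridge y (Y r) s t w := by
          simp only [bridge, hY, e1, e3]
          linear_combination √(2 * t) * r * q1
        have hx : bridge y (Y r) s t w + d * (t - t * s)
            + √(2 * (t - t * s)) * (- -√(1 - s) * r + √s * w) = Y r := by
          simp only [bridge, hY, e2, e3]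
          linear_combination √(2 * t) * r * q2
        simp only [hg, hf, hz, hx]
    _ = ∫ r, ∫ w, g (r, w) ∂γ ∂γ := hrot
    _ = evol N d (t * s) (fun z => N z (heatEvol d (t - t * s) a z)) y := by
        unfold evol heatEvol
        refine integral_congr_ae (Eventually.of_forall fun r => ?_)
        simp only [hg]
        rw [ContinuousLinearMap.integral_comp_comm, ContinuousLinearMap.integral_comp_comm]
        · exact integrable_of_continuous_bound (ha.comp (by fun_prop)) A
            (Eventually.of_forall fun w => hA _)
        · refine ContinuousLinearMap.integrable_comp _ ?_
          exact integrable_of_continuous_bound (ha.comp (by fun_prop)) A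
            (Eventually.of_forall fun w => hA _)

/-- Independent centred Gaussians of variances 2s and 2t add up to one of variance 2(s + t): after a
rotation the sum depends on a single coordinate. -/
theorem heatEvol_heatEvol {a : ℝ → F} (ha : Continuous a) {A : ℝ} (hA : ∀ x, ‖a x‖ ≤ A)
    {s t : ℝ} (hs : 0 ≤ s) (ht : 0 ≤ t) (y : ℝ) :
    heatEvol d s (fun z => heatEvol d t a z) y = heatEvol d (s + t) a y := by
  rcases eq_or_lt_of_le (add_nonneg hs ht) with h0 | h0
  · have h1 : s = 0 := by linarith
    have h2 : t = 0 := by linarith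
    subst h1 h2
    simp
  have hrot := integral_gaussian_rotation (c := √(s / (s + t))) (s := √(t / (s + t)))
    (by rw [Real.sq_sqrt (by positivity), Real.sq_sqrt (by positivity)]; field_simp)
    (f := fun p : ℝ × ℝ => a (y + d * (s + t) + √(2 * (s + t)) * p.1))
    (ha.comp (by fun_prop)) A (fun p => hA _)
  have e1 : √(2 * (s + t)) * √(s / (s + t)) = √(2 * s) := by
    rw [← Real.sqrt_mul (by positivity)]; congr 1; field_simp
  have e2 : √(2 * (s + t)) * √(t / (s + t)) = √(2 * t) := by
    rw [← Real.sqrt_mul (by positivity)]; congr 1; field_simp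
  simp only [integral_const, probReal_univ, one_smul] at hrot
  unfold heatEvol
  rw [← hrot]
  refine integral_congr_ae (Eventually.of_forall fun r => ?_)
  refine integral_congr_ae (Eventually.of_forall fun w => ?_)
  simp only
  congr 1
  rw [← e1, ← e2]
  ring

/-- By Duhamel's formula for both sides, the defect `D r b` of the semigroup law satisfies a
homogeneous Volterra equation in the second time r. Iterating it k times bounds the defect by a
multiple of (mr)^k / k!, so it vanishes. -/
theorem evol_evol (hN : Continuous N) (hm : ∀ z, ‖N z‖ ≤ m) {a : ℝ → F}
    (ha : Continuous a) {A : ℝ} (hA : ∀ x, ‖a x‖ ≤ A) {s t : ℝ} (hs : 0 ≤ s) (ht : 0 ≤ t) (y : ℝ) :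
    evol N d s (fun z => evol N d t a z) y = evol N d (s + t) a y := by
  have hm0 : 0 ≤ m := (norm_nonneg _).trans (hm 0)
  have hNb : ∀ {b : ℝ → F} {B : ℝ}, (∀ x, ‖b x‖ ≤ B) → ∀ x, ‖N x (b x)‖ ≤ m * B := fun hb x =>
    (ContinuousLinearMap.le_opNorm _ _).trans (mul_le_mul (hm _) (hb _) (norm_nonneg _) hm0)
  -- joint continuity of the inhomogeneity
  have hinh : ∀ {b : ℝ → F} {B : ℝ}, Continuous b → (∀ x, ‖b x‖ ≤ B) → ∀ T : ℝ,
      Continuous (Function.uncurry fun r z => N z (heatEvol d (T - r) b z)) := by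
    intro b B hb hB T
    refine (hN.comp continuous_snd).clm_apply ?_
    exact continuous_heatEvol (X := ℝ × ℝ) (a := fun _ => b) (hb.comp continuous_snd)
      (A := fun _ => B) continuous_const (fun _ => hB) (t := fun p => T - p.1) (by fun_prop)
      continuous_snd
  set D : ℝ → (ℝ → F) → F := fun r b =>
    evol N d s (fun z => evol N d r b z) y - evol N d (s + r) b y with hD
  have hrec : ∀ {b : ℝ → F} {B : ℝ}, Continuous b → (∀ x, ‖b x‖ ≤ B) → ∀ r, 0 ≤ r →
      D r b = ∫ w in (0 : ℝ)..r, D w (fun z => N z (heatEvol d (r - w) b z)) := by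
    intro b B hb hB r hr
    set c : ℝ → ℝ → F := fun w z => N z (heatEvol d (r - w) b z) with hc
    have hcc := hinh hb hB r
    have hcb : ∀ w x, ‖c w x‖ ≤ m * B := fun w => hNb fun x => norm_heatEvol_le hB _ _
    have hev : Continuous (Function.uncurry fun w z => evol N d w (c w) z) :=
      continuous_evol hN hm (X := ℝ × ℝ) (a := fun p => c p.1)
        (hcc.comp (by fun_prop : Continuous fun q : (ℝ × ℝ) × ℝ => (q.1.1, q.2)))
        (A := fun _ => m * B) continuous_const (fun p => hcb _) continuous_fst continuous_snd
    have hevb : ∀ w ∈ Set.Ioc 0 r, ∀ z, ‖evol N d w (c w) z‖ ≤ Real.exp (m * r) * (m * B) := by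
      intro w hw z
      refine (norm_evol_le hm (hcb w) _ _).trans ?_
      have hB0 : 0 ≤ B := (norm_nonneg _).trans (hB 0)
      rw [abs_of_pos hw.1]
      have := hw.2
      gcongr
    have hheat : Continuous fun z => heatEvol d r b z :=
      continuous_heatEvol (X := ℝ) (a := fun _ => b) (hb.comp continuous_snd) (A := fun _ => B)
        continuous_const (fun _ => hB) continuous_const continuous_id
    have h1 : evol N d s (fun z => evol N d r b z) y = evol N d s (fun z => heatEvol d r b z) y
        + ∫ w in (0 : ℝ)..r, evol N d s (fun z => evol N d w (c w) z) y := by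
      rw [← evol_intervalIntegral hN hm hev hr hevb]
      have : (fun z => evol N d r b z) = fun z => heatEvol d r b z
          + ∫ w in (0 : ℝ)..r, evol N d w (c w) z := by
        funext z; exact evol_eq_heatEvol_add hN hm hb hB hr z
      rw [this]
      refine evol_add hN hm hheat ?_ (fun x => norm_heatEvol_le hB _ _)
        (B := Real.exp (m * r) * (m * B) * |r - 0|) ?_ s y
      · exact intervalIntegral.continuous_parametric_intervalIntegral_of_continuous' (f :=
          fun z w => evol N d w (c w) z) (hev.comp continuous_swap) _ _
      · intro z
        refine intervalIntegral.norm_integral_le_of_norm_le_const fun w hw => ?_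
        rw [Set.uIoc_of_le hr] at hw
        exact hevb w hw z
    have hint : ∀ p q, IntervalIntegrable (fun w => evol N d w
        (fun z => N z (heatEvol d (s + r - w) b z)) y) volume p q := by
      intro p q
      refine Continuous.intervalIntegrable ?_ _ _
      exact continuous_evol hN hm (X := ℝ) (a := fun w z => N z (heatEvol d (s + r - w) b z))
        (hinh hb hB (s + r)) (A := fun _ => m * B) continuous_const
        (fun p => hNb fun x => norm_heatEvol_le hB _ _) continuous_id continuous_const
    -- Duhamel's formula over [0, s + r] is cut at time s. The first piece is the Duhamel term over
    -- time s for the datum `heatEvol d r b`, the second is shifted back to [0, r].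
    have h2 : evol N d (s + r) b y = evol N d s (fun z => heatEvol d r b z) y
        + ∫ w in (0 : ℝ)..r, evol N d (s + w) (c w) y := by
      rw [evol_eq_heatEvol_add hN hm hb hB (add_nonneg hs hr) y,
        evol_eq_heatEvol_add hN hm hheat (fun x => norm_heatEvol_le hB _ _) hs y,
        ← intervalIntegral.integral_add_adjacent_intervals (hint 0 s) (hint s (s + r)),
        heatEvol_heatEvol hb hB hs hr, add_assoc]
      congr 2
      · refine intervalIntegral.integral_congr fun w hw => ?_
        rw [Set.uIcc_of_le hs] at hw
        congr 1
        funext z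
        rw [heatEvol_heatEvol hb hB (by linarith [hw.2]) hr]
        congr 2
        ring
      · have := intervalIntegral.integral_comp_add_left (a := 0) (b := r)
          (fun w => evol N d w (fun z => N z (heatEvol d (s + r - w) b z)) y) s
        rw [add_zero] at this
        rw [← this]
        refine intervalIntegral.integral_congr fun w _ => ?_
        simp only [hc]
        congr 1
        funext z
        congr 2
        ring
    simp only [hD]
    rw [h1, h2, add_sub_add_left_eq_sub, ← intervalIntegral.integral_sub]
    · refine Continuous.intervalIntegrable ?_ _ _
      have hev' : Continuous (Function.uncurry fun w z => evol N d w (c w) z) := hev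
      exact continuous_evol hN hm (X := ℝ) (a := fun w z => evol N d w (c w) z) hev'
        (A := fun w => Real.exp (m * |w|) * (m * B)) (by fun_prop)
        (fun w z => norm_evol_le hm (hcb w) _ _) continuous_const continuous_const
    · refine Continuous.intervalIntegrable ?_ _ _
      exact continuous_evol hN hm (X := ℝ) (a := c) hcc (A := fun _ => m * B) continuous_const
        hcb (by fun_prop) continuous_const
  have hbound : ∀ k : ℕ, ∀ {b : ℝ → F} {B : ℝ}, Continuous b → (∀ x, ‖b x‖ ≤ B) →
      ∀ r ∈ Set.Icc 0 t, ‖D r b‖ ≤ 2 * Real.exp (m * (s + t)) * B * ((m * r) ^ k / k.factorial) := by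
    intro k
    induction k with
    | zero =>
      intro b B hb hB r hr
      have hB0 : 0 ≤ B := (norm_nonneg _).trans (hB 0)
      simp only [hD, pow_zero, Nat.factorial_zero, Nat.cast_one, div_one, mul_one]
      refine (norm_sub_le _ _).trans ?_
      have h1 := norm_evol_le (d := d) hm (fun z => norm_evol_le (d := d) hm hB r z) s y
      have h2 := norm_evol_le (d := d) hm hB (s + r) y
      rw [abs_of_nonneg hs, abs_of_nonneg hr.1, ← mul_assoc, ← Real.exp_add, ← mul_add] at h1
      rw [abs_of_nonneg (add_nonneg hs hr.1)] at h2
      have h3 : Real.exp (m * (s + r)) * B ≤ Real.exp (m * (s + t)) * B := by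
        have := hr.2
        gcongr
      linarith
    | succ k ih =>
      intro b B hb hB r hr
      rw [hrec hb hB r hr.1]
      have hB0 : 0 ≤ B := (norm_nonneg _).trans (hB 0)
      refine (intervalIntegral.norm_integral_le_of_norm_le hr.1 (g := fun w =>
        2 * Real.exp (m * (s + t)) * (m * B) * ((m * w) ^ k / k.factorial))
        (Eventually.of_forall fun w hw => ?_)
        (Continuous.intervalIntegrable (by fun_prop) _ _)).trans (le_of_eq ?_)
      · exact ih ((hinh hb hB r).comp (Continuous.prodMk_right w))
          (hNb fun x => norm_heatEvol_le hB _ _) w ⟨hw.1.le, hw.2.trans hr.2⟩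
      · simp only [mul_pow, mul_div_assoc]
        rw [intervalIntegral.integral_const_mul, intervalIntegral.integral_const_mul,
          intervalIntegral.integral_div, integral_pow, Nat.factorial_succ]
        push_cast
        field_simp
        simp
        ring
  have hlim : Tendsto (fun k : ℕ => 2 * Real.exp (m * (s + t)) * A
      * ((m * t) ^ k / k.factorial)) atTop (𝓝 0) := by
    have := (FloorSemiring.tendsto_pow_div_factorial_atTop (m * t)).const_mul
      (2 * Real.exp (m * (s + t)) * A)
    simpa using this
  have h0 : ‖D t a‖ ≤ 0 := ge_of_tendsto' hlim fun k => hbound k ha hA t ⟨ht, le_rfl⟩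
  exact sub_eq_zero.mp (norm_le_zero_iff.mp h0)

end

/-! ### Gaussian integration by parts and the weak form of the evolution equation -/

section

section Gauss

variable {E : Type*} [NormedAddCommGroup E] [NormedSpace ℝ E]

theorem hasDerivAt_gaussianPDFReal (r : ℝ) :
    HasDerivAt (gaussianPDFReal 0 1) (-r * gaussianPDFReal 0 1 r) r := by
  have h : HasDerivAt (fun r : ℝ => (√(2 * Real.pi * 1))⁻¹ * Real.exp (-(r - 0) ^ 2 / (2 * 1)))
      ((√(2 * Real.pi * 1))⁻¹ * (Real.exp (-(r - 0) ^ 2 / (2 * 1)) * (-r))) r := by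
    refine HasDerivAt.const_mul _ (HasDerivAt.exp ?_)
    have h := ((((hasDerivAt_id r).sub_const 0).pow 2).neg).div_const (2 * 1)
    refine h.congr_deriv ?_
    norm_num
    ring
  have hfun : gaussianPDFReal 0 1
      = fun r : ℝ => (√(2 * Real.pi * 1))⁻¹ * Real.exp (-(r - 0) ^ 2 / (2 * 1)) := by
    funext r; simp [gaussianPDFReal]
  rw [hfun]
  refine h.congr_deriv ?_
  ring

theorem integrable_id_mul_gaussianPDFReal :
    Integrable fun r : ℝ => r * gaussianPDFReal 0 1 r := by
  have h := (integrable_mul_exp_neg_mul_sq (b := 1 / 2) (by norm_num)).const_mul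
    (√(2 * Real.pi * 1))⁻¹
  refine h.congr (Eventually.of_forall fun r => ?_)
  simp only [gaussianPDFReal, NNReal.coe_one, sub_zero]
  rw [show -(1 / 2) * r ^ 2 = -r ^ 2 / (2 * 1) by ring]
  ring

theorem integrable_abs_gaussianReal : Integrable (fun r : ℝ => |r|) (gaussianReal 0 1) :=
  ((memLp_id_gaussianReal (μ := 0) (v := 1) 1).integrable (by norm_num)).abs

/-- Gaussian integration by parts. -/
theorem integral_smul_gaussianReal {f f' : ℝ → E} (hf : ∀ r, HasDerivAt f (f' r) r)
    (hf' : Continuous f') {C : ℝ} (hC : ∀ r, ‖f r‖ ≤ C) (hC' : ∀ r, ‖f' r‖ ≤ C) :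
    ∫ r, r • f r ∂(gaussianReal 0 1) = ∫ r, f' r ∂(gaussianReal 0 1) := by
  have hfc : Continuous f := continuous_iff_continuousAt.mpr fun r => (hf r).continuousAt
  have hw : Continuous (gaussianPDFReal 0 1) :=
    continuous_iff_continuousAt.mpr fun r => (hasDerivAt_gaussianPDFReal r).continuousAt
  have i1 : Integrable fun r => gaussianPDFReal 0 1 r • f' r := by
    refine ((integrable_gaussianPDFReal 0 1).mul_const C).mono'
      (hw.smul hf').aestronglyMeasurable (Eventually.of_forall fun r => ?_)
    rw [norm_smul, Real.norm_of_nonneg (gaussianPDFReal_nonneg _ _ _)]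
    exact mul_le_mul_of_nonneg_left (hC' r) (gaussianPDFReal_nonneg _ _ _)
  have i0 : Integrable fun r => gaussianPDFReal 0 1 r • f r := by
    refine ((integrable_gaussianPDFReal 0 1).mul_const C).mono'
      (hw.smul hfc).aestronglyMeasurable (Eventually.of_forall fun r => ?_)
    rw [norm_smul, Real.norm_of_nonneg (gaussianPDFReal_nonneg _ _ _)]
    exact mul_le_mul_of_nonneg_left (hC r) (gaussianPDFReal_nonneg _ _ _)
  have i2 : Integrable fun r => (-r * gaussianPDFReal 0 1 r) • f r := by
    refine (integrable_id_mul_gaussianPDFReal.norm.mul_const C).mono'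
      (((continuous_neg.mul hw)).smul hfc).aestronglyMeasurable (Eventually.of_forall fun r => ?_)
    rw [norm_smul, neg_mul, norm_neg]
    exact mul_le_mul_of_nonneg_left (hC r) (norm_nonneg _)
  have h := integral_eq_zero_of_hasDerivAt_of_integrable
    (fun r => (hasDerivAt_gaussianPDFReal r).smul (hf r)) (i1.add i2) i0
  rw [integral_add i1 i2] at h
  rw [integral_gaussianReal_eq_integral_smul one_ne_zero,
    integral_gaussianReal_eq_integral_smul one_ne_zero, eq_comm, ← sub_eq_zero, sub_eq_add_neg,
    ← integral_neg, ← h]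
  congr 1
  refine integral_congr_ae (Eventually.of_forall fun r => ?_)
  beta_reduce
  rw [smul_smul, ← neg_smul]
  congr 1
  ring

/-- Exchange of the order of integration over a triangle. -/
theorem intervalIntegral_triangle_swap {f : ℝ → ℝ → E} (hf : Continuous (Function.uncurry f))
    {T : ℝ} (hT : 0 ≤ T) :
    ∫ t in (0 : ℝ)..T, ∫ s in (0 : ℝ)..t, f t s = ∫ s in (0 : ℝ)..T, ∫ t in s..T, f t s := by
  set μ := volume.restrict (Set.Ioc 0 T) with hμ
  set S : Set (ℝ × ℝ) := {p | p.2 ≤ p.1} with hS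
  have hSm : MeasurableSet S := measurableSet_le measurable_snd measurable_fst
  have hint : Integrable (S.indicator (Function.uncurry f)) (μ.prod μ) := by
    refine Integrable.indicator ?_ hSm
    rw [hμ, Measure.prod_restrict]
    exact (hf.continuousOn.integrableOn_compact (isCompact_Icc.prod isCompact_Icc)).mono_set
      (Set.prod_mono Set.Ioc_subset_Icc_self Set.Ioc_subset_Icc_self)
  have hsw := integral_integral_swap (f := fun t s => S.indicator (Function.uncurry f) (t, s))
    (μ := μ) (ν := μ) hint
  rw [intervalIntegral.integral_of_le hT, intervalIntegral.integral_of_le hT]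
  convert hsw using 1
  · refine setIntegral_congr_fun measurableSet_Ioc fun t ht => ?_
    rw [intervalIntegral.integral_of_le ht.1.le]
    have : (fun s => S.indicator (Function.uncurry f) (t, s)) = (Set.Iic t).indicator (f t) := by
      funext s
      by_cases h : s ≤ t <;> simp [hS, h, Function.uncurry]
    rw [this, hμ, setIntegral_indicator measurableSet_Iic]
    congr 2
    ext s
    simp only [Set.mem_inter_iff, Set.mem_Ioc, Set.mem_Iic]
    constructor
    · rintro ⟨h1, h2⟩; exact ⟨⟨h1, h2.trans ht.2⟩, h2⟩
    · rintro ⟨⟨h1, _⟩, h2⟩; exact ⟨h1, h2⟩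
  · refine setIntegral_congr_fun measurableSet_Ioc fun s hs => ?_
    rw [intervalIntegral.integral_of_le hs.2, ← integral_Icc_eq_integral_Ioc]
    have : (fun t => S.indicator (Function.uncurry f) (t, s))
        = (Set.Ici s).indicator (fun t => f t s) := by
      funext t
      by_cases h : s ≤ t <;> simp [hS, h, Function.uncurry]
    rw [this, hμ, setIntegral_indicator measurableSet_Ici]
    congr 2
    ext t
    simp only [Set.mem_inter_iff, Set.mem_Ioc, Set.mem_Icc, Set.mem_Ici]
    constructor
    · rintro ⟨h1, h2⟩; exact ⟨⟨hs.1.trans_le h1, h2⟩, h1⟩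
    · rintro ⟨⟨_, h1⟩, h2⟩; exact ⟨h2, h1⟩

end Gauss

variable {F : Type*} [NormedAddCommGroup F] [NormedSpace ℂ F]

/-- `Φ` is a test function of time and space with time derivative `Φt` and space derivatives
`Φx`, `Φxx`, all continuous and bounded in space. -/
structure IsSpaceTimeTest (Φ Φt Φx Φxx : ℝ → ℝ → F) (B : ℝ → ℝ) : Prop where
  hasDerivAt_time : ∀ t x, HasDerivAt (fun t => Φ t x) (Φt t x) t
  hasDerivAt_space : ∀ t x, HasDerivAt (Φ t) (Φx t x) x
  hasDerivAt_space₂ : ∀ t x, HasDerivAt (Φx t) (Φxx t x) x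
  continuous : Continuous (Function.uncurry Φ)
  continuous_time : Continuous (Function.uncurry Φt)
  continuous_space : Continuous (Function.uncurry Φx)
  continuous_space₂ : Continuous (Function.uncurry Φxx)
  continuous_bound : Continuous B
  bound : ∀ t x, ‖Φ t x‖ ≤ B t
  bound_time : ∀ t x, ‖Φt t x‖ ≤ B t
  bound_space : ∀ t x, ‖Φx t x‖ ≤ B t
  bound_space₂ : ∀ t x, ‖Φxx t x‖ ≤ B t

variable {N : ℝ → F →L[ℂ] F} {m d : ℝ} {Φ Φt Φx Φxx : ℝ → ℝ → F} {B : ℝ → ℝ}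

namespace IsSpaceTimeTest

theorem bound_nonneg (h : IsSpaceTimeTest Φ Φt Φx Φxx B) (t : ℝ) : 0 ≤ B t :=
  (norm_nonneg _).trans (h.bound t 0)

theorem continuous_generator (h : IsSpaceTimeTest Φ Φt Φx Φxx B) (d : ℝ) :
    Continuous (Function.uncurry fun t x => Φt t x + Φxx t x + d • Φx t x) :=
  (h.continuous_time.add h.continuous_space₂).add (h.continuous_space.const_smul d)

theorem bound_generator (h : IsSpaceTimeTest Φ Φt Φx Φxx B) (d : ℝ) (t x : ℝ) :
    ‖Φt t x + Φxx t x + d • Φx t x‖ ≤ (2 + |d|) * B t := by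
  refine (norm_add₃_le).trans ?_
  rw [norm_smul, Real.norm_eq_abs]
  have := mul_le_mul_of_nonneg_left (h.bound_space t x) (abs_nonneg d)
  linarith [h.bound_time t x, h.bound_space₂ t x]

/-- Continuous partial derivatives give joint differentiability, hence the chain rule along a moving
point. -/
theorem hasDerivAt_comp (h : IsSpaceTimeTest Φ Φt Φx Φxx B) {p : ℝ → ℝ} {p' τ : ℝ}
    (hp : HasDerivAt p p' τ) :
    HasDerivAt (fun τ => Φ τ (p τ)) (Φt τ (p τ) + p' • Φx τ (p τ)) τ := by
  have key := hasStrictFDerivAt_uncurry_coprod (𝕜 := ℝ) (u := (τ, p τ)) (f := Φ)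
    (f₁ := fun t x => ContinuousLinearMap.toSpanSingleton ℝ (Φt t x))
    (f₂ := fun t x => ContinuousLinearMap.toSpanSingleton ℝ (Φx t x))
    (Eventually.of_forall fun v => (h.hasDerivAt_time v.1 v.2).hasFDerivAt)
    (Eventually.of_forall fun v => (h.hasDerivAt_space v.1 v.2).hasFDerivAt)
    (((ContinuousLinearMap.toSpanSingletonCLE (𝕜 := ℝ) (E := F)).continuous.comp
      h.continuous_time).continuousAt)
    (((ContinuousLinearMap.toSpanSingletonCLE (𝕜 := ℝ) (E := F)).continuous.comp
      h.continuous_space).continuousAt)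
  have := key.hasFDerivAt.comp_hasDerivAt τ ((hasDerivAt_id τ).prodMk hp)
  refine HasDerivAt.congr_deriv this ?_
  simp [Function.HasUncurry.uncurry]

/-- The point at which `Φ τ` is evaluated moves with τ, with velocity d + r / √(2(τ - s)). Gaussian
integration by parts trades the factor r for a space derivative, which turns this term into Φxx. The
strict inequality s < τ avoids the singularity of the square root. -/
theorem hasDerivAt_heatEvol (h : IsSpaceTimeTest Φ Φt Φx Φxx B) {s τ : ℝ} (hs : s < τ) (z : ℝ) :
    HasDerivAt (fun τ => heatEvol d (τ - s) (Φ τ) z)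
      (heatEvol d (τ - s) (fun x => Φt τ x + Φxx τ x + d • Φx τ x) z) τ := by
  set p : ℝ → ℝ → ℝ := fun r τ => z + d * (τ - s) + √(2 * (τ - s)) * r with hp
  set p' : ℝ → ℝ → ℝ := fun r τ => d + (√(2 * (τ - s)))⁻¹ * r with hp'
  have hpd : ∀ r τ, s < τ → HasDerivAt (p r) (p' r τ) τ := by
    intro r τ hτ
    have hlin : HasDerivAt (fun τ : ℝ => 2 * (τ - s)) 2 τ := by
      simpa using ((hasDerivAt_id τ).sub_const s).const_mul 2
    have h1 : HasDerivAt (fun τ : ℝ => z + d * (τ - s)) d τ := by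
      simpa using (((hasDerivAt_id τ).sub_const s).const_mul d).const_add z
    have h2 := h1.add ((hlin.sqrt (by nlinarith)).mul_const r)
    refine h2.congr_deriv ?_
    simp only [hp']
    congr 1
    field_simp
  obtain ⟨C, hC⟩ := (isCompact_Icc (a := s) (b := τ + 1)).exists_bound_of_continuousOn
    h.continuous_bound.continuousOn
  have hCB : ∀ τ' ∈ Set.Icc s (τ + 1), B τ' ≤ C := fun τ' hτ' =>
    (le_abs_self _).trans (hC τ' hτ')
  have hC0 : 0 ≤ C := (h.bound_nonneg s).trans (hCB s ⟨le_rfl, by linarith⟩)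
  -- On the neighbourhood used for domination the time stays at distance at least δ from s, so the
  -- inverse square root is at most (√(2δ))⁻¹.
  set δ := (τ - s) / 2 with hδ
  have hδ0 : 0 < δ := by rw [hδ]; linarith
  have hmain := hasDerivAt_integral_of_dominated_loc_of_deriv_le (μ := gaussianReal 0 1)
    (s := Set.Ioo (s + δ) (τ + 1)) (x₀ := τ)
    (F := fun τ r => Φ τ (p r τ)) (F' := fun τ r => Φt τ (p r τ) + p' r τ • Φx τ (p r τ))
    (bound := fun r => C + (|d| + (√(2 * δ))⁻¹ * |r|) * C)
    (Ioo_mem_nhds (by rw [hδ]; linarith) (by linarith)) ?_ ?_ ?_ ?_ ?_ ?_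
  · refine HasDerivAt.congr_deriv hmain.2 (Eq.symm ?_)
    have hq : Continuous fun r => p r τ := by fun_prop
    have hψ := integral_smul_gaussianReal (f := fun r => Φx τ (p r τ))
      (f' := fun r => √(2 * (τ - s)) • Φxx τ (p r τ)) (C := B τ * (1 + √(2 * (τ - s)))) ?_ ?_ ?_ ?_
    · have i1 : Integrable (fun r => Φt τ (p r τ)) (gaussianReal 0 1) :=
        integrable_of_continuous_bound (h.continuous_time.comp (f := fun r => (τ, p r τ))
          (by fun_prop)) (B τ) (Eventually.of_forall fun r => h.bound_time _ _)
      have i2 : Integrable (fun r => Φxx τ (p r τ)) (gaussianReal 0 1) :=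
        integrable_of_continuous_bound (h.continuous_space₂.comp (f := fun r => (τ, p r τ))
          (by fun_prop)) (B τ) (Eventually.of_forall fun r => h.bound_space₂ _ _)
      have i3 : Integrable (fun r => Φx τ (p r τ)) (gaussianReal 0 1) :=
        integrable_of_continuous_bound (h.continuous_space.comp (f := fun r => (τ, p r τ))
          (by fun_prop)) (B τ) (Eventually.of_forall fun r => h.bound_space _ _)
      have i4 : Integrable (fun r => r • Φx τ (p r τ)) (gaussianReal 0 1) := by
        refine (integrable_abs_gaussianReal.mul_const (B τ)).mono'
          (continuous_id.smul (h.continuous_space.comp (f := fun r => (τ, p r τ))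
          (by fun_prop))).aestronglyMeasurable (Eventually.of_forall fun r => ?_)
        rw [norm_smul, Real.norm_eq_abs]
        exact mul_le_mul_of_nonneg_left (h.bound_space _ _) (abs_nonneg _)
      have hsq : √(2 * (τ - s)) ≠ 0 := (Real.sqrt_pos.mpr (by linarith)).ne'
      unfold heatEvol
      have e1 : ∀ r, Φt τ (p r τ) + p' r τ • Φx τ (p r τ) = Φt τ (p r τ)
          + d • Φx τ (p r τ) + (√(2 * (τ - s)))⁻¹ • (r • Φx τ (p r τ)) := by
        intro r
        simp only [hp']
        rw [add_smul, mul_smul, add_assoc]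
      simp only [e1]
      have i3d : Integrable (fun r => d • Φx τ (p r τ)) (gaussianReal 0 1) := i3.smul d
      have i13 : Integrable (fun r => Φt τ (p r τ) + d • Φx τ (p r τ)) (gaussianReal 0 1) :=
        i1.add i3d
      have i12 : Integrable (fun r => Φt τ (p r τ) + Φxx τ (p r τ)) (gaussianReal 0 1) :=
        i1.add i2
      have i4s : Integrable (fun r => (√(2 * (τ - s)))⁻¹ • (r • Φx τ (p r τ)))
        (gaussianReal 0 1) := i4.smul _
      change ∫ r, Φt τ (p r τ) + Φxx τ (p r τ) + d • Φx τ (p r τ) ∂(gaussianReal 0 1) = _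
      rw [integral_add i13 i4s, integral_smul (√(2 * (τ - s)))⁻¹, hψ,
        integral_smul (√(2 * (τ - s))),
        smul_smul, inv_mul_cancel₀ hsq, one_smul, integral_add i1 i3d,
        integral_add i12 i3d, integral_add i1 i2]
      abel
    · intro r
      have h2 : HasDerivAt (fun r => p r τ) (√(2 * (τ - s))) r := by
        simpa [hp] using ((hasDerivAt_id r).const_mul (√(2 * (τ - s)))).const_add
          (z + d * (τ - s))
      exact (h.hasDerivAt_space₂ τ _).scomp r h2
    · exact (h.continuous_space₂.comp (f := fun r => (τ, p r τ)) (by fun_prop)).const_smul _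
    · intro r
      refine (h.bound_space _ _).trans ?_
      exact le_mul_of_one_le_right (h.bound_nonneg _) (by linarith [Real.sqrt_nonneg (2 * (τ - s))])
    · intro r
      rw [norm_smul, Real.norm_of_nonneg (Real.sqrt_nonneg _), mul_comm]
      exact mul_le_mul (h.bound_space₂ _ _) (by linarith) (Real.sqrt_nonneg _) (h.bound_nonneg _)
  · exact Eventually.of_forall fun τ' => (h.continuous.comp (f := fun r => (τ', p r τ'))
      (by fun_prop)).aestronglyMeasurable
  · exact integrable_of_continuous_bound (h.continuous.comp (f := fun r => (τ, p r τ))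
      (by fun_prop)) (B τ) (Eventually.of_forall fun r => h.bound _ _)
  · refine Continuous.aestronglyMeasurable ?_
    exact (h.continuous_time.comp (f := fun r => (τ, p r τ)) (by fun_prop)).add
      ((by fun_prop : Continuous fun r => p' r τ).smul
        (h.continuous_space.comp (f := fun r => (τ, p r τ)) (by fun_prop)))
  · refine Eventually.of_forall fun r τ' hτ' => ?_
    have hmem : τ' ∈ Set.Icc s (τ + 1) := ⟨by linarith [hτ'.1], hτ'.2.le⟩
    refine (norm_add_le _ _).trans (add_le_add ((h.bound_time _ _).trans (hCB _ hmem)) ?_)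
    rw [norm_smul]
    refine mul_le_mul ?_ ((h.bound_space _ _).trans (hCB _ hmem)) (norm_nonneg _) (by positivity)
    refine (norm_add_le _ _).trans (add_le_add le_rfl ?_)
    rw [norm_mul, norm_inv, Real.norm_of_nonneg (Real.sqrt_nonneg _)]
    refine mul_le_mul_of_nonneg_right ?_ (abs_nonneg _)
    have : 0 < √(2 * δ) := Real.sqrt_pos.mpr (by linarith)
    gcongr
    linarith [hτ'.1]
  · exact ((integrable_const C).add (((integrable_const _).add
      (integrable_abs_gaussianReal.const_mul _)).mul_const C))
  · exact Eventually.of_forall fun r τ' hτ' =>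
      h.hasDerivAt_comp (hpd r τ' (by linarith [hτ'.1]))

theorem continuous_heatEvol_generator (h : IsSpaceTimeTest Φ Φt Φx Φxx B) {X : Type*}
    [TopologicalSpace X] [FirstCountableTopology X] {t₁ t₂ y : X → ℝ} (h₁ : Continuous t₁)
    (h₂ : Continuous t₂) (hy : Continuous y) :
    Continuous fun p => heatEvol d (t₁ p) (fun x => Φt (t₂ p) x + Φxx (t₂ p) x
      + d • Φx (t₂ p) x) (y p) :=
  continuous_heatEvol (a := fun p x => Φt (t₂ p) x + Φxx (t₂ p) x + d • Φx (t₂ p) x)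
    ((h.continuous_generator d).comp (f := fun q : X × ℝ => (t₂ q.1, q.2)) (by fun_prop))
    (A := fun p => (2 + |d|) * B (t₂ p)) (by have := h.continuous_bound; fun_prop)
    (fun p x => h.bound_generator d _ _) h₁ hy

variable [CompleteSpace F] in
theorem heatEvol_eq (h : IsSpaceTimeTest Φ Φt Φx Φxx B) {s T : ℝ} (hs : s ≤ T) (z : ℝ) :
    ∫ τ in s..T, heatEvol d (τ - s) (fun x => Φt τ x + Φxx τ x + d • Φx τ x) z
      = heatEvol d (T - s) (Φ T) z - Φ s z := by
  rw [intervalIntegral.integral_eq_sub_of_hasDerivAt_of_le hs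
    (f := fun τ => heatEvol d (τ - s) (Φ τ) z)]
  · simp
  · exact (continuous_heatEvol h.continuous h.continuous_bound h.bound (by fun_prop)
      continuous_const).continuousOn
  · exact fun τ hτ => h.hasDerivAt_heatEvol hτ.1 z
  · exact (h.continuous_heatEvol_generator (X := ℝ) (t₁ := fun τ => τ - s) (t₂ := id)
      (by fun_prop) continuous_id continuous_const).intervalIntegrable _ _

variable [CompleteSpace F]

/-- The evolution solves its equation in the weak sense. -/
theorem evol_eq (h : IsSpaceTimeTest Φ Φt Φx Φxx B) (hN : Continuous N) (hm : ∀ z, ‖N z‖ ≤ m)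
    {T : ℝ} (hT : 0 ≤ T) (y : ℝ) :
    evol N d T (Φ T) y = Φ 0 y + ∫ t in (0 : ℝ)..T,
      evol N d t (fun x => Φt t x + Φxx t x + d • Φx t x + N x (Φ t x)) y := by
  have hm0 : 0 ≤ m := (norm_nonneg _).trans (hm 0)
  have hNb : ∀ {b : ℝ → F} {C : ℝ}, (∀ x, ‖b x‖ ≤ C) → ∀ x, ‖N x (b x)‖ ≤ m * C := fun hb x =>
    (ContinuousLinearMap.le_opNorm _ _).trans (mul_le_mul (hm _) (hb _) (norm_nonneg _) hm0)
  set L : ℝ → ℝ → F := fun t x => Φt t x + Φxx t x + d • Φx t x with hL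
  have hLc : Continuous (Function.uncurry L) := h.continuous_generator d
  have hLb : ∀ t x, ‖L t x‖ ≤ (2 + |d|) * B t := h.bound_generator d
  have hBc := h.continuous_bound
  have hNΦ : Continuous (Function.uncurry fun t x => N x (Φ t x)) :=
    (hN.comp continuous_snd).clm_apply h.continuous
  have hadd : ∀ t, evol N d t (fun x => L t x + N x (Φ t x)) y
      = evol N d t (L t) y + evol N d t (fun x => N x (Φ t x)) y := fun t =>
    evol_add hN hm (hLc.comp (Continuous.prodMk_right t)) (hNΦ.comp (Continuous.prodMk_right t))
      (hLb t) (hNb (h.bound t)) t y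
  have hc1 : Continuous fun t => evol N d t (L t) y :=
    continuous_evol hN hm hLc (A := fun t => (2 + |d|) * B t) (by fun_prop) hLb continuous_id
      continuous_const
  have hc2 : Continuous fun t => evol N d t (fun x => N x (Φ t x)) y :=
    continuous_evol hN hm hNΦ (A := fun t => m * B t) (by fun_prop) (fun t => hNb (h.bound t))
      continuous_id continuous_const
  -- the double integrand
  have hf : Continuous (Function.uncurry fun t s =>
      evol N d s (fun z => N z (heatEvol d (t - s) (L t) z)) y) := by
    refine continuous_evol hN hm (X := ℝ × ℝ)
      (a := fun p z => N z (heatEvol d (p.1 - p.2) (L p.1) z)) ?_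
      (A := fun p => m * ((2 + |d|) * B p.1)) (by fun_prop)
      (fun p => hNb fun x => norm_heatEvol_le (hLb p.1) _ _) continuous_snd continuous_const
    exact (hN.comp continuous_snd).clm_apply (h.continuous_heatEvol_generator
      (X := (ℝ × ℝ) × ℝ) (t₁ := fun q => q.1.1 - q.1.2) (t₂ := fun q => q.1.1) (by fun_prop)
      (by fun_prop) continuous_snd)
  have e1 : ∫ t in (0 : ℝ)..T, evol N d t (L t) y = (heatEvol d T (Φ T) y - Φ 0 y)
      + ∫ t in (0 : ℝ)..T, ∫ s in (0 : ℝ)..t,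
        evol N d s (fun z => N z (heatEvol d (t - s) (L t) z)) y := by
    have := h.heatEvol_eq (d := d) hT y
    simp only [sub_zero] at this
    rw [← this, ← intervalIntegral.integral_add]
    · refine intervalIntegral.integral_congr fun t ht => ?_
      rw [Set.uIcc_of_le hT] at ht
      exact evol_eq_heatEvol_add hN hm (hLc.comp (Continuous.prodMk_right t)) (hLb t) ht.1 y
    · exact (h.continuous_heatEvol_generator (X := ℝ) (t₁ := id) (t₂ := id)
        continuous_id continuous_id continuous_const).intervalIntegrable _ _
    · refine Continuous.intervalIntegrable ?_ _ _
      exact intervalIntegral.continuous_parametric_intervalIntegral_of_continuous (f := fun t s =>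
        evol N d s (fun z => N z (heatEvol d (t - s) (L t) z)) y) hf continuous_id
  -- With the triangle of integration read in the other order, the inner integral over t is that of
  -- an exact derivative and reduces to its end values. The one at t = T rebuilds the Duhamel term
  -- of the evolution up to T, the one at t = s cancels the potential term NΦ.
  have e2 : ∀ s ∈ Set.uIcc 0 T, ∫ t in s..T,
        evol N d s (fun z => N z (heatEvol d (t - s) (L t) z)) y
      = evol N d s (fun z => N z (heatEvol d (T - s) (Φ T) z)) y
        - evol N d s (fun z => N z (Φ s z)) y := by
    intro s hs
    rw [Set.uIcc_of_le hT] at hs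
    obtain ⟨C, hC⟩ := (isCompact_Icc (a := s) (b := T)).exists_bound_of_continuousOn
      hBc.continuousOn
    have hcz : Continuous (Function.uncurry fun t z => heatEvol d (t - s) (L t) z) :=
      h.continuous_heatEvol_generator (X := ℝ × ℝ) (t₁ := fun q => q.1 - s) (t₂ := fun q => q.1)
        (by fun_prop) (by fun_prop) continuous_snd
    rw [← evol_intervalIntegral hN hm (a := fun t z => N z (heatEvol d (t - s) (L t) z))
      ((hN.comp continuous_snd).clm_apply hcz) hs.2 (A := m * ((2 + |d|) * C))
      (fun t ht x => hNb (b := fun z => heatEvol d (t - s) (L t) z) (fun x =>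
        (norm_heatEvol_le (hLb t) _ _).trans (mul_le_mul_of_nonneg_left
          ((le_abs_self _).trans (hC t ⟨ht.1.le, ht.2⟩)) (by positivity))) x)]
    have e3 : (fun x => ∫ t in s..T, N x (heatEvol d (t - s) (L t) x))
        = fun x => N x (heatEvol d (T - s) (Φ T) x) + (-1 : ℂ) • N x (Φ s x) := by
      funext x
      have hi : IntervalIntegrable (fun t => heatEvol d (t - s) (L t) x) volume s T :=
        (hcz.comp (Continuous.prodMk_left x)).intervalIntegrable _ _
      rw [ContinuousLinearMap.intervalIntegral_comp_comm _ hi, h.heatEvol_eq hs.2 x,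
        map_sub, neg_one_smul, sub_eq_add_neg]
    have hΦT : Continuous (Φ T) := h.continuous.comp (Continuous.prodMk_right T)
    have hh : Continuous fun x => N x (heatEvol d (T - s) (Φ T) x) :=
      hN.clm_apply (continuous_heatEvol (X := ℝ) (a := fun _ => Φ T) (hΦT.comp continuous_snd)
        (A := fun _ => B T) continuous_const (fun _ => h.bound T) continuous_const continuous_id)
    have hΦs : Continuous fun x => (-1 : ℂ) • N x (Φ s x) :=
      (hNΦ.comp (Continuous.prodMk_right s)).const_smul (-1 : ℂ)
    rw [e3, evol_add hN hm hh hΦs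
      (hNb fun x => norm_heatEvol_le (h.bound T) _ _)
      (B := m * B s) (fun x => by simpa using hNb (h.bound s) x), evol_const_smul, neg_one_smul,
      ← sub_eq_add_neg]
  have hΦT : Continuous (Φ T) := h.continuous.comp (Continuous.prodMk_right T)
  have hc3 : Continuous fun s => evol N d s (fun z => N z (heatEvol d (T - s) (Φ T) z)) y := by
    refine continuous_evol hN hm (X := ℝ)
      (a := fun s z => N z (heatEvol d (T - s) (Φ T) z)) ?_
      (A := fun _ => m * B T) continuous_const
      (fun p => hNb fun x => norm_heatEvol_le (h.bound T) _ _) continuous_id continuous_const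
    exact (hN.comp continuous_snd).clm_apply (continuous_heatEvol (X := ℝ × ℝ)
      (a := fun _ => Φ T) (hΦT.comp continuous_snd) (A := fun _ => B T) continuous_const
      (fun _ => h.bound T) (t := fun p => T - p.1) (by fun_prop) continuous_snd)
  change _ = _ + ∫ t in (0 : ℝ)..T, evol N d t (fun x => L t x + N x (Φ t x)) y
  simp only [hadd]
  rw [intervalIntegral.integral_add (hc1.intervalIntegrable _ _) (hc2.intervalIntegrable _ _), e1,
    intervalIntegral_triangle_swap hf hT, intervalIntegral.integral_congr e2,
    intervalIntegral.integral_sub (hc3.intervalIntegrable _ _) (hc2.intervalIntegrable _ _),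
    evol_eq_heatEvol_add hN hm hΦT (h.bound T) hT y]
  abel

end IsSpaceTimeTest

end

section

/-! ### The kernel of the evolution -/

/-- The kernel of the evolution generated by `∂² + d ∂`. -/
def heatKernel (d y t x : ℝ) : ℝ :=
  (√(4 * Real.pi * t))⁻¹ * Real.exp (-(x - (y + d * t)) ^ 2 / (4 * t))

theorem heatKernel_nonneg (d y t x : ℝ) : 0 ≤ heatKernel d y t x := by
  unfold heatKernel; positivity

theorem integral_gaussianReal_eq_heatKernel {E : Type*} [NormedAddCommGroup E] [NormedSpace ℝ E]
    (d y : ℝ) {t : ℝ} (ht : 0 < t) (g : ℝ → E) :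
    ∫ r, g (y + d * t + √(2 * t) * r) ∂(gaussianReal 0 1) = ∫ x, heatKernel d y t x • g x := by
  rw [integral_gaussianReal_eq_integral_smul one_ne_zero]
  have hs : 0 < √(2 * t) := Real.sqrt_pos.mpr (by linarith)
  have h1 := Measure.integral_comp_mul_left
    (fun x => heatKernel d y t (y + d * t + x) • g (y + d * t + x)) (√(2 * t))
  rw [integral_add_left_eq_self (fun x => heatKernel d y t x • g x) (y + d * t)] at h1
  have h2 : ∫ x, heatKernel d y t x • g x = √(2 * t) • ∫ x, heatKernel d y t
      (y + d * t + √(2 * t) * x) • g (y + d * t + √(2 * t) * x) := by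
    rw [h1, smul_smul, abs_of_pos (inv_pos.mpr hs), mul_inv_cancel₀ hs.ne', one_smul]
  rw [h2, ← integral_smul]
  refine integral_congr_ae (Eventually.of_forall fun r => ?_)
  simp only [smul_smul]
  congr 1
  simp only [gaussianPDFReal, heatKernel, NNReal.coe_one, sub_zero, mul_one]
  rw [show 4 * Real.pi * t = (2 * Real.pi) * (2 * t) by ring,
    Real.sqrt_mul (by positivity) (2 * t)]
  rw [show (y + d * t + √(2 * t) * r - (y + d * t)) ^ 2 = √(2 * t) ^ 2 * r ^ 2 by ring,
    Real.sq_sqrt (by linarith)]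
  have : -(2 * t * r ^ 2) / (4 * t) = -r ^ 2 / 2 := by field_simp; ring
  rw [this]
  field_simp

/-- Completing the square recentres the Gaussian at y. The drift costs a factor e^{d²t/4} and half
of the exponent. -/
theorem heatKernel_le {d y t x : ℝ} (ht : 0 < t) :
    heatKernel d y t x
      ≤ t ^ (-(1 / 2) : ℝ) * (Real.exp (d ^ 2 * t / 4) * Real.exp (-(1 / 8) * (x - y) ^ 2 / t)) := by
  unfold heatKernel
  rw [← Real.exp_add]
  refine mul_le_mul ?_ (Real.exp_le_exp.mpr ?_) (Real.exp_pos _).le (by positivity)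
  · rw [Real.rpow_neg ht.le, ← Real.sqrt_eq_rpow]
    have := Real.pi_gt_three
    gcongr
    nlinarith
  · have h : (x - y) ^ 2 / (8 * t) ≤ (x - (y + d * t)) ^ 2 / (4 * t) + d ^ 2 * t / 4 := by
      have : (x - (y + d * t)) ^ 2 / (4 * t) + d ^ 2 * t / 4 - (x - y) ^ 2 / (8 * t)
          = (x - y - 2 * d * t) ^ 2 / (8 * t) := by
        field_simp; ring
      have h2 : 0 ≤ (x - y - 2 * d * t) ^ 2 / (8 * t) := by positivity
      linarith
    have e1 : -(x - (y + d * t)) ^ 2 / (4 * t) = -((x - (y + d * t)) ^ 2 / (4 * t)) := by ring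
    have e2 : -(1 / 8) * (x - y) ^ 2 / t = -((x - y) ^ 2 / (8 * t)) := by field_simp
    rw [e1, e2]
    linarith

theorem continuousOn_heatKernel (d : ℝ) :
    ContinuousOn (fun z : ℝ × ℝ × ℝ => heatKernel d z.2.2 z.2.1 z.1) {z | 0 < z.2.1} := by
  unfold heatKernel
  have h1 : ∀ z ∈ {z : ℝ × ℝ × ℝ | 0 < z.2.1}, √(4 * Real.pi * z.2.1) ≠ 0 := fun z hz =>
    (Real.sqrt_pos.mpr (mul_pos (by positivity) hz)).ne'
  have h2 : ∀ z ∈ {z : ℝ × ℝ × ℝ | 0 < z.2.1}, 4 * z.2.1 ≠ 0 := fun z hz =>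
    (mul_pos (by norm_num) hz).ne'
  exact (ContinuousOn.inv₀ (by fun_prop) h1).mul
    (ContinuousOn.rexp (ContinuousOn.div (by fun_prop) (by fun_prop) h2))

variable {F : Type*} [NormedAddCommGroup F] [NormedSpace ℂ F]

/-- The kernel of the evolution generated by `∂² + d ∂ + N`. -/
def evolKernel (N : ℝ → F →L[ℂ] F) (d y t x : ℝ) : F →L[ℂ] F :=
  heatKernel d y t x • pathFactor N y t x

variable {N : ℝ → F →L[ℂ] F} {m d : ℝ}

theorem evol_eq_integral {t : ℝ} (ht : 0 < t) (a : ℝ → F) (y : ℝ) :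
    evol N d t a y = ∫ x, evolKernel N d y t x (a x) :=
  integral_gaussianReal_eq_heatKernel d y ht fun x => pathFactor N y t x (a x)

theorem norm_evolKernel_le (hm : ∀ z, ‖N z‖ ≤ m) {y t x : ℝ} (ht : 0 < t) :
    ‖evolKernel N d y t x‖ ≤ Real.exp (m * t) * heatKernel d y t x := by
  unfold evolKernel
  rw [norm_smul, Real.norm_of_nonneg (heatKernel_nonneg _ _ _ _), mul_comm]
  refine mul_le_mul_of_nonneg_right ?_ (heatKernel_nonneg _ _ _ _)
  simpa [abs_of_pos ht] using norm_pathFactor_le hm y t x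

theorem continuousOn_evolKernel [CompleteSpace F] (hN : Continuous N) (hm : ∀ z, ‖N z‖ ≤ m) :
    ContinuousOn (fun z : ℝ × ℝ × ℝ => evolKernel N d z.2.2 z.2.1 z.1) {z | 0 < z.2.1} :=
  (continuousOn_heatKernel d).smul ((continuous_pathFactor hN hm).comp
    (f := fun z : ℝ × ℝ × ℝ => (z.2.2, z.2.1, z.1)) (by fun_prop)).continuousOn

theorem integrable_heatKernel (d y : ℝ) {t : ℝ} (ht : 0 < t) :
    Integrable fun x => heatKernel d y t x := by
  unfold heatKernel
  have h := ((integrable_exp_neg_mul_sq (b := 1 / (4 * t)) (by positivity)).comp_sub_right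
    (y + d * t)).const_mul (√(4 * Real.pi * t))⁻¹
  refine h.congr (Eventually.of_forall fun x => ?_)
  simp only
  congr 2
  field_simp

theorem integrable_evolKernel_apply [CompleteSpace F] (hN : Continuous N) (hm : ∀ z, ‖N z‖ ≤ m)
    {y t : ℝ} (ht : 0 < t) {a : ℝ → F} (ha : Continuous a) {A : ℝ} (hA : ∀ x, ‖a x‖ ≤ A) :
    Integrable fun x => evolKernel N d y t x (a x) := by
  have hc : Continuous fun x => evolKernel N d y t x :=
    (continuousOn_evolKernel hN hm).comp_continuous (f := fun x : ℝ => (x, t, y)) (by fun_prop)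
      fun x => ht
  refine (((integrable_heatKernel d y ht).const_mul (Real.exp (m * t))).mul_const A).mono'
    (hc.clm_apply ha).aestronglyMeasurable (Eventually.of_forall fun x => ?_)
  exact (ContinuousLinearMap.le_opNorm _ _).trans
    (mul_le_mul (norm_evolKernel_le hm ht) (hA x) (norm_nonneg _)
      (mul_nonneg (Real.exp_pos _).le (heatKernel_nonneg _ _ _ _)))

/-- The path factor commutes with the real operators that commute with the potential. -/
theorem pathTerm_comm (hN : Continuous N) (hm : ∀ z, ‖N z‖ ≤ m) [CompleteSpace F] (J : F →L[ℝ] F)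
    (hJ : ∀ z v, J (N z v) = N z (J v)) (k : ℕ) :
    ∀ y t x v, J (pathTerm N k y t x v) = pathTerm N k y t x (J v) := by
  induction k with
  | zero => intro y t x v; simp [pathTerm]
  | succ k ih =>
    intro y t x v
    have hm0 : 0 ≤ m := (norm_nonneg _).trans (hm 0)
    have hc : Continuous fun q : ℝ × ℝ => pathTerm N k y (t * q.1) (bridge y x q.1 t q.2)
        * N (bridge y x q.1 t q.2) := by
      have hb : Continuous fun q : ℝ × ℝ => bridge y x q.1 t q.2 :=
        continuous_bridge (by fun_prop) (by fun_prop) (by fun_prop) (by fun_prop) (by fun_prop)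
      exact ((continuous_pathTerm hN hm k).comp (f := fun q : ℝ × ℝ =>
        (y, t * q.1, bridge y x q.1 t q.2)) (by fun_prop)).mul (hN.comp hb)
    have hcb : ∀ s w, ‖pathTerm N k y (t * s) (bridge y x s t w) * N (bridge y x s t w)‖
        ≤ (m * |t * s|) ^ k / k.factorial * m := fun s w =>
      (norm_mul_le _ _).trans (mul_le_mul (norm_pathTerm_le hm k _ _ _) (hm _) (norm_nonneg _)
        (by positivity))
    have hin : ∀ s, Integrable (fun w => pathTerm N k y (t * s) (bridge y x s t w)
        * N (bridge y x s t w)) (gaussianReal 0 1) := fun s =>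
      integrable_of_continuous_bound (hc.comp (Continuous.prodMk_right s)) _
        (Eventually.of_forall fun w => hcb s w)
    have hout : Continuous fun s => ∫ w, pathTerm N k y (t * s) (bridge y x s t w)
        * N (bridge y x s t w) ∂(gaussianReal 0 1) :=
      continuous_integral_of_bound _ (f := fun s w => pathTerm N k y (t * s)
        (bridge y x s t w) * N (bridge y x s t w)) hc
        (B := fun s => (m * |t * s|) ^ k / k.factorial * m) (by fun_prop) hcb
    have happ : ∀ v, pathTerm N (k + 1) y t x v = t • ∫ s in (0 : ℝ)..1, ∫ w,
        pathTerm N k y (t * s) (bridge y x s t w) (N (bridge y x s t w) v)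
          ∂(gaussianReal 0 1) := by
      intro v
      simp only [pathTerm]
      rw [smul_apply, ContinuousLinearMap.intervalIntegral_apply (hout.intervalIntegrable _ _)]
      congr 1
      refine intervalIntegral.integral_congr fun s _ => ?_
      exact ContinuousLinearMap.integral_apply (hin s) v
    have hin' : ∀ s v, Integrable (fun w => pathTerm N k y (t * s) (bridge y x s t w)
        (N (bridge y x s t w) v)) (gaussianReal 0 1) := fun s v => (hin s).apply_continuousLinearMap v
    have hout' : ∀ v, Continuous fun s => ∫ w, pathTerm N k y (t * s) (bridge y x s t w)
        (N (bridge y x s t w) v) ∂(gaussianReal 0 1) := fun v => by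
      have := hout.clm_apply (continuous_const (y := v))
      refine this.congr fun s => ?_
      exact ContinuousLinearMap.integral_apply (hin s) v
    rw [happ, happ, map_smul, ← ContinuousLinearMap.intervalIntegral_comp_comm J
      ((hout' v).intervalIntegrable _ _)]
    congr 1
    refine intervalIntegral.integral_congr fun s _ => ?_
    refine (ContinuousLinearMap.integral_comp_comm J (hin' s v)).symm.trans ?_
    refine integral_congr_ae (Eventually.of_forall fun w => ?_)
    simp only [ih, hJ]

/-- `J` is only real linear because the intended case is complex conjugation, which commutes with a
real potential. -/
theorem pathFactor_comm (hN : Continuous N) (hm : ∀ z, ‖N z‖ ≤ m) [CompleteSpace F]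
    (J : F →L[ℝ] F) (hJ : ∀ z v, J (N z v) = N z (J v)) (y t x : ℝ) (v : F) :
    J (pathFactor N y t x v) = pathFactor N y t x (J v) := by
  have h1 := (ContinuousLinearMap.apply ℂ F v).hasSum (hasSum_pathFactor hm y t x)
  have h2 := (ContinuousLinearMap.apply ℂ F (J v)).hasSum (hasSum_pathFactor hm y t x)
  have h3 := J.hasSum h1
  simp only [ContinuousLinearMap.apply_apply] at h2 h3
  simp only [pathTerm_comm hN hm J hJ] at h3
  exact h3.unique h2

end

section

/-! ### The Green kernel -/

section EuclideanSpace

variable {n : ℕ}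

/-- The action of the transposed potential on row vectors. -/
def rowAct (M : ℝ → Matrix (Fin n) (Fin n) ℝ) (z : ℝ) :
    EuclideanSpace ℂ (Fin n) →L[ℂ] EuclideanSpace ℂ (Fin n) :=
  realMatrixAct (M z).transpose

theorem realMatrixAct_apply (A : Matrix (Fin n) (Fin n) ℝ) (v : EuclideanSpace ℂ (Fin n))
    (i : Fin n) : realMatrixAct A v i = ∑ j, (A i j : ℂ) * v j := by
  simp [realMatrixAct, Matrix.mulVec, dotProduct]

theorem continuous_realMatrixAct :
    Continuous (realMatrixAct : Matrix (Fin n) (Fin n) ℝ → _) := by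
  have h : Continuous fun A : Matrix (Fin n) (Fin n) ℂ =>
      Matrix.toEuclideanCLM (n := Fin n) (𝕜 := ℂ) A :=
    LinearMap.continuous_of_finiteDimensional
      (Matrix.toEuclideanCLM (n := Fin n) (𝕜 := ℂ)).toAlgEquiv.toLinearMap
  exact h.comp (Continuous.matrix_map continuous_id Complex.continuous_ofReal)

theorem exists_norm_le_of_periodic {E : Type*} [NormedAddCommGroup E] {f : ℝ → E}
    (hf : Continuous f) (hp : Function.Periodic f 1) : ∃ C, ∀ x, ‖f x‖ ≤ C := by
  obtain ⟨C, hC⟩ := (isCompact_Icc (a := (0 : ℝ)) (b := 1)).exists_bound_of_continuousOn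
    hf.continuousOn
  refine ⟨C, fun x => ?_⟩
  obtain ⟨y, hy, hxy⟩ := hp.exists_mem_Ico₀ one_pos x
  rw [hxy]
  exact hC y ⟨hy.1, hy.2.le⟩

/-- Entrywise complex conjugation. -/
def conjVec : EuclideanSpace ℂ (Fin n) →L[ℝ] EuclideanSpace ℂ (Fin n) :=
  LinearMap.toContinuousLinearMap
    { toFun := fun v => WithLp.toLp 2 fun i => (starRingEnd ℂ) (v i)
      map_add' := fun v w => by ext i; simp
      map_smul' := fun r v => by ext i; simp }

@[simp] theorem conjVec_apply (v : EuclideanSpace ℂ (Fin n)) (i : Fin n) :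
    conjVec v i = (starRingEnd ℂ) (v i) := rfl

/-- The Green kernel of `∂² + c ∂ + M`. -/
def greenKernel (M : ℝ → Matrix (Fin n) (Fin n) ℝ) (c x t y : ℝ) : Matrix (Fin n) (Fin n) ℝ :=
  Matrix.of fun i j => (evolKernel (rowAct M) (-c) y t x (EuclideanSpace.single i 1) j).re

variable {M : ℝ → Matrix (Fin n) (Fin n) ℝ} {c : ℝ}

theorem continuous_rowAct (hM : Continuous M) : Continuous (rowAct M) :=
  continuous_realMatrixAct.comp hM.matrix_transpose

theorem rowAct_periodic (hper : Function.Periodic M 1) : Function.Periodic (rowAct M) 1 := by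
  intro x; simp only [rowAct, hper x]

/-- The potential has real entries, so the path factor commutes with conjugation and fixes real
vectors. Hence the real part in the definition of `greenKernel` loses nothing. -/
theorem greenKernel_ofReal (hM : Continuous M) (hper : Function.Periodic M 1) (x t y : ℝ)
    (i j : Fin n) :
    (greenKernel M c x t y i j : ℂ)
      = evolKernel (rowAct M) (-c) y t x (EuclideanSpace.single i 1) j := by
  obtain ⟨m, hm⟩ := exists_norm_le_of_periodic (continuous_rowAct hM) (rowAct_periodic hper)
  have hJ : ∀ z (v : EuclideanSpace ℂ (Fin n)), conjVec (rowAct M z v) = rowAct M z (conjVec v) := by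
    intro z v
    ext k
    simp [rowAct, realMatrixAct_apply]
  have h := pathFactor_comm (continuous_rowAct hM) hm conjVec hJ y t x (EuclideanSpace.single i 1)
  have h1 : conjVec (EuclideanSpace.single i (1 : ℂ)) = EuclideanSpace.single i 1 := by
    ext k
    by_cases hk : k = i <;> simp [hk]
  rw [h1] at h
  have h2 := congrArg (fun v : EuclideanSpace ℂ (Fin n) => v j) h
  simp only [conjVec_apply] at h2
  rw [Complex.conj_eq_iff_re] at h2
  simp only [greenKernel, Matrix.of_apply, evolKernel, smul_apply, PiLp.smul_apply,
    Complex.real_smul, Complex.re_ofReal_mul, Complex.ofReal_mul]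
  rw [h2]

theorem abs_greenKernel_le {m : ℝ} (hm : ∀ z, ‖rowAct M z‖ ≤ m) {x t y : ℝ} (ht : 0 < t)
    (i j : Fin n) : |greenKernel M c x t y i j| ≤ Real.exp (m * t) * heatKernel (-c) y t x := by
  simp only [greenKernel, Matrix.of_apply]
  refine (Complex.abs_re_le_norm _).trans ((PiLp.norm_apply_le _ j).trans ?_)
  refine (ContinuousLinearMap.le_opNorm _ _).trans ?_
  simpa using norm_evolKernel_le hm ht

theorem continuousOn_greenKernel (hM : Continuous M) (hper : Function.Periodic M 1) (i j : Fin n) :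
    ContinuousOn (fun z : ℝ × ℝ × ℝ => greenKernel M c z.1 z.2.1 z.2.2 i j) {z | 0 < z.2.1} := by
  obtain ⟨m, hm⟩ := exists_norm_le_of_periodic (continuous_rowAct hM) (rowAct_periodic hper)
  have h := (continuousOn_evolKernel (d := -c) (continuous_rowAct hM) hm).clm_apply
    (continuousOn_const (c := EuclideanSpace.single i (1 : ℂ)))
  simp only [greenKernel, Matrix.of_apply]
  exact Complex.continuous_re.comp_continuousOn
    ((EuclideanSpace.proj (𝕜 := ℂ) j).continuous.comp_continuousOn h)

theorem isSpaceTimeTest_smul {F : Type*} [NormedAddCommGroup F] [NormedSpace ℂ F] {Φ : ℝ → ℝ → ℝ}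
    (hΦ : ContDiff ℝ (⊤ : ℕ∞) (fun z : ℝ × ℝ => Φ z.1 z.2))
    (hs : HasCompactSupport (fun z : ℝ × ℝ => Φ z.1 z.2)) (v : F) :
    ∃ B : ℝ, IsSpaceTimeTest (fun t x => Φ x t • v) (fun t x => deriv (fun t' => Φ x t') t • v)
      (fun t x => deriv (fun x' => Φ x' t) x • v)
      (fun t x => deriv (deriv fun x' => Φ x' t) x • v) (fun _ => B) := by
  set f : ℝ × ℝ → ℝ := fun z => Φ z.1 z.2 with hf
  have key : ∀ g : ℝ × ℝ → ℝ, ContDiff ℝ (⊤ : ℕ∞) g → HasCompactSupport g → ∀ w : ℝ × ℝ,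
      ContDiff ℝ (⊤ : ℕ∞) (fun z => fderiv ℝ g z w) ∧
      HasCompactSupport (fun z => fderiv ℝ g z w) := by
    intro g hg hgs w
    refine ⟨(hg.fderiv_right (m := (⊤ : ℕ∞)) (by simp)).clm_apply contDiff_const, ?_⟩
    exact (hgs.fderiv (𝕜 := ℝ)).comp_left (g := fun L : ℝ × ℝ →L[ℝ] ℝ => L w) (by simp)
  have hd1 : ∀ g : ℝ × ℝ → ℝ, ContDiff ℝ (⊤ : ℕ∞) g → ∀ x t,
      HasDerivAt (fun x' => g (x', t)) (fderiv ℝ g (x, t) (1, 0)) x := by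
    intro g hg x t
    exact ((hg.differentiable (by simp)).differentiableAt (x := (x, t))).hasFDerivAt.comp_hasDerivAt
      x ((hasDerivAt_id x).prodMk (hasDerivAt_const x t))
  have hd2 : ∀ g : ℝ × ℝ → ℝ, ContDiff ℝ (⊤ : ℕ∞) g → ∀ x t,
      HasDerivAt (fun t' => g (x, t')) (fderiv ℝ g (x, t) (0, 1)) t := by
    intro g hg x t
    exact ((hg.differentiable (by simp)).differentiableAt (x := (x, t))).hasFDerivAt.comp_hasDerivAt
      t ((hasDerivAt_const t x).prodMk (hasDerivAt_id t))
  obtain ⟨hx, hxs⟩ := key f hΦ hs (1, 0)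
  obtain ⟨ht, hts⟩ := key f hΦ hs (0, 1)
  obtain ⟨hxx, hxxs⟩ := key _ hx hxs (1, 0)
  have ex : ∀ t, (deriv fun x' => Φ x' t) = fun x => fderiv ℝ f (x, t) (1, 0) := fun t => by
    funext x; exact (hd1 f hΦ x t).deriv
  have et : ∀ t x, deriv (fun t' => Φ x t') t = fderiv ℝ f (x, t) (0, 1) := fun t x =>
    (hd2 f hΦ x t).deriv
  have exx : ∀ t x, deriv (deriv fun x' => Φ x' t) x
      = fderiv ℝ (fun z => fderiv ℝ f z (1, 0)) (x, t) (1, 0) := fun t x => by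
    rw [ex]; exact (hd1 _ hx x t).deriv
  obtain ⟨B0, hB0⟩ := hs.exists_bound_of_continuous hΦ.continuous
  obtain ⟨B1, hB1⟩ := hxs.exists_bound_of_continuous hx.continuous
  obtain ⟨B2, hB2⟩ := hts.exists_bound_of_continuous ht.continuous
  obtain ⟨B3, hB3⟩ := hxxs.exists_bound_of_continuous hxx.continuous
  set B := max (max B0 B1) (max B2 B3) with hB
  have hsw : ∀ g : ℝ × ℝ → ℝ, ContDiff ℝ (⊤ : ℕ∞) g →
      Continuous (Function.uncurry fun t x : ℝ => g (x, t) • v) := fun g hg =>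
    (hg.continuous.comp (f := fun p : ℝ × ℝ => (p.2, p.1)) (by fun_prop)).smul continuous_const
  have hbd : ∀ {b b' : ℝ}, ‖b‖ ≤ b' → b' ≤ B → ‖b • v‖ ≤ B * ‖v‖ := fun h1 h2 => by
    rw [norm_smul]
    exact mul_le_mul_of_nonneg_right (h1.trans h2) (norm_nonneg _)
  simp only [exx, et]
  simp only [ex]
  refine ⟨B * ‖v‖, ⟨?_, ?_, ?_, hsw f hΦ, hsw _ ht, hsw _ hx, hsw _ hxx, continuous_const,
    fun t x => hbd (hB0 (x, t)) ?_, fun t x => hbd (hB2 (x, t)) ?_, fun t x => hbd (hB1 (x, t)) ?_,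
    fun t x => hbd (hB3 (x, t)) ?_⟩⟩
  · exact fun t x => (hd2 f hΦ x t).smul_const v
  · exact fun t x => (hd1 f hΦ x t).smul_const v
  · exact fun t x => (hd1 _ hx x t).smul_const v
  all_goals simp [hB]

/-- This is `IsSpaceTimeTest.evol_eq` for the potential Mᵀ, the drift -c and the test function Φ
e_i. The operator ∂ₜ + ∂² - c∂ + Mᵀ is minus the formal adjoint of ∂ₜ - L, and Φ vanishes after its
support, so only the value at time 0 survives. -/
theorem greenKernel_fundamental (hM : Continuous M) (hper : Function.Periodic M 1)
    (y : ℝ) (Φ : ℝ → ℝ → ℝ) (hΦ : ContDiff ℝ (⊤ : ℕ∞) (fun z : ℝ × ℝ => Φ z.1 z.2))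
    (hs : HasCompactSupport (fun z : ℝ × ℝ => Φ z.1 z.2)) (i j : Fin n) :
    ∫ t in Set.Ioi (0 : ℝ), ∫ x : ℝ,
      (greenKernel M c x t y i j * (-(deriv (fun t' => Φ x t') t)
          - deriv (deriv fun x' => Φ x' t) x + c * deriv (fun x' => Φ x' t) x)
        - (M x * greenKernel M c x t y) i j * Φ x t)
      = if i = j then Φ y 0 else 0 := by
  obtain ⟨m, hm⟩ := exists_norm_le_of_periodic (continuous_rowAct hM) (rowAct_periodic hper)
  have hN := continuous_rowAct hM
  set e : EuclideanSpace ℂ (Fin n) := EuclideanSpace.single i 1 with he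
  obtain ⟨B, hB⟩ := isSpaceTimeTest_smul hΦ hs e
  -- vanishing for large times
  obtain ⟨T, hT0, hT⟩ : ∃ T : ℝ, 0 ≤ T ∧ ∀ x t, T ≤ t → Φ x t = 0 := by
    obtain ⟨R, hR⟩ := hs.isCompact.isBounded.exists_norm_le
    refine ⟨max R 0 + 1, by positivity, fun x t ht => ?_⟩
    by_contra h
    have h1 := hR (x, t) (subset_tsupport _ h)
    have h2 : t ≤ R := (le_abs_self t).trans ((norm_snd_le (x, t)).trans h1)
    have := le_max_left R 0
    linarith
  set g : ℝ → ℝ → EuclideanSpace ℂ (Fin n) := fun t x => deriv (fun t' => Φ x t') t • e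
    + deriv (deriv fun x' => Φ x' t) x • e + (-c) • deriv (fun x' => Φ x' t) x • e
    + rowAct M x (Φ x t • e) with hg
  have hgc : ∀ t, Continuous (g t) := fun t =>
    ((hB.continuous_generator (-c)).comp (Continuous.prodMk_right t)).add
      (hN.clm_apply (hB.continuous.comp (Continuous.prodMk_right t)))
  have hgb : ∀ t x, ‖g t x‖ ≤ (2 + |(-c)|) * B + m * B := fun t x =>
    (norm_add_le _ _).trans (add_le_add (hB.bound_generator (-c) t x)
      ((ContinuousLinearMap.le_opNorm _ _).trans (mul_le_mul (hm x) (hB.bound t x) (norm_nonneg _)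
        ((norm_nonneg _).trans (hm 0)))))
  set I : ℝ → ℝ := fun t => ∫ x : ℝ,
      (greenKernel M c x t y i j * (-(deriv (fun t' => Φ x t') t)
          - deriv (deriv fun x' => Φ x' t) x + c * deriv (fun x' => Φ x' t) x)
        - (M x * greenKernel M c x t y) i j * Φ x t) with hI
  have hpoint : ∀ t, 0 < t → (I t : ℂ) = - (evol (rowAct M) (-c) t (g t) y j) := by
    intro t ht
    rw [evol_eq_integral ht]
    have hint := integrable_evolKernel_apply (d := -c) (y := y) hN hm ht (hgc t) (hgb t)
    have h1 := (EuclideanSpace.proj (𝕜 := ℂ) j : EuclideanSpace ℂ (Fin n) →L[ℂ] ℂ).integral_comp_comm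
      hint
    simp only [PiLp.proj_apply] at h1
    rw [← h1]
    refine (integral_ofReal (𝕜 := ℂ)).symm.trans ?_
    rw [← integral_neg]
    refine integral_congr_ae (Eventually.of_forall fun x => ?_)
    have hexp : rowAct M x (Φ x t • e) = ∑ k, ((M x i k * Φ x t : ℝ) : ℂ) •
        EuclideanSpace.single k (1 : ℂ) := by
      ext k
      simp only [rowAct, realMatrixAct_apply, he, WithLp.ofLp_sum, WithLp.ofLp_smul,
        Finset.sum_apply, Pi.smul_apply, PiLp.single_apply, smul_eq_mul, mul_ite, mul_one,
        mul_zero, Finset.sum_ite_eq, Finset.mem_univ, if_true, Matrix.transpose_apply]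
      simp
    have hker : ∀ k, evolKernel (rowAct M) (-c) y t x (EuclideanSpace.single k 1) j
        = (greenKernel M c x t y k j : ℂ) := fun k => (greenKernel_ofReal hM hper x t y k j).symm
    simp only [hg]
    rw [hexp]
    simp only [map_add, map_sum, map_smul, PiLp.add_apply, PiLp.smul_apply, he, hker,
      WithLp.ofLp_sum, Finset.sum_apply, smul_eq_mul,
      ContinuousLinearMap.map_smul_of_tower, Complex.real_smul, Matrix.mul_apply]
    push_cast
    have hsum : (∑ k, (M x i k : ℂ) * (greenKernel M c x t y k j : ℂ)) * (Φ x t : ℂ)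
        = ∑ k, (M x i k : ℂ) * (Φ x t : ℂ) * (greenKernel M c x t y k j : ℂ) := by
      rw [Finset.sum_mul]
      exact Finset.sum_congr rfl fun k _ => by ring
    linear_combination -hsum
  have hzero : ∀ t, T < t → I t = 0 := by
    intro t ht
    have h0 : g t = fun _ => 0 := by
      funext x
      have e1 : (fun x' => Φ x' t) = fun _ => 0 := by funext x'; exact hT x' t ht.le
      have e2 : deriv (fun t' => Φ x t') t = 0 := by
        have : (fun t' => Φ x t') =ᶠ[𝓝 t] fun _ => 0 := by
          filter_upwards [lt_mem_nhds ht] with t' ht' using hT x t' ht'.le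
        rw [this.deriv_eq]; simp
      simp [hg, e1, e2, hT x t ht.le]
    have h1 := hpoint t (hT0.trans_lt ht)
    rw [h0] at h1
    simpa [evol] using h1
  have hwi := hB.evol_eq hN hm (d := -c) hT0 y
  have hend : (fun x => Φ x T • e) = fun _ => 0 := by
    funext x; rw [hT x T le_rfl, zero_smul]
  rw [hend] at hwi
  have h2 : Continuous fun t => evol (rowAct M) (-c) t (g t) y := by
    refine continuous_evol hN hm (X := ℝ) (a := g) ?_ (A := fun _ => (2 + |(-c)|) * B + m * B)
      continuous_const hgb continuous_id continuous_const
    exact (hB.continuous_generator (-c)).add ((hN.comp continuous_snd).clm_apply hB.continuous)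
  have h3 := (EuclideanSpace.proj (𝕜 := ℂ) j : EuclideanSpace ℂ (Fin n) →L[ℂ] ℂ
    ).intervalIntegral_comp_comm (h2.intervalIntegrable (μ := volume) 0 T)
  have h4 := congrArg (fun v : EuclideanSpace ℂ (Fin n) => v j) hwi
  simp only [PiLp.add_apply, PiLp.proj_apply] at h3 h4
  change _ = _ + (∫ t in (0 : ℝ)..T, evol (rowAct M) (-c) t (g t) y) j at h4
  rw [← h3] at h4
  have h5 : ∫ t in Set.Ioi (0 : ℝ), I t = ∫ t in (0 : ℝ)..T, I t := by
    rw [intervalIntegral.integral_of_le hT0]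
    refine setIntegral_eq_of_subset_of_forall_sdiff_eq_zero measurableSet_Ioi
      Set.Ioc_subset_Ioi_self fun t ht => hzero t ?_
    by_contra h
    exact ht.2 ⟨ht.1, not_lt.mp h⟩
  change ∫ t in Set.Ioi (0 : ℝ), I t = _
  rw [h5]
  apply Complex.ofReal_injective
  rw [← intervalIntegral.integral_ofReal]
  have h6 : ∫ t in (0 : ℝ)..T, (I t : ℂ) = ∫ t in (0 : ℝ)..T, -(evol (rowAct M) (-c) t (g t) y j) := by
    rw [intervalIntegral.integral_of_le hT0, intervalIntegral.integral_of_le hT0]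
    exact setIntegral_congr_fun measurableSet_Ioc fun t ht => hpoint t ht.1
  rw [h6, intervalIntegral.integral_neg]
  have h7 : evol (rowAct M) (-c) T (fun _ => (0 : EuclideanSpace ℂ (Fin n))) y j = 0 := by
    simp [evol]
  rw [h7] at h4
  have h8 : (Φ y 0 • e) j = ((if i = j then Φ y 0 else 0 : ℝ) : ℂ) := by
    rw [he]
    by_cases hij : i = j
    · simp [hij]
    · simp [hij, Ne.symm hij]
  rw [h8] at h4
  linear_combination h4

theorem isGreenKernel_greenKernel (hM : Continuous M) (hper : Function.Periodic M 1) :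
    IsGreenKernel M c (greenKernel M c) where
  continuousOn := continuousOn_greenKernel hM hper
  gaussian_bound := by
    intro T hT
    obtain ⟨m, hm⟩ := exists_norm_le_of_periodic (continuous_rowAct hM) (rowAct_periodic hper)
    have hm0 : 0 ≤ m := (norm_nonneg _).trans (hm 0)
    refine ⟨Real.exp (m * T) * Real.exp (c ^ 2 * T / 4), 1 / 8, by norm_num,
      fun x t y ht htT i j => ?_⟩
    refine (abs_greenKernel_le hm ht i j).trans ?_
    have h1 := heatKernel_le (d := -c) (y := y) (x := x) ht
    have h2 : Real.exp (m * t) ≤ Real.exp (m * T) := by gcongr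
    have h3 : Real.exp ((-c) ^ 2 * t / 4) ≤ Real.exp (c ^ 2 * T / 4) := by
      rw [neg_sq]; gcongr
    calc _ ≤ Real.exp (m * T) * (t ^ (-(1 / 2) : ℝ) * (Real.exp (c ^ 2 * T / 4)
          * Real.exp (-(1 / 8) * (x - y) ^ 2 / t))) := by
          refine mul_le_mul h2 (h1.trans ?_) (heatKernel_nonneg _ _ _ _) (Real.exp_pos _).le
          gcongr
      _ = _ := by ring
  fundamental := greenKernel_fundamental hM hper

end EuclideanSpace

end

section

/-! ### Continuous functions on the circle and the Bloch evolutions -/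

variable {F : Type*} [NormedAddCommGroup F]

variable (F) in
/-- The Banach space of continuous `1`-periodic functions. -/
def CircleFun : Type _ := C(AddCircle (1 : ℝ), F)

namespace CircleFun

instance : NormedAddCommGroup (CircleFun F) :=
  inferInstanceAs (NormedAddCommGroup C(AddCircle (1 : ℝ), F))

instance [NormedSpace ℂ F] : NormedSpace ℂ (CircleFun F) :=
  inferInstanceAs (NormedSpace ℂ C(AddCircle (1 : ℝ), F))

instance [CompleteSpace F] : CompleteSpace (CircleFun F) :=
  inferInstanceAs (CompleteSpace C(AddCircle (1 : ℝ), F))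

/-- The underlying function on the line. -/
def toFun (w : CircleFun F) (x : ℝ) : F := ContinuousMap.toFun w (x : AddCircle (1 : ℝ))

instance : CoeFun (CircleFun F) fun _ => ℝ → F := ⟨toFun⟩

/-- A continuous `1`-periodic function as an element of `CircleFun`. -/
def mk (f : ℝ → F) (hc : Continuous f) (hp : Function.Periodic f 1) : CircleFun F :=
  (⟨hp.lift, continuous_coinduced_dom.mpr hc⟩ : C(AddCircle (1 : ℝ), F))

@[simp] theorem mk_apply (f : ℝ → F) (hc : Continuous f) (hp : Function.Periodic f 1)
    (x : ℝ) : mk f hc hp x = f x := rfl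

theorem ext {v w : CircleFun F} (h : ∀ x : ℝ, v x = w x) : v = w := by
  refine ContinuousMap.ext fun θ => ?_
  induction θ using QuotientAddGroup.induction_on with
  | H x => exact h x

theorem norm_le {v : CircleFun F} {C : ℝ} (hC : 0 ≤ C) (h : ∀ x : ℝ, ‖v x‖ ≤ C) : ‖v‖ ≤ C := by
  refine (ContinuousMap.norm_le _ hC).mpr fun θ => ?_
  induction θ using QuotientAddGroup.induction_on with
  | H x => exact h x

theorem continuous (v : CircleFun F) : Continuous v :=
  (ContinuousMap.continuous_toFun v).comp (AddCircle.continuous_mk' 1)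

theorem add_one (v : CircleFun F) (x : ℝ) : v (x + 1) = v x := by
  simp only [toFun, AddCircle.coe_add_period]

theorem norm_apply_le (v : CircleFun F) (x : ℝ) : ‖v x‖ ≤ ‖v‖ :=
  ContinuousMap.norm_coe_le_norm v (x : AddCircle (1 : ℝ))

@[simp] theorem zero_apply (x : ℝ) : (0 : CircleFun F) x = 0 := rfl

@[simp] theorem add_apply (v w : CircleFun F) (x : ℝ) : (v + w) x = v x + w x := rfl

@[simp] theorem sub_apply (v w : CircleFun F) (x : ℝ) : (v - w) x = v x - w x := rfl

@[simp] theorem neg_apply (v : CircleFun F) (x : ℝ) : (-v) x = -v x := rfl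

@[simp] theorem smul_apply [NormedSpace ℂ F] (a : ℂ) (v : CircleFun F) (x : ℝ) :
    (a • v) x = a • v x := rfl

@[simp] theorem real_smul_apply [NormedSpace ℂ F] (a : ℝ) (v : CircleFun F) (x : ℝ) :
    (a • v) x = a • v x := rfl

end CircleFun

/-- The plane wave `e^{iξx}`. -/
def wave (ξ x : ℝ) : ℂ := Complex.exp (Complex.I * (ξ : ℂ) * (x : ℂ))

@[simp] theorem norm_wave (ξ x : ℝ) : ‖wave ξ x‖ = 1 := by
  rw [wave, Complex.norm_exp]; simp

theorem continuous_wave : Continuous fun p : ℝ × ℝ => wave p.1 p.2 := by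
  unfold wave; fun_prop

theorem Continuous.wave {X : Type*} [TopologicalSpace X] {ξ x : X → ℝ} (hξ : Continuous ξ)
    (hx : Continuous x) : Continuous fun p => wave (ξ p) (x p) :=
  continuous_wave.comp (hξ.prodMk hx)

theorem wave_add (ξ x y : ℝ) : wave ξ (x + y) = wave ξ x * wave ξ y := by
  unfold wave; rw [← Complex.exp_add]; push_cast; ring_nf

theorem wave_neg_mul (ξ x : ℝ) : wave (-ξ) x * wave ξ x = 1 := by
  unfold wave; rw [← Complex.exp_add]; simp

theorem wave_mul_neg (ξ x : ℝ) : wave ξ x * wave (-ξ) x = 1 := by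
  rw [mul_comm, wave_neg_mul]

@[simp] theorem wave_zero_right (ξ : ℝ) : wave ξ 0 = 1 := by simp [wave]

@[simp] theorem wave_zero_left (x : ℝ) : wave 0 x = 1 := by simp [wave]

theorem norm_wave_sub_wave_le (ξ η x : ℝ) : ‖wave ξ x - wave η x‖ ≤ |ξ - η| * |x| := by
  have h : wave ξ x - wave η x = wave η x * (Complex.exp (Complex.I * ((ξ - η) * x : ℝ)) - 1) := by
    unfold wave
    rw [mul_sub, ← Complex.exp_add]
    push_cast
    ring_nf
  rw [h, norm_mul, norm_wave, one_mul, ← abs_mul]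
  exact Real.norm_exp_I_mul_ofReal_sub_one_le

variable [NormedSpace ℂ F]

variable (F) in
/-- A continuous `1`-periodic operator-valued potential. -/
structure PeriodicPotential where
  /-- the operator at a point -/
  op : ℝ → F →L[ℂ] F
  continuous : Continuous op
  periodic : Function.Periodic op 1

namespace PeriodicPotential

/-- A bound of the potential. -/
def bound (N : PeriodicPotential F) : ℝ :=
  Classical.choose (exists_norm_le_of_periodic N.continuous N.periodic)

theorem norm_le (N : PeriodicPotential F) (z : ℝ) : ‖N.op z‖ ≤ N.bound :=
  Classical.choose_spec (exists_norm_le_of_periodic N.continuous N.periodic) z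

theorem bound_nonneg (N : PeriodicPotential F) : 0 ≤ N.bound :=
  (norm_nonneg _).trans (N.norm_le 0)


theorem continuous_wave_smul (ξ : ℝ) (w : CircleFun F) :
    Continuous fun x : ℝ => wave ξ x • w x :=
  (continuous_const.wave continuous_id).smul (CircleFun.continuous w)

theorem norm_wave_smul_le (ξ : ℝ) (w : CircleFun F) (x : ℝ) :
    ‖wave ξ x • w x‖ ≤ ‖w‖ := by
  rw [norm_smul, norm_wave, one_mul]
  exact CircleFun.norm_apply_le w x

variable (N : PeriodicPotential F) (d : ℝ)

/-- A periodic potential makes the evolution commute with the unit shift, so Floquet multipliers are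
preserved. -/
theorem evol_add_one (ξ t y : ℝ) {b : ℝ → F} (hb : ∀ x, b (x + 1) = wave (-ξ) 1 • b x) :
    evol N.op d t b (y + 1) = wave (-ξ) 1 • evol N.op d t b y := by
  unfold evol
  rw [← integral_smul]
  refine integral_congr_ae (Eventually.of_forall fun r => ?_)
  simp only
  rw [show y + 1 + d * t + √(2 * t) * r = y + d * t + √(2 * t) * r + 1 by ring,
    pathFactor_add_one N.periodic, hb, map_smul]

variable [CompleteSpace F]

theorem continuous_evol_wave_smul (ξ t : ℝ) (w : CircleFun F) : Continuous fun y =>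
    evol N.op d t (fun x => wave (-ξ) x • w x) y :=
  continuous_evol N.continuous N.norm_le (X := ℝ)
    (a := fun _ x => wave (-ξ) x • w x)
    ((continuous_wave_smul (-ξ) w).comp continuous_snd) (A := fun _ => ‖w‖)
    continuous_const (fun _ => norm_wave_smul_le _ _) continuous_const continuous_id

/-- The evolution generated by `(∂ - iξ)² + d (∂ - iξ) + N` on continuous periodic functions. -/
def blochEvol (ξ t : ℝ) : CircleFun F →L[ℂ] CircleFun F :=
  LinearMap.mkContinuous
    { toFun := fun w => CircleFun.mk
        (fun y => wave ξ y • evol N.op d t (fun x => wave (-ξ) x • w x) y)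
        ((continuous_const.wave continuous_id).smul (N.continuous_evol_wave_smul d ξ t w))
        (fun y => by
          change wave ξ (y + 1) • evol N.op d t (fun x => wave (-ξ) x • w x)
            (y + 1) = _
          rw [evol_add_one N d ξ t y, wave_add, smul_smul, mul_assoc, wave_mul_neg, mul_one]
          intro x
          rw [wave_add, mul_comm, mul_smul, CircleFun.add_one])
      map_add' := fun v w => CircleFun.ext fun x => by
        simp only [CircleFun.mk_apply, CircleFun.add_apply, smul_add]
        rw [evol_add N.continuous N.norm_le (continuous_wave_smul (-ξ) v)
          (continuous_wave_smul (-ξ) w) (norm_wave_smul_le _ _) (norm_wave_smul_le _ _), smul_add]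
        rfl
      map_smul' := fun a w => CircleFun.ext fun x => by
        simp only [CircleFun.mk_apply, CircleFun.smul_apply, RingHom.id_apply]
        simp only [smul_comm _ a]
        rw [evol_const_smul, smul_comm]
        rfl }
    (Real.exp (N.bound * |t|)) fun w => CircleFun.norm_le (by positivity) fun y => by
      refine (norm_smul_le _ _).trans ?_
      rw [norm_wave, one_mul]
      exact norm_evol_le N.norm_le (norm_wave_smul_le _ _) _ _

theorem blochEvol_apply (ξ t : ℝ) (w : CircleFun F) (y : ℝ) :
    N.blochEvol d ξ t w y
      = wave ξ y • evol N.op d t (fun x => wave (-ξ) x • w x) y := rfl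

theorem wave_smul_blochEvol (ξ t : ℝ) (w : CircleFun F) (y : ℝ) :
    wave (-ξ) y • N.blochEvol d ξ t w y
      = evol N.op d t (fun x => wave (-ξ) x • w x) y := by
  rw [blochEvol_apply, smul_smul, wave_neg_mul, one_smul]

theorem norm_blochEvol_le (ξ t : ℝ) : ‖N.blochEvol d ξ t‖ ≤ Real.exp (N.bound * |t|) :=
  LinearMap.mkContinuous_norm_le _ (Real.exp_pos _).le _

theorem blochEvol_blochEvol {s t : ℝ} (hs : 0 ≤ s) (ht : 0 ≤ t) (ξ : ℝ)
    (w : CircleFun F) :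
    N.blochEvol d ξ s (N.blochEvol d ξ t w) = N.blochEvol d ξ (s + t) w := by
  refine CircleFun.ext fun y => ?_
  rw [blochEvol_apply, blochEvol_apply]
  simp only [wave_smul_blochEvol]
  rw [evol_evol N.continuous N.norm_le (continuous_wave_smul (-ξ) w) (norm_wave_smul_le _ _) hs ht]

theorem blochEvol_natCast_pow (ξ : ℝ) (j : ℕ) : N.blochEvol d ξ j = N.blochEvol d ξ 1 ^ j := by
  induction j with
  | zero =>
    ext1 w
    refine CircleFun.ext fun y => ?_
    simp [blochEvol_apply, smul_smul, wave_mul_neg]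
  | succ j ih =>
    ext1 w
    rw [pow_succ, ← ih, mul_apply_eq_comp,
      blochEvol_blochEvol N d (Nat.cast_nonneg j) zero_le_one]
    push_cast
    rfl

theorem continuous_blochEvol_apply (w : CircleFun F) :
    Continuous fun p : ℝ × ℝ × ℝ => N.blochEvol d p.1 p.2.1 w p.2.2 := by
  simp only [blochEvol_apply]
  refine (continuous_fst.wave continuous_snd.snd).smul ?_
  refine continuous_evol N.continuous N.norm_le (X := ℝ × ℝ × ℝ)
    (a := fun p x => wave (-p.1) x • w x) ?_ (A := fun _ => ‖w‖)
    continuous_const (fun p => norm_wave_smul_le _ _) continuous_snd.fst continuous_snd.snd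
  exact ((continuous_fst.comp continuous_fst).neg.wave continuous_snd).smul
    ((CircleFun.continuous w).comp continuous_snd)

/-- Conjugation by plane waves multiplies the kernel by a wave in the displacement only, so a change
of ξ is controlled by the first absolute moment of the displacement dt + √(2t) r. The resulting
continuity in operator norm is what the compactness argument in ξ requires. -/
theorem norm_blochEvol_sub_le {t : ℝ} (ht : 0 ≤ t) (ξ η : ℝ) :
    ‖N.blochEvol d ξ t - N.blochEvol d η t‖ ≤ |ξ - η| * (Real.exp (N.bound * t)
      * (|d| * t + √(2 * t) * ∫ r, |r| ∂(gaussianReal 0 1))) := by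
  have hI : 0 ≤ ∫ r, |r| ∂(gaussianReal 0 1) := integral_nonneg fun r => abs_nonneg r
  refine ContinuousLinearMap.opNorm_le_bound _ (by positivity) fun w =>
    CircleFun.norm_le (by positivity) fun y => ?_
  rw [sub_apply, CircleFun.sub_apply, blochEvol_apply, blochEvol_apply]
  unfold evol
  rw [← integral_smul, ← integral_smul, ← integral_sub]
  rotate_left
  · exact (integrable_evol N.continuous N.norm_le (continuous_wave_smul (-ξ) w)
      (norm_wave_smul_le _ _) t y).smul (wave ξ y)
  · exact (integrable_evol N.continuous N.norm_le (continuous_wave_smul (-η) w)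
      (norm_wave_smul_le _ _) t y).smul (wave η y)
  have hb : ∀ r : ℝ, ‖wave ξ y • (pathFactor N.op y t (y + d * t + √(2 * t) * r))
        (wave (-ξ) (y + d * t + √(2 * t) * r)
          • w (y + d * t + √(2 * t) * r))
      - wave η y • (pathFactor N.op y t (y + d * t + √(2 * t) * r))
        (wave (-η) (y + d * t + √(2 * t) * r)
          • w (y + d * t + √(2 * t) * r))‖
      ≤ |ξ - η| * (|d| * t + √(2 * t) * |r|) * (Real.exp (N.bound * t) * ‖w‖) := by
    intro r
    set Y := y + d * t + √(2 * t) * r with hY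
    have h1 : ∀ ζ : ℝ, wave ζ y * wave (-ζ) Y = wave (-ζ) (d * t + √(2 * t) * r) := by
      intro ζ
      rw [hY, add_assoc, wave_add, ← mul_assoc, wave_mul_neg, one_mul]
    rw [map_smul, map_smul, smul_smul, smul_smul, h1, h1, ← sub_smul, norm_smul]
    refine mul_le_mul ?_ ?_ (norm_nonneg _) (by positivity)
    · refine (norm_wave_sub_wave_le _ _ _).trans ?_
      rw [show -ξ - -η = -(ξ - η) by ring, abs_neg]
      refine mul_le_mul_of_nonneg_left ((abs_add_le _ _).trans ?_) (abs_nonneg _)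
      rw [abs_mul, abs_mul, abs_of_nonneg ht, abs_of_nonneg (Real.sqrt_nonneg _)]
    · have := norm_evol_integrand_le (N := N.op) N.norm_le (a := fun x : ℝ => w x)
        (CircleFun.norm_apply_le w) t y Y
      rwa [abs_of_nonneg ht] at this
  have hint : Integrable (fun r : ℝ => |ξ - η| * (|d| * t + √(2 * t) * |r|)
      * (Real.exp (N.bound * t) * ‖w‖)) (gaussianReal 0 1) :=
    (((integrable_const _).add (integrable_abs_gaussianReal.const_mul _)).const_mul _).mul_const _
  refine (norm_integral_le_of_norm_le hint (Eventually.of_forall hb)).trans (le_of_eq ?_)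
  rw [integral_mul_const, integral_const_mul, integral_add (integrable_const _)
    (integrable_abs_gaussianReal.const_mul _), integral_const_mul √(2 * t), integral_const,
    probReal_univ, one_smul]
  ring

theorem continuous_blochEvol {t : ℝ} (ht : 0 ≤ t) : Continuous fun ξ => N.blochEvol d ξ t := by
  refine (LipschitzWith.of_dist_le_mul (f := fun ξ => N.blochEvol d ξ t) (K := Real.toNNReal (Real.exp (N.bound * t)
      * (|d| * t + √(2 * t) * ∫ r, |r| ∂(gaussianReal 0 1)))) fun ξ η => ?_).continuous
  have hI : 0 ≤ ∫ r, |r| ∂(gaussianReal 0 1) := integral_nonneg fun r => abs_nonneg r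
  rw [dist_eq_norm (N.blochEvol d ξ t), Real.dist_eq, Real.coe_toNNReal _ (by positivity), mul_comm]
  exact norm_blochEvol_sub_le N d ht ξ η

end PeriodicPotential

/-- A family of operators into equicontinuous functions is compact. -/
theorem isCompactOperator_of_equicontinuous [FiniteDimensional ℂ F] {E : Type*}
    [NormedAddCommGroup E] [NormedSpace ℂ E] (T : E →L[ℂ] CircleFun F)
    (h : ∀ x : ℝ, ∃ b : ℝ → ℝ, Tendsto b (𝓝 x) (𝓝 0) ∧ (∀ x', 0 ≤ b x') ∧ ∀ (x' : ℝ) w,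
      ‖T w x' - T w x‖ ≤ b x' * ‖w‖) :
    IsCompactOperator T := by
  have : ProperSpace F := FiniteDimensional.proper ℂ F
  refine (isCompactOperator_iff_image_closedBall_subset_compact (𝕜₁ := ℂ)
    (T : E →ₗ[ℂ] CircleFun F) one_pos).mpr ?_
  set e := ContinuousMap.isometryEquivBoundedOfCompact (AddCircle (1 : ℝ)) F
  set S : Set C(AddCircle (1 : ℝ), F) := T '' Metric.closedBall (0 : E) 1
  set A := e '' S
  have hA : IsCompact (closure A) := by
    refine BoundedContinuousFunction.arzela_ascoli (Metric.closedBall (0 : F) ‖T‖)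
      (isCompact_closedBall _ _) A ?_ ?_
    · rintro f θ ⟨_, ⟨w, hw, rfl⟩, rfl⟩
      rw [mem_closedBall_zero_iff] at hw ⊢
      refine (ContinuousMap.norm_coe_le_norm (T w) θ).trans ((T.le_opNorm w).trans
        (mul_le_of_le_one_right (norm_nonneg _) hw))
    · intro θ
      induction θ using QuotientAddGroup.induction_on with
      | H x =>
        obtain ⟨b, hb, hb0, hT⟩ := h x
        rw [Metric.equicontinuousAt_iff_right]
        intro ε hε
        rw [QuotientAddGroup.nhds_eq, eventually_map]
        filter_upwards [hb.eventually (gt_mem_nhds hε)] with x' hx'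
        rintro ⟨_, ⟨_, ⟨w, hw, rfl⟩, rfl⟩⟩
        rw [mem_closedBall_zero_iff] at hw
        change dist (T w x) (T w x') < ε
        rw [dist_comm, dist_eq_norm]
        refine (hT x' w).trans_lt (lt_of_le_of_lt ?_ hx')
        exact mul_le_of_le_one_right (hb0 x') hw
  refine ⟨e ⁻¹' closure A, e.toHomeomorph.isCompact_preimage.mpr hA, fun v hv => ?_⟩
  exact subset_closure ⟨v, hv, rfl⟩

end

/-! ### Compactness and L¹ to sup smoothing of the Bloch evolutions -/

section

/-- An integrable majorant in x that does not depend on y within distance one of y₀, obtained from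
(x - y₀)² ≤ 2(x - y)² + 2. -/
theorem heatKernel_le_of_abs_sub_le {d y y₀ t x : ℝ} (ht : 0 < t) (hy : |y - y₀| ≤ 1) :
    heatKernel d y t x ≤ t ^ (-(1 / 2) : ℝ) * Real.exp (d ^ 2 * t / 4) * Real.exp (1 / (8 * t))
      * Real.exp (-(1 / (16 * t)) * (x - y₀) ^ 2) := by
  refine (heatKernel_le ht).trans ?_
  rw [mul_assoc, mul_assoc, ← Real.exp_add (1 / (8 * t))]
  refine mul_le_mul_of_nonneg_left (mul_le_mul_of_nonneg_left (Real.exp_le_exp.mpr ?_)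
    (Real.exp_pos _).le) (by positivity)
  have h1 : (x - y₀) ^ 2 ≤ 2 * (x - y) ^ 2 + 2 := by
    have : (y - y₀) ^ 2 ≤ 1 := by rw [← sq_abs]; nlinarith [abs_nonneg (y - y₀)]
    nlinarith [sq_nonneg ((x - y) - (y - y₀))]
  rw [show -(1 / 8) * (x - y) ^ 2 / t = -(2 * (x - y) ^ 2) * (1 / (16 * t)) by field_simp; ring,
    show 1 / (8 * t) = 2 * (1 / (16 * t)) by field_simp; ring]
  have : 0 < 1 / (16 * t) := by positivity
  nlinarith

namespace PeriodicPotential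

variable {F : Type*} [NormedAddCommGroup F] [NormedSpace ℂ F] [CompleteSpace F]
  (N : PeriodicPotential F) (d : ℝ)

theorem continuous_evolKernel {t : ℝ} (ht : 0 < t) :
    Continuous fun p : ℝ × ℝ => evolKernel N.op d p.1 t p.2 :=
  (continuousOn_evolKernel N.continuous N.norm_le).comp_continuous
    (f := fun p : ℝ × ℝ => (p.2, t, p.1)) (by fun_prop) fun p => ht

theorem blochEvol_eq_integral {ξ t : ℝ} (ht : 0 < t) (w : CircleFun F) (y : ℝ) :
    N.blochEvol d ξ t w y
      = ∫ x, (wave ξ (y - x) • evolKernel N.op d y t x) (w x) := by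
  rw [blochEvol_apply, evol_eq_integral ht, ← integral_smul]
  refine integral_congr_ae (Eventually.of_forall fun x => ?_)
  simp only [smul_apply, map_smul, smul_smul]
  congr 1
  rw [sub_eq_add_neg, wave_add]
  simp [wave]

theorem integrable_norm_evolKernel {t : ℝ} (ht : 0 < t) (y : ℝ) :
    Integrable fun x => evolKernel N.op d y t x :=
  ((integrable_heatKernel d y ht).const_mul (Real.exp (N.bound * t))).mono'
    ((N.continuous_evolKernel d ht).comp (Continuous.prodMk_right y)).aestronglyMeasurable
    (Eventually.of_forall fun _ => norm_evolKernel_le N.norm_le ht)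

/-- For positive time the kernel, as a function of x in L¹, depends continuously on y. The L¹
distance between the kernels at y and y₀ is then a modulus of continuity common to the image of the
unit ball. -/
theorem isCompactOperator_blochEvol [FiniteDimensional ℂ F] (ξ : ℝ) {t : ℝ} (ht : 0 < t) :
    IsCompactOperator (N.blochEvol d ξ t) := by
  refine isCompactOperator_of_equicontinuous _ fun y₀ => ?_
  set k : ℝ → ℝ → (F →L[ℂ] F) := fun y x => wave ξ (y - x) • evolKernel N.op d y t x with hk
  have hkc : Continuous (Function.uncurry k) :=
    (continuous_const.wave (by fun_prop)).smul (N.continuous_evolKernel d ht)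
  have hki : ∀ y, Integrable (k y) := fun y => by
    refine (N.integrable_norm_evolKernel d ht y).norm.mono'
      (hkc.comp (Continuous.prodMk_right y)).aestronglyMeasurable
      (Eventually.of_forall fun x => ?_)
    simp only [hk, norm_smul, norm_wave, one_mul, le_refl]
  set C : ℝ := Real.exp (N.bound * t) * (t ^ (-(1 / 2) : ℝ) * Real.exp (d ^ 2 * t / 4)
    * Real.exp (1 / (8 * t))) with hC
  have hkb : ∀ y x, |y - y₀| ≤ 1 → ‖k y x‖ ≤ C * Real.exp (-(1 / (16 * t)) * (x - y₀) ^ 2) := by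
    intro y x hy
    simp only [hk, norm_smul, norm_wave, one_mul]
    refine (norm_evolKernel_le N.norm_le ht).trans ?_
    rw [hC, mul_assoc]
    exact mul_le_mul_of_nonneg_left (heatKernel_le_of_abs_sub_le ht hy) (Real.exp_pos _).le
  refine ⟨fun y => ∫ x, ‖k y x - k y₀ x‖, ?_, fun y => integral_nonneg fun x => norm_nonneg _, ?_⟩
  · have h0 : (∫ x, ‖k y₀ x - k y₀ x‖) = 0 := by simp
    rw [← h0]
    refine tendsto_integral_filter_of_dominated_convergence
      (fun x => 2 * (C * Real.exp (-(1 / (16 * t)) * (x - y₀) ^ 2))) ?_ ?_ ?_ ?_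
    · exact Eventually.of_forall fun y => ((hki y).sub (hki y₀)).norm.aestronglyMeasurable
    · filter_upwards [Metric.closedBall_mem_nhds y₀ one_pos] with y hy
      rw [Metric.mem_closedBall, Real.dist_eq] at hy
      refine Eventually.of_forall fun x => ?_
      rw [norm_norm]
      refine (norm_sub_le _ _).trans ?_
      linarith [hkb y x hy, hkb y₀ x (by simp)]
    · exact (((integrable_exp_neg_mul_sq (b := 1 / (16 * t)) (by positivity)).comp_sub_right
        y₀).const_mul C).const_mul 2
    · refine Eventually.of_forall fun x => ?_
      have : Continuous fun y => ‖k y x - k y₀ x‖ := by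
        exact ((hkc.comp (Continuous.prodMk_left x)).sub continuous_const).norm
      exact this.tendsto y₀
  · intro y w
    have hi : ∀ y, Integrable fun x => k y x (w x) := fun y => by
      refine ((hki y).norm.mul_const ‖w‖).mono' ((hkc.comp (Continuous.prodMk_right y)).clm_apply
        (CircleFun.continuous w)).aestronglyMeasurable (Eventually.of_forall fun x => ?_)
      exact (ContinuousLinearMap.le_opNorm _ _).trans
        (mul_le_mul_of_nonneg_left (CircleFun.norm_apply_le w x) (norm_nonneg _))
    rw [N.blochEvol_eq_integral d ht, N.blochEvol_eq_integral d ht,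
      ← integral_sub (hi y) (hi y₀), ← integral_mul_const]
    refine norm_integral_le_of_norm_le (((hki y).sub (hki y₀)).norm.mul_const _)
      (Eventually.of_forall fun x => ?_)
    simp only [hk]
    rw [← sub_apply]
    exact (ContinuousLinearMap.le_opNorm _ _).trans
      (mul_le_mul_of_nonneg_left (CircleFun.norm_apply_le w x) (norm_nonneg _))

end PeriodicPotential

theorem integrable_exp_neg_abs : Integrable fun s : ℝ => Real.exp (-|s|) := by
  refine (integrable_inv_one_add_sq.const_mul 2).mono' (by fun_prop)
    (Eventually.of_forall fun s => ?_)
  rw [Real.norm_of_nonneg (Real.exp_pos _).le, Real.exp_neg, ← div_eq_mul_inv,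
    inv_le_comm₀ (Real.exp_pos _) (by positivity), inv_div]
  have := Real.quadratic_le_exp_of_nonneg (abs_nonneg s)
  rw [sq_abs] at this
  linarith [abs_nonneg s]

theorem integrableOn_exp_neg_mul_periodic {h : ℝ → ℝ} (hc : Continuous h)
    (hp : Function.Periodic h 1) : IntegrableOn (fun s => Real.exp (-s) * h s) (Set.Ioi 0) := by
  obtain ⟨C, hC⟩ := exists_norm_le_of_periodic hc hp
  have := (integrableOn_exp_neg_Ioi 0).mul_const C
  refine Integrable.mono' this (by fun_prop) (Eventually.of_forall fun s => ?_)
  rw [norm_mul, Real.norm_of_nonneg (Real.exp_pos _).le]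
  exact mul_le_mul_of_nonneg_left (hC s) (Real.exp_pos _).le

/-- Shifting by one period multiplies the integral by e⁻¹ ≤ 1/2, so the whole is at most twice the
part over the first period. -/
theorem integral_exp_neg_mul_periodic_le {h : ℝ → ℝ} (hc : Continuous h)
    (hp : Function.Periodic h 1) (h0 : ∀ x, 0 ≤ h x) :
    ∫ s in Set.Ioi (0 : ℝ), Real.exp (-s) * h s ≤ 2 * ∫ s in (0 : ℝ)..1, h s := by
  have hi := integrableOn_exp_neg_mul_periodic hc hp
  have hI : IntegrableOn (fun s => Real.exp (-s) * h s) (Set.Ioi 1) :=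
    hi.mono_set (Set.Ioi_subset_Ioi zero_le_one)
  have hsplit := intervalIntegral.integral_interval_add_Ioi hi hI
  have hshift : ∫ s in Set.Ioi (1 : ℝ), Real.exp (-s) * h s
      = Real.exp (-1) * ∫ s in Set.Ioi (0 : ℝ), Real.exp (-s) * h s := by
    have := (measurePreserving_add_right volume (1 : ℝ)).setIntegral_preimage_emb
      (measurableEmbedding_addRight 1) (fun s => Real.exp (-s) * h s) (Set.Ioi 1)
    rw [Set.preimage_add_const_Ioi, sub_self] at this
    rw [← this, ← integral_const_mul]
    refine integral_congr_ae (Eventually.of_forall fun s => ?_)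
    simp only
    rw [hp, neg_add, Real.exp_add]
    ring
  have hle : ∫ s in (0 : ℝ)..1, Real.exp (-s) * h s ≤ ∫ s in (0 : ℝ)..1, h s := by
    refine intervalIntegral.integral_mono_on zero_le_one
      (Continuous.intervalIntegrable (by fun_prop) _ _) (hc.intervalIntegrable _ _) fun s hs => ?_
    exact mul_le_of_le_one_left (h0 s) (Real.exp_le_one_iff.mpr (by linarith [hs.1]))
  have hpos : 0 ≤ ∫ s in Set.Ioi (0 : ℝ), Real.exp (-s) * h s :=
    integral_nonneg fun s => mul_nonneg (Real.exp_pos _).le (h0 s)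
  have he : Real.exp (-1) ≤ 1 / 2 := by
    rw [Real.exp_neg, inv_eq_one_div]
    exact one_div_le_one_div_of_le two_pos (by linarith [Real.add_one_le_exp (1 : ℝ)])
  rw [hshift] at hsplit
  nlinarith

theorem integral_exp_neg_abs_mul_periodic_le {h : ℝ → ℝ} (hc : Continuous h)
    (hp : Function.Periodic h 1) (h0 : ∀ x, 0 ≤ h x) (y : ℝ) :
    Integrable (fun x => Real.exp (-|x - y|) * h x) ∧
      ∫ x, Real.exp (-|x - y|) * h x ≤ 4 * ∫ s in (0 : ℝ)..1, h s := by
  have hper : ∀ a : ℝ, ∫ s in (0 : ℝ)..1, h (s + a) = ∫ s in (0 : ℝ)..1, h s := by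
    intro a
    rw [intervalIntegral.integral_comp_add_right, zero_add, add_comm 1 a]
    have := hp.intervalIntegral_add_eq a 0
    rwa [zero_add] at this
  have c1 : Continuous fun s => h (s + y) := by fun_prop
  have c2 : Continuous fun s => h (-s + y) := by fun_prop
  have p1 : Function.Periodic (fun s => h (s + y)) 1 := fun s => by
    simp only; rw [add_right_comm]; exact hp _
  have p2 : Function.Periodic (fun s => h (-s + y)) 1 := fun s => by
    simp only
    rw [← hp]
    congr 1
    ring
  have e2 : ∫ s in (0 : ℝ)..1, h (-s + y) = ∫ s in (0 : ℝ)..1, h s := by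
    have := intervalIntegral.integral_comp_neg (a := 0) (b := 1) (fun s => h (s + y))
    rw [this, neg_zero, ← hper y]
    have := (p1.intervalIntegral_add_eq (-1) 0)
    simpa using this
  have f1 : ∀ s ∈ Set.Ioi (0 : ℝ), Real.exp (-s) * h (s + y) = Real.exp (-|s|) * h (s + y) :=
    fun s hs => by rw [abs_of_pos hs]
  have f2 : ∀ s ∈ Set.Ioi (0 : ℝ), Real.exp (-s) * h (-s + y) = Real.exp (-|(-s)|) * h (-s + y) :=
    fun s hs => by rw [abs_neg, abs_of_pos hs]
  have itot : Integrable fun s => Real.exp (-|s|) * h (s + y) := by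
    obtain ⟨C, hC⟩ := exists_norm_le_of_periodic c1 p1
    refine (integrable_exp_neg_abs.mul_const C).mono' (by fun_prop)
      (Eventually.of_forall fun s => ?_)
    rw [norm_mul, Real.norm_of_nonneg (Real.exp_pos _).le]
    exact mul_le_mul_of_nonneg_left (hC s) (Real.exp_pos _).le
  have hsub := integral_sub_right_eq_self (μ := volume)
    (fun s => Real.exp (-|s|) * h (s + y)) y
  simp only [sub_add_cancel] at hsub
  refine ⟨by simpa using itot.comp_sub_right y, ?_⟩
  rw [hsub, ← intervalIntegral.integral_Iic_add_Ioi itot.integrableOn itot.integrableOn (b := 0)]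
  have g1 := integral_exp_neg_mul_periodic_le c1 p1 fun x => h0 _
  have g2 := integral_exp_neg_mul_periodic_le c2 p2 fun x => h0 _
  rw [setIntegral_congr_fun measurableSet_Ioi f1, hper] at g1
  have h4 := integral_comp_neg_Ioi 0 (fun s => Real.exp (-|s|) * h (s + y))
  rw [neg_zero] at h4
  rw [setIntegral_congr_fun measurableSet_Ioi f2, e2, h4] at g2
  linarith

namespace PeriodicPotential

variable {F : Type*} [NormedAddCommGroup F] [NormedSpace ℂ F] [CompleteSpace F]
  (N : PeriodicPotential F) (d : ℝ)

/-- The kernel at time one is at most a multiple of e^{-|x-y|}, uniformly in ξ, and against a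
periodic function this weight only sees the L¹ norm over a period. One unit of time thus lets L¹
data enter the decay estimates in sup norm. -/
theorem exists_norm_blochEvol_one_le : ∃ C, 0 ≤ C ∧ ∀ (ξ : ℝ) (w : CircleFun F),
    ‖N.blochEvol d ξ 1 w‖ ≤ C * ∫ x in (0 : ℝ)..1, ‖w x‖ := by
  set C : ℝ := Real.exp N.bound * (Real.exp (d ^ 2 / 4) * Real.exp 2) with hC
  refine ⟨C * 4, by positivity, fun ξ w => ?_⟩
  have hw : Continuous fun x : ℝ => ‖w x‖ := (CircleFun.continuous w).norm
  have hI : 0 ≤ ∫ x in (0 : ℝ)..1, ‖w x‖ :=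
    intervalIntegral.integral_nonneg zero_le_one fun x _ => norm_nonneg _
  refine CircleFun.norm_le (by positivity) fun y => ?_
  obtain ⟨hi, hle⟩ := integral_exp_neg_abs_mul_periodic_le hw
    (fun x => by simp only [CircleFun.add_one]) (fun x => norm_nonneg _) y
  rw [N.blochEvol_eq_integral d one_pos, mul_assoc]
  refine (norm_integral_le_of_norm_le (hi.const_mul C) (Eventually.of_forall fun x => ?_)).trans ?_
  · rw [← mul_assoc]
    refine (ContinuousLinearMap.le_opNorm _ _).trans
      (mul_le_mul_of_nonneg_right ?_ (norm_nonneg _))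
    rw [norm_smul, norm_wave, one_mul]
    refine (norm_evolKernel_le N.norm_le one_pos).trans ?_
    rw [mul_one, hC, mul_assoc, mul_assoc, ← Real.exp_add 2]
    refine mul_le_mul_of_nonneg_left ((heatKernel_le one_pos).trans ?_) (Real.exp_pos _).le
    rw [Real.one_rpow, one_mul, mul_one, div_one]
    refine mul_le_mul_of_nonneg_left (Real.exp_le_exp.mpr ?_) (Real.exp_pos _).le
    rw [← sq_abs]
    -- The constant 2 is the one in |z| ≤ z²/8 + 2.
    nlinarith [sq_nonneg (|x - y| - 4)]
  · rw [integral_const_mul]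
    exact mul_le_mul_of_nonneg_left hle (by positivity)

end PeriodicPotential

end

section

/-! ### Resolvents of the Bloch operators -/

variable {F : Type*} [NormedAddCommGroup F] [NormedSpace ℂ F]

theorem one_sub_exp_neg_pos {γ : ℝ} (hγ : 0 < γ) : 0 < 1 - Real.exp (-γ) :=
  sub_pos.mpr (by rw [Real.exp_lt_one_iff]; linarith)

/-- The inverse of `γ - σ ∂` on continuous periodic functions, for `γ > 0` and `σ = ±1`. -/
def expAverage (γ σ : ℝ) : CircleFun F →L[ℂ] CircleFun F :=
  LinearMap.mkContinuous
    { toFun := fun w => CircleFun.mk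
        (fun x => (1 - Real.exp (-γ))⁻¹ • ∫ s in (0 : ℝ)..1,
          Real.exp (-γ * s) • w (x + σ * s))
        (Continuous.const_smul
          (intervalIntegral.continuous_parametric_intervalIntegral_of_continuous'
            (f := fun x s => Real.exp (-γ * s) • w (x + σ * s))
            ((by fun_prop : Continuous fun p : ℝ × ℝ => Real.exp (-γ * p.2)).smul
              ((CircleFun.continuous w).comp (by fun_prop))) _ _) _)
        (fun x => by
          simp only [add_right_comm x 1, CircleFun.add_one])
      map_add' := fun v w => CircleFun.ext fun x => by
        have hi : ∀ v : CircleFun F, IntervalIntegrable (fun s => Real.exp (-γ * s) •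
            v (x + σ * s)) volume 0 1 := fun v =>
          ((by fun_prop : Continuous fun s => Real.exp (-γ * s)).smul
            ((CircleFun.continuous v).comp (by fun_prop))).intervalIntegrable _ _
        simp only [CircleFun.mk_apply, CircleFun.add_apply, smul_add]
        rw [intervalIntegral.integral_add (hi v) (hi w), smul_add]
        rfl
      map_smul' := fun a w => CircleFun.ext fun x => by
        simp only [CircleFun.mk_apply, CircleFun.smul_apply, RingHom.id_apply]
        simp only [smul_comm _ a, intervalIntegral.integral_smul]
        rfl }
    -- The operator is defined for every real γ. At γ = 0 both the prefactor and the bound are 0, by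
    -- the convention for inverses.
    |γ|⁻¹ fun w => CircleFun.norm_le (by positivity) fun x => by
      have hi : IntervalIntegrable (fun s => Real.exp (-γ * s) * ‖w‖) volume 0 1 :=
        (by fun_prop : Continuous fun s => Real.exp (-γ * s) * ‖w‖).intervalIntegrable _ _
      have h1 : ‖∫ s in (0 : ℝ)..1, Real.exp (-γ * s) • w (x + σ * s)‖
          ≤ |∫ s in (0 : ℝ)..1, Real.exp (-γ * s)| * ‖w‖ := by
        refine (intervalIntegral.norm_integral_le_of_norm_le zero_le_one
          (Eventually.of_forall fun s _ => ?_) hi).trans ?_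
        · rw [norm_smul, Real.norm_of_nonneg (Real.exp_pos _).le]
          exact mul_le_mul_of_nonneg_left (CircleFun.norm_apply_le w _) (Real.exp_pos _).le
        · rw [intervalIntegral.integral_mul_const]
          exact mul_le_mul_of_nonneg_right (le_abs_self _) (norm_nonneg _)
      refine (norm_smul_le _ _).trans ((mul_le_mul_of_nonneg_left h1 (norm_nonneg _)).trans ?_)
      rw [← mul_assoc, Real.norm_eq_abs, ← abs_mul]
      refine mul_le_mul_of_nonneg_right ?_ (norm_nonneg _)
      rcases eq_or_ne γ 0 with rfl | hγ
      · simp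
      · rw [intervalIntegral.integral_comp_mul_left (fun s => Real.exp s) (neg_ne_zero.mpr hγ)]
        rw [integral_exp]
        rcases eq_or_ne (1 - Real.exp (-γ)) 0 with h0 | h0
        · simp [h0]
        · refine le_of_eq ?_
          rw [← abs_inv]
          have : (1 - Real.exp (-γ))⁻¹ * ((-γ)⁻¹ • (Real.exp (-γ * 1) - Real.exp (-γ * 0)))
              = γ⁻¹ := by
            simp only [mul_one, mul_zero, Real.exp_zero, smul_eq_mul]
            field_simp
            ring
          rw [this]

theorem expAverage_apply (γ σ : ℝ) (w : CircleFun F) (x : ℝ) :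
    expAverage γ σ w x = (1 - Real.exp (-γ))⁻¹ • ∫ s in (0 : ℝ)..1,
      Real.exp (-γ * s) • w (x + σ * s) := rfl

theorem norm_expAverage_le {γ : ℝ} (hγ : 0 < γ) (σ : ℝ) :
    ‖(expAverage γ σ : CircleFun F →L[ℂ] CircleFun F)‖ ≤ γ⁻¹ :=
  (LinearMap.mkContinuous_norm_le _ (by positivity) _).trans_eq (by rw [abs_of_pos hγ])

/-- The substitution τ = x + σs writes the average as e^{γσx} times a difference of values of a
primitive. Since w is periodic, differentiating that difference leaves the factor 1 - e^{-γ}, which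
the normalisation removes. -/
theorem hasDerivAt_expAverage [CompleteSpace F] {γ σ : ℝ} (hγ : 0 < γ) (hσ : σ ^ 2 = 1)
    (w : CircleFun F) (x : ℝ) :
    HasDerivAt (fun x : ℝ => expAverage γ σ w x)
      (σ • (γ • expAverage γ σ w x - w x)) x := by
  set g : ℝ → F := fun τ => Real.exp (-(γ * σ) * τ) • w τ with hg
  have hgc : Continuous g :=
    (by fun_prop : Continuous fun τ : ℝ => Real.exp (-(γ * σ) * τ)).smul (CircleFun.continuous w)
  set G : ℝ → F := fun x => ∫ τ in (0 : ℝ)..x, g τ with hG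
  have hGd : ∀ x, HasDerivAt G (g x) x := fun x =>
    intervalIntegral.integral_hasDerivAt_right (hgc.intervalIntegrable _ _)
      hgc.aestronglyMeasurable.stronglyMeasurableAtFilter hgc.continuousAt
  have hform : ∀ x : ℝ, expAverage γ σ w x
      = (1 - Real.exp (-γ))⁻¹ • σ • Real.exp (γ * σ * x) • (G (x + σ) - G x) := by
    intro x
    rw [expAverage_apply]
    congr 1
    have h1 := intervalIntegral.smul_integral_comp_add_mul (a := 0) (b := 1) g σ x
    rw [mul_zero, add_zero, mul_one] at h1
    have h2 : G (x + σ) - G x = ∫ τ in x..(x + σ), g τ :=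
      intervalIntegral.integral_interval_sub_left (hgc.intervalIntegrable _ _)
        (hgc.intervalIntegrable _ _)
    rw [h2, ← h1, smul_comm _ σ, smul_smul, ← sq, hσ, one_smul, ← intervalIntegral.integral_smul]
    refine intervalIntegral.integral_congr fun s _ => ?_
    simp only [hg]
    rw [smul_smul, ← Real.exp_add]
    congr 2
    linear_combination (γ * s) * hσ
  have hE : HasDerivAt (fun x : ℝ => Real.exp (γ * σ * x)) (Real.exp (γ * σ * x) * (γ * σ)) x := by
    have := ((hasDerivAt_id x).const_mul (γ * σ)).exp
    simpa using this
  have hGs : HasDerivAt (fun x => G (x + σ) - G x) (g (x + σ) - g x) x :=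
    ((hGd (x + σ)).comp_add_const x σ).sub (hGd x)
  have hd := ((hE.smul hGs).const_smul σ).const_smul (1 - Real.exp (-γ))⁻¹
  have hfun : (fun x : ℝ => expAverage γ σ w x)
      = fun x => (1 - Real.exp (-γ))⁻¹ • σ • Real.exp (γ * σ * x) • (G (x + σ) - G x) :=
    funext hform
  rw [hfun]
  refine hd.congr_deriv ?_
  have hw : w (x + σ) = w x := by
    rcases (sq_eq_sq_iff_eq_or_eq_neg.mp (hσ.trans (one_pow 2).symm)) with rfl | rfl
    · rw [CircleFun.add_one]
    · rw [← CircleFun.add_one w (x + -1), neg_add_cancel_right]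
  have hg1 : Real.exp (γ * σ * x) • (g (x + σ) - g x)
      = -((1 - Real.exp (-γ)) • w x) := by
    simp only [hg, hw]
    rw [← sub_smul, smul_smul, ← neg_smul]
    congr 1
    rw [mul_sub, ← Real.exp_add, ← Real.exp_add,
      show γ * σ * x + -(γ * σ) * (x + σ) = -γ by linear_combination (-γ) * hσ]
    simp
  have hne : 1 - Real.exp (-γ) ≠ 0 := (one_sub_exp_neg_pos hγ).ne'
  rw [hg1, hform]
  match_scalars <;> field_simp

/-- A solution is a multiple of e^{κx}, and a nonzero real κ is incompatible with periodicity. This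
gives the uniqueness needed to invert γ - σ∂. -/
theorem eq_zero_of_hasDerivAt_smul {κ : ℝ} (hκ : κ ≠ 0) {D : ℝ → F} (hp : Function.Periodic D 1)
    (hD : ∀ x, HasDerivAt D (κ • D x) x) (x : ℝ) : D x = 0 := by
  have hd : ∀ y, HasDerivAt (fun y => Real.exp (-κ * y) • D y) 0 y := by
    intro y
    have h1 : HasDerivAt (fun y : ℝ => Real.exp (-κ * y)) (Real.exp (-κ * y) * (-κ)) y := by
      have := ((hasDerivAt_id y).const_mul (-κ)).exp
      simpa using this
    refine (h1.smul (hD y)).congr_deriv ?_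
    rw [smul_smul, ← add_smul]
    simp
  have hc := is_const_of_deriv_eq_zero (fun y => (hd y).differentiableAt) (fun y => (hd y).deriv)
    (x + 1) x
  rw [hp x, ← sub_eq_zero, ← sub_smul, smul_eq_zero] at hc
  refine hc.resolve_left fun h => hκ ?_
  have := Real.exp_injective (sub_eq_zero.mp h)
  linarith

theorem expAverage_eq [CompleteSpace F] {γ σ : ℝ} (hγ : 0 < γ) (hσ : σ ^ 2 = 1) {V V₁ : CircleFun F}
    (hV : ∀ x : ℝ, HasDerivAt (fun x : ℝ => V x) (V₁ x) x) :
    expAverage γ σ (γ • V - σ • V₁) = V := by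
  set W := expAverage γ σ (γ • V - σ • V₁)
  refine CircleFun.ext fun x => sub_eq_zero.mp (eq_zero_of_hasDerivAt_smul (κ := σ * γ)
    (D := fun x : ℝ => W x - V x) ?_ ?_ ?_ x)
  · exact mul_ne_zero (by rintro rfl; norm_num at hσ) hγ.ne'
  · intro x; simp only [CircleFun.add_one]
  · intro x
    refine ((hasDerivAt_expAverage hγ hσ (γ • V - σ • V₁) x).sub (hV x)).congr_deriv ?_
    simp only [CircleFun.sub_apply, CircleFun.real_smul_apply]
    simp only [smul_sub, smul_smul]
    rw [← sq, hσ, one_smul]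
    module

namespace PeriodicPotential

variable (N : PeriodicPotential F)

/-- Multiplication by the potential. -/
def mulOp : CircleFun F →L[ℂ] CircleFun F :=
  LinearMap.mkContinuous
    { toFun := fun w => CircleFun.mk (fun x => N.op x (w x))
        (N.continuous.clm_apply (CircleFun.continuous w))
        (fun x => by simp only [N.periodic x, CircleFun.add_one])
      map_add' := fun v w => CircleFun.ext fun x => by
        simp only [CircleFun.mk_apply, CircleFun.add_apply, map_add]
        rfl
      map_smul' := fun a w => CircleFun.ext fun x => by
        simp only [CircleFun.mk_apply, CircleFun.smul_apply, RingHom.id_apply, map_smul]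
        rfl }
    N.bound fun w => CircleFun.norm_le (mul_nonneg N.bound_nonneg (norm_nonneg _)) fun x =>
      (ContinuousLinearMap.le_opNorm _ _).trans
        (mul_le_mul (N.norm_le x) (CircleFun.norm_apply_le w x) (norm_nonneg _) N.bound_nonneg)

theorem mulOp_apply (w : CircleFun F) (x : ℝ) :
    N.mulOp w x = N.op x (w x) := rfl

theorem norm_mulOp_le : ‖N.mulOp‖ ≤ N.bound := LinearMap.mkContinuous_norm_le _ N.bound_nonneg _

/-- `V` is a classical periodic solution of `(∂ + iξ)² V + c (∂ + iξ) V + N V = h`. -/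
def IsBlochSolution (c : ℝ) (ξ : ℂ) (V h : CircleFun F) : Prop :=
  ∃ V₁ V₂ : CircleFun F,
    (∀ x : ℝ, HasDerivAt (fun x : ℝ => V x) (V₁ x) x) ∧
    (∀ x : ℝ, HasDerivAt (fun x : ℝ => V₁ x) (V₂ x) x) ∧
    V₂ + (c + 2 * Complex.I * ξ) • V₁ + (Complex.I * c * ξ - ξ ^ 2) • V + N.mulOp V = h

/-- The inverse of `γ² - ∂²`. -/
def freeResolvent (γ : ℝ) : CircleFun F →L[ℂ] CircleFun F :=
  expAverage γ (-1) * expAverage γ 1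

/-- The operator `∂ (γ² - ∂²)⁻¹`. -/
def freeResolventDeriv (γ : ℝ) : CircleFun F →L[ℂ] CircleFun F :=
  expAverage γ 1 - (γ : ℂ) • freeResolvent γ

theorem norm_freeResolvent_le {γ : ℝ} (hγ : 0 < γ) :
    ‖(freeResolvent γ : CircleFun F →L[ℂ] CircleFun F)‖ ≤ γ⁻¹ * γ⁻¹ := by
  refine (ContinuousLinearMap.opNorm_comp_le (expAverage γ (-1)) (expAverage γ 1)).trans ?_
  exact mul_le_mul (norm_expAverage_le hγ _) (norm_expAverage_le hγ _)
    (norm_nonneg _) (inv_nonneg.mpr hγ.le)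

theorem norm_freeResolventDeriv_le {γ : ℝ} (hγ : 0 < γ) :
    ‖(freeResolventDeriv γ : CircleFun F →L[ℂ] CircleFun F)‖
      ≤ 2 * γ⁻¹ := by
  refine (norm_sub_le (expAverage γ 1) ((γ : ℂ) • freeResolvent γ)).trans ?_
  have h1 := norm_expAverage_le (F := F) hγ 1
  have h2 : ‖(γ : ℂ) • (freeResolvent γ : CircleFun F →L[ℂ] CircleFun F)‖
      ≤ γ⁻¹ := by
    rw [norm_smul, Complex.norm_real, Real.norm_of_nonneg hγ.le]
    refine (mul_le_mul_of_nonneg_left (norm_freeResolvent_le hγ) hγ.le).trans_eq ?_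
    field_simp
  linarith

theorem hasDerivAt_freeResolvent [CompleteSpace F] {γ : ℝ} (hγ : 0 < γ)
    (w : CircleFun F) (x : ℝ) :
    HasDerivAt (fun x : ℝ => freeResolvent γ w x)
      (freeResolventDeriv γ w x) x := by
  refine (hasDerivAt_expAverage hγ (σ := -1) (by norm_num) (expAverage γ 1 w) x).congr_deriv ?_
  simp only [freeResolventDeriv, freeResolvent, sub_apply, smul_apply, CircleFun.sub_apply,
    CircleFun.real_smul_apply, mul_apply_eq_comp, Complex.coe_smul]
  module

theorem hasDerivAt_freeResolventDeriv [CompleteSpace F] {γ : ℝ} (hγ : 0 < γ)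
    (w : CircleFun F) (x : ℝ) :
    HasDerivAt (fun x : ℝ => freeResolventDeriv γ w x)
      ((γ ^ 2) • freeResolvent γ w x - w x) x := by
  refine ((hasDerivAt_expAverage hγ (σ := 1) (by norm_num) w x).sub
    ((hasDerivAt_freeResolvent hγ w x).const_smul γ)).congr_deriv ?_
  simp only [freeResolventDeriv, sub_apply, smul_apply, CircleFun.sub_apply,
    CircleFun.real_smul_apply, Complex.coe_smul]
  module

theorem freeResolvent_eq [CompleteSpace F] {γ : ℝ} (hγ : 0 < γ)
    {V V₁ V₂ : CircleFun F}
    (hV : ∀ x : ℝ, HasDerivAt (fun x : ℝ => V x)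
      (V₁ x) x)
    (hV₁ : ∀ x : ℝ, HasDerivAt (fun x : ℝ => V₁ x)
      (V₂ x) x) :
    freeResolvent γ (γ ^ 2 • V - V₂) = V := by
  have h1 : expAverage γ 1 (γ ^ 2 • V - V₂) = γ • V + V₁ := by
    have := expAverage_eq hγ (σ := 1) (by norm_num) (V := γ • V + V₁) (V₁ := γ • V₁ + V₂)
      fun x => ((hV x).const_smul γ).add (hV₁ x)
    rw [← this]
    congr 1
    module
  have h2 := expAverage_eq hγ (σ := -1) (by norm_num) hV
  rw [freeResolvent, mul_apply_eq_comp, h1, ← h2]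
  congr 1
  rw [h2]
  module

/-- The perturbation of the free resolvent equation. -/
def resolventPert (γ c : ℝ) (ξ : ℂ) : CircleFun F →L[ℂ] CircleFun F :=
  (c + 2 * Complex.I * ξ) • freeResolventDeriv (γ)
    + (Complex.I * c * ξ - ξ ^ 2) • freeResolvent (γ)
    + N.mulOp * freeResolvent (γ)

/-- For |ξ| ≤ 4 the first order coefficient is at most |c| + 8 and the zeroth order one at most 4|c|
+ 16. Against the operator norms 2/γ and 1/γ they add up to the stated threshold, so a Neumann
series converges. The disc of radius 4 contains [-π, π] and a complex neighbourhood of 0. -/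
theorem norm_resolventPert_lt {γ c : ℝ} (hγ : 6 * |c| + 32 + N.bound < γ) {ξ : ℂ}
    (hξ : ‖ξ‖ ≤ 4) : ‖N.resolventPert γ c ξ‖ < 1 := by
  have hm := N.bound_nonneg
  have hγ1 : 1 ≤ γ := by linarith [abs_nonneg c]
  have hγ0 : 0 < γ := by linarith
  have hinv : γ⁻¹ * γ⁻¹ ≤ γ⁻¹ := mul_le_of_le_one_left (by positivity) (inv_le_one_of_one_le₀ hγ1)
  have h1 := norm_freeResolventDeriv_le (F := F) hγ0
  have h2 := (norm_freeResolvent_le (F := F) hγ0).trans hinv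
  have h3 : ‖(c + 2 * Complex.I * ξ : ℂ)‖ ≤ |c| + 8 := by
    refine (norm_add_le _ _).trans ?_
    simp only [norm_mul, Complex.norm_I, Complex.norm_real, Real.norm_eq_abs, Complex.norm_ofNat,
      mul_one]
    linarith
  have h4 : ‖(Complex.I * c * ξ - ξ ^ 2 : ℂ)‖ ≤ 4 * |c| + 16 := by
    refine (norm_sub_le _ _).trans ?_
    simp only [norm_mul, norm_pow, Complex.norm_I, Complex.norm_real, Real.norm_eq_abs, one_mul]
    nlinarith [abs_nonneg c, norm_nonneg ξ]
  have h5 : ‖N.resolventPert γ c ξ‖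
      ≤ (|c| + 8) * (2 * γ⁻¹) + (4 * |c| + 16) * γ⁻¹ + N.bound * γ⁻¹ := by
    unfold resolventPert
    refine (norm_add₃_le (a := (c + 2 * Complex.I * ξ) • freeResolventDeriv γ)).trans
      (add_le_add (add_le_add ?_ ?_) ?_)
    · rw [norm_smul]; exact mul_le_mul h3 h1 (norm_nonneg _) (by positivity)
    · rw [norm_smul]; exact mul_le_mul h4 h2 (norm_nonneg _) (by positivity)
    · exact (ContinuousLinearMap.opNorm_comp_le N.mulOp (freeResolvent γ)).trans
        (mul_le_mul N.norm_mulOp_le h2 (norm_nonneg _) hm)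
  refine h5.trans_lt ?_
  rw [show (|c| + 8) * (2 * γ⁻¹) + (4 * |c| + 16) * γ⁻¹ + N.bound * γ⁻¹
    = (6 * |c| + 32 + N.bound) * γ⁻¹ by ring, ← div_eq_mul_inv, div_lt_one hγ0]
  exact hγ

/-- The resolvent `(γ² - L_ξ)⁻¹`. -/
def resolventOp (γ c : ℝ) (ξ : ℂ) : CircleFun F →L[ℂ] CircleFun F :=
  freeResolvent (γ) * Ring.inverse (1 - N.resolventPert γ c ξ)

variable [CompleteSpace F]

theorem isUnit_one_sub_resolventPert {γ c : ℝ} (hγ : 6 * |c| + 32 + N.bound < γ)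
    {ξ : ℂ} (hξ : ‖ξ‖ ≤ 4) :
    IsUnit (1 - N.resolventPert γ c ξ) :=
  isUnit_one_sub_of_norm_lt_one (R := CircleFun F →L[ℂ] CircleFun F)
    (N.norm_resolventPert_lt hγ hξ)

/-- With X = γ²V - V'' as unknown, V is the free resolvent of X and the equation reads (1 - pert) X
= γ²V - h. The differential equation thus becomes an identity between bounded operators, with no
derivatives left to track. -/
theorem isBlochSolution_iff {γ c : ℝ} (hγ : 6 * |c| + 32 + N.bound < γ) {ξ : ℂ} (hξ : ‖ξ‖ ≤ 4) (V h : CircleFun F) :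
    N.IsBlochSolution c ξ V h
      ↔ V = N.resolventOp γ c ξ (γ ^ 2 • V - h) := by
  have hγ0 : 0 < γ := by linarith [abs_nonneg c, N.bound_nonneg]
  have hu := N.isUnit_one_sub_resolventPert hγ hξ
  constructor
  · rintro ⟨V₁, V₂, h1, h2, h3⟩
    have e0 : freeResolvent γ (γ ^ 2 • V - V₂) = V := freeResolvent_eq hγ0 h1 h2
    have e1 : freeResolventDeriv γ (γ ^ 2 • V - V₂) = V₁ := by
      refine CircleFun.ext fun x => (hasDerivAt_freeResolvent hγ0 _ x).unique ?_
      rw [e0]; exact h1 x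
    have e2 : γ ^ 2 • V - h = (1 - N.resolventPert γ c ξ) (γ ^ 2 • V - V₂) := by
      simp only [resolventPert, sub_apply, add_apply, smul_apply, mul_apply_eq_comp,
        one_apply_eq_self, e0, e1, ← h3]
      abel
    rw [resolventOp, mul_apply_eq_comp, e2, ← mul_apply_eq_comp (Ring.inverse _),
      Ring.inverse_mul_cancel _ hu, one_apply_eq_self, e0]
  · intro hV
    set X := Ring.inverse (1 - N.resolventPert γ c ξ) (γ ^ 2 • V - h) with hX
    have hV' : V = freeResolvent γ X := hV
    have e2 : γ ^ 2 • V - h = (1 - N.resolventPert γ c ξ) X := by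
      rw [hX, ← mul_apply_eq_comp (1 - N.resolventPert γ c ξ), Ring.mul_inverse_cancel _ hu,
        one_apply_eq_self]
    refine ⟨freeResolventDeriv γ X, γ ^ 2 • V - X, fun x => ?_, fun x => ?_, ?_⟩
    · rw [hV']; exact hasDerivAt_freeResolvent hγ0 X x
    · rw [hV']; exact hasDerivAt_freeResolventDeriv hγ0 X x
    · simp only [resolventPert, sub_apply, add_apply, smul_apply, mul_apply_eq_comp,
        one_apply_eq_self, ← hV'] at e2
      rw [← sub_eq_zero] at e2 ⊢
      rw [← e2]
      abel

theorem analyticAt_resolventOp {γ c : ℝ} (hγ : 6 * |c| + 32 + N.bound < γ) {ξ : ℂ} (hξ : ‖ξ‖ ≤ 4) :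
    AnalyticAt ℂ (N.resolventOp γ c) ξ := by
  have h1 : AnalyticAt ℂ (fun ξ => 1 - N.resolventPert γ c ξ) ξ := by
    unfold resolventPert
    have a1 : AnalyticAt ℂ (fun ξ : ℂ => (c + 2 * Complex.I * ξ : ℂ)) ξ := by fun_prop
    have a2 : AnalyticAt ℂ (fun ξ : ℂ => (Complex.I * c * ξ - ξ ^ 2 : ℂ)) ξ := by fun_prop
    exact analyticAt_const.sub (((a1.smul analyticAt_const).add (a2.smul analyticAt_const)).add
      analyticAt_const)
  have h2 := analyticAt_inverse (𝕜 := ℂ)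
    (A := CircleFun F →L[ℂ] CircleFun F) (N.isUnit_one_sub_resolventPert hγ hξ).unit
  rw [IsUnit.unit_spec] at h2
  exact (analyticAt_const (v := freeResolvent (F := F) (γ))).mul (h2.comp_of_eq h1 rfl)

/-- The derivative of the average is at most 2‖w‖, so the image of the unit ball is uniformly
Lipschitz. -/
theorem isCompactOperator_expAverage [FiniteDimensional ℂ F] {γ σ : ℝ} (hγ : 0 < γ)
    (hσ : σ ^ 2 = 1) :
    IsCompactOperator (expAverage γ σ : CircleFun F →L[ℂ] CircleFun F) := by
  refine isCompactOperator_of_equicontinuous _ fun x => ⟨fun x' => 2 * |x' - x|, ?_, ?_, ?_⟩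
  · have : Continuous fun x' => 2 * |x' - x| := by fun_prop
    simpa using this.tendsto x
  · intro x'; positivity
  · intro x' w
    have hb : ∀ y : ℝ, ‖σ • (γ • expAverage γ σ w y
        - w y)‖ ≤ 2 * ‖w‖ := by
      intro y
      have hσ1 : |σ| = 1 := by rw [← sq_eq_sq₀ (abs_nonneg _) zero_le_one, sq_abs, hσ, one_pow]
      rw [norm_smul, Real.norm_eq_abs, hσ1, one_mul]
      refine (norm_sub_le _ _).trans ?_
      have h1 : ‖expAverage γ σ w y‖ ≤ γ⁻¹ * ‖w‖ :=
        (CircleFun.norm_apply_le _ _).trans (((expAverage γ σ).le_opNorm w).trans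
          (mul_le_mul_of_nonneg_right (norm_expAverage_le hγ σ) (norm_nonneg _)))
      have h2 : ‖γ • expAverage γ σ w y‖ ≤ ‖w‖ := by
        rw [norm_smul, Real.norm_of_nonneg hγ.le]
        refine (mul_le_mul_of_nonneg_left h1 hγ.le).trans_eq ?_
        field_simp
      linarith [CircleFun.norm_apply_le w y]
    have := convex_univ.norm_image_sub_le_of_norm_hasDerivWithin_le (𝕜 := ℝ)
      (f := fun x : ℝ => expAverage γ σ w x)
      (fun y _ => (hasDerivAt_expAverage hγ hσ w y).hasDerivWithinAt) (fun y _ => hb y)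
      (Set.mem_univ x) (Set.mem_univ x')
    rw [Real.norm_eq_abs] at this
    linarith

theorem isCompactOperator_resolventOp [FiniteDimensional ℂ F] {γ : ℝ} (hγ0 : 0 < γ) (c : ℝ) (ξ : ℂ) :
    IsCompactOperator (N.resolventOp γ c ξ) := by
  have h := (isCompactOperator_expAverage (F := F) hγ0 (σ := -1) (by norm_num)).comp_clm
    (expAverage (γ) 1 * Ring.inverse (1 - N.resolventPert γ c ξ))
  exact h

end PeriodicPotential

end

/-! ### Bloch solutions, the bilinear pairing and transposition -/

section

namespace PeriodicPotential

variable {F : Type*} [NormedAddCommGroup F] [NormedSpace ℂ F] {N : PeriodicPotential F} {c : ℝ}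
  {ξ : ℂ}

theorem isBlochSolution_zero : N.IsBlochSolution c ξ 0 0 :=
  ⟨0, 0, fun x => hasDerivAt_const x 0, fun x => hasDerivAt_const x 0, by simp⟩

theorem IsBlochSolution.right_unique {V h h' : CircleFun F} (hV : N.IsBlochSolution c ξ V h)
    (hV' : N.IsBlochSolution c ξ V h') : h = h' := by
  obtain ⟨V₁, V₂, h1, h2, rfl⟩ := hV
  obtain ⟨W₁, W₂, g1, g2, rfl⟩ := hV'
  have e1 : V₁ = W₁ := CircleFun.ext fun x => (h1 x).unique (g1 x)
  subst e1
  have e2 : V₂ = W₂ := CircleFun.ext fun x => (h2 x).unique (g2 x)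
  rw [e2]

variable [CompleteSpace F] {γ : ℝ}

theorem isBlochSolution_resolventOp (hγ : 6 * |c| + 32 + N.bound < γ) (hξ : ‖ξ‖ ≤ 4)
    (a : CircleFun F) :
    N.IsBlochSolution c ξ (N.resolventOp γ c ξ a) (γ ^ 2 • N.resolventOp γ c ξ a - a) := by
  rw [N.isBlochSolution_iff hγ hξ, sub_sub_cancel]

theorem resolventOp_injective (hγ : 6 * |c| + 32 + N.bound < γ) (hξ : ‖ξ‖ ≤ 4)
    {a : CircleFun F} (ha : N.resolventOp γ c ξ a = 0) : a = 0 := by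
  have h := isBlochSolution_resolventOp hγ hξ a
  rw [ha, smul_zero, zero_sub] at h
  simpa using h.right_unique isBlochSolution_zero

/-- Eigenfunctions for ν are those of the resolvent for (γ² - ν)⁻¹. Written without division, the
equivalence also covers ν = γ², where it says V = 0. -/
theorem isBlochSolution_smul_iff (hγ : 6 * |c| + 32 + N.bound < γ) (hξ : ‖ξ‖ ≤ 4)
    (V : CircleFun F) (ν : ℂ) :
    N.IsBlochSolution c ξ V (ν • V) ↔ V = ((γ : ℂ) ^ 2 - ν) • N.resolventOp γ c ξ V := by
  rw [N.isBlochSolution_iff hγ hξ, ← map_smul, sub_smul, ← Complex.ofReal_pow, Complex.coe_smul]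

end PeriodicPotential

section Pairing

variable {n : ℕ}


theorem norm_bilinPair_le (a b : EuclideanSpace ℂ (Fin n)) : ‖bilinPair a b‖ ≤ n * ‖a‖ * ‖b‖ := by
  refine (norm_sum_le _ _).trans ?_
  have : ∀ i ∈ Finset.univ, ‖a i * b i‖ ≤ ‖a‖ * ‖b‖ := fun i _ => by
    rw [norm_mul]
    exact mul_le_mul (PiLp.norm_apply_le a i) (PiLp.norm_apply_le b i) (norm_nonneg _)
      (norm_nonneg _)
  refine (Finset.sum_le_card_nsmul _ _ _ this).trans (le_of_eq ?_)
  simp [mul_assoc]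

theorem continuous_bilinPair : Continuous fun p : EuclideanSpace ℂ (Fin n) × EuclideanSpace ℂ (Fin n) => bilinPair p.1 p.2 := by
  unfold bilinPair
  fun_prop

theorem bilinPair_add_left (a b v : EuclideanSpace ℂ (Fin n)) : bilinPair (a + b) v = bilinPair a v + bilinPair b v := by
  simp [bilinPair, add_mul, Finset.sum_add_distrib]

theorem bilinPair_add_right (a v w : EuclideanSpace ℂ (Fin n)) : bilinPair a (v + w) = bilinPair a v + bilinPair a w := by
  simp [bilinPair, mul_add, Finset.sum_add_distrib]

theorem bilinPair_smul_left (k : ℂ) (a v : EuclideanSpace ℂ (Fin n)) : bilinPair (k • a) v = k * bilinPair a v := by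
  simp [bilinPair, Finset.mul_sum, mul_assoc]

theorem bilinPair_smul_right (k : ℂ) (a v : EuclideanSpace ℂ (Fin n)) : bilinPair a (k • v) = k * bilinPair a v := by
  simp [bilinPair, Finset.mul_sum, mul_left_comm]

theorem bilinPair_comm (a v : EuclideanSpace ℂ (Fin n)) : bilinPair a v = bilinPair v a := by
  simp [bilinPair, mul_comm]

theorem bilinPair_conjVec (a : EuclideanSpace ℂ (Fin n)) : bilinPair a (conjVec a) = ((‖a‖ ^ 2 : ℝ) : ℂ) := by
  rw [EuclideanSpace.norm_sq_eq, bilinPair]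
  push_cast
  refine Finset.sum_congr rfl fun i _ => ?_
  rw [conjVec_apply, Complex.mul_conj, Complex.normSq_eq_norm_sq]
  push_cast
  rfl

theorem bilinPair_realMatrixAct (A : Matrix (Fin n) (Fin n) ℝ) (a v : EuclideanSpace ℂ (Fin n)) :
    bilinPair (realMatrixAct A.transpose a) v = bilinPair a (realMatrixAct A v) := by
  simp only [bilinPair, realMatrixAct_apply, Matrix.transpose_apply, Finset.sum_mul,
    Finset.mul_sum]
  rw [Finset.sum_comm]
  exact Finset.sum_congr rfl fun i _ => Finset.sum_congr rfl fun j _ => by ring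

theorem HasDerivAt.bilinPair {a b : ℝ → EuclideanSpace ℂ (Fin n)} {a' b' : EuclideanSpace ℂ (Fin n)} {x : ℝ} (ha : HasDerivAt a a' x)
    (hb : HasDerivAt b b' x) : HasDerivAt (fun x => bilinPair (a x) (b x))
      (_root_.bilinPair a' (b x) + _root_.bilinPair (a x) b') x := by
  have hc : ∀ {f : ℝ → EuclideanSpace ℂ (Fin n)} {f' : EuclideanSpace ℂ (Fin n)}, HasDerivAt f f' x → ∀ i, HasDerivAt (fun x => f x i) (f' i) x :=
    fun hf i => ((EuclideanSpace.proj (𝕜 := ℂ) i : EuclideanSpace ℂ (Fin n) →L[ℂ] ℂ).restrictScalars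
      ℝ).hasFDerivAt.comp_hasDerivAt x hf
  have := HasDerivAt.fun_sum (u := Finset.univ) fun i _ => (hc ha i).mul (hc hb i)
  refine this.congr_deriv ?_
  simp only [_root_.bilinPair, Finset.sum_add_distrib]

theorem continuous_pair (a b : CircleFun (EuclideanSpace ℂ (Fin n))) : Continuous fun x => bilinPair (a x) (b x) :=
  continuous_bilinPair.comp (a.continuous.prodMk b.continuous)

/-- The pairing `∫₀¹ a(x) b(x) dx` of periodic functions. -/
def pair : CircleFun (EuclideanSpace ℂ (Fin n)) →L[ℂ] CircleFun (EuclideanSpace ℂ (Fin n)) →L[ℂ] ℂ :=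
  LinearMap.mkContinuous₂
    (LinearMap.mk₂ ℂ (fun a b => ∫ x in (0 : ℝ)..1, bilinPair (a x) (b x))
      (fun a b v => by
        rw [← intervalIntegral.integral_add ((continuous_pair a v).intervalIntegrable _ _)
          ((continuous_pair b v).intervalIntegrable _ _)]
        simp only [CircleFun.add_apply, bilinPair_add_left])
      (fun k a v => by
        simp only [CircleFun.smul_apply, bilinPair_smul_left, smul_eq_mul,
          intervalIntegral.integral_const_mul])
      (fun a v w => by
        rw [← intervalIntegral.integral_add ((continuous_pair a v).intervalIntegrable _ _)
          ((continuous_pair a w).intervalIntegrable _ _)]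
        simp only [CircleFun.add_apply, bilinPair_add_right])
      (fun k a v => by
        simp only [CircleFun.smul_apply, bilinPair_smul_right, smul_eq_mul,
          intervalIntegral.integral_const_mul]))
    n fun a b => by
      have := intervalIntegral.norm_integral_le_of_norm_le_const (a := 0) (b := 1)
        (f := fun x => bilinPair (a x) (b x)) (C := n * ‖a‖ * ‖b‖) fun x _ =>
          (norm_bilinPair_le _ _).trans (mul_le_mul (mul_le_mul_of_nonneg_left
            (a.norm_apply_le x) (Nat.cast_nonneg n)) (b.norm_apply_le x) (norm_nonneg _)
            (by positivity))
      simpa using this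

theorem pair_apply (a b : CircleFun (EuclideanSpace ℂ (Fin n))) :
    pair a b = ∫ x in (0 : ℝ)..1, bilinPair (a x) (b x) := rfl

theorem pair_comm (a b : CircleFun (EuclideanSpace ℂ (Fin n))) : pair a b = pair b a := by
  simp only [pair_apply, bilinPair_comm]

/-- Complex conjugation of periodic functions. -/
def CircleFun.conj (w : CircleFun (EuclideanSpace ℂ (Fin n))) : CircleFun (EuclideanSpace ℂ (Fin n)) :=
  CircleFun.mk (fun x => conjVec (w x)) (conjVec.continuous.comp w.continuous)
    fun x => by simp only [w.add_one]

theorem pair_conj (w : CircleFun (EuclideanSpace ℂ (Fin n))) :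
    pair w w.conj = ((∫ x in (0 : ℝ)..1, ‖w x‖ ^ 2 : ℝ) : ℂ) := by
  rw [pair_apply, ← intervalIntegral.integral_ofReal]
  exact intervalIntegral.integral_congr fun x _ => bilinPair_conjVec (w x)

theorem eq_zero_of_pair_conj {w : CircleFun (EuclideanSpace ℂ (Fin n))} (h : pair w w.conj = 0) : w = 0 := by
  rw [pair_conj, Complex.ofReal_eq_zero] at h
  have hc : Continuous fun x => ‖w x‖ ^ 2 := w.continuous.norm.pow 2
  by_contra hw
  obtain ⟨x, hx⟩ : ∃ x, w x ≠ 0 := by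
    by_contra! h0
    exact hw (CircleFun.ext h0)
  have hp : Function.Periodic (fun x => ‖w x‖ ^ 2) 1 := fun x => by simp only [w.add_one]
  have h2 := hp.intervalIntegral_add_eq 0 x
  rw [zero_add] at h2
  rw [h2] at h
  have := intervalIntegral.integral_pos (a := x) (b := x + 1) (by linarith) hc.continuousOn
    (fun y _ => by positivity) ⟨x, ⟨le_rfl, by linarith⟩, by positivity⟩
  linarith

/-- The potential given by a periodic matrix function. -/
def matrixPotential (M : ℝ → Matrix (Fin n) (Fin n) ℝ) (hM : Continuous M)
    (hper : Function.Periodic M 1) : PeriodicPotential (EuclideanSpace ℂ (Fin n)) where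
  op z := realMatrixAct (M z)
  continuous := continuous_realMatrixAct.comp hM
  periodic x := by simp only [hper x]

/-- `N'` is the transpose of `N`. -/
def IsTranspose (N N' : PeriodicPotential (EuclideanSpace ℂ (Fin n))) : Prop :=
  ∀ x a v, bilinPair (N'.op x a) v = bilinPair a (N.op x v)

variable {N N' : PeriodicPotential (EuclideanSpace ℂ (Fin n))} {c : ℝ} {ξ : ℂ}

/-- Green's identity: the difference of the two integrands is the derivative of the periodic
function W·V' - W'·V + (c + 2iξ) W·V. -/
theorem pair_eq_of_isBlochSolution (hN : IsTranspose N N') {V h W k : CircleFun (EuclideanSpace ℂ (Fin n))}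
    (hV : N.IsBlochSolution c ξ V h) (hW : N'.IsBlochSolution (-c) (-ξ) W k) :
    pair W h = pair k V := by
  obtain ⟨V₁, V₂, h1, h2, rfl⟩ := hV
  obtain ⟨W₁, W₂, g1, g2, rfl⟩ := hW
  have hd : ∀ x, HasDerivAt (fun x => bilinPair (W x) (V₁ x) - bilinPair (W₁ x) (V x)
      + (c + 2 * Complex.I * ξ) * bilinPair (W x) (V x))
      (bilinPair (W x) (V₂ x) - bilinPair (W₂ x) (V x) + (c + 2 * Complex.I * ξ) *
        (bilinPair (W₁ x) (V x) + bilinPair (W x) (V₁ x))) x := fun x => by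
    refine ((((g1 x).bilinPair (h2 x)).sub ((g2 x).bilinPair (h1 x))).add
      (((g1 x).bilinPair (h1 x)).const_mul _)).congr_deriv ?_
    ring
  have hc : Continuous fun x => bilinPair (W x) (V₂ x) - bilinPair (W₂ x) (V x)
      + (c + 2 * Complex.I * ξ) * (bilinPair (W₁ x) (V x) + bilinPair (W x) (V₁ x)) :=
    ((continuous_pair W V₂).sub (continuous_pair W₂ V)).add
      (((continuous_pair W₁ V).add (continuous_pair W V₁)).const_mul _)
  have hint := intervalIntegral.integral_eq_sub_of_hasDerivAt (a := 0) (b := 1) (fun x _ => hd x)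
    (hc.intervalIntegrable _ _)
  have p : ∀ w : CircleFun (EuclideanSpace ℂ (Fin n)), w 1 = w 0 := fun w => by rw [← w.add_one 0, zero_add]
  rw [p W, p V, p V₁, p W₁, sub_self] at hint
  rw [← sub_eq_zero, ← hint, pair_apply, pair_apply, ← intervalIntegral.integral_sub
    ((continuous_pair _ _).intervalIntegrable _ _) ((continuous_pair _ _).intervalIntegrable _ _)]
  refine intervalIntegral.integral_congr fun x _ => ?_
  simp only [CircleFun.add_apply, CircleFun.smul_apply, PeriodicPotential.mulOp_apply,
    bilinPair_add_left, bilinPair_add_right, bilinPair_smul_left, bilinPair_smul_right, hN x]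
  push_cast
  ring

theorem pair_resolventOp (hN : IsTranspose N N') {γ : ℝ} (hγ : 6 * |c| + 32 + N.bound < γ)
    (hγ' : 6 * |c| + 32 + N'.bound < γ) (hξ : ‖ξ‖ ≤ 4) (a b : CircleFun (EuclideanSpace ℂ (Fin n))) :
    pair (N'.resolventOp γ (-c) (-ξ) a) b = pair a (N.resolventOp γ c ξ b) := by
  have h1 := PeriodicPotential.isBlochSolution_resolventOp hγ hξ b
  have h2 := PeriodicPotential.isBlochSolution_resolventOp (N := N') (c := -c) (γ := γ) (ξ := -ξ)
    (by rwa [abs_neg]) (by rwa [norm_neg]) a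
  have := pair_eq_of_isBlochSolution hN h1 h2
  simp only [map_sub, sub_apply, ContinuousLinearMap.map_smul_of_tower, smul_apply] at this
  linear_combination -this

/-! ### Bloch operators on `L²` -/

variable {M : ℝ → Matrix (Fin n) (Fin n) ℝ} (hM : Continuous M) (hper : Function.Periodic M 1)

theorem memL2Per_circleFun (h : CircleFun (EuclideanSpace ℂ (Fin n))) : MemL2Per h :=
  ⟨h.add_one, MemLp.of_bound h.continuous.aestronglyMeasurable ‖h‖
    (Eventually.of_forall h.norm_apply_le)⟩

/-- For continuous data the equation, solved for the weak second derivative, gives a continuous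
function. Then w' is its primitive and the H² solution is classical. This links the L² Bloch
operators of the hypotheses to those on continuous functions. -/
theorem blochMaps_iff {η : ℝ} (V h : CircleFun (EuclideanSpace ℂ (Fin n))) :
    BlochMaps M c η V h ↔ (matrixPotential M hM hper).IsBlochSolution c η V h := by
  constructor
  · rintro ⟨-, w₁, w₂, hd, hp1, hc1, hL2, hint, hae⟩
    set V₁ : CircleFun (EuclideanSpace ℂ (Fin n)) := CircleFun.mk w₁ hc1 hp1
    set V₂ : CircleFun (EuclideanSpace ℂ (Fin n)) := h - (c + 2 * Complex.I * η : ℂ) • V₁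
      - (Complex.I * c * η - η ^ 2 : ℂ) • V - (matrixPotential M hM hper).mulOp V with hV₂
    have hae' : ∀ᵐ x, w₂ x = V₂ x := by
      filter_upwards [hae] with x hx
      rw [hV₂]
      simp only [CircleFun.sub_apply, CircleFun.smul_apply, PeriodicPotential.mulOp_apply, ← hx]
      change _ = _ - _ - _ - realMatrixAct (M x) (V x)
      change _ = _ - _ • w₁ x - _ - _
      module
    refine ⟨V₁, V₂, hd, fun x => ?_, by rw [hV₂]; abel⟩
    have e : ∀ x, w₁ x = w₁ 0 + ∫ s in (0 : ℝ)..x, V₂ s := fun x => by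
      rw [hint x]
      congr 1
      exact intervalIntegral.integral_congr_ae (hae'.mono fun s hs _ => hs)
    change HasDerivAt w₁ _ _
    rw [funext e]
    exact (intervalIntegral.integral_hasDerivAt_right (V₂.continuous.intervalIntegrable _ _)
      V₂.continuous.aestronglyMeasurable.stronglyMeasurableAtFilter
      V₂.continuous.continuousAt).const_add _
  · rintro ⟨V₁, V₂, h1, h2, rfl⟩
    refine ⟨V.add_one, V₁, V₂, h1, V₁.add_one, V₁.continuous, memL2Per_circleFun V₂, fun x => ?_,
      Eventually.of_forall fun x => ?_⟩
    · rw [intervalIntegral.integral_eq_sub_of_hasDerivAt (fun x _ => h2 x)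
        (V₂.continuous.intervalIntegrable _ _)]
      abel
    · simp only [CircleFun.add_apply, CircleFun.smul_apply, PeriodicPotential.mulOp_apply]
      change _ = _ + _ + _ + realMatrixAct (M x) (V x)
      module

/-- A function in the domain of a Bloch operator is continuous and periodic. -/
theorem BlochMaps.exists_circleFun {η : ℝ} {w h : ℝ → EuclideanSpace ℂ (Fin n)} (hw : BlochMaps M c η w h) :
    ∃ V : CircleFun (EuclideanSpace ℂ (Fin n)), w = V := by
  obtain ⟨hp, w₁, _, hd, _⟩ := hw
  exact ⟨CircleFun.mk w (continuous_iff_continuousAt.mpr fun x => (hd x).continuousAt) hp, rfl⟩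

/-- If ν - L_η were onto, the solution for the conjugate of W, paired with the left eigenfunction W,
would give ∫|W|² = 0. Only this implication is needed: it transfers the assumed bounds on the L²
spectrum to eigenvalues of the transposed operators. -/
theorem mem_blochSpectrum_of_transpose (hN : IsTranspose (matrixPotential M hM hper) N')
    {η : ℝ} {W : CircleFun (EuclideanSpace ℂ (Fin n))} {ν : ℂ} (hW0 : W ≠ 0)
    (hW : N'.IsBlochSolution (-c) (-η) W (ν • W)) : ν ∈ blochSpectrum M c η := by
  intro hall
  obtain ⟨w, hw, -⟩ := hall W.conj (memL2Per_circleFun _)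
  obtain ⟨V, rfl⟩ := BlochMaps.exists_circleFun hw
  have h1 := (blochMaps_iff hM hper V (ν • V - W.conj)).mp hw
  have h2 := pair_eq_of_isBlochSolution hN h1 hW
  rw [map_sub, map_smul, map_smul, smul_apply, sub_eq_self] at h2
  exact hW0 (eq_zero_of_pair_conj h2)

end Pairing

end

/-! ### Bloch evolutions, their generators and resolvents -/

section

namespace CircleFun

variable {F : Type*} [NormedAddCommGroup F]

/-- Joint continuity on the line descends to the circle because the projection is an open quotient
map. Currying then gives continuity into the space of continuous functions. -/
theorem continuous_of_uncurry {X : Type*} [TopologicalSpace X] {f : X → CircleFun F}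
    (h : Continuous fun p : X × ℝ => f p.1 p.2) : Continuous f := by
  refine ContinuousMap.continuous_of_continuous_uncurry
    (f := (f : X → C(AddCircle (1 : ℝ), F))) ?_
  have hq : IsOpenQuotientMap (Prod.map (id : X → X) ((↑) : ℝ → AddCircle (1 : ℝ))) :=
    IsOpenQuotientMap.id.prodMap QuotientAddGroup.isOpenQuotientMap_mk
  exact hq.isQuotientMap.continuous_iff.mpr h

variable [NormedSpace ℂ F]

variable (F) in
/-- Evaluation at a point. -/
def evalCLM (x : ℝ) : CircleFun F →L[ℂ] F :=
  LinearMap.mkContinuous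
    { toFun := fun w => w x
      map_add' := fun _ _ => rfl
      map_smul' := fun _ _ => rfl } 1 fun w => by
    rw [one_mul]
    exact w.norm_apply_le x

@[simp] theorem evalCLM_apply (x : ℝ) (w : CircleFun F) : evalCLM F x w = w x := rfl

theorem intervalIntegral_apply [CompleteSpace F] {f : ℝ → CircleFun F} (hf : Continuous f)
    (a b x : ℝ) : (∫ t in a..b, f t) x = ∫ t in a..b, f t x :=
  ((evalCLM F x).intervalIntegral_comp_comm (hf.intervalIntegrable a b)).symm

end CircleFun

theorem hasDerivAt_wave (ξ x : ℝ) : HasDerivAt (wave ξ) (Complex.I * ξ * wave ξ x) x := by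
  have h : HasDerivAt (fun x : ℝ => Complex.I * (ξ : ℂ) * (x : ℂ)) (Complex.I * ξ) x := by
    simpa using (hasDerivAt_id x).ofReal_comp.const_mul (Complex.I * (ξ : ℂ))
  exact h.cexp.congr_deriv (mul_comm _ _)

namespace PeriodicPotential

variable {F : Type*} [NormedAddCommGroup F] [NormedSpace ℂ F] [CompleteSpace F]
  {N : PeriodicPotential F} {d ξ : ℝ}

theorem continuous_blochEvol_vec (N : PeriodicPotential F) (d : ℝ) (w : CircleFun F) :
    Continuous fun p : ℝ × ℝ => N.blochEvol d p.1 p.2 w :=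
  CircleFun.continuous_of_uncurry (f := fun p : ℝ × ℝ => N.blochEvol d p.1 p.2 w)
    ((N.continuous_blochEvol_apply d w).comp
      (f := fun p : (ℝ × ℝ) × ℝ => (p.1.1, p.1.2, p.2)) (by fun_prop))

theorem continuous_blochEvol_time (N : PeriodicPotential F) (d ξ : ℝ) (w : CircleFun F) :
    Continuous fun t => N.blochEvol d ξ t w :=
  (N.continuous_blochEvol_vec d w).comp (f := fun t : ℝ => (ξ, t)) (by fun_prop)

theorem continuous_exp_smul_blochEvol (N : PeriodicPotential F) (d ξ : ℝ) (κ : ℂ)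
    (w : CircleFun F) : Continuous fun t : ℝ => Complex.exp (κ * t) • N.blochEvol d ξ t w :=
  Continuous.smul (f := fun t : ℝ => Complex.exp (κ * t)) (by fun_prop)
    (continuous_blochEvol_time N d ξ w)

theorem blochEvol_zero (w : CircleFun F) : N.blochEvol d ξ 0 w = w := by
  have := N.blochEvol_natCast_pow d ξ 0
  rw [Nat.cast_zero, pow_zero] at this
  rw [this]
  rfl

theorem blochEvol_comm {s t : ℝ} (hs : 0 ≤ s) (ht : 0 ≤ t) (w : CircleFun F) :
    N.blochEvol d ξ s (N.blochEvol d ξ t w) = N.blochEvol d ξ t (N.blochEvol d ξ s w) := by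
  rw [blochEvol_blochEvol N d hs ht, blochEvol_blochEvol N d ht hs, add_comm]

/-- The weak equation `IsSpaceTimeTest.evol_eq` for the test function e^{-κt} e^{-iξx} V. The
parameter κ is left free: an eigenvalue makes the integral vanish, and γ² turns it into a Laplace
transform. -/
theorem exp_smul_blochEvol {V h : CircleFun F} (hV : N.IsBlochSolution d (-ξ : ℝ) V h) (κ : ℂ)
    {T : ℝ} (hT : 0 ≤ T) :
    Complex.exp (-κ * T) • N.blochEvol d ξ T V
      = V + ∫ t in (0 : ℝ)..T, Complex.exp (-κ * t) • N.blochEvol d ξ t (h - κ • V) := by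
  obtain ⟨V₁, V₂, h1, h2, rfl⟩ := hV
  set h := V₂ + (d + 2 * Complex.I * (-ξ : ℝ) : ℂ) • V₁
    + (Complex.I * d * (-ξ : ℝ) - (-ξ : ℝ) ^ 2 : ℂ) • V + N.mulOp V with hh
  have hint : Continuous fun t : ℝ => Complex.exp (-κ * t) • N.blochEvol d ξ t (h - κ • V) :=
    continuous_exp_smul_blochEvol N d ξ _ _
  refine CircleFun.ext fun y => ?_
  rw [CircleFun.add_apply, CircleFun.intervalIntegral_apply hint]
  simp only [CircleFun.smul_apply, blochEvol_apply]
  -- `W₁` and `W₂` are (∂ - iξ)V and (∂ - iξ)²V, so that conjugation by the wave turns them into the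
  -- space derivatives of the test function.
  set W₁ : CircleFun F := V₁ - (Complex.I * ξ) • V with hW₁
  set W₂ : CircleFun F := V₂ - (2 * Complex.I * ξ) • V₁ - ((ξ : ℂ) ^ 2) • V with hW₂
  have hw : ∀ {A B : CircleFun F}, (∀ x, HasDerivAt A (B x) x) → ∀ x,
      HasDerivAt (fun x => wave (-ξ) x • A x) (wave (-ξ) x • (B x - (Complex.I * ξ) • A x)) x :=
    fun hA x => ((hasDerivAt_wave (-ξ) x).smul (hA x)).congr_deriv (by push_cast; module)
  have test : IsSpaceTimeTest (fun t x => Complex.exp (-κ * t) • wave (-ξ) x • V x)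
      (fun t x => Complex.exp (-κ * t) • wave (-ξ) x • (-κ • V) x)
      (fun t x => Complex.exp (-κ * t) • wave (-ξ) x • W₁ x)
      (fun t x => Complex.exp (-κ * t) • wave (-ξ) x • W₂ x)
      (fun t : ℝ => ‖Complex.exp (-κ * t)‖ * (‖V‖ + ‖-κ • V‖ + ‖W₁‖ + ‖W₂‖)) := by
    have hc : ∀ A : CircleFun F, Continuous (Function.uncurry fun t x : ℝ =>
        Complex.exp (-κ * t) • wave (-ξ) x • A x) := fun A =>
      Continuous.smul (by fun_prop) ((continuous_wave_smul (-ξ) A).comp continuous_snd)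
    have hb : ∀ (A : CircleFun F) {B : ℝ}, ‖A‖ ≤ B → ∀ t x : ℝ,
        ‖Complex.exp (-κ * t) • wave (-ξ) x • A x‖ ≤ ‖Complex.exp (-κ * t)‖ * B :=
      fun A B hB t x => by
        rw [norm_smul]
        exact mul_le_mul_of_nonneg_left ((norm_wave_smul_le _ _ _).trans hB) (norm_nonneg _)
    have n1 := norm_nonneg V
    have n2 := norm_nonneg (-κ • V)
    have n3 := norm_nonneg W₁
    have n4 := norm_nonneg W₂
    refine ⟨fun t x => ?_, fun t x => ?_, fun t x => ?_, hc _, hc _, hc _, hc _, by fun_prop,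
      hb _ (by linarith), hb _ (by linarith), hb _ (by linarith), hb _ (by linarith)⟩
    · have : HasDerivAt (fun t : ℝ => Complex.exp (-κ * t)) (Complex.exp (-κ * t) * -κ) t := by
        have := ((hasDerivAt_id t).ofReal_comp.const_mul (-κ)).cexp
        simpa using this
      refine (this.smul_const _).congr_deriv ?_
      simp only [CircleFun.smul_apply]
      module
    · exact ((hw h1 x).const_smul _)
    · refine ((hw (A := W₁) (B := V₂ - (Complex.I * ξ) • V₁) (fun x => ?_) x).const_smul
        _).congr_deriv ?_
      · exact ((h2 x).sub ((h1 x).const_smul (Complex.I * ξ : ℂ)))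
      · rw [hW₁, hW₂]
        simp only [CircleFun.sub_apply, CircleFun.smul_apply]
        congr 2
        match_scalars <;> ring_nf
        simp [Complex.I_sq]
  have key := test.evol_eq (d := d) N.continuous N.norm_le hT y
  rw [evol_const_smul] at key
  rw [smul_comm, key, smul_add, ← intervalIntegral.integral_smul]
  congr 1
  · simp [smul_smul, wave_mul_neg]
  · refine intervalIntegral.integral_congr fun t _ => ?_
    rw [smul_comm (Complex.exp _) (wave ξ y), ← evol_const_smul (Complex.exp _)]
    congr 2
    funext x
    rw [hh, hW₁, hW₂]
    simp only [CircleFun.sub_apply, CircleFun.smul_apply, CircleFun.add_apply, mulOp_apply,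
      map_smul]
    rw [← Complex.coe_smul d]
    push_cast
    module

theorem blochEvol_eq_exp_smul {V : CircleFun F} {κ : ℂ}
    (hV : N.IsBlochSolution d (-ξ : ℝ) V (κ • V)) {T : ℝ} (hT : 0 ≤ T) :
    N.blochEvol d ξ T V = Complex.exp (κ * T) • V := by
  have h := exp_smul_blochEvol hV κ hT
  simp only [sub_self, map_zero, smul_zero, intervalIntegral.integral_zero, add_zero] at h
  conv_rhs => rw [← h]
  rw [smul_smul, ← Complex.exp_add, neg_mul, add_neg_cancel, Complex.exp_zero, one_smul]

variable {γ : ℝ}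

/-- The Laplace formula for the resolvent, cut at time T with its remainder kept. No limit T → ∞ is
needed anywhere. -/
theorem resolventOp_eq (hγ : 6 * |d| + 32 + N.bound < γ) (hξ : |ξ| ≤ 4) (a : CircleFun F)
    {T : ℝ} (hT : 0 ≤ T) :
    N.resolventOp γ d (-ξ : ℝ) a
      = Complex.exp (-(γ ^ 2 : ℝ) * T) • N.blochEvol d ξ T (N.resolventOp γ d (-ξ : ℝ) a)
        + ∫ t in (0 : ℝ)..T, Complex.exp (-(γ ^ 2 : ℝ) * t) • N.blochEvol d ξ t a := by
  have h := exp_smul_blochEvol (isBlochSolution_resolventOp (N := N) (c := d) (ξ := (-ξ : ℝ)) hγ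
    (by rwa [Complex.norm_real, Real.norm_eq_abs, abs_neg]) a) ((γ ^ 2 : ℝ) : ℂ) hT
  simp only [Complex.coe_smul, sub_sub_cancel_left, map_neg, smul_neg,
    intervalIntegral.integral_neg] at h
  rw [h]
  abel

/-- By the truncated Laplace formula the commutator D satisfies D = e^{-γ²} U(1) D, where U(1) is
the time-one evolution. Since γ² exceeds the growth rate of the evolution, D = 0. -/
theorem resolventOp_blochEvol (hγ : 6 * |d| + 32 + N.bound < γ) (hξ : |ξ| ≤ 4) {s : ℝ}
    (hs : 0 ≤ s) (a : CircleFun F) :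
    N.resolventOp γ d (-ξ : ℝ) (N.blochEvol d ξ s a)
      = N.blochEvol d ξ s (N.resolventOp γ d (-ξ : ℝ) a) := by
  have hγ1 : 1 ≤ γ := by linarith [abs_nonneg d, N.bound_nonneg]
  have hγ2 : N.bound < γ ^ 2 := by nlinarith [abs_nonneg d, N.bound_nonneg]
  rw [← sub_eq_zero]
  set D := N.resolventOp γ d (-ξ : ℝ) (N.blochEvol d ξ s a)
      - N.blochEvol d ξ s (N.resolventOp γ d (-ξ : ℝ) a) with hD
  have hint : ∀ b : CircleFun F, Continuous fun t : ℝ =>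
      Complex.exp (-(γ ^ 2 : ℝ) * t) • N.blochEvol d ξ t b := fun b =>
    continuous_exp_smul_blochEvol N d ξ _ b
  have h1 := resolventOp_eq hγ hξ (N.blochEvol d ξ s a) zero_le_one
  have h2 := congrArg (N.blochEvol d ξ s) (resolventOp_eq hγ hξ a zero_le_one)
  rw [map_add, map_smul, ← ContinuousLinearMap.intervalIntegral_comp_comm _
    ((hint a).intervalIntegrable _ _), blochEvol_comm hs zero_le_one] at h2
  have h3 : ∫ t in (0 : ℝ)..1, Complex.exp (-(γ ^ 2 : ℝ) * t) • N.blochEvol d ξ t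
        (N.blochEvol d ξ s a)
      = ∫ t in (0 : ℝ)..1, N.blochEvol d ξ s
        (Complex.exp (-(γ ^ 2 : ℝ) * t) • N.blochEvol d ξ t a) := by
    refine intervalIntegral.integral_congr fun t ht => ?_
    rw [Set.uIcc_of_le zero_le_one] at ht
    simp only [map_smul]
    rw [blochEvol_comm hs ht.1]
  have h4 : D = Complex.exp (-(γ ^ 2 : ℝ) * (1 : ℝ)) • N.blochEvol d ξ 1 D := by
    rw [hD, map_sub, smul_sub]
    nth_rw 1 [h1, h2]
    rw [h3]
    abel
  have h5 : ‖D‖ ≤ Real.exp (N.bound - γ ^ 2) * ‖D‖ := by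
    conv_lhs => rw [h4]
    rw [norm_smul, ← Complex.ofReal_neg, ← Complex.ofReal_mul, ← Complex.ofReal_exp,
      Complex.norm_real, Real.norm_of_nonneg (Real.exp_pos _).le, mul_one, sub_eq_neg_add,
      Real.exp_add, mul_assoc]
    refine mul_le_mul_of_nonneg_left ((ContinuousLinearMap.le_opNorm _ _).trans
      (mul_le_mul_of_nonneg_right ?_ (norm_nonneg _))) (Real.exp_pos _).le
    simpa using N.norm_blochEvol_le d ξ 1
  have h6 : Real.exp (N.bound - γ ^ 2) < 1 := by
    rw [Real.exp_lt_one_iff]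
    linarith
  by_contra hne
  nlinarith [norm_pos_iff.mpr hne]

end PeriodicPotential

variable {n : ℕ} {N N' : PeriodicPotential (EuclideanSpace ℂ (Fin n))}

/-- Formally ⟨U(t)a, q⟩ has derivative μ⟨U(t)a, q⟩, but `a` need not lie in the domain of the
generator. Pairing the truncated Laplace formula with q gives instead an integral equation for
e^{-βt}⟨U(t)a, q⟩, β = γ², whose solution is explicit. -/
theorem pair_blochEvol (hN : IsTranspose N N') {c ξ : ℝ} (hξ : |ξ| ≤ 4)
    {q : CircleFun (EuclideanSpace ℂ (Fin n))} {μ : ℂ} (hq : N.IsBlochSolution c ξ q (μ • q))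
    (a : CircleFun (EuclideanSpace ℂ (Fin n))) {T : ℝ} (hT : 0 ≤ T) :
    pair (N'.blochEvol (-c) ξ T a) q = Complex.exp (μ * T) * pair a q := by
  set γ := 6 * |c| + 33 + N.bound + N'.bound with hγ
  have m1 := N.bound_nonneg
  have m2 := N'.bound_nonneg
  set β : ℂ := ((γ ^ 2 : ℝ) : ℂ) with hβ
  set f : ℝ → ℂ := fun t => pair (N'.blochEvol (-c) ξ t a) q with hf
  set ℓ := (pair (n := n)).flip q with hℓ
  set K := N'.resolventOp γ (-c) (-ξ : ℝ) with hK
  have hγ' : 6 * |-c| + 32 + N'.bound < γ := by rw [abs_neg]; linarith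
  have hfc : Continuous f := ℓ.continuous.comp (N'.continuous_blochEvol_time (-c) ξ a)
  have hKq : ∀ b, (β - μ) * ℓ (K b) = ℓ b := fun b => by
    change (β - μ) * pair (K b) q = pair b q
    have h1 := pair_resolventOp hN (γ := γ) (c := c) (ξ := (ξ : ℂ)) (by linarith) (by linarith)
      (by rwa [Complex.norm_real]) b q
    rw [← Complex.ofReal_neg] at h1
    rw [h1]
    conv_rhs => rw [(PeriodicPotential.isBlochSolution_smul_iff (N := N) (γ := γ) (by linarith)
      (by rwa [Complex.norm_real]) q μ).mp hq]
    rw [map_smul, smul_eq_mul, hβ]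
    push_cast
    rfl
  set g : ℝ → ℂ := fun t => Complex.exp (-β * t) * f t with hg
  have hgc : Continuous g := by fun_prop
  have key : ∀ t, 0 ≤ t → g t = f 0 - (β - μ) * ∫ s in (0 : ℝ)..t, g s := by
    intro t ht
    have h := congrArg (fun v => (β - μ) * ℓ v) (PeriodicPotential.resolventOp_eq hγ' hξ a ht)
    beta_reduce at h
    rw [map_add, map_smul, ← PeriodicPotential.resolventOp_blochEvol hγ' hξ ht, mul_add, hKq,
      smul_eq_mul, mul_left_comm, hKq, ← ContinuousLinearMap.intervalIntegral_comp_comm _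
      ((N'.continuous_exp_smul_blochEvol (-c) ξ _ a).intervalIntegrable _ _)] at h
    have f0 : f 0 = ℓ a := by simp only [hf, PeriodicPotential.blochEvol_zero]; rfl
    rw [f0, h]
    simp only [map_smul, smul_eq_mul]
    change Complex.exp (-β * t) * f t = Complex.exp (-β * t) * f t
      + (β - μ) * (∫ s in (0 : ℝ)..t, Complex.exp (-β * s) * f s)
        - (β - μ) * ∫ s in (0 : ℝ)..t, g s
    rw [add_sub_cancel_right]
  -- `G` equals `g` only for t ≥ 0, but it is differentiable on the whole line, also at the end
  -- point 0.
  set G : ℝ → ℂ := fun t => f 0 - (β - μ) * ∫ s in (0 : ℝ)..t, g s with hG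
  have hGd : ∀ t, HasDerivAt G (-(β - μ) * g t) t := fun t => by
    have := ((intervalIntegral.integral_hasDerivAt_right (hgc.intervalIntegrable 0 t)
      hgc.aestronglyMeasurable.stronglyMeasurableAtFilter hgc.continuousAt).const_mul
        (β - μ)).const_sub (f 0)
    exact this.congr_deriv (by ring)
  have hEd : ∀ t : ℝ, HasDerivAt (fun t : ℝ => Complex.exp ((β - μ) * t))
      (Complex.exp ((β - μ) * t) * (β - μ)) t := fun t => by
    have := ((hasDerivAt_id t).ofReal_comp.const_mul (β - μ)).cexp
    simpa using this
  have hHd : ∀ t, 0 ≤ t → HasDerivAt (fun t : ℝ => Complex.exp ((β - μ) * t) * G t) 0 t := by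
    intro t ht
    refine ((hEd t).mul (hGd t)).congr_deriv ?_
    rw [key t ht]
    change _ * G t + _ * (_ * G t) = _
    ring
  have hconst := constant_of_has_deriv_right_zero (a := 0) (b := T)
    (fun t ht => (hHd t ht.1).continuousAt.continuousWithinAt)
    (fun t ht => (hHd t ht.1).hasDerivWithinAt) T ⟨hT, le_rfl⟩
  have e1 : G T = g T := (key T hT).symm
  have e0 : G 0 = f 0 := by simp [hG]
  have f0 : f 0 = pair a q := by simp only [hf, PeriodicPotential.blochEvol_zero]
  rw [e1, e0, f0, Complex.ofReal_zero, mul_zero, Complex.exp_zero, one_mul] at hconst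
  rw [← hconst]
  change f T = _ * (_ * (_ * f T))
  rw [← mul_assoc, ← mul_assoc, ← Complex.exp_add, ← Complex.exp_add,
    show μ * T + (β - μ) * T + -β * T = 0 by ring, Complex.exp_zero, one_mul]

end

/-! ### Perturbation of a simple eigenvalue and duality for compact operators -/

section

section Branch

variable {X : Type*} [NormedAddCommGroup X] [NormedSpace ℂ X]

theorem apply_ringInverse {A : X →L[ℂ] X} (hA : IsUnit A) (v : X) : A (Ring.inverse A v) = v := by
  rw [← mul_apply_eq_comp, Ring.mul_inverse_cancel A hA, one_apply_eq_self]

theorem ringInverse_apply {A : X →L[ℂ] X} (hA : IsUnit A) (v : X) : Ring.inverse A (A v) = v := by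
  rw [← mul_apply_eq_comp, Ring.inverse_mul_cancel A hA, one_apply_eq_self]

theorem isCompactOperator_smulRight (φ : X →L[ℂ] ℂ) (w : X) :
    IsCompactOperator (φ.smulRight w) := by
  have : IsCompactOperator φ :=
    ⟨Metric.closedBall 0 1, isCompact_closedBall _ _,
      φ.continuous.continuousAt.preimage_mem_nhds
        (by rw [map_zero]; exact Metric.closedBall_mem_nhds _ one_pos)⟩
  exact this.clm_comp (ContinuousLinearMap.smulRight (1 : ℂ →L[ℂ] ℂ) w)

variable [CompleteSpace X]

theorem isUnit_one_sub_of_isCompactOperator {T : X →L[ℂ] X} (hT : IsCompactOperator T)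
    (h : ∀ v, T v = v → v = 0) : IsUnit (1 - T) := by
  rcases hT.hasEigenvalue_or_mem_resolventSet (one_ne_zero (α := ℂ)) with h1 | h1
  · obtain ⟨v, hv⟩ := h1.exists_hasEigenvector
    exact absurd (h v (by simpa using hv.apply_eq_smul)) hv.2
  · simpa [spectrum.mem_resolventSet_iff] using h1

theorem analyticAt_ringInverse {E : Type*} [NormedAddCommGroup E] [NormedSpace ℂ E]
    {A : E → X →L[ℂ] X} {p : E} (hA : AnalyticAt ℂ A p) (hu : IsUnit (A p)) :
    AnalyticAt ℂ (fun z => Ring.inverse (A z)) p := by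
  obtain ⟨U, hU⟩ := hu
  exact (analyticAt_inverse (𝕜 := ℂ) (A := X →L[ℂ] X) U).comp_of_eq hA hU.symm

theorem AnalyticAt.eventually_isUnit {E : Type*} [NormedAddCommGroup E] [NormedSpace ℂ E]
    {A : E → X →L[ℂ] X} {p : E} (hA : AnalyticAt ℂ A p) (hu : IsUnit (A p)) :
    ∀ᶠ z in 𝓝 p, IsUnit (A z) :=
  hA.continuousAt.eventually (Units.isOpen.mem_nhds hu)

variable (B : X →L[ℂ] X →L[ℂ] ℂ) {K K' : ℂ → X →L[ℂ] X} {β : ℂ} {w₀ b₀ : X}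

/-- A bordered form of the Lyapunov-Schmidt reduction. The rank one term makes A = 1 - (β - ν)K(ξ) +
⟨b₀, ·⟩w₀ invertible near (0, 0), and Q = A⁻¹w₀ satisfies the eigenvector equation as soon as ⟨b₀,
Q⟩ = 1. This scalar equation `D = 0` is solved for ν = μ(ξ) by the analytic implicit function
theorem. The transposed bordered operator yields left eigenvectors for the same μ. -/
theorem exists_analytic_eigenbranch (hK : AnalyticAt ℂ K 0) (hK' : AnalyticAt ℂ K' 0)
    (hadj : ∀ᶠ ξ in 𝓝 0, ∀ a b, B (K' ξ a) b = B a (K ξ b)) (hβ : β ≠ 0)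
    (hw : β • K 0 w₀ = w₀) (hb : β • K' 0 b₀ = b₀) (h1 : B b₀ w₀ = 1)
    (hu : IsUnit (1 - β • K 0 + (B b₀).smulRight w₀))
    (hu' : IsUnit (1 - β • K' 0 + (B.flip w₀).smulRight b₀)) :
    ∃ (μ : ℂ → ℂ) (q q' : ℂ → X), AnalyticAt ℂ μ 0 ∧ AnalyticAt ℂ q 0 ∧ AnalyticAt ℂ q' 0 ∧
      μ 0 = 0 ∧ q 0 = w₀ ∧ ∀ᶠ ξ in 𝓝 0, q ξ = (β - μ ξ) • K ξ (q ξ) ∧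
        q' ξ = (β - μ ξ) • K' ξ (q' ξ) ∧ B (q' ξ) (q ξ) = 1 := by
  set A : ℂ × ℂ → X →L[ℂ] X := fun p => 1 - (β - p.2) • K p.1 + (B b₀).smulRight w₀ with hA
  set A' : ℂ × ℂ → X →L[ℂ] X := fun p =>
    1 - (β - p.2) • K' p.1 + (B.flip w₀).smulRight b₀ with hA'
  have hs : AnalyticAt ℂ (fun p : ℂ × ℂ => β - p.2) (0, 0) :=
    analyticAt_const.sub analyticAt_snd
  have hAa : AnalyticAt ℂ A (0, 0) :=
    (analyticAt_const.sub (hs.smul (hK.comp_of_eq analyticAt_fst rfl))).add analyticAt_const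
  have hAa' : AnalyticAt ℂ A' (0, 0) :=
    (analyticAt_const.sub (hs.smul (hK'.comp_of_eq analyticAt_fst rfl))).add analyticAt_const
  have hA0 : A (0, 0) = 1 - β • K 0 + (B b₀).smulRight w₀ := by simp [hA]
  have hA0' : A' (0, 0) = 1 - β • K' 0 + (B.flip w₀).smulRight b₀ := by simp [hA']
  rw [← hA0] at hu
  rw [← hA0'] at hu'
  set Q : ℂ × ℂ → X := fun p => Ring.inverse (A p) w₀ with hQ
  set Q' : ℂ × ℂ → X := fun p => Ring.inverse (A' p) b₀ with hQ'
  have hQa : AnalyticAt ℂ Q (0, 0) :=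
    ((ContinuousLinearMap.apply ℂ X w₀).analyticAt _).comp (analyticAt_ringInverse hAa hu)
  have hQa' : AnalyticAt ℂ Q' (0, 0) :=
    ((ContinuousLinearMap.apply ℂ X b₀).analyticAt _).comp (analyticAt_ringInverse hAa' hu')
  set D : ℂ × ℂ → ℂ := fun p => 1 - B b₀ (Q p) with hD
  have hDa : AnalyticAt ℂ D (0, 0) :=
    analyticAt_const.sub (((B b₀).analyticAt _).comp hQa)
  have hw0 : K 0 w₀ = β⁻¹ • w₀ := by
    nth_rw 2 [← hw]
    rw [smul_smul, inv_mul_cancel₀ hβ, one_smul]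
  -- At ξ = 0 the vector w₀ is an eigenvector of A(0, ν) with eigenvalue 1 + ν/β. Hence `D` is
  -- explicit there, and its derivative in ν at 0 is β⁻¹ ≠ 0.
  have hQν : ∀ᶠ ν in 𝓝 (0 : ℂ), D (0, ν) = 1 - (1 + ν * β⁻¹)⁻¹ := by
    have e1 : ∀ᶠ ν in 𝓝 (0 : ℂ), IsUnit (A (0, ν)) :=
      (Continuous.prodMk_right (0 : ℂ)).continuousAt.eventually (hAa.eventually_isUnit hu)
    have e2 : ∀ᶠ ν in 𝓝 (0 : ℂ), 1 + ν * β⁻¹ ≠ 0 :=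
      ContinuousAt.eventually_ne (by fun_prop) (by simp)
    filter_upwards [e1, e2] with ν h3 h4
    have h5 : A (0, ν) w₀ = (1 + ν * β⁻¹) • w₀ := by
      simp only [hA, add_apply, sub_apply, one_apply_eq_self, smul_apply, hw0,
        ContinuousLinearMap.smulRight_apply, h1, smul_smul]
      rw [sub_mul, mul_inv_cancel₀ hβ]
      module
    have h6 : Q (0, ν) = (1 + ν * β⁻¹)⁻¹ • w₀ := by
      have := ringInverse_apply h3 w₀
      rw [h5, map_smul] at this
      rw [← this, smul_smul, inv_mul_cancel₀ h4, one_smul]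
    simp [hD, h6, h1]
  have hD0 : D (0, 0) = 0 := by simpa using hQν.self_of_nhds
  have hder : HasDerivAt (fun ν => D (0, ν)) β⁻¹ 0 := by
    have : HasDerivAt (fun ν : ℂ => 1 - (1 + ν * β⁻¹)⁻¹) β⁻¹ 0 := by
      have h3 := ((((hasDerivAt_id (0 : ℂ)).mul_const β⁻¹).const_add 1).inv (by simp)).const_sub 1
      simpa using h3
    exact this.congr_of_eventuallyEq hQν
  have cdf : ContDiffAt ℂ ⊤ D (0, 0) := hDa.contDiffAt
  have hne : (⊤ : WithTop ℕ∞) ≠ 0 := by simp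
  have hinv : (fderiv ℂ D (0, 0) ∘L .inr ℂ ℂ ℂ).IsInvertible := by
    refine ⟨ContinuousLinearEquiv.unitsEquivAut ℂ (Units.mk0 β⁻¹ (inv_ne_zero hβ)), ?_⟩
    refine ContinuousLinearMap.ext_ring ?_
    have h3 := (hDa.differentiableAt.hasFDerivAt (x := ((0 : ℂ), (0 : ℂ)))).comp_hasDerivAt
      (0 : ℂ) (((hasDerivAt_const (0 : ℂ) (0 : ℂ)).prodMk (hasDerivAt_id (0 : ℂ))))
    simpa using hder.unique h3
  set μ := cdf.implicitFunction hne hinv with hμ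
  have hμ0 : μ 0 = 0 := cdf.implicitFunction_apply_self hne hinv
  have hμa : AnalyticAt ℂ μ 0 := (cdf.contDiffAt_implicitFunction hne hinv).analyticAt
  have hμD : ∀ᶠ ξ in 𝓝 0, D (ξ, μ ξ) = 0 :=
    (cdf.eventually_apply_implicitFunction hne hinv).mono fun ξ h => h.trans hD0
  have hpa : AnalyticAt ℂ (fun ξ => (ξ, μ ξ)) 0 := analyticAt_id.prod hμa
  have hp0 : ((0 : ℂ), μ 0) = (0, 0) := by rw [hμ0]
  have hqa : AnalyticAt ℂ (fun ξ => Q (ξ, μ ξ)) 0 := hQa.comp_of_eq hpa hp0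
  have hqa' : AnalyticAt ℂ (fun ξ => Q' (ξ, μ ξ)) 0 := hQa'.comp_of_eq hpa hp0
  have hpt : Tendsto (fun ξ => (ξ, μ ξ)) (𝓝 0) (𝓝 (0, 0)) := hp0 ▸ hpa.continuousAt.tendsto
  set s : ℂ → ℂ := fun ξ => B (Q' (ξ, μ ξ)) (Q (ξ, μ ξ)) with hs'
  have hsa : AnalyticAt ℂ s 0 := by
    have := (B.analyticAt_bilinear (Q' (0, μ 0), Q (0, μ 0))).comp_of_eq (hqa'.prod hqa) rfl
    exact this
  have hQ0 : Q (0, 0) = w₀ := by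
    have h5 : A (0, 0) w₀ = w₀ := by
      rw [hA0]
      simp only [add_apply, sub_apply, one_apply_eq_self, smul_apply, hw, sub_self,
        ContinuousLinearMap.smulRight_apply, h1, one_smul, zero_add]
    conv_rhs => rw [← ringInverse_apply hu w₀, h5]
  have hQ0' : Q' (0, 0) = b₀ := by
    have h5 : A' (0, 0) b₀ = b₀ := by
      rw [hA0']
      simp only [add_apply, sub_apply, one_apply_eq_self, smul_apply, hb, sub_self,
        ContinuousLinearMap.smulRight_apply, ContinuousLinearMap.flip_apply, h1, one_smul,
        zero_add]
    conv_rhs => rw [← ringInverse_apply hu' b₀, h5]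
  have hs0 : s 0 = 1 := by simp only [hs', hμ0, hQ0, hQ0', h1]
  refine ⟨μ, fun ξ => Q (ξ, μ ξ), fun ξ => (s ξ)⁻¹ • Q' (ξ, μ ξ), hμa, hqa,
    (hsa.inv (by simp [hs0])).smul hqa', hμ0, by simp only [hμ0, hQ0], ?_⟩
  filter_upwards [hμD, hpt.eventually (hAa.eventually_isUnit hu),
    hpt.eventually (hAa'.eventually_isUnit hu'), hadj,
    hsa.continuousAt.eventually_ne (by rw [hs0]; exact one_ne_zero)] with ξ e1 e2 e3 e4 e5
  have f1 : B b₀ (Q (ξ, μ ξ)) = 1 := (sub_eq_zero.mp e1).symm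
  have f2 : A (ξ, μ ξ) (Q (ξ, μ ξ)) = w₀ := apply_ringInverse e2 _
  have f3 : A' (ξ, μ ξ) (Q' (ξ, μ ξ)) = b₀ := apply_ringInverse e3 _
  have f4 : ∀ a b, B (A' (ξ, μ ξ) a) b = B a (A (ξ, μ ξ) b) := fun a b => by
    simp only [hA, hA', add_apply, sub_apply, one_apply_eq_self, smul_apply, map_add, map_sub,
      map_smul, ContinuousLinearMap.smulRight_apply, ContinuousLinearMap.flip_apply, e4,
      smul_eq_mul]
    ring
  -- Transposition carries the solvability condition to the left problem: ⟨Q', w₀⟩ = ⟨Q', AQ⟩ =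
  -- ⟨A'Q', Q⟩ = ⟨b₀, Q⟩ = 1.
  have f5 : B (Q' (ξ, μ ξ)) w₀ = 1 := by
    rw [← f1, ← f3, f4, f2]
  refine ⟨?_, ?_, ?_⟩
  · simp only [hA, add_apply, sub_apply, one_apply_eq_self, smul_apply,
      ContinuousLinearMap.smulRight_apply, f1, one_smul] at f2
    exact sub_eq_zero.mp (by simpa using f2)
  · simp only [hA', add_apply, sub_apply, one_apply_eq_self, smul_apply,
      ContinuousLinearMap.smulRight_apply, ContinuousLinearMap.flip_apply, f5, one_smul] at f3
    have f6 : Q' (ξ, μ ξ) = (β - μ ξ) • K' ξ (Q' (ξ, μ ξ)) := sub_eq_zero.mp (by simpa using f3)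
    rw [map_smul, smul_comm, ← f6]
  · rw [map_smul, smul_apply, smul_eq_mul]
    exact inv_mul_cancel₀ e5

/-- Since 1 - T has no generalized kernel beyond w₀, bordering it with a functional that is nonzero
on w₀ makes it invertible. Writing every vector as an image of the bordered operator shows that a
null vector of 1 - T' orthogonal to w₀ is zero. A nonzero null vector exists by the Fredholm
alternative: the range of 1 - T' pairs to zero with w₀, so 1 - T' is not onto. -/
theorem exists_dual_kernel {T T' : X →L[ℂ] X} (hT : IsCompactOperator T)
    (hT' : IsCompactOperator T') (hadj : ∀ a b, B (T' a) b = B a (T b))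
    (hnd : ∀ a, (∀ b, B a b = 0) → a = 0) (hw : T w₀ = w₀)
    (hker : ∀ v, T v = v → ∃ a : ℂ, v = a • w₀) (hgen : ∀ v (κ : ℂ), v - T v = κ • w₀ → κ = 0)
    {z₀ : X} (hz : B z₀ w₀ ≠ 0) :
    (∀ b, T' b = b → B b w₀ = 0 → b = 0) ∧ ∃ b₀, T' b₀ = b₀ ∧ B b₀ w₀ = 1 ∧
      IsUnit (1 - T + (B b₀).smulRight w₀) ∧ IsUnit (1 - T' + (B.flip w₀).smulRight b₀) := by
  have hunit : ∀ {S : X →L[ℂ] X} (φ : X →L[ℂ] ℂ) (w : X), IsCompactOperator S →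
      (∀ v, v - S v + φ v • w = 0 → v = 0) → IsUnit (1 - S + φ.smulRight w) := by
    intro S φ w hS h
    have hc : IsCompactOperator (S - φ.smulRight w) :=
      hS.sub (isCompactOperator_smulRight φ w)
    have e : 1 - S + φ.smulRight w = 1 - (S - φ.smulRight w) := by abel
    rw [e]
    refine isUnit_one_sub_of_isCompactOperator hc fun v hv => h v ?_
    rw [sub_apply, ContinuousLinearMap.smulRight_apply] at hv
    nth_rw 1 [← hv]
    abel
  have hpair : ∀ {b : X}, T' b = b → ∀ v, B b (v - T v) = 0 := fun hb v => by
    rw [map_sub, ← hadj, hb, sub_self]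
  have hz0 : ∀ b, T' b = b → B b w₀ = 0 → b = 0 := by
    have hu : IsUnit (1 - T + (B z₀).smulRight w₀) := by
      refine hunit _ _ hT fun v hv => ?_
      have h1 : v - T v = (-B z₀ v) • w₀ := by rw [neg_smul]; exact eq_neg_of_add_eq_zero_left hv
      have h2 := hgen v _ h1
      rw [h2, zero_smul, sub_eq_zero] at h1
      obtain ⟨a, rfl⟩ := hker v h1.symm
      rw [neg_eq_zero, map_smul, smul_eq_mul, mul_eq_zero, or_iff_left hz] at h2
      rw [h2, zero_smul]
    intro b hb hb0
    refine hnd b fun v => ?_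
    rw [← apply_ringInverse hu v]
    simp only [add_apply, sub_apply, one_apply_eq_self, ContinuousLinearMap.smulRight_apply]
    rw [map_add, hpair hb, map_smul, hb0, smul_zero, add_zero]
  obtain ⟨b, hb, hbne⟩ : ∃ b, T' b = b ∧ b ≠ 0 := by
    by_contra! h
    have hu := isUnit_one_sub_of_isCompactOperator hT' h
    have h1 := apply_ringInverse hu z₀
    refine hz ?_
    rw [← h1, sub_apply, one_apply_eq_self, map_sub, sub_apply, hadj, hw, sub_self]
  have hbw : B b w₀ ≠ 0 := fun h => hbne (hz0 b hb h)
  set b₀ := (B b w₀)⁻¹ • b with hb₀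
  have hb0 : T' b₀ = b₀ := by rw [hb₀, map_smul, hb]
  have h1 : B b₀ w₀ = 1 := by
    rw [hb₀, map_smul, smul_apply, smul_eq_mul, inv_mul_cancel₀ hbw]
  have hu : IsUnit (1 - T + (B b₀).smulRight w₀) := by
    refine hunit _ _ hT fun v hv => ?_
    have h2 := congrArg (B b₀) hv
    rw [map_add, hpair hb0, map_smul, h1, zero_add, smul_eq_mul, mul_one, map_zero] at h2
    rw [h2, zero_smul, add_zero, sub_eq_zero] at hv
    obtain ⟨a, rfl⟩ := hker v hv.symm
    rw [map_smul, h1, smul_eq_mul, mul_one] at h2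
    rw [h2, zero_smul]
  -- Injectivity of the transposed bordered operator follows from surjectivity of the original one.
  refine ⟨hz0, b₀, hb0, h1, hu, hunit _ _ hT' fun a ha => hnd a fun v => ?_⟩
  rw [← apply_ringInverse hu v]
  set y := Ring.inverse (1 - T + (B b₀).smulRight w₀) v
  have h2 := congrArg (fun b => B b y) ha
  simp only [map_add, map_sub, map_smul, add_apply, sub_apply, smul_apply, hadj, map_zero,
    zero_apply, ContinuousLinearMap.flip_apply, smul_eq_mul] at h2
  simp only [add_apply, sub_apply, one_apply_eq_self, ContinuousLinearMap.smulRight_apply,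
    map_add, map_sub, map_smul, smul_eq_mul]
  rw [← h2]
  ring

end Branch

end

/-! ### The simple eigenvalue zero and its critical branch -/

section

theorem IsCompactOperator.clm_smul {X : Type*} [NormedAddCommGroup X] [NormedSpace ℂ X]
    {T : X →L[ℂ] X} (hT : IsCompactOperator T) (a : ℂ) : IsCompactOperator (a • T) :=
  hT.smul a

section SimpleZero

variable {n : ℕ} {N N' : PeriodicPotential (EuclideanSpace ℂ (Fin n))} {c : ℝ}
  {w₀ : CircleFun (EuclideanSpace ℂ (Fin n))}

/-- `w₀` spans the generalized kernel of `∂² + c ∂ + N`. -/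
structure IsSimpleKernel (N : PeriodicPotential (EuclideanSpace ℂ (Fin n))) (c : ℝ)
    (w₀ : CircleFun (EuclideanSpace ℂ (Fin n))) : Prop where
  ne_zero : w₀ ≠ 0
  solution : N.IsBlochSolution c 0 w₀ 0
  eq_smul : ∀ v, N.IsBlochSolution c 0 v 0 → ∃ a : ℂ, v = a • w₀
  eq_zero : ∀ v (κ : ℂ), N.IsBlochSolution c 0 v (κ • w₀) → κ = 0

theorem IsSimpleKernel.exists_dual (h : IsSimpleKernel N c w₀) (hN : IsTranspose N N') {γ : ℝ}
    (hγ : 6 * |c| + 32 + N.bound < γ) (hγ' : 6 * |c| + 32 + N'.bound < γ) :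
    (∀ b, N'.IsBlochSolution (-c) 0 b 0 → pair b w₀ = 0 → b = 0) ∧
    ((γ : ℂ) ^ 2) • N.resolventOp γ c 0 w₀ = w₀ ∧
    ∃ b₀, ((γ : ℂ) ^ 2) • N'.resolventOp γ (-c) 0 b₀ = b₀ ∧ pair b₀ w₀ = 1 ∧
      IsUnit (1 - ((γ : ℂ) ^ 2) • N.resolventOp γ c 0 + (pair b₀).smulRight w₀) ∧
      IsUnit (1 - ((γ : ℂ) ^ 2) • N'.resolventOp γ (-c) 0 + (pair.flip w₀).smulRight b₀) := by
  have hγ0 : 0 < γ := by linarith [abs_nonneg c, N.bound_nonneg]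
  have hγ'' : 6 * |-c| + 32 + N'.bound < γ := by rwa [abs_neg]
  have hβ : ((γ : ℂ) ^ 2) ≠ 0 := by
    have : (γ : ℂ) ≠ 0 := by exact_mod_cast hγ0.ne'
    positivity
  have h4 : ‖(0 : ℂ)‖ ≤ 4 := by simp
  have hker : ∀ v, N.IsBlochSolution c 0 v 0 ↔ ((γ : ℂ) ^ 2 • N.resolventOp γ c 0) v = v := by
    intro v
    have := PeriodicPotential.isBlochSolution_smul_iff (N := N) hγ h4 v 0
    rw [zero_smul, sub_zero] at this
    rw [this, smul_apply, eq_comm]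
  have hker' : ∀ v, N'.IsBlochSolution (-c) 0 v 0 ↔
      ((γ : ℂ) ^ 2 • N'.resolventOp γ (-c) 0) v = v := by
    intro v
    have := PeriodicPotential.isBlochSolution_smul_iff (N := N') hγ'' h4 v 0
    rw [zero_smul, sub_zero] at this
    rw [this, smul_apply, eq_comm]
  have hw := (hker w₀).mp h.solution
  obtain ⟨h1, b₀, h2, h3, h4, h5⟩ := exists_dual_kernel (pair (n := n))
    (T := (γ : ℂ) ^ 2 • N.resolventOp γ c 0) (T' := (γ : ℂ) ^ 2 • N'.resolventOp γ (-c) 0)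
    (w₀ := w₀) (z₀ := w₀.conj) ((N.isCompactOperator_resolventOp hγ0 c 0).clm_smul _)
    ((N'.isCompactOperator_resolventOp hγ0 (-c) 0).clm_smul _)
    (fun a b => by
      have := pair_resolventOp hN hγ hγ' h4 a b
      rw [neg_zero] at this
      simp only [smul_apply, map_smul, this])
    (fun a ha => eq_zero_of_pair_conj (ha a.conj)) hw (fun v hv => h.eq_smul v ((hker v).mpr hv))
    (fun v κ hv => by
      -- With T = γ² times the resolvent, v - Tv = κw₀ says that v solves the differential equation
      -- with right-hand side -κγ²w₀. So a Jordan chain of T would be one of the operator.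
      have e : N.IsBlochSolution c 0 v (-(κ * (γ : ℂ) ^ 2) • w₀) := by
        rw [N.isBlochSolution_iff hγ h4]
        have e1 : (γ ^ 2 • v - -(κ * (γ : ℂ) ^ 2) • w₀ : CircleFun (EuclideanSpace ℂ (Fin n)))
            = ((γ : ℂ) ^ 2) • v + κ • ((γ : ℂ) ^ 2) • w₀ := by
          rw [← Complex.coe_smul]
          push_cast
          module
        rw [e1, map_add, map_smul, map_smul, map_smul, ← smul_apply, ← smul_apply, hw, ← hv]
        abel
      have := h.eq_zero v _ e
      rw [neg_eq_zero, mul_eq_zero] at this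
      exact this.resolve_right hβ)
    (fun h0 => h.ne_zero (eq_zero_of_pair_conj (by rw [pair_comm, h0])))
  exact ⟨fun b hb => h1 b ((hker' b).mp hb), hw, b₀, h2, h3, h4, h5⟩

theorem IsSimpleKernel.eq_zero_of_pair (h : IsSimpleKernel N c w₀) (hN : IsTranspose N N')
    {b : CircleFun (EuclideanSpace ℂ (Fin n))} (hb : N'.IsBlochSolution (-c) 0 b 0)
    (hb0 : pair b w₀ = 0) : b = 0 :=
  (h.exists_dual hN (γ := 6 * |c| + 33 + N.bound + N'.bound) (by linarith [N'.bound_nonneg])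
    (by linarith [N.bound_nonneg])).1 b hb hb0

/-- The branch is built for complex ξ near 0 and restricted to real ξ. The bound ε₀ ≤ 1 keeps its
frequencies inside [-π, π], where the spectral assumptions apply, and makes ξ² ≤ 1 available in the
estimates. -/
theorem IsSimpleKernel.exists_branch (h : IsSimpleKernel N c w₀) (hN : IsTranspose N N') :
    ∃ ε₀ : ℝ, 0 < ε₀ ∧ ε₀ ≤ 1 ∧ ∃ (μ : ℝ → ℂ) (q q' : ℝ → CircleFun (EuclideanSpace ℂ (Fin n))),
      AnalyticOnNhd ℝ μ (Set.Ioo (-ε₀) ε₀) ∧ AnalyticOnNhd ℝ q (Set.Ioo (-ε₀) ε₀) ∧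
      AnalyticOnNhd ℝ q' (Set.Ioo (-ε₀) ε₀) ∧ μ 0 = 0 ∧ q 0 = w₀ ∧ ∀ ξ ∈ Set.Ioo (-ε₀) ε₀,
        N.IsBlochSolution c ξ (q ξ) (μ ξ • q ξ) ∧
        N'.IsBlochSolution (-c) (-ξ : ℝ) (q' ξ) (μ ξ • q' ξ) ∧ pair (q' ξ) (q ξ) = 1 := by
  set γ := 6 * |c| + 33 + N.bound + N'.bound with hγd
  have hγ : 6 * |c| + 32 + N.bound < γ := by linarith [N'.bound_nonneg]
  have hγ' : 6 * |c| + 32 + N'.bound < γ := by linarith [N.bound_nonneg]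
  have hγ'' : 6 * |-c| + 32 + N'.bound < γ := by rwa [abs_neg]
  have hγ0 : 0 < γ := by linarith [abs_nonneg c, N.bound_nonneg]
  have hβ : ((γ : ℂ) ^ 2) ≠ 0 := by
    have : (γ : ℂ) ≠ 0 := by exact_mod_cast hγ0.ne'
    positivity
  have h4 : ‖(0 : ℂ)‖ ≤ 4 := by simp
  obtain ⟨-, hw, b₀, h2, h3, h5, h6⟩ := h.exists_dual hN hγ hγ'
  have hsmall : ∀ᶠ ξ : ℂ in 𝓝 0, ‖ξ‖ ≤ 4 := by
    filter_upwards [Metric.ball_mem_nhds (0 : ℂ) (by norm_num : (0 : ℝ) < 4)] with ξ hξ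
    exact (mem_ball_zero_iff.mp hξ).le
  obtain ⟨μ, q, q', a1, a2, a3, m0, q0, hev⟩ := exists_analytic_eigenbranch (pair (n := n))
    (K := N.resolventOp γ c) (K' := fun ξ => N'.resolventOp γ (-c) (-ξ)) (β := (γ : ℂ) ^ 2)
    (N.analyticAt_resolventOp hγ h4)
    ((N'.analyticAt_resolventOp (c := -c) (ξ := 0) hγ'' h4).comp_of_eq analyticAt_id.neg
      (by simp)) (hsmall.mono fun ξ hξ a b => pair_resolventOp hN hγ hγ' hξ a b) hβ hw
    (by simpa using h2) h3 h5 (by simpa using h6)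
  obtain ⟨r, hr, hball⟩ := Metric.eventually_nhds_iff_ball.mp
    (((hev.and hsmall).and a1.eventually_analyticAt).and
      (a2.eventually_analyticAt.and a3.eventually_analyticAt))
  have hmem : ∀ ξ ∈ Set.Ioo (-min r 1) (min r 1), (ξ : ℂ) ∈ Metric.ball (0 : ℂ) r := fun ξ hξ => by
    rw [mem_ball_zero_iff, Complex.norm_real]
    exact (abs_lt.mpr hξ).trans_le (min_le_left _ _)
  have hana : ∀ {E : Type _} [NormedAddCommGroup E] [NormedSpace ℂ E] {g : ℂ → E} {ξ : ℝ},
      AnalyticAt ℂ g ξ → AnalyticAt ℝ (fun ξ : ℝ => g ξ) ξ := fun hg =>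
    (hg.restrictScalars (𝕜 := ℝ)).comp (Complex.ofRealCLM.analyticAt _)
  refine ⟨min r 1, lt_min hr one_pos, min_le_right _ _, fun ξ => μ ξ, fun ξ => q ξ,
    fun ξ => q' ξ, fun ξ hξ => hana (hball _ (hmem ξ hξ)).1.2,
    fun ξ hξ => hana (hball _ (hmem ξ hξ)).2.1, fun ξ hξ => hana (hball _ (hmem ξ hξ)).2.2,
    by simpa using m0, by simpa using q0, fun ξ hξ => ?_⟩
  obtain ⟨⟨⟨⟨e1, e2, e3⟩, e4⟩, -⟩, -⟩ := hball _ (hmem ξ hξ)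
  refine ⟨(PeriodicPotential.isBlochSolution_smul_iff hγ e4 _ _).mpr e1,
    (PeriodicPotential.isBlochSolution_smul_iff hγ'' ?_ _ _).mpr ?_, e3⟩
  · rwa [Complex.ofReal_neg, norm_neg]
  · rw [Complex.ofReal_neg]
    exact e2

end SimpleZero

/-! ### The derivative of the profile spans the kernel -/

section Profile

variable {n : ℕ}

/-- Complexification of vectors as a linear map. -/
def complexifyCLM : EuclideanSpace ℝ (Fin n) →L[ℝ] EuclideanSpace ℂ (Fin n) :=
  LinearMap.toContinuousLinearMap
    { toFun := complexify
      map_add' := fun v w => by ext i; simp [complexify]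
      map_smul' := fun a v => by ext i; simp [complexify] }

theorem complexify_eq_zero {v : EuclideanSpace ℝ (Fin n)} (h : complexify v = 0) : v = 0 := by
  ext i
  have := congrArg (fun w : EuclideanSpace ℂ (Fin n) => w i) h
  simpa [complexify] using this

variable {f : EuclideanSpace ℝ (Fin n) → EuclideanSpace ℝ (Fin n)} {c : ℝ}
  {u : ℝ → EuclideanSpace ℝ (Fin n)}

theorem realMatrixAct_profileJacobian (x : ℝ) (v : EuclideanSpace ℝ (Fin n)) :
    realMatrixAct (profileJacobian f u x) (complexify v) = complexify (fderiv ℝ f (u x) v) := by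
  ext i
  rw [realMatrixAct_apply]
  have hv : v = ∑ j, v j • EuclideanSpace.single j (1 : ℝ) := by
    ext k
    simp [Finset.sum_apply, Pi.single_apply]
  conv_rhs => rw [hv, map_sum]
  simp only [map_smul, complexify, profileJacobian, Matrix.of_apply]
  simp [mul_comm]

namespace IsPeriodicProfile

theorem continuous_profileJacobian (hu : IsPeriodicProfile f c u) (hf : ContDiff ℝ 1 f) :
    Continuous (profileJacobian f u) := by
  refine continuous_matrix fun i j => ?_
  have h1 : Continuous fun x => fderiv ℝ f (u x) :=
    (hf.continuous_fderiv (by norm_num)).comp hu.contDiff.continuous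
  exact (EuclideanSpace.proj (𝕜 := ℝ) i).continuous.comp (h1.clm_apply continuous_const)

theorem periodic_profileJacobian (hu : IsPeriodicProfile f c u) :
    Function.Periodic (profileJacobian f u) 1 := fun x => by
  unfold profileJacobian
  rw [hu.periodic x]

theorem periodic_deriv {E : Type*} [NormedAddCommGroup E] [NormedSpace ℝ E] {v : ℝ → E}
    (hv : Function.Periodic v 1) : Function.Periodic (deriv v) 1 := fun x => by
  rw [← deriv_comp_add_const, funext hv]

theorem hasDerivAt_deriv (hu : IsPeriodicProfile f c u) (x : ℝ) :
    HasDerivAt (deriv u) (deriv (deriv u) x) x :=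
  ((contDiff_succ_iff_deriv (n := 1)).mp hu.contDiff).2.2.differentiable (by norm_num)
    |>.differentiableAt.hasDerivAt

/-- The profile equation expresses u'' through u and u', which provides a third derivative beyond
the assumed two. -/
theorem hasDerivAt_deriv_deriv (hu : IsPeriodicProfile f c u) (hf : ContDiff ℝ 1 f) (x : ℝ) :
    HasDerivAt (deriv (deriv u)) (-(c • deriv (deriv u) x + fderiv ℝ f (u x) (deriv u x))) x := by
  have e : deriv (deriv u) = fun x => -(c • deriv u x + f (u x)) := funext fun x => by
    rw [← sub_eq_zero, sub_neg_eq_add, ← add_assoc]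
    exact hu.profile_eq x
  have h1 : HasDerivAt u (deriv u x) x :=
    (hu.contDiff.differentiable (by norm_num)).differentiableAt.hasDerivAt
  have h2 := ((hf.differentiable (by norm_num)).differentiableAt.hasFDerivAt
    (x := u x)).comp_hasDerivAt x h1
  have h3 := (((hu.hasDerivAt_deriv x).const_smul c).add h2).neg
  refine h3.congr_of_eventuallyEq (Eventually.of_forall fun y => ?_)
  exact congrFun e y

/-- The derivative of the profile. -/
def derivCircle (hu : IsPeriodicProfile f c u) : CircleFun (EuclideanSpace ℂ (Fin n)) :=
  CircleFun.mk (fun x => complexify (deriv u x))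
    (complexifyCLM.continuous.comp (hu.contDiff.continuous_deriv (by norm_num)))
    fun x => by simp only [periodic_deriv hu.periodic x]

theorem derivCircle_apply (hu : IsPeriodicProfile f c u) (x : ℝ) :
    hu.derivCircle x = complexify (deriv u x) := rfl

theorem derivCircle_ne_zero (hu : IsPeriodicProfile f c u) : hu.derivCircle ≠ 0 := by
  intro h
  obtain ⟨x, y, hxy⟩ := hu.nonconstant
  refine hxy (is_const_of_deriv_eq_zero (hu.contDiff.differentiable (by norm_num)) (fun z => ?_)
    x y)
  refine complexify_eq_zero ?_
  rw [← hu.derivCircle_apply, h]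
  rfl

/-- Translation invariance: differentiating the profile equation puts u' into the kernel of the
linearization. -/
theorem isBlochSolution_derivCircle (hu : IsPeriodicProfile f c u) (hf : ContDiff ℝ 1 f) :
    (matrixPotential _ (hu.continuous_profileJacobian hf)
      hu.periodic_profileJacobian).IsBlochSolution c 0 hu.derivCircle 0 := by
  have hd : ∀ {v : ℝ → EuclideanSpace ℝ (Fin n)} {v' : EuclideanSpace ℝ (Fin n)} {x : ℝ},
      HasDerivAt v v' x → HasDerivAt (fun x => complexify (v x)) (complexify v') x :=
    fun hv => complexifyCLM.hasFDerivAt.comp_hasDerivAt _ hv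
  have hc2 : Continuous (deriv (deriv u)) :=
    continuous_iff_continuousAt.mpr fun x => (hu.hasDerivAt_deriv_deriv hf x).continuousAt
  have hc1 : Continuous (deriv u) := hu.contDiff.continuous_deriv (by norm_num)
  have hp1 := periodic_deriv hu.periodic
  have hp2 := periodic_deriv hp1
  set V₁ : CircleFun (EuclideanSpace ℂ (Fin n)) :=
    CircleFun.mk (fun x => complexify (deriv (deriv u) x)) (complexifyCLM.continuous.comp hc2)
      fun x => by simp only [hp2 x] with hV₁
  set V₂ : CircleFun (EuclideanSpace ℂ (Fin n)) := CircleFun.mk (fun x => complexify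
      (-(c • deriv (deriv u) x + fderiv ℝ f (u x) (deriv u x))))
    (complexifyCLM.continuous.comp (((hc2.const_smul c).add
      (((hf.continuous_fderiv (by norm_num)).comp hu.contDiff.continuous).clm_apply hc1)).neg))
    (fun x => by simp only [hp2 x, hp1 x, hu.periodic x]) with hV₂
  refine ⟨V₁, V₂, fun x => hd (hu.hasDerivAt_deriv x), fun x =>
    hd (hu.hasDerivAt_deriv_deriv hf x), CircleFun.ext fun x => ?_⟩
  simp only [CircleFun.add_apply, CircleFun.smul_apply, PeriodicPotential.mulOp_apply,
    CircleFun.zero_apply]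
  change complexifyCLM (-(c • deriv (deriv u) x + fderiv ℝ f (u x) (deriv u x)))
    + _ • complexifyCLM (deriv (deriv u) x) + _ • _
    + realMatrixAct (profileJacobian f u x) (complexify (deriv u x)) = 0
  rw [realMatrixAct_profileJacobian]
  change _ + _ + _ + complexifyCLM _ = 0
  rw [map_neg, map_add, map_smul, ← Complex.coe_smul c]
  module

/-- The simple eigenvalue assumption provides some spanning eigenfunction. As a nonzero element of
the kernel, u' is a nonzero multiple of it and can take its place. -/
theorem isSimpleKernel (hu : IsPeriodicProfile f c u) (hf : ContDiff ℝ 1 f)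
    (hD1 : IsSimpleBlochEigenvalue (profileJacobian f u) c 0 0) :
    IsSimpleKernel (matrixPotential _ (hu.continuous_profileJacobian hf)
      hu.periodic_profileJacobian) c hu.derivCircle := by
  set hM := hu.continuous_profileJacobian hf
  set hper := hu.periodic_profileJacobian
  obtain ⟨w, -, hw, hspan, hgen⟩ := hD1
  have hiff : ∀ V h : CircleFun (EuclideanSpace ℂ (Fin n)), BlochMaps _ c 0 V h ↔
      (matrixPotential _ hM hper).IsBlochSolution c 0 V h := fun V h => by
    rw [blochMaps_iff hM hper, Complex.ofReal_zero]
  have hz : ∀ v : ℝ → EuclideanSpace ℂ (Fin n), (fun x => (0 : ℂ) • v x)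
      = (0 : CircleFun (EuclideanSpace ℂ (Fin n))) := fun v => funext fun x => zero_smul _ _
  obtain ⟨W, rfl⟩ := BlochMaps.exists_circleFun hw
  have hspan' : ∀ v : CircleFun (EuclideanSpace ℂ (Fin n)),
      (matrixPotential _ hM hper).IsBlochSolution c 0 v 0 → ∃ a : ℂ, v = a • W := fun v hv => by
    obtain ⟨a, ha⟩ := hspan v (by rw [hz]; exact (hiff v 0).mpr hv)
    exact ⟨a, CircleFun.ext fun x => congrFun ha x⟩
  obtain ⟨a, ha⟩ := hspan' _ (hu.isBlochSolution_derivCircle hf)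
  have ha0 : a ≠ 0 := by
    rintro rfl
    exact hu.derivCircle_ne_zero (by rw [ha, zero_smul])
  refine ⟨hu.derivCircle_ne_zero, hu.isBlochSolution_derivCircle hf, fun v hv => ?_,
    fun v κ hv => ?_⟩
  · obtain ⟨b, rfl⟩ := hspan' v hv
    exact ⟨b * a⁻¹, by rw [ha, smul_smul, mul_assoc, inv_mul_cancel₀ ha0, mul_one]⟩
  · by_contra hκ
    have hk : κ * a ≠ 0 := mul_ne_zero hκ ha0
    rw [ha, smul_smul] at hv
    obtain ⟨V₁, V₂, h1, h2, h3⟩ := hv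
    refine hgen ((κ * a)⁻¹ • v : CircleFun (EuclideanSpace ℂ (Fin n))) ?_
    have e : (fun x => (0 : ℂ) • ((κ * a)⁻¹ • v : CircleFun (EuclideanSpace ℂ (Fin n))) x + W x)
        = W := funext fun x => by rw [zero_smul, zero_add]
    rw [e, hiff]
    refine ⟨(κ * a)⁻¹ • V₁, (κ * a)⁻¹ • V₂, fun x => (h1 x).const_smul _,
      fun x => (h2 x).const_smul _, ?_⟩
    have h4 := congrArg (fun w => (κ * a)⁻¹ • w) h3
    simp only [smul_smul, inv_mul_cancel₀ hk, one_smul] at h4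
    rw [← h4, map_smul]
    module

end IsPeriodicProfile

end Profile

end

/-! ### Decay of the powers of compact operators -/

section

section PowerDecay

variable {X : Type*} [NormedAddCommGroup X] [NormedSpace ℂ X]

/-- Operators commuting with a compact operator have eigenvectors in its eigenspaces. -/
theorem exists_common_eigenvector {U K : X →L[ℂ] X} {φ : X →L[ℂ] ℂ} (hU : IsCompactOperator U)
    (hUK : ∀ a, U (K a) = K (U a)) (hφ : ∀ a, φ a = 0 → φ (K a) = 0) {l : ℂ} (hl : l ≠ 0)
    {a₀ : X} (ha₀ : a₀ ≠ 0) (h₀ : U a₀ = l • a₀) (hφ₀ : φ a₀ = 0) :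
    ∃ (a : X) (κ : ℂ), a ≠ 0 ∧ U a = l • a ∧ φ a = 0 ∧ K a = κ • a := by
  let V : Submodule ℂ X := LinearMap.ker ((U - l • (1 : X →L[ℂ] X) : X →L[ℂ] X) : X →ₗ[ℂ] X)
    ⊓ LinearMap.ker (φ : X →ₗ[ℂ] ℂ)
  have hV : ∀ a, a ∈ V ↔ U a = l • a ∧ φ a = 0 := fun a => by
    simp only [V, Submodule.mem_inf, LinearMap.mem_ker, ContinuousLinearMap.coe_coe, sub_apply,
      smul_apply, one_apply_eq_self, sub_eq_zero]
  have hclosed : IsClosed (V : Set X) := by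
    have : (V : Set X) = {a | U a = l • a} ∩ {a | φ a = 0} := by
      ext a
      exact hV a
    rw [this]
    exact (isClosed_eq U.continuous (continuous_const_smul l)).inter
      (isClosed_eq φ.continuous continuous_const)
  -- On `V` the operator U is multiplication by l, so the identity of `V` is l⁻¹U, which is compact.
  have hfin : FiniteDimensional ℂ V := by
    have h1 : IsCompactOperator ((U : X →ₗ[ℂ] X).restrict (p := V) (q := V) fun a ha => by
        have h := ((hV a).mp ha).1
        change U a ∈ V
        rw [h]
        exact V.smul_mem _ ha) := IsCompactOperator.restrict hU _ hclosed
    have h2 := h1.smul l⁻¹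
    refine FiniteDimensional.of_isCompactOperator_id (𝕜 := ℂ) (E := V) ?_
    refine (congrArg IsCompactOperator (funext fun a => Subtype.ext ?_)).mp h2
    change l⁻¹ • U a = (a : X)
    rw [((hV a).mp a.2).1, smul_smul, inv_mul_cancel₀ hl, one_smul]
  have hnt : Nontrivial V := ⟨⟨⟨a₀, (hV a₀).mpr ⟨h₀, hφ₀⟩⟩, 0, fun h => ha₀ (congrArg Subtype.val h)⟩⟩
  have hKV : ∀ a ∈ V, (K : X →ₗ[ℂ] X) a ∈ V := fun a ha => by
    obtain ⟨h1, h2⟩ := (hV a).mp ha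
    refine (hV _).mpr ⟨?_, hφ a h2⟩
    change U (K a) = l • K a
    rw [hUK, h1, map_smul]
  obtain ⟨κ, hκ⟩ := Module.End.exists_eigenvalue ((K : X →ₗ[ℂ] X).restrict hKV)
  obtain ⟨v, hv⟩ := hκ.exists_hasEigenvector
  obtain ⟨h1, h2⟩ := (hV v).mp v.2
  exact ⟨v, κ, fun h => hv.2 (Subtype.ext h), h1, h2, congrArg Subtype.val hv.apply_eq_smul⟩

variable [CompleteSpace X]

/-- Nonzero spectral values of a compact operator are eigenvalues, so the compact spectrum lies
inside the open unit disc. Gelfand's formula then gives a contractive power. The zero space, whose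
spectrum is empty, is treated apart. -/
theorem exists_norm_pow_lt_one {T : X →L[ℂ] X} (hT : IsCompactOperator T)
    (h : ∀ (l : ℂ) a, 1 ≤ ‖l‖ → T a = l • a → a = 0) : ∃ k : ℕ, 0 < k ∧ ‖T ^ k‖ < 1 := by
  rcases subsingleton_or_nontrivial X with hX | hX
  · refine ⟨1, one_pos, ?_⟩
    have : T ^ 1 = 0 := ContinuousLinearMap.ext fun v => Subsingleton.elim _ _
    rw [this, norm_zero]
    exact one_pos
  have hr : spectralRadius ℂ T < (1 : NNReal) := by
    refine spectrum.spectralRadius_lt_of_forall_lt_of_nonempty (spectrum.nonempty T) fun l hl => ?_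
    by_contra! h1
    have hl1 : 1 ≤ ‖l‖ := by exact_mod_cast h1
    have hl0 : l ≠ 0 := norm_pos_iff.mp (by linarith)
    obtain ⟨v, hv⟩ := ((hT.hasEigenvalue_iff_mem_spectrum hl0).mpr hl).exists_hasEigenvector
    exact hv.2 (h l v hl1 hv.apply_eq_smul)
  have ht := (spectrum.pow_nnnorm_pow_one_div_tendsto_nhds_spectralRadius T).eventually
    (gt_mem_nhds hr)
  obtain ⟨k, hk, hk0⟩ := (ht.and (eventually_gt_atTop 0)).exists
  refine ⟨k, hk0, ?_⟩
  have hk' : (0 : ℝ) < 1 / k := by positivity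
  by_contra! h1
  refine absurd hk (not_lt.mpr ?_)
  rw [ENNReal.coe_one]
  refine ENNReal.one_le_rpow ?_ hk'
  exact_mod_cast h1

/-- By norm continuity a contractive power at ξ₀ stays contractive nearby, and division of the
exponent by that power gives local exponential decay. Compactness of `S` makes the constants
uniform. -/
theorem exists_norm_pow_le {S : Set ℝ} (hS : IsCompact S) {T : ℝ → X →L[ℂ] X}
    (hTc : ContinuousOn T S) (hT : ∀ ξ ∈ S, IsCompactOperator (T ξ))
    (h : ∀ ξ ∈ S, ∀ (l : ℂ) a, 1 ≤ ‖l‖ → T ξ a = l • a → a = 0) :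
    ∃ C η : ℝ, 0 < η ∧ ∀ ξ ∈ S, ∀ j : ℕ, ‖T ξ ^ j‖ ≤ C * Real.exp (-η * j) := by
  obtain ⟨M, hM⟩ := hS.exists_bound_of_continuousOn hTc
  refine hS.induction_on (p := fun s => ∃ C η : ℝ, 0 < η ∧ ∀ ξ ∈ s, ∀ j : ℕ,
    ‖T ξ ^ j‖ ≤ C * Real.exp (-η * j)) ⟨0, 1, one_pos, fun ξ hξ => hξ.elim⟩ ?_ ?_ ?_
  · rintro s t hst ⟨C, η, h0, h1⟩
    exact ⟨C, η, h0, fun ξ hξ => h1 ξ (hst hξ)⟩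
  · rintro s t ⟨C, η, h0, h1⟩ ⟨C', η', h0', h1'⟩
    refine ⟨max C C', min η η', lt_min h0 h0', ?_⟩
    have aux : ∀ {C₁ η₁ : ℝ} (j : ℕ), C₁ ≤ max C C' → min η η' ≤ η₁ → 0 ≤ max C C' →
        C₁ * Real.exp (-η₁ * j) ≤ max C C' * Real.exp (-min η η' * j) := fun j hC hη h0 => by
      refine mul_le_mul hC (Real.exp_le_exp.mpr ?_) (Real.exp_pos _).le h0
      nlinarith [(Nat.cast_nonneg j : (0 : ℝ) ≤ j)]
    have hpos : ∀ {C₁ η₁ : ℝ} {ξ : ℝ}, (∀ j : ℕ, ‖T ξ ^ j‖ ≤ C₁ * Real.exp (-η₁ * j)) → 0 ≤ C₁ :=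
      fun hj => by simpa using (norm_nonneg _).trans (hj 0)
    rintro ξ (hξ | hξ) j
    · exact (h1 ξ hξ j).trans (aux j (le_max_left _ _) (min_le_left _ _)
        ((hpos (h1 ξ hξ)).trans (le_max_left _ _)))
    · exact (h1' ξ hξ j).trans (aux j (le_max_right _ _) (min_le_right _ _)
        ((hpos (h1' ξ hξ)).trans (le_max_right _ _)))
  · intro ξ₀ hξ₀
    obtain ⟨k, hk0, hk⟩ := exists_norm_pow_lt_one (hT ξ₀ hξ₀) (h ξ₀ hξ₀)
    obtain ⟨r, hr1, hr2⟩ := exists_between hk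
    have hr0 : 0 < r := (norm_nonneg _).trans_lt hr1
    have hev : ∀ᶠ ξ in 𝓝[S] ξ₀, ‖T ξ ^ k‖ < r :=
      (((hTc ξ₀ hξ₀).pow k).norm).eventually (gt_mem_nhds hr1)
    -- In the constant, r⁻¹ pays for the rounding of j/k and (max 1 M)^k for the fewer than k
    -- factors left over. The rate is that of r^{j/k}.
    refine ⟨{ξ | ‖T ξ ^ k‖ < r} ∩ S, inter_mem hev self_mem_nhdsWithin,
      (max 1 M) ^ k * r⁻¹, -Real.log r / k, ?_, ?_⟩
    · have := Real.log_neg hr0 hr2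
      have : (0 : ℝ) < k := by exact_mod_cast hk0
      exact div_pos (by linarith) this
    · rintro ξ ⟨hξ, hξS⟩ j
      have hk' : (0 : ℝ) < k := by exact_mod_cast hk0
      have hpw : ∀ {x : X →L[ℂ] X} {b : ℝ}, ‖x‖ ≤ b → ∀ m : ℕ, ‖x ^ m‖ ≤ b ^ m := by
        intro x b hb m
        induction m with
        | zero =>
          rw [pow_zero, pow_zero]
          exact ContinuousLinearMap.norm_id_le
        | succ m ih =>
          rw [pow_succ, pow_succ]
          exact (norm_mul_le (x ^ m) x).trans (mul_le_mul ih hb (norm_nonneg _)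
            ((norm_nonneg _).trans ih))
      have e : T ξ ^ j = (T ξ ^ k) ^ (j / k) * T ξ ^ (j % k) := by
        rw [← pow_mul, ← pow_add, Nat.div_add_mod]
      have h1 := hpw (le_of_lt hξ) (j / k)
      have h2 : ‖T ξ ^ (j % k)‖ ≤ (max 1 M) ^ k :=
        (hpw ((hM ξ hξS).trans (le_max_right 1 M)) _).trans
          (pow_le_pow_right₀ (le_max_left _ _) (Nat.mod_lt _ hk0).le)
      have h3 : r ^ (j / k) ≤ r⁻¹ * Real.exp (-(-Real.log r / k) * j) := by
        have e1 : r ^ (j / k) = Real.exp ((j / k : ℕ) * Real.log r) := by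
          rw [mul_comm, Real.exp_mul, Real.exp_log hr0, Real.rpow_natCast]
        have e2 : r⁻¹ = Real.exp (-Real.log r) := by rw [Real.exp_neg, Real.exp_log hr0]
        rw [e1, e2, ← Real.exp_add]
        refine Real.exp_le_exp.mpr ?_
        have hlt : (j : ℝ) / k < (j / k : ℕ) + 1 := by
          rw [div_lt_iff₀ hk']
          have := Nat.lt_div_mul_add (a := j) hk0
          exact_mod_cast (by linarith : j < (j / k + 1) * k)
        have hlog := Real.log_neg hr0 hr2
        have e3 : -(-Real.log r / k) * j = Real.log r * ((j : ℝ) / k) := by ring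
        rw [e3]
        nlinarith
      rw [e]
      refine (norm_mul_le _ _).trans ((mul_le_mul h1 h2 (norm_nonneg _)
        (pow_nonneg hr0.le _)).trans ((mul_le_mul_of_nonneg_right h3 (by positivity)).trans
        (le_of_eq (by ring))))

end PowerDecay

end

/-! ### Exponential decay of the Bloch evolutions off the critical branch -/

section

theorem IsCompactOperator.clm_sub {X : Type*} [NormedAddCommGroup X] [NormedSpace ℂ X]
    {S T : X →L[ℂ] X} (hS : IsCompactOperator S) (hT : IsCompactOperator T) :
    IsCompactOperator (S - T) :=
  hS.sub hT

theorem ContinuousOn.sub_smul_clm {X : Type*} [NormedAddCommGroup X] [NormedSpace ℂ X] {S : Set ℝ}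
    {U R : ℝ → X →L[ℂ] X} {a : ℝ → ℂ} (hU : ContinuousOn U S) (ha : ContinuousOn a S)
    (hR : ContinuousOn R S) : ContinuousOn (fun ξ => U ξ - a ξ • R ξ) S :=
  hU.sub (ha.smul hR)

theorem ContinuousOn.smulRight_clm {X : Type*} [NormedAddCommGroup X] [NormedSpace ℂ X] {S : Set ℝ}
    {φ : ℝ → X →L[ℂ] ℂ} {w : ℝ → X} (hφ : ContinuousOn φ S) (hw : ContinuousOn w S) :
    ContinuousOn (fun ξ => (φ ξ).smulRight (w ξ)) S :=
  (ContinuousLinearMap.smulRightL ℂ X X).continuous₂.comp_continuousOn (hφ.prodMk hw)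

section SpectralBranch

variable {n : ℕ} {N N' : PeriodicPotential (EuclideanSpace ℂ (Fin n))} {c : ℝ}
  {w₀ : CircleFun (EuclideanSpace ℂ (Fin n))} {ε₀ : ℝ} {μ : ℝ → ℂ}
  {q q' : ℝ → CircleFun (EuclideanSpace ℂ (Fin n))} {θ : ℝ}

/-- An analytic branch of eigenvalues with right and left eigenfunctions. -/
structure IsSpectralBranch (N N' : PeriodicPotential (EuclideanSpace ℂ (Fin n))) (c : ℝ)
    (w₀ : CircleFun (EuclideanSpace ℂ (Fin n))) (ε₀ : ℝ) (μ : ℝ → ℂ)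
    (q q' : ℝ → CircleFun (EuclideanSpace ℂ (Fin n))) : Prop where
  mu_analytic : AnalyticOnNhd ℝ μ (Set.Ioo (-ε₀) ε₀)
  right_analytic : AnalyticOnNhd ℝ q (Set.Ioo (-ε₀) ε₀)
  left_analytic : AnalyticOnNhd ℝ q' (Set.Ioo (-ε₀) ε₀)
  mu_zero : μ 0 = 0
  right_zero : q 0 = w₀
  right_solution : ∀ ξ ∈ Set.Ioo (-ε₀) ε₀, N.IsBlochSolution c ξ (q ξ) (μ ξ • q ξ)
  left_solution : ∀ ξ ∈ Set.Ioo (-ε₀) ε₀,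
    N'.IsBlochSolution (-c) (-ξ : ℝ) (q' ξ) (μ ξ • q' ξ)
  pair_eq_one : ∀ ξ ∈ Set.Ioo (-ε₀) ε₀, pair (q' ξ) (q ξ) = 1

/-- Diffusive spectral stability of the adjoint Bloch operators. -/
structure IsDiffusivelyStable (N' : PeriodicPotential (EuclideanSpace ℂ (Fin n))) (c θ : ℝ) :
    Prop where
  pos : 0 < θ
  re_le : ∀ ξ : ℝ, |ξ| ≤ Real.pi → ∀ W (ν : ℂ), W ≠ 0 →
    N'.IsBlochSolution (-c) (-ξ : ℝ) W (ν • W) → ν.re ≤ -θ * ξ ^ 2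
  re_neg : ∀ W (ν : ℂ), W ≠ 0 → N'.IsBlochSolution (-c) 0 W (ν • W) → ν ≠ 0 → ν.re < 0

/-- The rank one projection `a ↦ ⟨a, q⟩ q'`. -/
def rankOne (q q' : CircleFun (EuclideanSpace ℂ (Fin n))) :
    CircleFun (EuclideanSpace ℂ (Fin n)) →L[ℂ] CircleFun (EuclideanSpace ℂ (Fin n)) :=
  (pair.flip q).smulRight q'

theorem rankOne_apply (q q' a : CircleFun (EuclideanSpace ℂ (Fin n))) :
    rankOne q q' a = pair a q • q' := rfl

theorem continuousOn_rankOne {S : Set ℝ} (hq : ContinuousOn q S) (hq' : ContinuousOn q' S) :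
    ContinuousOn (fun ξ => rankOne (q ξ) (q' ξ)) S :=
  ContinuousOn.smulRight_clm ((pair (n := n)).flip.continuous.comp_continuousOn hq) hq'

/-- A spectral mapping argument. An eigenvector of the time-one evolution with |l| ≥ 1 can be
chosen, by `exists_common_eigenvector`, as an eigenvector of the resolvent too. It then belongs to
an eigenvalue ν of the Bloch operator with e^ν = l, so Re ν ≥ 0. The diffusive bound forces ξ = 0,
then ν = 0, and `h0` excludes what is left. The functional `φ` confines the argument to a complement
of the critical mode. -/
theorem IsDiffusivelyStable.eq_zero_of_blochEvol (hS : IsDiffusivelyStable N' c θ) {ξ : ℝ}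
    (hξ : |ξ| ≤ Real.pi) {φ : CircleFun (EuclideanSpace ℂ (Fin n)) →L[ℂ] ℂ}
    (hφ : ∀ γ : ℝ, 6 * |c| + 32 + N.bound + N'.bound < γ → ∀ a, φ a = 0 →
      φ (N'.resolventOp γ (-c) (-ξ : ℝ) a) = 0)
    (h0 : ξ = 0 → ∀ a, N'.IsBlochSolution (-c) 0 a 0 → φ a = 0 → a = 0)
    {l : ℂ} (hl : 1 ≤ ‖l‖) {a : CircleFun (EuclideanSpace ℂ (Fin n))}
    (ha : N'.blochEvol (-c) ξ 1 a = l • a) (hφa : φ a = 0) : a = 0 := by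
  by_contra hne
  set γ := 6 * |c| + 33 + N.bound + N'.bound with hγd
  have hγ : 6 * |-c| + 32 + N'.bound < γ := by rw [abs_neg]; linarith [N.bound_nonneg]
  have hξ4 : |ξ| ≤ 4 := hξ.trans Real.pi_le_four
  have hl0 : l ≠ 0 := norm_pos_iff.mp (by linarith)
  obtain ⟨b, κ, hb, h1, h2, h3⟩ := exists_common_eigenvector (φ := φ)
    (N'.isCompactOperator_blochEvol (-c) ξ one_pos)
    (fun a => (PeriodicPotential.resolventOp_blochEvol hγ hξ4 zero_le_one a).symm)
    (hφ γ (by linarith)) hl0 hne ha hφa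
  have hξ' : ‖((-ξ : ℝ) : ℂ)‖ ≤ 4 := by rwa [Complex.norm_real, Real.norm_eq_abs, abs_neg]
  have hκ : κ ≠ 0 := by
    rintro rfl
    rw [zero_smul] at h3
    exact hb (PeriodicPotential.resolventOp_injective hγ hξ' h3)
  set ν : ℂ := (γ : ℂ) ^ 2 - κ⁻¹ with hν
  have hsol : N'.IsBlochSolution (-c) (-ξ : ℝ) b (ν • b) := by
    rw [PeriodicPotential.isBlochSolution_smul_iff hγ hξ', h3, hν, sub_sub_cancel, smul_smul,
      inv_mul_cancel₀ hκ, one_smul]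
  have hexp := PeriodicPotential.blochEvol_eq_exp_smul hsol zero_le_one
  rw [h1, Complex.ofReal_one, mul_one] at hexp
  have hle : l = Complex.exp ν := by
    have h := sub_eq_zero.mpr hexp
    rw [← sub_smul, smul_eq_zero, or_iff_left hb, sub_eq_zero] at h
    exact h
  have hre : 0 ≤ ν.re := by
    rwa [hle, Complex.norm_exp, Real.one_le_exp_iff] at hl
  have h4 := hS.re_le ξ hξ b ν hb hsol
  have hξ0 : ξ = 0 := by
    by_contra hne
    have : 0 < θ * ξ ^ 2 := mul_pos hS.pos (by positivity)
    linarith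
  rw [hξ0, neg_zero, Complex.ofReal_zero] at hsol
  have hν0 : ν = 0 := by
    by_contra hne
    exact absurd (hS.re_neg b ν hb hsol hne) (not_lt.mpr hre)
  rw [hν0, zero_smul] at hsol
  exact hb (h0 hξ0 b hsol h2)

namespace IsSpectralBranch

theorem re_le (hb : IsSpectralBranch N N' c w₀ ε₀ μ q q') (hS : IsDiffusivelyStable N' c θ)
    (hε₀ : ε₀ ≤ 1) {ξ : ℝ} (hξ : ξ ∈ Set.Ioo (-ε₀) ε₀) : (μ ξ).re ≤ -θ * ξ ^ 2 := by
  refine hS.re_le ξ ?_ (q' ξ) _ (fun h => ?_) (hb.left_solution ξ hξ)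
  · linarith [abs_lt.mpr hξ, Real.pi_gt_three]
  · have := hb.pair_eq_one ξ hξ
    rw [h, map_zero, zero_apply] at this
    exact zero_ne_one this

theorem pair_resolventOp_eq_zero (hb : IsSpectralBranch N N' c w₀ ε₀ μ q q')
    (hN : IsTranspose N N') (hε₀ : ε₀ ≤ 1) {ξ : ℝ} (hξ : ξ ∈ Set.Ioo (-ε₀) ε₀) {γ : ℝ}
    (hγ : 6 * |c| + 32 + N.bound + N'.bound < γ) {a : CircleFun (EuclideanSpace ℂ (Fin n))}
    (ha : pair a (q ξ) = 0) : pair (N'.resolventOp γ (-c) (-ξ : ℝ) a) (q ξ) = 0 := by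
  have hξ4 : ‖(ξ : ℂ)‖ ≤ 4 := by
    rw [Complex.norm_real]
    have := abs_lt.mpr hξ
    rw [Real.norm_eq_abs]
    linarith
  have hγ1 : 6 * |c| + 32 + N.bound < γ := by linarith [N'.bound_nonneg]
  have h1 := pair_resolventOp hN hγ1 (by linarith [N.bound_nonneg]) hξ4 a (q ξ)
  rw [← Complex.ofReal_neg] at h1
  have h2 := (PeriodicPotential.isBlochSolution_smul_iff hγ1 hξ4 _ _).mp (hb.right_solution ξ hξ)
  rw [h1]
  rw [h2, map_smul, smul_eq_mul, mul_eq_zero] at ha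
  refine ha.resolve_left fun h0 => ?_
  rw [h0, zero_smul] at h2
  have := hb.pair_eq_one ξ hξ
  rw [h2, map_zero] at this
  exact zero_ne_one this

/-- Subtracting e^μ times the rank one projection removes the critical eigenvalue. The difference
`A` agrees with the time-one evolution on the complement ⟨·, q⟩ = 0 and maps everything into it, so
its eigenvectors for nonzero eigenvalues lie there. -/
theorem exists_norm_blochEvol_le (hb : IsSpectralBranch N N' c w₀ ε₀ μ q q')
    (hN : IsTranspose N N') (hk : IsSimpleKernel N c w₀) (hS : IsDiffusivelyStable N' c θ)
    (hε₀ : ε₀ ≤ 1) {δ : ℝ} (hδ : δ < ε₀) :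
    ∃ C η : ℝ, 0 < η ∧ ∀ ξ : ℝ, |ξ| ≤ δ → ∀ (j : ℕ) a, pair a (q ξ) = 0 →
      ‖N'.blochEvol (-c) ξ j a‖ ≤ C * Real.exp (-η * j) * ‖a‖ := by
  have hmem : ∀ {ξ : ℝ}, ξ ∈ Set.Icc (-δ) δ → ξ ∈ Set.Ioo (-ε₀) ε₀ := fun h =>
    ⟨by linarith [h.1], by linarith [h.2]⟩
  have hsub : Set.Icc (-δ) δ ⊆ Set.Ioo (-ε₀) ε₀ := fun _ => hmem
  set A : ℝ → CircleFun (EuclideanSpace ℂ (Fin n)) →L[ℂ] CircleFun (EuclideanSpace ℂ (Fin n)) :=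
    fun ξ => N'.blochEvol (-c) ξ 1 - Complex.exp (μ ξ) • rankOne (q ξ) (q' ξ) with hA
  have hAp : ∀ ξ ∈ Set.Icc (-δ) δ, ∀ a, pair (A ξ a) (q ξ) = 0 := fun ξ hξ a => by
    have h1 := pair_blochEvol hN (by linarith [abs_lt.mpr (hmem hξ)])
      (hb.right_solution ξ (hmem hξ)) a zero_le_one
    rw [Complex.ofReal_one, mul_one] at h1
    simp only [hA, sub_apply, smul_apply, rankOne_apply, map_sub, map_smul,
      hb.pair_eq_one ξ (hmem hξ), h1, smul_eq_mul, mul_one, sub_self]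
  have hAeq : ∀ (ξ : ℝ) (a), pair a (q ξ) = 0 → A ξ a = N'.blochEvol (-c) ξ 1 a :=
    fun ξ a ha => by
      simp only [hA, sub_apply, smul_apply, rankOne_apply, ha, zero_smul, smul_zero, sub_zero]
  have hcont : ContinuousOn A (Set.Icc (-δ) δ) := by
    have c1 : ContinuousOn μ (Set.Icc (-δ) δ) := hb.mu_analytic.continuousOn.mono hsub
    have c2 : ContinuousOn q (Set.Icc (-δ) δ) := hb.right_analytic.continuousOn.mono hsub
    have c3 : ContinuousOn q' (Set.Icc (-δ) δ) := hb.left_analytic.continuousOn.mono hsub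
    exact (N'.continuous_blochEvol (-c) zero_le_one).continuousOn.sub_smul_clm
      (Complex.continuous_exp.comp_continuousOn c1) (continuousOn_rankOne c2 c3)
  have hcomp : ∀ ξ ∈ Set.Icc (-δ) δ, IsCompactOperator (A ξ) := by
    intro ξ hξ
    exact (N'.isCompactOperator_blochEvol (-c) ξ one_pos).clm_sub
      ((isCompactOperator_smulRight _ _).clm_smul _)
  have heig : ∀ ξ ∈ Set.Icc (-δ) δ, ∀ (l : ℂ) a, 1 ≤ ‖l‖ → A ξ a = l • a → a = 0 := by
    intro ξ hξ l a hl ha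
    have hl0 : l ≠ 0 := norm_pos_iff.mp (by linarith)
    have hpa : pair a (q ξ) = 0 := by
      have := hAp ξ hξ a
      rw [ha, map_smul, smul_apply, smul_eq_mul, mul_eq_zero] at this
      exact this.resolve_left hl0
    rw [hAeq ξ a hpa] at ha
    have hfl : ∀ a, pair.flip (q ξ) a = pair a (q ξ) := fun a =>
      ContinuousLinearMap.flip_apply _ _ _
    refine hS.eq_zero_of_blochEvol (N := N) (φ := pair.flip (q ξ)) ?_ (fun γ hγ a h => ?_) ?_ hl
      ha ((hfl a).trans hpa)
    · linarith [abs_lt.mpr (hmem hξ), Real.pi_gt_three]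
    · rw [hfl] at h ⊢
      exact hb.pair_resolventOp_eq_zero hN hε₀ (hmem hξ) hγ h
    · rintro rfl a h1 h2
      rw [hfl] at h2
      refine hk.eq_zero_of_pair hN h1 ?_
      rw [← hb.right_zero]
      exact h2
  obtain ⟨C, η, hη, hC⟩ := exists_norm_pow_le (S := Set.Icc (-δ) δ) isCompact_Icc (T := A) hcont
    hcomp heig
  refine ⟨C, η, hη, fun ξ hξ j a ha => ?_⟩
  have hξ' := abs_le.mp hξ
  have e : ∀ j : ℕ, (A ξ ^ j) a = N'.blochEvol (-c) ξ j a ∧ pair ((A ξ ^ j) a) (q ξ) = 0 := by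
    intro j
    induction j with
    | zero =>
      rw [Nat.cast_zero, PeriodicPotential.blochEvol_zero, pow_zero]
      exact ⟨rfl, ha⟩
    | succ j ih =>
      rw [pow_succ', mul_apply_eq_comp]
      refine ⟨?_, hAp ξ hξ' _⟩
      rw [hAeq ξ _ ih.2, ih.1, N'.blochEvol_blochEvol _ zero_le_one (Nat.cast_nonneg j),
        Nat.cast_succ, add_comm]
  rw [← (e j).1]
  exact (ContinuousLinearMap.le_opNorm _ _).trans
    (mul_le_mul_of_nonneg_right (hC ξ hξ' j) (norm_nonneg _))

end IsSpectralBranch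

theorem IsDiffusivelyStable.exists_norm_blochEvol_le (hS : IsDiffusivelyStable N' c θ) {δ : ℝ}
    (hδ : 0 < δ) : ∃ C η : ℝ, 0 < η ∧ ∀ ξ : ℝ, δ ≤ |ξ| → |ξ| ≤ Real.pi → ∀ (j : ℕ) a,
      ‖N'.blochEvol (-c) ξ j a‖ ≤ C * Real.exp (-η * j) * ‖a‖ := by
  have hcomp : IsCompact {ξ : ℝ | δ ≤ |ξ| ∧ |ξ| ≤ Real.pi} := by
    refine (isCompact_Icc (a := -Real.pi) (b := Real.pi)).of_isClosed_subset
      ((isClosed_le continuous_const continuous_abs).inter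
        (isClosed_le continuous_abs continuous_const)) fun ξ hξ => abs_le.mp hξ.2
  obtain ⟨C, η, hη, hC⟩ := exists_norm_pow_le hcomp (T := fun ξ => N'.blochEvol (-c) ξ 1)
    (N'.continuous_blochEvol (-c) zero_le_one).continuousOn
    (fun ξ _ => N'.isCompactOperator_blochEvol (-c) ξ one_pos)
    (fun ξ hξ l a hl ha => hS.eq_zero_of_blochEvol (N := N') (φ := 0) hξ.2
      (fun _ _ _ _ => rfl) (fun h0 => by
        have := hξ.1
        rw [h0, abs_zero] at this
        linarith) hl ha rfl)
  refine ⟨C, η, hη, fun ξ h1 h2 j a => ?_⟩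
  rw [N'.blochEvol_natCast_pow]
  exact (ContinuousLinearMap.le_opNorm _ _).trans
    (mul_le_mul_of_nonneg_right (hC ξ ⟨h1, h2⟩ j) (norm_nonneg _))

/-- From integer to real times: the fractional part of t costs e^{bound}, and rounding t down in the
exponential costs e^η. -/
theorem norm_blochEvol_le_of_nat {ξ C η : ℝ} {a : CircleFun (EuclideanSpace ℂ (Fin n))}
    (hη : 0 < η) (h : ∀ j : ℕ, ‖N'.blochEvol c ξ j a‖ ≤ C * Real.exp (-η * j) * ‖a‖) {t : ℝ}
    (ht : 0 ≤ t) :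
    ‖N'.blochEvol c ξ t a‖ ≤ Real.exp N'.bound * Real.exp η * |C| * Real.exp (-η * t) * ‖a‖ := by
  have h1 := Nat.floor_le ht
  have h2 := Nat.lt_floor_add_one t
  have hs : 0 ≤ t - ⌊t⌋₊ := by linarith
  have e : N'.blochEvol c ξ t a = N'.blochEvol c ξ (t - ⌊t⌋₊) (N'.blochEvol c ξ ⌊t⌋₊ a) := by
    rw [N'.blochEvol_blochEvol c hs (Nat.cast_nonneg _), sub_add_cancel]
  rw [e]
  refine (ContinuousLinearMap.le_opNorm _ _).trans ?_
  have h3 : ‖N'.blochEvol c ξ (t - ⌊t⌋₊)‖ ≤ Real.exp N'.bound := by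
    refine (N'.norm_blochEvol_le c ξ _).trans (Real.exp_le_exp.mpr ?_)
    rw [abs_of_nonneg hs]
    nlinarith [N'.bound_nonneg]
  have h4 : C * Real.exp (-η * ⌊t⌋₊) ≤ |C| * (Real.exp η * Real.exp (-η * t)) := by
    refine mul_le_mul (le_abs_self C) ?_ (Real.exp_pos _).le (abs_nonneg _)
    rw [← Real.exp_add]
    refine Real.exp_le_exp.mpr ?_
    nlinarith
  refine (mul_le_mul h3 ((h _).trans (mul_le_mul_of_nonneg_right h4 (norm_nonneg _)))
    (norm_nonneg _) (Real.exp_pos _).le).trans (le_of_eq ?_)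
  ring

/-- Exponential decay of the Bloch evolutions away from the critical branch. -/
theorem IsSpectralBranch.exists_norm_remainder_le (hb : IsSpectralBranch N N' c w₀ ε₀ μ q q')
    (hN : IsTranspose N N') (hk : IsSimpleKernel N c w₀) (hS : IsDiffusivelyStable N' c θ)
    (hε₀ : ε₀ ≤ 1) {ε : ℝ} (hε : 0 < ε) (hε' : 2 * ε < ε₀) {φ : ℝ → ℝ} {Cφ : ℝ}
    (hφ1 : ∀ ξ, |ξ| ≤ ε → φ ξ = 1) (hφ0 : ∀ ξ, 2 * ε ≤ |ξ| → φ ξ = 0) (hφb : ∀ ξ, |φ ξ| ≤ Cφ) :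
    ∃ C η : ℝ, 0 < η ∧ ∀ ξ : ℝ, |ξ| ≤ Real.pi → ∀ (t : ℝ), 0 ≤ t → ∀ a,
      ‖N'.blochEvol (-c) ξ t a - (φ ξ * Complex.exp (μ ξ * t) * pair a (q ξ)) • q' ξ‖
        ≤ C * Real.exp (-η * t) * ‖a‖ := by
  obtain ⟨C₁, η₁, hη₁, hC₁⟩ := hb.exists_norm_blochEvol_le hN hk hS hε₀ hε'
  obtain ⟨C₂, η₂, hη₂, hC₂⟩ := hS.exists_norm_blochEvol_le hε
  have hsub : Set.Icc (-(2 * ε)) (2 * ε) ⊆ Set.Ioo (-ε₀) ε₀ := fun ξ h =>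
    ⟨by linarith [h.1], by linarith [h.2]⟩
  obtain ⟨M, hM⟩ := isCompact_Icc.exists_bound_of_continuousOn (continuousOn_rankOne
    (hb.right_analytic.continuousOn.mono hsub) (hb.left_analytic.continuousOn.mono hsub))
  have hCφ : 0 ≤ Cφ := (abs_nonneg _).trans (hφb 0)
  have hM0 : 0 ≤ M := (norm_nonneg _).trans (hM 0 ⟨by linarith, by linarith⟩)
  set D₁ := Real.exp N'.bound * Real.exp η₁ * |C₁| * (1 + M) with hD₁
  set D₂ := Real.exp N'.bound * Real.exp η₂ * |C₂| with hD₂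
  have hθ := hS.pos
  have hη₃ : 0 < θ * ε ^ 2 := by positivity
  have hexp : ∀ {η : ℝ} {t : ℝ}, 0 ≤ t → min η₁ (min η₂ (θ * ε ^ 2)) ≤ η →
      Real.exp (-η * t) ≤ Real.exp (-min η₁ (min η₂ (θ * ε ^ 2)) * t) := fun ht h =>
    Real.exp_le_exp.mpr (by nlinarith)
  refine ⟨D₁ + D₂ + Cφ * M, min η₁ (min η₂ (θ * ε ^ 2)), by positivity, fun ξ hξ t ht a => ?_⟩
  have hD₁0 : 0 ≤ D₁ := by positivity
  have hD₂0 : 0 ≤ D₂ := by positivity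
  have hE := (Real.exp_pos (-min η₁ (min η₂ (θ * ε ^ 2)) * t)).le
  have hfar : ε ≤ |ξ| → ‖N'.blochEvol (-c) ξ t a‖
      ≤ D₂ * Real.exp (-min η₁ (min η₂ (θ * ε ^ 2)) * t) * ‖a‖ := fun h =>
    (norm_blochEvol_le_of_nat hη₂ (fun j => hC₂ ξ h hξ j a) ht).trans
      (mul_le_mul_of_nonneg_right (mul_le_mul_of_nonneg_left
        (hexp ht ((min_le_right _ _).trans (min_le_left _ _))) hD₂0) (norm_nonneg _))
  have hfin : ∀ {D : ℝ} {v : CircleFun (EuclideanSpace ℂ (Fin n))}, D ≤ D₁ + D₂ + Cφ * M →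
      ‖v‖ ≤ D * Real.exp (-min η₁ (min η₂ (θ * ε ^ 2)) * t) * ‖a‖ →
      ‖v‖ ≤ (D₁ + D₂ + Cφ * M) * Real.exp (-min η₁ (min η₂ (θ * ε ^ 2)) * t) * ‖a‖ :=
    fun hD hv => hv.trans (mul_le_mul_of_nonneg_right (mul_le_mul_of_nonneg_right hD hE)
      (norm_nonneg _))
  have hCM : 0 ≤ Cφ * M := by positivity
  rcases le_total (2 * ε) |ξ| with h2 | h2
  · rw [hφ0 ξ h2, Complex.ofReal_zero, zero_mul, zero_mul, zero_smul, sub_zero]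
    exact hfin (by linarith) (hfar (by linarith))
  have hI : ξ ∈ Set.Icc (-(2 * ε)) (2 * ε) := abs_le.mp h2
  have hξ₀ := hsub hI
  have hP : ‖pair a (q ξ) • q' ξ‖ ≤ M * ‖a‖ := by
    rw [← rankOne_apply]
    exact (ContinuousLinearMap.le_opNorm _ _).trans
      (mul_le_mul_of_nonneg_right (hM ξ hI) (norm_nonneg _))
  rcases le_total |ξ| ε with h1 | h1
  · rw [hφ1 ξ h1, Complex.ofReal_one, one_mul]
    -- The left eigenfunction evolves by e^{μt}, so the difference is the evolution of the component
    -- of `a` in the complement.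
    have e : N'.blochEvol (-c) ξ t a - (Complex.exp (μ ξ * t) * pair a (q ξ)) • q' ξ
        = N'.blochEvol (-c) ξ t (a - pair a (q ξ) • q' ξ) := by
      rw [map_sub, map_smul, PeriodicPotential.blochEvol_eq_exp_smul (hb.left_solution ξ hξ₀) ht,
        smul_smul, mul_comm (pair a (q ξ))]
    rw [e]
    have h0 : pair (a - pair a (q ξ) • q' ξ) (q ξ) = 0 := by
      rw [map_sub, map_smul, sub_apply, smul_apply, hb.pair_eq_one ξ hξ₀, smul_eq_mul, mul_one,
        sub_self]
    have h3 := norm_blochEvol_le_of_nat hη₁ (fun j => hC₁ ξ h2 j _ h0) ht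
    refine hfin (D := D₁) (by linarith) (h3.trans ?_)
    have h4 : ‖a - pair a (q ξ) • q' ξ‖ ≤ (1 + M) * ‖a‖ :=
      (norm_sub_le _ _).trans (by linarith)
    have h5 := hexp ht (min_le_left η₁ (min η₂ (θ * ε ^ 2)))
    calc _ ≤ Real.exp N'.bound * Real.exp η₁ * |C₁|
          * Real.exp (-min η₁ (min η₂ (θ * ε ^ 2)) * t) * ((1 + M) * ‖a‖) := by gcongr
      _ = _ := by rw [hD₁]; ring
  -- In the transition zone ε ≤ |ξ| ≤ 2ε no cancellation is used: the evolution decays there, and so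
  -- does e^{μt}, because Re μ ≤ -θε².
  · refine hfin (D := D₂ + Cφ * M) (by linarith) ((norm_sub_le _ _).trans ?_)
    have h3 := hfar h1
    have h4 : ‖(φ ξ * Complex.exp (μ ξ * t) * pair a (q ξ)) • q' ξ‖
        ≤ Cφ * Real.exp (-min η₁ (min η₂ (θ * ε ^ 2)) * t) * (M * ‖a‖) := by
      rw [mul_smul, norm_smul, norm_mul, Complex.norm_real, Complex.norm_exp, Real.norm_eq_abs]
      refine mul_le_mul (mul_le_mul (hφb ξ) ?_ (Real.exp_pos _).le hCφ) hP (norm_nonneg _)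
        (by positivity)
      refine (Real.exp_le_exp.mpr ?_).trans (hexp ht ((min_le_right _ _).trans (min_le_right _ _)))
      rw [Complex.re_mul_ofReal]
      refine mul_le_mul_of_nonneg_right ((hb.re_le hS hε₀ hξ₀).trans ?_) ht
      have : ε ^ 2 ≤ ξ ^ 2 := by rw [← sq_abs ξ]; gcongr
      nlinarith
    linarith

end SpectralBranch

end

/-! ### Regularity of functions and integrals depending on a parameter -/

section

section ParametricRegularity

variable {E : Type*} [NormedAddCommGroup E] [NormedSpace ℝ E]

theorem hasDerivAt_intervalIntegral_param {F F' : ℝ → ℝ → E} (hF : Continuous (Function.uncurry F))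
    (hF' : Continuous (Function.uncurry F')) (hd : ∀ ξ y, HasDerivAt (F ξ) (F' ξ y) y)
    (a b y : ℝ) :
    HasDerivAt (fun y => ∫ ξ in a..b, F ξ y) (∫ ξ in a..b, F' ξ y) y := by
  obtain ⟨C, hC⟩ := ((isCompact_uIcc (a := a) (b := b)).prod
    (isCompact_closedBall y 1)).exists_bound_of_continuousOn hF'.continuousOn
  have hs : ∀ y, Continuous fun ξ => F ξ y := fun y => hF.comp (Continuous.prodMk_left y)
  refine (intervalIntegral.hasDerivAt_integral_of_dominated_loc_of_deriv_le (bound := fun _ => C)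
    (F := fun y ξ => F ξ y) (F' := fun y ξ => F' ξ y)
    (Metric.closedBall_mem_nhds y one_pos)
    (Eventually.of_forall fun y => (hs y).aestronglyMeasurable)
    ((hs y).intervalIntegrable _ _)
    (hF'.comp (Continuous.prodMk_left y)).aestronglyMeasurable ?_
    (intervalIntegrable_const) ?_).2
  · exact Eventually.of_forall fun ξ hξ z hz => hC (ξ, z) ⟨Set.uIoc_subset_uIcc hξ, hz⟩
  · exact Eventually.of_forall fun ξ _ z _ => hd ξ z

theorem continuous_intervalIntegral_param {X : Type*} [TopologicalSpace X]
    [FirstCountableTopology X] [LocallyCompactSpace X]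
    {F : ℝ → X → E} (hF : Continuous (Function.uncurry F)) (a b : ℝ) :
    Continuous fun y => ∫ ξ in a..b, F ξ y :=
  intervalIntegral.continuous_parametric_intervalIntegral_of_continuous'
    (f := fun x ξ => F ξ x) (hF.comp continuous_swap) a b

theorem iteratedDeriv_eq_of_hasDerivAt {f : ℕ → ℝ → E} {R : ℕ}
    (h : ∀ r < R, ∀ y, HasDerivAt (f r) (f (r + 1) y) y) {r : ℕ} (hr : r ≤ R) :
    iteratedDeriv r (f 0) = f r := by
  induction r with
  | zero => exact iteratedDeriv_zero
  | succ r ih =>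
    rw [iteratedDeriv_succ, ih (by omega)]
    exact funext fun y => (h r (by omega) y).deriv

theorem contDiff_of_hasDerivAt {R : ℕ} : ∀ {f : ℕ → ℝ → E},
    (∀ r < R, ∀ y, HasDerivAt (f r) (f (r + 1) y) y) → Continuous (f R) →
    ContDiff ℝ R (f 0) := by
  induction R with
  | zero => exact fun _ hc => contDiff_zero.mpr hc
  | succ R ih =>
    intro f h hc
    have hd : deriv (f 0) = f 1 := funext fun y => (h 0 (by omega) y).deriv
    rw [Nat.cast_succ]
    refine contDiff_succ_iff_deriv.mpr ⟨fun y => (h 0 (by omega) y).differentiableAt, by simp, ?_⟩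
    rw [hd]
    exact ih (f := fun r => f (r + 1)) (fun r hr => h (r + 1) (by omega)) hc

/-- `v(ξ, y)` has `r` derivatives in `y` that are jointly continuous. -/
def JointlyContDiff : ℕ → (ℝ → ℝ → E) → Prop
  | 0, v => Continuous (Function.uncurry v)
  | r + 1, v => Continuous (Function.uncurry v) ∧
      ∃ v', (∀ ξ y, HasDerivAt (v ξ) (v' ξ y) y) ∧ JointlyContDiff r v'

namespace JointlyContDiff

variable {v w : ℝ → ℝ → E} {r : ℕ}

theorem continuous (h : JointlyContDiff r v) : Continuous (Function.uncurry v) := by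
  cases r with
  | zero => exact h
  | succ r => exact h.1

theorem of_succ : ∀ {r : ℕ} {v : ℝ → ℝ → E}, JointlyContDiff (r + 1) v → JointlyContDiff r v
  | 0, _, h => h.1
  | _ + 1, _, ⟨hc, v', hd, h⟩ => ⟨hc, v', hd, of_succ h⟩

theorem add : ∀ {r : ℕ} {v w : ℝ → ℝ → E}, JointlyContDiff r v → JointlyContDiff r w →
    JointlyContDiff r (fun ξ y => v ξ y + w ξ y)
  | 0, _, _, h, g => Continuous.add h g
  | _ + 1, _, _, ⟨hc, _, hd, h⟩, ⟨gc, _, gd, g⟩ =>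
    ⟨Continuous.add hc gc, _, fun ξ y => (hd ξ y).add (gd ξ y), add h g⟩

theorem bilin {E₁ E₂ : Type*} [NormedAddCommGroup E₁] [NormedSpace ℝ E₁] [NormedAddCommGroup E₂]
    [NormedSpace ℝ E₂] (B : E₁ →L[ℝ] E₂ →L[ℝ] E) : ∀ {r : ℕ} {a : ℝ → ℝ → E₁} {b : ℝ → ℝ → E₂},
    JointlyContDiff r a → JointlyContDiff r b → JointlyContDiff r (fun ξ y => B (a ξ y) (b ξ y))
  | 0, _, _, h, g => B.continuous₂.comp (Continuous.prodMk h g)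
  | r + 1, a, b, ⟨hc, a', hd, h⟩, ⟨gc, b', gd, g⟩ => by
    have h' : JointlyContDiff (r + 1) a := ⟨hc, a', hd, h⟩
    have g' : JointlyContDiff (r + 1) b := ⟨gc, b', gd, g⟩
    exact ⟨B.continuous₂.comp (Continuous.prodMk hc gc), _,
      fun ξ y => B.hasDerivAt_of_bilinear (fun _ => hd ξ y) (fun _ => gd ξ y),
      add (bilin B h'.of_succ g) (bilin B h g'.of_succ)⟩

theorem of_contDiff : ∀ {r : ℕ} {g : ℝ → E}, ContDiff ℝ r g → JointlyContDiff r (fun _ => g)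
  | 0, _, h => h.continuous.comp continuous_snd
  | r + 1, g, h => by
    rw [Nat.cast_succ] at h
    obtain ⟨h1, -, h2⟩ := contDiff_succ_iff_deriv.mp h
    exact ⟨h.continuous.comp continuous_snd, fun _ => deriv g, fun _ y => (h1 y).hasDerivAt,
      of_contDiff h2⟩

theorem of_continuous {g : ℝ → E} (hg : Continuous g) :
    ∀ r : ℕ, JointlyContDiff r (fun ξ _ => g ξ)
  | 0 => hg.comp continuous_fst
  | r + 1 => ⟨hg.comp continuous_fst, fun _ _ => 0, fun _ _ => hasDerivAt_const _ _,
      of_continuous (g := fun _ => 0) continuous_const r⟩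

theorem iteratedDeriv : ∀ {r : ℕ} {v : ℝ → ℝ → E}, JointlyContDiff r v →
    ∀ s ≤ r, Continuous (Function.uncurry fun ξ y => iteratedDeriv s (v ξ) y) ∧
      (s < r → ∀ ξ y, HasDerivAt (_root_.iteratedDeriv s (v ξ))
        (_root_.iteratedDeriv (s + 1) (v ξ) y) y)
  | 0, v, h, s, hs => by
    obtain rfl : s = 0 := by omega
    simp only [iteratedDeriv_zero]
    exact ⟨h, fun h => absurd h (lt_irrefl 0)⟩
  | r + 1, v, ⟨hc, v', hd, h⟩, s, hs => by
    have e : ∀ ξ s, _root_.iteratedDeriv (s + 1) (v ξ) = _root_.iteratedDeriv s (v' ξ) :=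
      fun ξ s => by rw [iteratedDeriv_succ', funext fun y => (hd ξ y).deriv]
    cases s with
    | zero =>
      simp only [iteratedDeriv_zero, e]
      exact ⟨hc, fun _ => hd⟩
    | succ s =>
      have := iteratedDeriv h s (by omega)
      simp only [e]
      exact ⟨this.1, fun hs => this.2 (by omega)⟩

theorem cexp {μ : ℝ → ℂ} (hμ : Continuous μ) :
    ∀ r : ℕ, JointlyContDiff r (fun ξ t : ℝ => Complex.exp (μ ξ * t)) := by
  have hc : Continuous (Function.uncurry fun ξ t : ℝ => Complex.exp (μ ξ * t)) :=
    Complex.continuous_exp.comp ((hμ.comp continuous_fst).mul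
      (Complex.continuous_ofReal.comp continuous_snd))
  intro r
  induction r with
  | zero => exact hc
  | succ r ih =>
    refine ⟨hc, fun ξ t => μ ξ * Complex.exp (μ ξ * t), fun ξ t => ?_,
      (of_continuous hμ r).bilin (ContinuousLinearMap.mul ℝ ℂ) ih⟩
    have := ((hasDerivAt_id t).ofReal_comp.const_mul (μ ξ)).cexp
    simpa [mul_comm] using this

end JointlyContDiff

end ParametricRegularity

end

/-! ### The Bloch transform and its Plancherel inequality -/

section

theorem intervalIntegral_mul_le_sqrt_mul_sqrt {f g : ℝ → ℝ} (hf : Continuous f) (hg : Continuous g)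
    (hf0 : ∀ x, 0 ≤ f x) (hg0 : ∀ x, 0 ≤ g x) {a b : ℝ} (hab : a ≤ b) :
    ∫ x in a..b, f x * g x ≤ √(∫ x in a..b, f x ^ 2) * √(∫ x in a..b, g x ^ 2) := by
  have hm : ∀ {f : ℝ → ℝ}, Continuous f →
      MemLp f (ENNReal.ofReal 2) (volume.restrict (Set.Ioc a b)) := fun hf => by
    obtain ⟨C, hC⟩ := (isCompact_Icc (a := a) (b := b)).exists_bound_of_continuousOn hf.continuousOn
    refine MemLp.of_bound hf.aestronglyMeasurable C ?_
    filter_upwards [ae_restrict_mem measurableSet_Ioc] with x hx using hC x ⟨hx.1.le, hx.2⟩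
  have h := integral_mul_le_Lp_mul_Lq_of_nonneg (μ := volume.restrict (Set.Ioc a b))
    Real.HolderConjugate.two_two (Eventually.of_forall hf0) (Eventually.of_forall hg0) (hm hf)
    (hm hg)
  simp only [intervalIntegral.integral_of_le hab, Real.sqrt_eq_rpow]
  simpa using h

theorem intervalIntegral_finsetSum_of_continuous {ι E : Type*} [NormedAddCommGroup E]
    [NormedSpace ℝ E] (S : Finset ι) {f : ι → ℝ → E} (hf : ∀ i, Continuous (f i)) (a b : ℝ) :
    ∫ x in a..b, ∑ i ∈ S, f i x = ∑ i ∈ S, ∫ x in a..b, f i x :=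
  intervalIntegral.integral_finsetSum fun i _ => (hf i).intervalIntegrable a b

section Zak

theorem integral_wave_intCast (k : ℤ) :
    ∫ ξ in -Real.pi..Real.pi, wave ξ k = if k = 0 then 2 * (Real.pi : ℂ) else 0 := by
  split_ifs with h
  · simp only [h, Int.cast_zero, wave_zero_right, intervalIntegral.integral_const,
      Complex.real_smul, mul_one]
    push_cast
    ring
  · have hk : Complex.I * (k : ℂ) ≠ 0 := mul_ne_zero Complex.I_ne_zero (by exact_mod_cast h)
    have e : ∀ ξ : ℝ, wave ξ k = Complex.exp (Complex.I * (k : ℂ) * ξ) := fun ξ => by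
      unfold wave
      push_cast
      ring_nf
    simp only [e]
    rw [integral_exp_mul_complex hk]
    have e2 : Complex.exp (Complex.I * k * (Real.pi : ℝ))
        = Complex.exp (Complex.I * k * ((-Real.pi : ℝ) : ℂ)) := by
      rw [Complex.exp_eq_exp_iff_exists_int]
      exact ⟨k, by push_cast; ring⟩
    rw [e2, sub_self, zero_div]

theorem integral_norm_sq_sum_wave (S : Finset ℤ) (a : ℤ → ℂ) :
    ∫ ξ in -Real.pi..Real.pi, ‖∑ m ∈ S, wave ξ m * a m‖ ^ 2
      = 2 * Real.pi * ∑ m ∈ S, ‖a m‖ ^ 2 := by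
  rw [← Complex.ofReal_inj, ← intervalIntegral.integral_ofReal]
  have e : ∀ ξ : ℝ, ((‖∑ m ∈ S, wave ξ m * a m‖ ^ 2 : ℝ) : ℂ)
      = ∑ m ∈ S, ∑ k ∈ S, wave ξ ((m - k : ℤ) : ℝ) * (a m * starRingEnd ℂ (a k)) := fun ξ => by
    rw [← Complex.normSq_eq_norm_sq, ← Complex.mul_conj, map_sum, Finset.sum_mul_sum]
    refine Finset.sum_congr rfl fun m _ => Finset.sum_congr rfl fun k _ => ?_
    have : starRingEnd ℂ (wave ξ k) = wave ξ (-k) := by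
      unfold wave
      rw [← Complex.exp_conj]
      simp
    rw [map_mul, this, Int.cast_sub, sub_eq_add_neg, wave_add]
    ring
  simp only [e]
  have hc : ∀ x : ℝ, Continuous fun ξ => wave ξ x := fun x => continuous_id.wave continuous_const
  rw [intervalIntegral_finsetSum_of_continuous S
    (f := fun m ξ => ∑ k ∈ S, wave ξ ((m - k : ℤ) : ℝ) * (a m * starRingEnd ℂ (a k)))
    fun m => continuous_finsetSum _ fun k _ => (hc _).mul continuous_const]
  push_cast
  rw [Finset.mul_sum]
  refine Finset.sum_congr rfl fun m hm => ?_
  rw [intervalIntegral_finsetSum_of_continuous S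
    (f := fun k ξ => wave ξ (m - k) * (a m * starRingEnd ℂ (a k)))
    fun k => (hc _).mul continuous_const]
  simp only [intervalIntegral.integral_mul_const, ← Int.cast_sub, integral_wave_intCast, sub_eq_zero]
  simp only [ite_mul, zero_mul]
  rw [Finset.sum_ite_eq, if_pos hm, Complex.mul_conj, Complex.normSq_eq_norm_sq]
  push_cast
  rfl

/-- The Bloch transform of a compactly supported function. -/
def zak (b : ℝ → ℂ) (ξ x : ℝ) : ℂ := ∑ᶠ m : ℤ, wave ξ (x + m) * b (x + m)

variable {b : ℝ → ℂ} {R : ℕ}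

theorem zak_eq_sum (hs : ∀ x : ℝ, (R : ℝ) ≤ |x| → b x = 0) {L : ℕ} {x : ℝ} (hx : |x| ≤ L) (ξ : ℝ) :
    zak b ξ x = ∑ m ∈ Finset.Icc (-(R + L : ℤ)) (R + L), wave ξ (x + m) * b (x + m) := by
  refine finsum_eq_finsetSum_of_support_subset _ fun m hm => ?_
  by_contra hmem
  refine hm ?_
  simp only
  rw [hs, mul_zero]
  rw [Finset.coe_Icc, Set.mem_Icc, ← abs_le, not_le] at hmem
  have h1 : ((R + L : ℤ) : ℝ) < |(m : ℝ)| := by exact_mod_cast hmem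
  push_cast at h1
  have h2 := abs_sub_abs_le_abs_sub (m : ℝ) (-x)
  rw [abs_neg, sub_neg_eq_add, add_comm (m : ℝ)] at h2
  linarith

theorem continuous_zak (hb : Continuous b) (hs : ∀ x : ℝ, (R : ℝ) ≤ |x| → b x = 0) :
    Continuous (Function.uncurry (zak b)) := by
  rw [continuous_iff_continuousAt]
  rintro ⟨ξ₀, x₀⟩
  obtain ⟨L, hL⟩ := exists_nat_gt |x₀|
  have hc : Continuous fun p : ℝ × ℝ => ∑ m ∈ Finset.Icc (-(R + L : ℤ)) (R + L),
      wave p.1 (p.2 + m) * b (p.2 + m) :=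
    continuous_finsetSum _ fun m _ => (continuous_fst.wave (by fun_prop)).mul (by fun_prop)
  refine hc.continuousAt.congr ?_
  have : ∀ᶠ p : ℝ × ℝ in 𝓝 (ξ₀, x₀), |p.2| < L :=
    (continuous_abs.comp continuous_snd).continuousAt.eventually (gt_mem_nhds hL)
  filter_upwards [this] with p hp
  exact (zak_eq_sum hs hp.le p.1).symm

theorem zak_add_one (b : ℝ → ℂ) (ξ x : ℝ) : zak b ξ (x + 1) = zak b ξ x := by
  unfold zak
  rw [← finsum_comp_equiv (Equiv.addRight (1 : ℤ)) (f := fun m : ℤ => wave ξ (x + m) * b (x + m))]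
  refine finsum_congr fun m => ?_
  simp only [Equiv.coe_addRight]
  push_cast
  ring_nf

/-- Inversion of the Bloch transform: by orthogonality of the waves at integers only the term m = 0
survives. -/
theorem integral_wave_mul_zak (hs : ∀ x : ℝ, (R : ℝ) ≤ |x| → b x = 0) (x : ℝ) :
    ∫ ξ in -Real.pi..Real.pi, wave (-ξ) x * zak b ξ x = 2 * Real.pi * b x := by
  obtain ⟨L, hL⟩ := exists_nat_ge |x|
  simp only [zak_eq_sum hs hL, wave_add, Finset.mul_sum, ← mul_assoc, wave_neg_mul, one_mul]
  rw [intervalIntegral_finsetSum_of_continuous _ (f := fun (m : ℤ) ξ => wave ξ m * b (x + m))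
    fun m => (continuous_id.wave continuous_const).mul continuous_const]
  simp only [intervalIntegral.integral_mul_const, integral_wave_intCast, ite_mul, zero_mul]
  rw [Finset.sum_ite_eq', if_pos (Finset.mem_Icc.mpr (by omega)), Int.cast_zero, add_zero]

theorem intervalIntegral_sum_comp_add {E : Type*} [NormedAddCommGroup E] [NormedSpace ℝ E]
    {h : ℝ → E} (hc : Continuous h)
    (hs : ∀ x : ℝ, (R : ℝ) ≤ |x| → h x = 0) :
    ∫ x in (0 : ℝ)..1, ∑ m ∈ Finset.Icc (-(R + 1 : ℤ)) (R + 1), h (x + m) = ∫ x, h x := by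
  rw [intervalIntegral_finsetSum_of_continuous _ (f := fun (m : ℤ) x => h (x + m))
    fun m => hc.comp (continuous_add_const _)]
  have hi : Integrable h := hc.integrable_of_hasCompactSupport
    (HasCompactSupport.of_support_subset_isCompact (isCompact_Icc (a := -(R : ℝ)) (b := R))
      fun x hx => abs_le.mp (le_of_not_ge fun hR => hx (hs x hR)))
  refine (hasSum_sum_of_ne_finset_zero fun m hm => ?_).unique
    hi.hasSum_intervalIntegral_comp_add_int
  refine (intervalIntegral.integral_congr (g := fun _ => 0) fun x hx => ?_).trans (by simp)
  rw [Set.uIcc_of_le zero_le_one] at hx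
  refine hs _ ?_
  rw [Finset.mem_Icc, ← abs_le, not_le] at hm
  have h1 : ((R + 1 : ℤ) : ℝ) < |(m : ℝ)| := by exact_mod_cast hm
  push_cast at h1
  have h2 := abs_sub_abs_le_abs_sub (m : ℝ) (-x)
  rw [abs_neg, sub_neg_eq_add, add_comm (m : ℝ), abs_of_nonneg hx.1] at h2
  linarith [hx.2]

theorem integral_zak_mul (hb : Continuous b) (hs : ∀ x : ℝ, (R : ℝ) ≤ |x| → b x = 0) {k : ℝ → ℂ}
    (hk : Continuous k) (hp : Function.Periodic k 1) (ξ : ℝ) :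
    ∫ x in (0 : ℝ)..1, zak b ξ x * k x = ∫ x, wave ξ x * b x * k x := by
  have hc : Continuous fun x => wave ξ x * b x * k x :=
    ((continuous_const.wave continuous_id).mul hb).mul hk
  rw [← intervalIntegral_sum_comp_add (R := R) hc fun x hx => by rw [hs x hx, mul_zero, zero_mul]]
  refine intervalIntegral.integral_congr fun x hx => ?_
  rw [Set.uIcc_of_le zero_le_one] at hx
  rw [zak_eq_sum hs (L := 1) (by rw [abs_of_nonneg hx.1]; exact_mod_cast hx.2), Finset.sum_mul]
  refine Finset.sum_congr rfl fun m _ => ?_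
  have := hp.int_mul m x
  rw [mul_one] at this
  rw [this]

theorem integral_norm_zak_le (hb : Continuous b) (hs : ∀ x : ℝ, (R : ℝ) ≤ |x| → b x = 0) (ξ : ℝ) :
    ∫ x in (0 : ℝ)..1, ‖zak b ξ x‖ ≤ ∫ x, ‖b x‖ := by
  rw [← intervalIntegral_sum_comp_add (R := R) hb.norm fun x hx => by rw [hs x hx, norm_zero]]
  have hz : Continuous fun x => ‖zak b ξ x‖ :=
    ((continuous_zak hb hs).comp (Continuous.prodMk_right ξ)).norm
  refine intervalIntegral.integral_mono_on zero_le_one (hz.intervalIntegrable _ _)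
    (Continuous.intervalIntegrable (continuous_finsetSum _ fun m _ =>
      hb.norm.comp (continuous_add_const _)) _ _) fun x hx => ?_
  rw [zak_eq_sum hs (L := 1) (by rw [abs_of_nonneg hx.1]; exact_mod_cast hx.2)]
  refine (norm_sum_le _ _).trans (le_of_eq (Finset.sum_congr rfl fun m _ => ?_))
  rw [norm_mul, norm_wave, one_mul]

/-- Cauchy-Schwarz in the unit cell, then the Plancherel identity in ξ for the finite sum over
translates. -/
theorem integral_sq_integral_norm_zak_le (hb : Continuous b)
    (hs : ∀ x : ℝ, (R : ℝ) ≤ |x| → b x = 0) :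
    ∫ ξ in -Real.pi..Real.pi, (∫ x in (0 : ℝ)..1, ‖zak b ξ x‖) ^ 2
      ≤ 2 * Real.pi * ∫ x, ‖b x‖ ^ 2 := by
  have hz : Continuous fun p : ℝ × ℝ => ‖zak b p.2 p.1‖ :=
    ((continuous_zak hb hs).comp (f := Prod.swap) continuous_swap).norm
  have hz1 : ∀ ξ, Continuous fun x => ‖zak b ξ x‖ := fun ξ =>
    hz.comp (f := fun x => (x, ξ)) (by fun_prop)
  have hπ : -Real.pi ≤ Real.pi := by linarith [Real.pi_pos]
  have h1 : ∀ ξ, (∫ x in (0 : ℝ)..1, ‖zak b ξ x‖) ^ 2 ≤ ∫ x in (0 : ℝ)..1, ‖zak b ξ x‖ ^ 2 := by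
    intro ξ
    have h := intervalIntegral_mul_le_sqrt_mul_sqrt (hz1 ξ) (continuous_const (y := (1 : ℝ)))
      (fun x => norm_nonneg _) (fun _ => zero_le_one) zero_le_one
    have h0 : 0 ≤ ∫ x in (0 : ℝ)..1, ‖zak b ξ x‖ ^ 2 :=
      intervalIntegral.integral_nonneg zero_le_one fun x _ => by positivity
    have h00 : 0 ≤ ∫ x in (0 : ℝ)..1, ‖zak b ξ x‖ :=
      intervalIntegral.integral_nonneg zero_le_one fun x _ => norm_nonneg _
    simp only [mul_one, one_pow, intervalIntegral.integral_const, sub_zero, smul_eq_mul,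
      Real.sqrt_one] at h
    calc _ ≤ (√(∫ x in (0 : ℝ)..1, ‖zak b ξ x‖ ^ 2)) ^ 2 := by gcongr
      _ = _ := Real.sq_sqrt h0
  have hsq : Continuous (Function.uncurry fun x ξ => ‖zak b ξ x‖ ^ 2) := hz.pow 2
  have hLc : Continuous fun ξ => ∫ x in (0 : ℝ)..1, ‖zak b ξ x‖ :=
    continuous_intervalIntegral_param (F := fun x ξ => ‖zak b ξ x‖) hz 0 1
  refine (intervalIntegral.integral_mono_on hπ ((hLc.pow 2).intervalIntegrable _ _)
    ((continuous_intervalIntegral_param hsq 0 1).intervalIntegrable _ _)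
    fun ξ _ => h1 ξ).trans (le_of_eq ?_)
  have hswap : ∫ ξ in -Real.pi..Real.pi, ∫ x in (0 : ℝ)..1, ‖zak b ξ x‖ ^ 2
      = ∫ x in (0 : ℝ)..1, ∫ ξ in -Real.pi..Real.pi, ‖zak b ξ x‖ ^ 2 :=
    intervalIntegral_intervalIntegral_swap
      ((hsq.comp continuous_swap).continuousOn.integrableOn_compact
        (isCompact_uIcc.prod isCompact_uIcc) |>.mono_set
          (Set.prod_mono Set.uIoc_subset_uIcc Set.uIoc_subset_uIcc))
  rw [hswap, ← intervalIntegral_sum_comp_add (R := R) (h := fun x => ‖b x‖ ^ 2) (hb.norm.pow 2) fun x hx => by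
      rw [hs x hx, norm_zero, zero_pow two_ne_zero], ← intervalIntegral.integral_const_mul]
  refine intervalIntegral.integral_congr fun x hx => ?_
  rw [Set.uIcc_of_le zero_le_one] at hx
  rw [← integral_norm_sq_sum_wave]
  refine intervalIntegral.integral_congr fun ξ _ => ?_
  rw [zak_eq_sum hs (L := 1) (by rw [abs_of_nonneg hx.1]; exact_mod_cast hx.2)]
  simp only [wave_add, mul_assoc, ← Finset.mul_sum]
  rw [norm_mul, norm_wave, one_mul]
  norm_cast

end Zak

/-! ### Kernel bounds by duality -/

section Duality

theorem integrable_of_abs_ge {E : Type*} [NormedAddCommGroup E] {h : ℝ → E} {R : ℕ}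
    (hc : Continuous h) (hs : ∀ x : ℝ, (R : ℝ) ≤ |x| → h x = 0) : Integrable h :=
  hc.integrable_of_hasCompactSupport
    (HasCompactSupport.of_support_subset_isCompact (isCompact_Icc (a := -(R : ℝ)) (b := R))
      fun x hx => abs_le.mp (le_of_not_ge fun hR => hx (hs x hR)))

/-- Testing with b = ψḡ for cutoffs ψ gives I ≤ A√I, where I = ∫ψ|g|² is finite. Hence I ≤ A², and
the claim follows as the cutoffs exhaust the line. Square integrability of g is a conclusion here.
-/
theorem lintegral_enorm_sq_le_of_forall {g : ℝ → ℂ} (hg : Continuous g) {A : ℝ} (hA : 0 ≤ A)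
    (h : ∀ (b : ℝ → ℂ) (R : ℕ), Continuous b → (∀ x : ℝ, (R : ℝ) ≤ |x| → b x = 0) →
      ‖∫ x, b x * g x‖ ≤ A * √(∫ x, ‖b x‖ ^ 2)) :
    ∫⁻ x, ‖g x‖ₑ ^ 2 ≤ ENNReal.ofReal (A ^ 2) := by
  have hU : (⋃ R : ℕ, Set.Icc (-(R : ℝ)) R) = Set.univ := by
    refine Set.eq_univ_of_forall fun x => ?_
    obtain ⟨R, hR⟩ := exists_nat_ge |x|
    exact Set.mem_iUnion.mpr ⟨R, abs_le.mp hR⟩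
  rw [← setLIntegral_univ, ← hU, setLIntegral_iUnion_of_directed]
  rotate_left
  · refine (Monotone.directed_le fun R S hRS => Set.Icc_subset_Icc ?_ ?_)
    · exact neg_le_neg (by exact_mod_cast hRS)
    · exact_mod_cast hRS
  refine iSup_le fun R => ?_
  set ψ : ℝ → ℝ := fun x => max 0 (min 1 (R + 1 - |x|)) with hψ
  have hψc : Continuous ψ := by fun_prop
  have hψ0 : ∀ x, 0 ≤ ψ x := fun x => le_max_left _ _
  have hψ1 : ∀ x, ψ x ≤ 1 := fun x => max_le zero_le_one (min_le_left _ _)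
  have hψs : ∀ x : ℝ, ((R + 1 : ℕ) : ℝ) ≤ |x| → ψ x = 0 := fun x hx => by
    push_cast at hx
    exact max_eq_left ((min_le_right _ _).trans (by linarith))
  have hψR : ∀ x ∈ Set.Icc (-(R : ℝ)) R, ψ x = 1 := fun x hx => by
    have := abs_le.mpr hx
    simp only [hψ]
    rw [min_eq_left (by linarith), max_eq_right zero_le_one]
  set I := ∫ x, ψ x * ‖g x‖ ^ 2 with hI
  have hi : Integrable fun x => ψ x * ‖g x‖ ^ 2 :=
    integrable_of_abs_ge (R := R + 1) (by fun_prop) fun x hx => by rw [hψs x hx, zero_mul]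
  have hI0 : 0 ≤ I := integral_nonneg fun x => mul_nonneg (hψ0 x) (by positivity)
  have h1 := h (fun x => ψ x * starRingEnd ℂ (g x)) (R + 1) (by fun_prop) fun x hx => by
    rw [hψs x hx, Complex.ofReal_zero, zero_mul]
  have e1 : ∫ x, (ψ x * starRingEnd ℂ (g x)) * g x = (I : ℂ) := by
    rw [hI, ← integral_complex_ofReal]
    refine integral_congr_ae (Eventually.of_forall fun x => ?_)
    simp only
    rw [mul_assoc, mul_comm (starRingEnd ℂ _), Complex.mul_conj, Complex.normSq_eq_norm_sq]
    push_cast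
    rfl
  have e2 : ∫ x, ‖ψ x * starRingEnd ℂ (g x)‖ ^ 2 ≤ I := by
    refine integral_mono_of_nonneg (Eventually.of_forall fun x => by positivity) hi
      (Eventually.of_forall fun x => ?_)
    simp only
    rw [norm_mul, RCLike.norm_conj, Complex.norm_real, Real.norm_of_nonneg (hψ0 x), mul_pow]
    refine mul_le_mul_of_nonneg_right ?_ (by positivity)
    nlinarith [hψ0 x, hψ1 x]
  rw [e1, Complex.norm_real, Real.norm_of_nonneg hI0] at h1
  have h2 : I ≤ A * √I := h1.trans (mul_le_mul_of_nonneg_left (Real.sqrt_le_sqrt e2) hA)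
  have h3 : I ≤ A ^ 2 := by
    have := Real.sq_sqrt hI0
    have h0 := Real.sqrt_nonneg I
    rcases h0.eq_or_lt with h0 | h0
    · rw [← this, ← h0, zero_pow two_ne_zero]
      exact sq_nonneg A
    · have : √I ≤ A := by nlinarith
      nlinarith
  calc ∫⁻ x in Set.Icc (-(R : ℝ)) R, ‖g x‖ₑ ^ 2
      ≤ ∫⁻ x, ENNReal.ofReal (ψ x * ‖g x‖ ^ 2) := by
        rw [← lintegral_indicator measurableSet_Icc]
        refine lintegral_mono fun x => ?_
        rw [Set.indicator_apply]
        split_ifs with hx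
        swap
        · exact zero_le
        rw [hψR x hx, one_mul, ENNReal.ofReal_pow (norm_nonneg _), ofReal_norm]
    _ = ENNReal.ofReal I := (ofReal_integral_eq_lintegral_ofReal hi
        (Eventually.of_forall fun x => mul_nonneg (hψ0 x) (by positivity))).symm
    _ ≤ _ := ENNReal.ofReal_le_ofReal h3

/-- Tent functions of small radius δ around x₀ recover the value g(x₀) up to η, by continuity. -/
theorem norm_le_of_forall_integral {g : ℝ → ℂ} (hg : Continuous g) {A : ℝ}
    (h : ∀ (b : ℝ → ℂ) (R : ℕ), Continuous b → (∀ x : ℝ, (R : ℝ) ≤ |x| → b x = 0) →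
      ‖∫ x, b x * g x‖ ≤ A * ∫ x, ‖b x‖) (x₀ : ℝ) : ‖g x₀‖ ≤ A := by
  refine le_of_forall_pos_le_add fun η hη => ?_
  obtain ⟨δ, hδ, hball⟩ := Metric.continuousAt_iff.mp (hg.continuousAt (x := x₀)) η hη
  set ψ : ℝ → ℝ := fun x => max 0 (δ - |x - x₀|) with hψ
  have hψc : Continuous ψ := by fun_prop
  have hψ0 : ∀ x, 0 ≤ ψ x := fun x => le_max_left _ _
  obtain ⟨R, hR⟩ := exists_nat_ge (|x₀| + δ)
  have hψs : ∀ x : ℝ, (R : ℝ) ≤ |x| → ψ x = 0 := fun x hx => by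
    have := abs_sub_abs_le_abs_sub x x₀
    exact max_eq_left (by linarith)
  have hi : Integrable ψ := integrable_of_abs_ge hψc hψs
  have hpos : 0 < ∫ x, ψ x := by
    refine hψc.integral_pos_of_hasCompactSupport_nonneg_nonzero
      (HasCompactSupport.of_support_subset_isCompact (isCompact_Icc (a := -(R : ℝ)) (b := R))
        fun x hx => abs_le.mp (le_of_not_ge fun hR => hx (hψs x hR))) hψ0 (x := x₀) ?_
    simp only [hψ, sub_self, abs_zero, sub_zero]
    rw [max_eq_right hδ.le]
    exact hδ.ne'
  have h1 := h (fun x => ψ x) R (by fun_prop) fun x hx => by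
    rw [hψs x hx, Complex.ofReal_zero]
  have e1 : ∫ x, ‖(ψ x : ℂ)‖ = ∫ x, ψ x := by
    simp only [Complex.norm_real, Real.norm_of_nonneg (hψ0 _)]
  have hi1 : Integrable fun x => (ψ x : ℂ) * g x :=
    integrable_of_abs_ge (R := R) (by fun_prop) fun x hx => by
      rw [hψs x hx, Complex.ofReal_zero, zero_mul]
  have hi2 : Integrable fun x => (ψ x : ℂ) * g x₀ := hi.ofReal.mul_const _
  have h2 : ‖(∫ x, (ψ x : ℂ) * g x₀) - ∫ x, (ψ x : ℂ) * g x‖ ≤ η * ∫ x, ψ x := by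
    rw [← integral_sub hi2 hi1, ← integral_const_mul]
    refine norm_integral_le_of_norm_le (hi.const_mul η) (Eventually.of_forall fun x => ?_)
    rw [← mul_sub, norm_mul, Complex.norm_real, Real.norm_of_nonneg (hψ0 x), mul_comm]
    rcases le_or_gt δ |x - x₀| with hx | hx
    · have : ψ x = 0 := max_eq_left (by linarith)
      rw [this, mul_zero, mul_zero]
    · refine mul_le_mul_of_nonneg_right ?_ (hψ0 x)
      rw [← dist_eq_norm, dist_comm]
      exact (hball (by rwa [Real.dist_eq])).le
  have e2 : ‖∫ x, (ψ x : ℂ) * g x₀‖ = (∫ x, ψ x) * ‖g x₀‖ := by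
    rw [integral_mul_const, integral_complex_ofReal, norm_mul, Complex.norm_real,
      Real.norm_of_nonneg hpos.le]
  rw [e1] at h1
  have h3 := norm_le_norm_add_norm_sub' (∫ x, (ψ x : ℂ) * g x₀) (∫ x, (ψ x : ℂ) * g x)
  rw [e2] at h3
  have h4 : (∫ x, ψ x) * ‖g x₀‖ ≤ (∫ x, ψ x) * (A + η) := by linarith
  exact le_of_mul_le_mul_left h4 hpos

/-- A kernel bounded by its Bloch symbol `ω`. -/
theorem bounds_of_zak {g : ℝ → ℂ} (hg : Continuous g) {ω : ℝ → ℝ} (hω : Continuous ω)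
    (hω0 : ∀ ξ, 0 ≤ ω ξ)
    (h : ∀ (b : ℝ → ℂ) (R : ℕ), Continuous b → (∀ x : ℝ, (R : ℝ) ≤ |x| → b x = 0) →
      ‖∫ x, b x * g x‖ ≤ (2 * Real.pi)⁻¹ * ∫ ξ in -Real.pi..Real.pi,
        ω ξ * ∫ x in (0 : ℝ)..1, ‖zak b ξ x‖) :
    (∀ x, ‖g x‖ ≤ (2 * Real.pi)⁻¹ * ∫ ξ in -Real.pi..Real.pi, ω ξ) ∧
      ∫⁻ x, ‖g x‖ₑ ^ 2
        ≤ ENNReal.ofReal ((2 * Real.pi)⁻¹ * ∫ ξ in -Real.pi..Real.pi, ω ξ ^ 2) := by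
  have hπ : -Real.pi ≤ Real.pi := by linarith [Real.pi_pos]
  have hπ0 := Real.pi_pos
  have hLc : ∀ (b : ℝ → ℂ) (R : ℕ), Continuous b → (∀ x : ℝ, (R : ℝ) ≤ |x| → b x = 0) →
      Continuous fun ξ => ∫ x in (0 : ℝ)..1, ‖zak b ξ x‖ := fun b R hb hs =>
    continuous_intervalIntegral_param (F := fun x ξ => ‖zak b ξ x‖)
      ((continuous_zak hb hs).comp (f := Prod.swap) continuous_swap).norm 0 1
  -- For the sup bound the Bloch transform is estimated by the L¹ norm of b at every ξ. For the L²
  -- bound, Cauchy-Schwarz in ξ is combined with the Plancherel inequality.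
  constructor
  · refine norm_le_of_forall_integral hg fun b R hb hs => (h b R hb hs).trans ?_
    rw [mul_assoc]
    refine mul_le_mul_of_nonneg_left ?_ (by positivity)
    rw [← intervalIntegral.integral_mul_const]
    exact intervalIntegral.integral_mono_on hπ ((hω.mul (hLc b R hb hs)).intervalIntegrable _ _)
      ((hω.mul continuous_const).intervalIntegrable _ _) fun ξ _ =>
        mul_le_mul_of_nonneg_left (integral_norm_zak_le hb hs ξ) (hω0 ξ)
  · have hW : 0 ≤ ∫ ξ in -Real.pi..Real.pi, ω ξ ^ 2 :=
      intervalIntegral.integral_nonneg hπ fun ξ _ => by positivity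
    have key := lintegral_enorm_sq_le_of_forall hg
      (A := √((2 * Real.pi)⁻¹ * ∫ ξ in -Real.pi..Real.pi, ω ξ ^ 2)) (Real.sqrt_nonneg _)
      fun b R hb hs => (h b R hb hs).trans ?_
    · rwa [Real.sq_sqrt (by positivity)] at key
    have hcs := intervalIntegral_mul_le_sqrt_mul_sqrt hω (hLc b R hb hs) hω0
      (fun ξ => intervalIntegral.integral_nonneg zero_le_one fun x _ => norm_nonneg _) hπ
    have hB := Real.sqrt_le_sqrt (integral_sq_integral_norm_zak_le hb hs)
    calc _ ≤ (2 * Real.pi)⁻¹ * (√(∫ ξ in -Real.pi..Real.pi, ω ξ ^ 2)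
          * √(2 * Real.pi * ∫ x, ‖b x‖ ^ 2)) := by gcongr; exact hcs.trans (by gcongr)
      _ = _ := by
        rw [Real.sqrt_mul (x := 2 * Real.pi) (by positivity),
          Real.sqrt_mul (x := (2 * Real.pi)⁻¹) (by positivity), Real.sqrt_inv]
        have h1 : √(2 * Real.pi) ≠ 0 := (Real.sqrt_pos.mpr (by positivity)).ne'
        have h2 : (2 * Real.pi)⁻¹ = (√(2 * Real.pi))⁻¹ * (√(2 * Real.pi))⁻¹ := by
          rw [← mul_inv, Real.mul_self_sqrt (by positivity)]
        rw [h2]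
        field_simp

end Duality

end

/-! ### Regularity of the left eigenfunctions in y -/

section

section FloquetRegularity

variable {F : Type*} [NormedAddCommGroup F] [NormedSpace ℂ F]

/-- Joint regularity of solutions of `v'' = c v' + (μ - A) v` depending continuously on `ξ`. -/
theorem JointlyContDiff.of_ode [CompleteSpace F] {c : ℝ} {v v₁ : ℝ → ℝ → F} {μ : ℝ → ℂ} {A : ℝ → F →L[ℂ] F}
    (hv : Continuous (Function.uncurry v)) (hμ : Continuous μ)
    (hd : ∀ ξ y, HasDerivAt (v ξ) (v₁ ξ y) y)
    (hd₁ : ∀ ξ y, HasDerivAt (v₁ ξ) ((c : ℂ) • v₁ ξ y + (μ ξ • v ξ y - A y (v ξ y))) y) (r : ℕ)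
    (hA : ContDiff ℝ r A) : JointlyContDiff (r + 2) v := by
  have hAc : Continuous A := hA.continuous
  have hgc : Continuous (Function.uncurry fun ξ y => μ ξ • v ξ y - A y (v ξ y)) :=
    ((hμ.comp continuous_fst).smul hv).sub ((hAc.comp continuous_snd).clm_apply hv)
  have hshift : ∀ {h : ℝ → ℝ → F}, Continuous (Function.uncurry h) →
      Continuous fun p : ℝ × ℝ × ℝ => h p.2.1 (p.2.2 + p.1) := fun hh =>
    hh.comp (f := fun p : ℝ × ℝ × ℝ => (p.2.1, p.2.2 + p.1)) (by fun_prop)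
  have hFc : Continuous (Function.uncurry fun (s : ℝ) (p : ℝ × ℝ) =>
      ((1 - s : ℝ) : ℂ) • (μ p.1 • v p.1 (p.2 + s) - A (p.2 + s) (v p.1 (p.2 + s)))
        + (c : ℂ) • v p.1 (p.2 + s)) :=
    ((Complex.continuous_ofReal.comp (continuous_const.sub continuous_fst)).smul
      (hshift hgc)).add (continuous_const.smul (hshift hv))
  -- Integrating the equation over [y, y + 1] with weight 1 - s expresses the derivative `v₁`
  -- through values of `v` alone. Joint continuity of `v` is therefore inherited by `v₁`.
  have key : ∀ ξ y, v₁ ξ y = v ξ (y + 1) - v ξ y + (c : ℂ) • v ξ y - ∫ s in (0 : ℝ)..1,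
      (((1 - s : ℝ) : ℂ) • (μ ξ • v ξ (y + s) - A (y + s) (v ξ (y + s)))
        + (c : ℂ) • v ξ (y + s)) := by
    intro ξ y
    have hs : ∀ (s : ℝ), HasDerivAt (fun s : ℝ => y + s) 1 s := fun s => (hasDerivAt_id s).const_add y
    have := intervalIntegral.integral_eq_sub_of_hasDerivAt (a := 0) (b := 1)
      (f := fun s : ℝ => ((1 - s : ℝ) : ℂ) • (v₁ ξ (y + s) - (c : ℂ) • v ξ (y + s)) + v ξ (y + s))
      (f' := fun s : ℝ => ((1 - s : ℝ) : ℂ) • (μ ξ • v ξ (y + s) - A (y + s) (v ξ (y + s)))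
        + (c : ℂ) • v ξ (y + s)) (fun s _ => ?_)
      ((hFc.comp (f := fun s : ℝ => (s, (ξ, y))) (by fun_prop)).intervalIntegrable _ _)
    · rw [this]
      simp only [sub_self, sub_zero, Complex.ofReal_zero, Complex.ofReal_one, zero_smul, one_smul,
        add_zero]
      module
    · have h1 := (hd ξ (y + s)).scomp s (hs s)
      have h2 := (hd₁ ξ (y + s)).scomp s (hs s)
      have h3 : HasDerivAt (fun s : ℝ => ((1 - s : ℝ) : ℂ)) (-1) s := by
        simpa using ((hasDerivAt_id s).const_sub 1).ofReal_comp
      refine ((h3.smul (h2.sub (h1.const_smul (c : ℂ)))).add h1).congr_deriv ?_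
      simp only [one_smul, Function.comp_apply, Pi.sub_apply, Pi.smul_apply]
      module
  have hv₁ : Continuous (Function.uncurry v₁) := by
    have : Function.uncurry v₁ = fun p : ℝ × ℝ => v p.1 (p.2 + 1) - v p.1 p.2 + (c : ℂ) • v p.1 p.2
        - ∫ s in (0 : ℝ)..1, (((1 - s : ℝ) : ℂ) • (μ p.1 • v p.1 (p.2 + s)
          - A (p.2 + s) (v p.1 (p.2 + s))) + (c : ℂ) • v p.1 (p.2 + s)) :=
      funext fun p => key p.1 p.2
    rw [this]
    exact ((hv.comp (f := fun p : ℝ × ℝ => (p.1, p.2 + 1)) (by fun_prop)).sub hv).add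
      (hv.const_smul _) |>.sub (continuous_intervalIntegral_param hFc 0 1)
  induction r with
  | zero =>
    exact ⟨hv, v₁, hd, hv₁, _, hd₁, (hv₁.const_smul (c : ℂ)).add hgc⟩
  -- Bootstrap: `v` and `v₁` already have r + 1 joint derivatives, so the equation gives as many to
  -- the second derivative.
  | succ r ih =>
    have hr := ih (hA.of_le (by exact_mod_cast Nat.le_succ r))
    have h1 : JointlyContDiff (r + 1) v₁ := by
      obtain ⟨-, v', hd', h'⟩ := hr
      have : v₁ = v' := funext fun ξ => funext fun y => (hd ξ y).unique (hd' ξ y)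
      exact this ▸ h'
    have h0 : JointlyContDiff (r + 1) v := hr.of_succ
    have hcv : JointlyContDiff (r + 1) fun ξ y => (c : ℂ) • v₁ ξ y :=
      (of_continuous (g := fun _ => (c : ℂ)) continuous_const (r + 1)).bilin
        (ContinuousLinearMap.lsmul ℝ ℂ) h1
    have hmv : JointlyContDiff (r + 1) fun ξ y => μ ξ • v ξ y :=
      (of_continuous hμ (r + 1)).bilin (ContinuousLinearMap.lsmul ℝ ℂ) h0
    have hAv : JointlyContDiff (r + 1) fun ξ y => -A y (v ξ y) :=
      (of_contDiff hA).bilin (-((ContinuousLinearMap.restrictScalarsL ℂ F F ℝ ℝ))) h0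
    refine ⟨hv, v₁, hd, hv₁, _, hd₁, ?_⟩
    simp only [sub_eq_add_neg]
    exact hcv.add (hmv.add hAv)

/-- Undoing the Bloch conjugation leaves a differential equation in which the frequency enters only
through ν, the form required by `JointlyContDiff.of_ode`. -/
theorem PeriodicPotential.IsBlochSolution.exists_hasDerivAt_wave_smul {N : PeriodicPotential F}
    {c κ : ℝ} {V : CircleFun F} {ν : ℂ} (h : N.IsBlochSolution (-c) (-κ : ℝ) V (ν • V)) :
    ∃ v₁ : ℝ → F, (∀ y, HasDerivAt (fun y => wave (-κ) y • V y) (v₁ y) y) ∧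
      ∀ y, HasDerivAt v₁ ((c : ℂ) • v₁ y
        + (ν • (wave (-κ) y • V y) - N.op y (wave (-κ) y • V y))) y := by
  obtain ⟨V₁, V₂, h1, h2, he⟩ := h
  refine ⟨fun y => wave (-κ) y • (V₁ y - (Complex.I * κ) • V y), fun y => ?_, fun y => ?_⟩
  · refine ((hasDerivAt_wave (-κ) y).smul (h1 y)).congr_deriv ?_
    push_cast
    module
  · refine ((hasDerivAt_wave (-κ) y).smul
      ((h2 y).sub ((h1 y).const_smul (Complex.I * κ : ℂ)))).congr_deriv ?_
    have hy : V₂ y + ((-c : ℝ) + 2 * Complex.I * ((-κ : ℝ) : ℂ)) • V₁ y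
        + (Complex.I * (-c : ℝ) * ((-κ : ℝ) : ℂ) - ((-κ : ℝ) : ℂ) ^ 2) • V y + N.op y (V y)
        = ν • V y := congrArg (fun w : CircleFun F => w y) he
    rw [map_smul, smul_comm ν, ← hy]
    push_cast
    simp only [Pi.sub_apply, Pi.smul_apply]
    match_scalars <;> ring_nf
    rw [Complex.I_sq]
    ring

end FloquetRegularity

/-! ### Regularity of the profile and of the linearized potential -/

section ProfileRegularity

variable {n : ℕ}

theorem contDiff_realMatrixAct {M : ℝ → Matrix (Fin n) (Fin n) ℝ} {r : WithTop ℕ∞}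
    (h : ∀ i j, ContDiff ℝ r fun x => M x i j) : ContDiff ℝ r fun x => realMatrixAct (M x) := by
  have e : ∀ A : Matrix (Fin n) (Fin n) ℝ, realMatrixAct A
      = ∑ i, ∑ j, A i j • realMatrixAct (Matrix.single i j 1) := fun A => by
    ext v k
    simp only [_root_.sum_apply, FunLike.coe_smul, Pi.smul_apply]
    simp only [WithLp.ofLp_sum, Finset.sum_apply, PiLp.smul_apply, realMatrixAct_apply,
      Matrix.single_apply]
    rw [Finset.sum_comm]
    refine Finset.sum_congr rfl fun j _ => ?_
    rw [Finset.sum_eq_single k (fun i _ hi => by simp [hi]) (by simp)]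
    simp [Finset.sum_ite_eq, apply_ite, ite_mul]
  rw [funext fun x => e (M x)]
  exact ContDiff.sum fun i _ => ContDiff.sum fun j _ => (h i j).smul contDiff_const

variable {f : EuclideanSpace ℝ (Fin n) → EuclideanSpace ℝ (Fin n)} {c : ℝ}
  {u : ℝ → EuclideanSpace ℝ (Fin n)}

namespace IsPeriodicProfile

/-- Bootstrap in the profile equation: u has two derivatives more than f. -/
theorem contDiff_of_le (hu : IsPeriodicProfile f c u) {r : ℕ} (hf : ContDiff ℝ r f) :
    ∀ m ≤ r, ContDiff ℝ (m + 2 : ℕ) u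
  | 0, _ => hu.contDiff
  | m + 1, hm => by
    have h := hu.contDiff_of_le hf m (by omega)
    have h1 : ContDiff ℝ (m + 1 : ℕ) (deriv u) := by
      rw [Nat.cast_succ] at h
      exact (contDiff_succ_iff_deriv.mp h).2.2
    have e : deriv (deriv u) = fun x => -(c • deriv u x + f (u x)) := funext fun x => by
      rw [← sub_eq_zero, sub_neg_eq_add, ← add_assoc]
      exact hu.profile_eq x
    have h2 : ContDiff ℝ (m + 1 : ℕ) (deriv (deriv u)) := by
      rw [e]
      exact ((h1.const_smul c).add ((hf.of_le (by exact_mod_cast hm)).comp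
        (h.of_le (by exact_mod_cast Nat.le_succ _)))).neg
    have h3 : ContDiff ℝ (m + 2 : ℕ) (deriv u) := by
      rw [Nat.cast_succ]
      exact contDiff_succ_iff_deriv.mpr
        ⟨fun x => (hu.hasDerivAt_deriv x).differentiableAt, by simp, h2⟩
    rw [Nat.cast_succ]
    exact contDiff_succ_iff_deriv.mpr
      ⟨hu.contDiff.differentiable (by norm_num), by simp, h3⟩

/-- One derivative of f is spent on df. The two gained by `JointlyContDiff.of_ode` bring the left
eigenfunctions one order above f. -/
theorem contDiff_rowAct (hu : IsPeriodicProfile f c u) {r : ℕ} (hf : ContDiff ℝ (r + 1 : ℕ) f) :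
    ContDiff ℝ r (rowAct (profileJacobian f u)) := by
  refine contDiff_realMatrixAct fun i j => ?_
  have hu' : ContDiff ℝ r u :=
    (hu.contDiff_of_le hf r (by omega)).of_le (by exact_mod_cast (by omega : r ≤ r + 2))
  have h1 : ContDiff ℝ r fun x => fderiv ℝ f (u x) :=
    (hf.fderiv_right (m := r) (by norm_cast)).comp hu'
  exact (EuclideanSpace.proj (𝕜 := ℝ) j).contDiff.comp (h1.clm_apply contDiff_const)

end IsPeriodicProfile

end ProfileRegularity

/-! ### Differentiation of oscillatory integrals -/

section OscillatoryIntegral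

variable {E : Type*} [NormedAddCommGroup E] [NormedSpace ℝ E]

theorem iteratedDeriv_integral_of_jointlyContDiff {E₁ E₂ : Type*} [NormedAddCommGroup E₁]
    [NormedSpace ℝ E₁] [NormedAddCommGroup E₂] [NormedSpace ℝ E₂] (B : E₁ →L[ℝ] E₂ →L[ℝ] E)
    {A : ℝ → E₁} (hA : Continuous A) {R : ℕ} {v : ℝ → ℝ → E₂} (hv : JointlyContDiff R v)
    (a b : ℝ) :
    ContDiff ℝ R (fun y => ∫ ξ in a..b, B (A ξ) (v ξ y)) ∧
    ∀ r ≤ R, iteratedDeriv r (fun y => ∫ ξ in a..b, B (A ξ) (v ξ y))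
      = fun y => ∫ ξ in a..b, B (A ξ) (iteratedDeriv r (v ξ) y) := by
  have hc : ∀ r ≤ R, Continuous (Function.uncurry fun ξ y =>
      B (A ξ) (iteratedDeriv r (v ξ) y)) := fun r hr =>
    B.continuous₂.comp ((hA.comp continuous_fst).prodMk (hv.iteratedDeriv r hr).1)
  have hd : ∀ r < R, ∀ y, HasDerivAt (fun y => ∫ ξ in a..b, B (A ξ) (iteratedDeriv r (v ξ) y))
      (∫ ξ in a..b, B (A ξ) (iteratedDeriv (r + 1) (v ξ) y)) y := fun r hr y =>
    hasDerivAt_intervalIntegral_param (hc r hr.le) (hc (r + 1) hr) (fun ξ y =>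
      (B (A ξ)).hasFDerivAt.comp_hasDerivAt y ((hv.iteratedDeriv r hr.le).2 hr ξ y)) a b y
  refine ⟨?_, fun r hr => ?_⟩
  · have := contDiff_of_hasDerivAt
      (f := fun r y => ∫ ξ in a..b, B (A ξ) (iteratedDeriv r (v ξ) y)) hd
      (continuous_intervalIntegral_param (hc R le_rfl) a b)
    simpa only [iteratedDeriv_zero] using this
  · have := iteratedDeriv_eq_of_hasDerivAt
      (f := fun r y => ∫ ξ in a..b, B (A ξ) (iteratedDeriv r (v ξ) y)) hd hr
    simpa only [iteratedDeriv_zero] using this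

variable {F : Type*} [NormedAddCommGroup F] [NormedSpace ℂ F]

/-- The integral is a bounded linear map `J` applied to exp(z₁A + z₂B) in the Banach algebra of
continuous functions on [a, b], where the exponential is analytic. Joint smoothness follows without
differentiating under the integral. -/
theorem contDiff_integral_cexp_smul {α β : ℝ → ℂ} (hα : Continuous α) (hβ : Continuous β)
    {g : ℝ → F} (hg : Continuous g) {a b : ℝ} (hab : a ≤ b) (r : WithTop ℕ∞) :
    ContDiff ℝ r fun z : ℝ × ℝ => ∫ ξ in a..b, Complex.exp (α ξ * z.1 + β ξ * z.2) • g ξ := by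
  let X := C(Set.Icc a b, ℂ)
  let ext : X → ℝ → ℂ := fun h ξ => h (Set.projIcc a b hab ξ)
  have hext : ∀ h : X, Continuous (ext h) := fun h => h.continuous.comp continuous_projIcc
  obtain ⟨C, hC⟩ := (isCompact_Icc (a := a) (b := b)).exists_bound_of_continuousOn hg.continuousOn
  have hii : ∀ h : X, IntervalIntegrable (fun ξ => ext h ξ • g ξ) volume a b := fun h =>
    ((hext h).smul hg).intervalIntegrable _ _
  let J : X →L[ℝ] F := LinearMap.mkContinuous
    { toFun := fun h => ∫ ξ in a..b, ext h ξ • g ξ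
      map_add' := fun h k => by
        rw [← intervalIntegral.integral_add (hii h) (hii k)]
        exact intervalIntegral.integral_congr fun ξ _ => add_smul _ _ _
      map_smul' := fun s h => by
        rw [RingHom.id_apply, ← intervalIntegral.integral_smul]
        exact intervalIntegral.integral_congr fun ξ _ => smul_assoc s _ _ }
    (C * |b - a|) fun h => by
      have := intervalIntegral.norm_integral_le_of_norm_le_const (a := a) (b := b)
        (f := fun ξ => ext h ξ • g ξ) (C := ‖h‖ * C) fun ξ hξ => by
          rw [norm_smul]
          rw [Set.uIoc_of_le hab] at hξ
          exact mul_le_mul (h.norm_coe_le_norm _) (hC ξ ⟨hξ.1.le, hξ.2⟩) (norm_nonneg _)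
            (norm_nonneg _)
      exact this.trans (le_of_eq (by ring))
  let A : X := ⟨fun ξ => α ξ, hα.comp continuous_subtype_val⟩
  let B : X := ⟨fun ξ => β ξ, hβ.comp continuous_subtype_val⟩
  have hexp : ContDiff ℝ r (NormedSpace.exp : X → X) :=
    contDiff_iff_contDiffAt.mpr fun x => (NormedSpace.exp_analytic (𝕂 := ℝ) x).contDiffAt
  have hmain : ContDiff ℝ r fun z : ℝ × ℝ => J (NormedSpace.exp (z.1 • A + z.2 • B)) :=
    J.contDiff.comp (hexp.comp ((contDiff_fst.smul contDiff_const).add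
      (contDiff_snd.smul contDiff_const)))
  refine (congrArg (ContDiff ℝ r) (funext fun z => ?_)).mp hmain
  refine intervalIntegral.integral_congr fun ξ hξ => ?_
  rw [Set.uIcc_of_le hab] at hξ
  simp only [ext]
  rw [Set.projIcc_of_mem hab hξ]
  have := NormedSpace.map_exp (ContinuousMap.evalAlgHom ℝ ℂ (⟨ξ, hξ⟩ : Set.Icc a b))
    (continuous_eval_const (F := X) _) (z.1 • A + z.2 • B)
  change _ = NormedSpace.exp (z.1 • α ξ + z.2 • β ξ) at this
  rw [← Complex.exp_eq_exp_ℂ] at this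
  simp only [Complex.real_smul] at this
  rw [mul_comm (α ξ), mul_comm (β ξ), ← this]
  rfl

end OscillatoryIntegral

end

/-! ### The phase kernel e and its derivatives -/

section

section PhaseKernel

variable {n : ℕ}

/-- Mixed derivatives of separated oscillatory integrals. -/
theorem mixedDeriv_integral {p s : ℝ → ℝ → ℂ} (hp : ∀ r, JointlyContDiff r p)
    (hs : ∀ r, JointlyContDiff r s) {R : ℕ} {v : ℝ → ℝ → EuclideanSpace ℂ (Fin n)}
    (hv : JointlyContDiff R v) (a b : ℝ) (j k : ℕ) {r : ℕ} (hr : r ≤ R) (x t y : ℝ) :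
    mixedDeriv (fun x t y => ∫ ξ in a..b, p ξ x • s ξ t • v ξ y) j k r x t y
      = ∫ ξ in a..b, iteratedDeriv j (p ξ) x • iteratedDeriv k (s ξ) t
        • iteratedDeriv r (v ξ) y := by
  have hc : ∀ {f : ℝ → ℝ → ℂ}, (∀ r, JointlyContDiff r f) → ∀ k x,
      Continuous fun ξ => iteratedDeriv k (f ξ) x := fun hf k x =>
    ((hf k).iteratedDeriv k le_rfl).1.comp (f := fun ξ => (ξ, x)) (by fun_prop)
  have hvc : ∀ y, Continuous fun ξ => iteratedDeriv r (v ξ) y := fun y =>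
    (hv.iteratedDeriv r hr).1.comp (f := fun ξ => (ξ, y)) (by fun_prop)
  have h1 : ∀ x t, iteratedDeriv r (fun y => ∫ ξ in a..b, p ξ x • s ξ t • v ξ y)
      = fun y => ∫ ξ in a..b, p ξ x • s ξ t • iteratedDeriv r (v ξ) y := fun x t => by
    have hpx : Continuous fun ξ => p ξ x := by simpa using hc hp 0 x
    have hst : Continuous fun ξ => s ξ t := by simpa using hc hs 0 t
    have := (iteratedDeriv_integral_of_jointlyContDiff
      (ContinuousLinearMap.lsmul ℝ ℂ : ℂ →L[ℝ] EuclideanSpace ℂ (Fin n) →L[ℝ] _)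
      (A := fun ξ => p ξ x * s ξ t) (hpx.mul hst) hv a b).2 r hr
    simpa only [ContinuousLinearMap.lsmul_apply, mul_smul] using this
  have h2 : ∀ x y, iteratedDeriv k (fun t => ∫ ξ in a..b, p ξ x • s ξ t • iteratedDeriv r (v ξ) y)
      = fun t => ∫ ξ in a..b, p ξ x • iteratedDeriv k (s ξ) t • iteratedDeriv r (v ξ) y :=
    fun x y => by
    have := (iteratedDeriv_integral_of_jointlyContDiff
      (ContinuousLinearMap.lsmul ℝ ℂ : ℂ →L[ℝ] EuclideanSpace ℂ (Fin n) →L[ℝ] _).flip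
      (A := fun ξ => p ξ x • iteratedDeriv r (v ξ) y)
      ((by simpa using hc hp 0 x : Continuous fun ξ => p ξ x).smul (hvc y)) (hs k) a b).2 k le_rfl
    simpa only [ContinuousLinearMap.flip_apply, ContinuousLinearMap.lsmul_apply,
      smul_comm (iteratedDeriv k _ _) (p _ _), smul_comm (s _ _) (p _ _)] using this
  have h3 := (iteratedDeriv_integral_of_jointlyContDiff
      (ContinuousLinearMap.lsmul ℝ ℂ : ℂ →L[ℝ] EuclideanSpace ℂ (Fin n) →L[ℝ] _).flip
      (A := fun ξ => iteratedDeriv k (s ξ) t • iteratedDeriv r (v ξ) y)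
      ((hc hs k t).smul (hvc y)) (hp j) a b).2 j le_rfl
  simp only [ContinuousLinearMap.flip_apply, ContinuousLinearMap.lsmul_apply] at h3
  unfold mixedDeriv
  simp only [h1, h2, h3]

theorem jointlyContDiff_wave (r : ℕ) : JointlyContDiff r wave :=
  JointlyContDiff.cexp (μ := fun ξ : ℝ => Complex.I * ξ) (by fun_prop) r

theorem iteratedDeriv_cexp (a : ℂ) (k : ℕ) :
    iteratedDeriv k (fun t : ℝ => Complex.exp (a * t))
      = fun t : ℝ => a ^ k * Complex.exp (a * t) := by
  refine (iteratedDeriv_eq_of_hasDerivAt (R := k)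
    (f := fun k (t : ℝ) => a ^ k * Complex.exp (a * t)) (fun r _ t => ?_) le_rfl).symm ▸ ?_
  · have := (((hasDerivAt_id t).ofReal_comp.const_mul a).cexp).const_mul (a ^ r)
    refine this.congr_deriv ?_
    simp only [id, Complex.ofReal_one, mul_one, pow_succ]
    ring
  · simp

/-- The projection of `ℝ` onto `[-2ε, 2ε]`. -/
def clampFreq (ε ξ : ℝ) : ℝ := max (-(2 * ε)) (min (2 * ε) ξ)

theorem continuous_clampFreq (ε : ℝ) : Continuous (clampFreq ε) := by
  unfold clampFreq; fun_prop

theorem abs_clampFreq_le {ε : ℝ} (hε : 0 < ε) (ξ : ℝ) : |clampFreq ε ξ| ≤ 2 * ε :=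
  abs_le.mpr ⟨le_max_left _ _, max_le (by linarith) (min_le_left _ _)⟩

theorem clampFreq_eq {ε ξ : ℝ} (h : |ξ| ≤ 2 * ε) : clampFreq ε ξ = ξ := by
  rw [abs_le] at h
  rw [clampFreq, min_eq_right h.2, max_eq_right h.1]

/-- The rows `(2π)⁻¹ φ(ξ) e^{-iξy} q'(y, ξ)`, with `ξ` clamped in the last two factors. -/
def branchRow (ε : ℝ) (φ : ℝ → ℝ) (q' : ℝ → CircleFun (EuclideanSpace ℂ (Fin n))) (ξ y : ℝ) :
    EuclideanSpace ℂ (Fin n) :=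
  ((φ ξ : ℂ) * (1 / (2 * (Real.pi : ℂ)))) •
    wave (-clampFreq ε ξ) y • q' (clampFreq ε ξ) y

/-- The time factor `χ(t) e^{μ(ξ)t}`, with `ξ` clamped. -/
def timeFactor (ε : ℝ) (χ : ℝ → ℝ) (μ : ℝ → ℂ) (ξ t : ℝ) : ℂ :=
  (χ t : ℂ) * Complex.exp (μ (clampFreq ε ξ) * t)

variable {N N' : PeriodicPotential (EuclideanSpace ℂ (Fin n))} {c : ℝ}
  {w₀ : CircleFun (EuclideanSpace ℂ (Fin n))} {ε₀ : ℝ} {μ : ℝ → ℂ}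
  {q q' : ℝ → CircleFun (EuclideanSpace ℂ (Fin n))} {θ ε : ℝ} {φ χ : ℝ → ℝ}

/-- The cutoff vanishes for |ξ| ≥ 2ε, so the integral can be restricted to [-π, π] and μ and q'
taken at the clamped frequency. Nothing is known about the branch outside (-ε₀, ε₀); clamping makes
every factor continuous in ξ on the whole line. -/
theorem phaseKernel_eq_integral (hφ : IsFrequencyCutoff ε φ) (hε : 2 * ε ≤ Real.pi) (x t y : ℝ) :
    phaseKernel χ φ μ q' x t y = ∫ ξ in -Real.pi..Real.pi,
      wave ξ x • timeFactor ε χ μ ξ t • branchRow ε φ q' ξ y := by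
  have hπ : -Real.pi ≤ Real.pi := by linarith [Real.pi_pos]
  change ((χ t : ℂ) * (1 / (2 * (Real.pi : ℂ)))) • ∫ ξ : ℝ,
    (Complex.exp (Complex.I * (ξ : ℂ) * ((x : ℂ) - (y : ℂ))) * (φ ξ : ℂ)
      * Complex.exp (μ ξ * (t : ℂ))) • q' ξ y = _
  rw [← integral_smul, intervalIntegral.integral_of_le hπ,
    ← integral_Icc_eq_integral_Ioc, ← setIntegral_univ]
  refine (setIntegral_eq_of_subset_of_forall_sdiff_eq_zero MeasurableSet.univ
    (Set.subset_univ _) fun ξ hξ => ?_).trans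
    (setIntegral_congr_fun measurableSet_Icc fun ξ _ => ?_)
  · have h1 : Real.pi ≤ |ξ| := le_of_not_ge fun h => hξ.2 (abs_le.mp h)
    rw [hφ.2.2 ξ (hε.trans h1)]
    simp
  · simp only [timeFactor, branchRow]
    rcases le_or_gt (2 * ε) |ξ| with h | h
    · simp [hφ.2.2 ξ h]
    · rw [clampFreq_eq h.le]
      simp only [smul_smul]
      congr 1
      have : Complex.exp (Complex.I * ξ * (x - y)) = wave ξ x * wave (-ξ) y := by
        unfold wave
        rw [← Complex.exp_add]
        push_cast
        ring_nf
      rw [this]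
      ring

theorem jointlyContDiff_timeFactor (hχ : ContDiff ℝ (⊤ : ℕ∞) χ)
    (hμ : Continuous fun ξ => μ (clampFreq ε ξ)) (r : ℕ) :
    JointlyContDiff r (timeFactor ε χ μ) :=
  (JointlyContDiff.of_contDiff ((Complex.ofRealCLM.contDiff.comp
    (hχ.of_le (by exact_mod_cast le_top))))).bilin (ContinuousLinearMap.mul ℝ ℂ)
    (JointlyContDiff.cexp hμ r)

namespace IsSpectralBranch

theorem clampFreq_mem (hε : 0 < ε) (hε' : 2 * ε < ε₀) (ξ : ℝ) :
    clampFreq ε ξ ∈ Set.Ioo (-ε₀) ε₀ :=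
  abs_lt.mp ((abs_clampFreq_le hε ξ).trans_lt hε')

theorem continuous_mu_clampFreq (hb : IsSpectralBranch N N' c w₀ ε₀ μ q q') (hε : 0 < ε)
    (hε' : 2 * ε < ε₀) : Continuous fun ξ => μ (clampFreq ε ξ) :=
  hb.mu_analytic.continuousOn.comp_continuous (continuous_clampFreq ε)
    (clampFreq_mem hε hε')

theorem continuous_left_clampFreq (hb : IsSpectralBranch N N' c w₀ ε₀ μ q q') (hε : 0 < ε)
    (hε' : 2 * ε < ε₀) : Continuous fun ξ => q' (clampFreq ε ξ) :=
  hb.left_analytic.continuousOn.comp_continuous (continuous_clampFreq ε)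
    (clampFreq_mem hε hε')

theorem jointlyContDiff_branchRow (hb : IsSpectralBranch N N' c w₀ ε₀ μ q q') (hε : 0 < ε)
    (hε' : 2 * ε < ε₀) (hφ : Continuous φ) {r : ℕ} (hN : ContDiff ℝ r N'.op) :
    JointlyContDiff (r + 2) (branchRow ε φ q') := by
  have hq' := hb.continuous_left_clampFreq hε hε'
  have hv : Continuous (Function.uncurry fun ξ y =>
      wave (-clampFreq ε ξ) y • q' (clampFreq ε ξ) y) := by
    refine Continuous.smul (((continuous_clampFreq ε).comp continuous_fst).neg.wave
      continuous_snd) ?_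
    have h1 : Continuous fun p : ℝ × ℝ => q' (clampFreq ε p.1) := hq'.comp continuous_fst
    have h2 : Continuous fun p : C(AddCircle (1 : ℝ), EuclideanSpace ℂ (Fin n)) × AddCircle (1 : ℝ)
      => p.1 p.2 := continuous_eval
    exact h2.comp (h1.prodMk ((AddCircle.continuous_mk' 1).comp continuous_snd))
  choose v₁ hd hd₁ using fun ξ =>
    (hb.left_solution _ (clampFreq_mem hε hε' ξ)).exists_hasDerivAt_wave_smul
  have := JointlyContDiff.of_ode (v₁ := v₁) hv (hb.continuous_mu_clampFreq hε hε') hd hd₁ r hN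
  exact (JointlyContDiff.of_continuous (g := fun ξ => (φ ξ : ℂ) * (1 / (2 * (Real.pi : ℂ))))
    (by fun_prop) (r + 2)).bilin (ContinuousLinearMap.lsmul ℝ ℂ) this

end IsSpectralBranch

/-- A shift of y by one multiplies the row by a unimodular constant, so it is enough to bound its
derivatives on the compact set [-π, π] × [0, 1]. -/
theorem exists_norm_iteratedDeriv_branchRow_le {R : ℕ}
    (h : JointlyContDiff R (branchRow ε φ q')) {r : ℕ} (hr : r ≤ R) :
    ∃ C, ∀ ξ, |ξ| ≤ Real.pi → ∀ y, ‖iteratedDeriv r (branchRow ε φ q' ξ) y‖ ≤ C := by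
  obtain ⟨C, hC⟩ := ((isCompact_Icc (a := -Real.pi) (b := Real.pi)).prod
    (isCompact_Icc (a := (0 : ℝ)) (b := 1))).exists_bound_of_continuousOn
    (h.iteratedDeriv r hr).1.continuousOn
  refine ⟨C, fun ξ hξ y => ?_⟩
  have e : ∀ y, branchRow ε φ q' ξ (y + 1) = wave (-clampFreq ε ξ) 1 • branchRow ε φ q' ξ y := by
    intro y
    simp only [branchRow, CircleFun.add_one, wave_add, smul_smul]
    ring_nf
  have hp : Function.Periodic (fun y => ‖iteratedDeriv r (branchRow ε φ q' ξ) y‖) 1 := fun y => by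
    have h1 := congrFun (iteratedDeriv_comp_add_const r (branchRow ε φ q' ξ) 1) y
    rw [funext e] at h1
    beta_reduce
    rw [← h1, iteratedDeriv_fun_const_smul_field, norm_smul, norm_wave, one_mul]
  obtain ⟨z, hz, hyz⟩ := hp.exists_mem_Ico₀ one_pos y
  rw [hyz]
  exact hC (ξ, z) ⟨abs_le.mp hξ, hz.1, hz.2.le⟩

theorem mixedDeriv_phaseKernel (hφ : IsFrequencyCutoff ε φ) (hε : 2 * ε ≤ Real.pi)
    (hs : ∀ r, JointlyContDiff r (timeFactor ε χ μ)) {R : ℕ}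
    (hv : JointlyContDiff R (branchRow ε φ q')) (j k : ℕ) {r : ℕ} (hr : r ≤ R) (x t y : ℝ) :
    mixedDeriv (phaseKernel χ φ μ q') j k r x t y = ∫ ξ in -Real.pi..Real.pi,
      ((Complex.I * ξ) ^ j * wave ξ x) • iteratedDeriv k (timeFactor ε χ μ ξ) t
        • iteratedDeriv r (branchRow ε φ q' ξ) y := by
  have e : phaseKernel χ φ μ q' = fun x t y => ∫ ξ in -Real.pi..Real.pi,
      wave ξ x • timeFactor ε χ μ ξ t • branchRow ε φ q' ξ y :=
    funext fun x => funext fun t => funext fun y => phaseKernel_eq_integral hφ hε x t y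
  rw [e, mixedDeriv_integral jointlyContDiff_wave hs hv _ _ j k hr]
  refine intervalIntegral.integral_congr fun ξ _ => ?_
  have : iteratedDeriv j (wave ξ) x = (Complex.I * ξ) ^ j * wave ξ x :=
    congrFun (iteratedDeriv_cexp (Complex.I * ξ) j) x
  beta_reduce
  rw [this]

theorem contDiff_phaseKernel (hφ : IsFrequencyCutoff ε φ) (hε : 2 * ε ≤ Real.pi)
    (hs : ∀ r, JointlyContDiff r (timeFactor ε χ μ)) {R : ℕ}
    (hv : JointlyContDiff R (branchRow ε φ q')) (x t : ℝ) :
    ContDiff ℝ R (fun y => phaseKernel χ φ μ q' x t y) := by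
  simp only [phaseKernel_eq_integral hφ hε, smul_smul]
  exact (iteratedDeriv_integral_of_jointlyContDiff
      (ContinuousLinearMap.lsmul ℝ ℂ : ℂ →L[ℝ] EuclideanSpace ℂ (Fin n) →L[ℝ] _)
      (A := fun ξ => wave ξ x * timeFactor ε χ μ ξ t)
      ((continuous_id.wave continuous_const).mul
        ((hs 0).continuous.comp (f := fun ξ => (ξ, t)) (by fun_prop))) hv _ _).1

theorem contDiff_iteratedDeriv_phaseKernel (hφ : IsFrequencyCutoff ε φ) (hε : 2 * ε ≤ Real.pi)
    (hχ : ContDiff ℝ (⊤ : ℕ∞) χ) (hμ : Continuous fun ξ => μ (clampFreq ε ξ)) {R : ℕ}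
    (hv : JointlyContDiff R (branchRow ε φ q')) {r : ℕ} (hr : r ≤ R) (y : ℝ) :
    ContDiff ℝ (⊤ : ℕ∞) (fun z : ℝ × ℝ =>
      iteratedDeriv r (fun y' => phaseKernel χ φ μ q' z.1 z.2 y') y) := by
  have hs := jointlyContDiff_timeFactor (ε := ε) hχ hμ
  have e : ∀ z : ℝ × ℝ, iteratedDeriv r (fun y' => phaseKernel χ φ μ q' z.1 z.2 y') y
      = χ z.2 • ∫ ξ in -Real.pi..Real.pi, Complex.exp (Complex.I * ξ * z.1
        + μ (clampFreq ε ξ) * z.2) • iteratedDeriv r (branchRow ε φ q' ξ) y := fun z => by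
    have := mixedDeriv_phaseKernel (χ := χ) (μ := μ) hφ hε hs hv 0 0 hr z.1 z.2 y
    simp only [mixedDeriv, iteratedDeriv_zero, pow_zero, one_mul] at this
    rw [this, ← intervalIntegral.integral_smul]
    refine intervalIntegral.integral_congr fun ξ _ => ?_
    simp only [timeFactor, wave, Complex.exp_add]
    rw [← Complex.coe_smul, smul_smul, smul_smul]
    ring_nf
  rw [funext e]
  exact (hχ.comp contDiff_snd).smul (contDiff_integral_cexp_smul (α := fun ξ : ℝ => Complex.I * ξ)
    (by fun_prop) hμ ((hv.iteratedDeriv r hr).1.comp (f := fun ξ => (ξ, y)) (by fun_prop))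
    (by linarith [Real.pi_pos]) _)

end PhaseKernel

end

/-! ### From Gaussian bounds on the Bloch symbol to decay rates -/

section

section SymbolBounds

/-- Half of the Gaussian absorbs the power of ξ, at the price of T^{-l/2}. -/
theorem exists_pow_mul_exp_le {a : ℝ} (ha : 0 < a) (l : ℕ) : ∃ C, 0 ≤ C ∧ ∀ ξ T : ℝ, 0 < T →
    |ξ| ^ l * Real.exp (-(a * ξ ^ 2 * T))
      ≤ C * T ^ (-(l / 2 : ℝ)) * Real.exp (-(a / 2 * ξ ^ 2 * T)) := by
  refine ⟨1 + l.factorial * (2 / a) ^ l, by positivity, fun ξ T hT => ?_⟩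
  have hs : T ^ (-(l / 2 : ℝ)) = ((√T) ^ l)⁻¹ := by
    rw [Real.rpow_neg hT.le, Real.sqrt_eq_rpow, ← Real.rpow_natCast, ← Real.rpow_mul hT.le]
    ring_nf
  have hT2 := Real.sq_sqrt hT.le
  have hs0 : 0 < √T := Real.sqrt_pos.mpr hT
  have h1 := Real.pow_div_factorial_le_exp (a / 2 * ξ ^ 2 * T) (by positivity) l
  have h2 : (|ξ| * √T) ^ l ≤ 1 + (ξ ^ 2 * T) ^ l := by
    have : (ξ ^ 2 * T) ^ l = ((|ξ| * √T) ^ l) ^ 2 := by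
      rw [← hT2, ← sq_abs ξ, ← mul_pow, ← pow_mul, ← pow_mul, mul_comm 2 l, Real.sqrt_sq hs0.le]
    rw [this]
    nlinarith [sq_nonneg ((|ξ| * √T) ^ l - 1), sq_nonneg ((|ξ| * √T) ^ l)]
  have hE : 1 ≤ Real.exp (a / 2 * ξ ^ 2 * T) := Real.one_le_exp (by positivity)
  have h3 : (ξ ^ 2 * T) ^ l ≤ l.factorial * (2 / a) ^ l * Real.exp (a / 2 * ξ ^ 2 * T) := by
    rw [div_le_iff₀ (by positivity)] at h1
    have : (ξ ^ 2 * T) ^ l = (2 / a) ^ l * (a / 2 * ξ ^ 2 * T) ^ l := by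
      rw [← mul_pow]
      congr 1
      field_simp
    rw [this]
    calc _ ≤ (2 / a) ^ l * (Real.exp (a / 2 * ξ ^ 2 * T) * l.factorial) := by gcongr
      _ = _ := by ring
  have h4 : |ξ| ^ l * (√T) ^ l
      ≤ (1 + l.factorial * (2 / a) ^ l) * Real.exp (a / 2 * ξ ^ 2 * T) := by
    rw [← mul_pow]
    linarith
  have e : Real.exp (-(a * ξ ^ 2 * T))
      = (Real.exp (a / 2 * ξ ^ 2 * T))⁻¹ * Real.exp (-(a / 2 * ξ ^ 2 * T)) := by
    rw [← Real.exp_neg, ← Real.exp_add]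
    ring_nf
  rw [hs, e, ← mul_assoc]
  refine mul_le_mul_of_nonneg_right ?_ (Real.exp_pos _).le
  rw [← div_eq_mul_inv, ← div_eq_mul_inv, div_le_div_iff₀ (Real.exp_pos _) (by positivity)]
  exact h4

theorem integral_exp_neg_mul_sq_le {a : ℝ} (ha : 0 < a) (L : ℝ) (hL : 0 ≤ L) :
    ∫ ξ in -L..L, Real.exp (-(a * ξ ^ 2)) ≤ √(Real.pi / a) := by
  rw [intervalIntegral.integral_of_le (by linarith), ← integral_gaussian]
  simp only [← neg_mul]
  exact setIntegral_le_integral (integrable_exp_neg_mul_sq ha)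
    (Eventually.of_forall fun ξ => (Real.exp_pos _).le)

/-- Decay of a kernel with a Gaussian Bloch symbol. -/
theorem bounds_of_gaussian_symbol {g : ℝ → ℂ} (hg : Continuous g) {B a T : ℝ} (hB : 0 ≤ B)
    (ha : 0 < a) (hT : 0 < T)
    (h : ∀ (b : ℝ → ℂ) (R : ℕ), Continuous b → (∀ x : ℝ, (R : ℝ) ≤ |x| → b x = 0) →
      ‖∫ x, b x * g x‖ ≤ (2 * Real.pi)⁻¹ * ∫ ξ in -Real.pi..Real.pi,
        B * Real.exp (-(a * ξ ^ 2 * T)) * ∫ x in (0 : ℝ)..1, ‖zak b ξ x‖) :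
    (∀ x, ‖g x‖ ≤ (1 + √(Real.pi / a)) * B * T ^ (-(1 / 2) : ℝ)) ∧
      ∫⁻ x, ‖g x‖ₑ ^ 2
        ≤ ENNReal.ofReal (((1 + √(Real.pi / a)) * B * T ^ (-(1 / 4) : ℝ)) ^ 2) := by
  have hπ := Real.pi_pos
  have hπ1 : (2 * Real.pi)⁻¹ ≤ 1 := inv_le_one_of_one_le₀ (by linarith [Real.pi_gt_three])
  have hT2 : T ^ (-(1 / 2) : ℝ) = (√T)⁻¹ := by rw [Real.rpow_neg hT.le, Real.sqrt_eq_rpow]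
  have hA := Real.sqrt_nonneg (Real.pi / a)
  obtain ⟨h1, h2⟩ := bounds_of_zak hg (ω := fun ξ => B * Real.exp (-(a * ξ ^ 2 * T)))
    (by fun_prop) (fun ξ => by positivity) h
  have hsq : ∀ r : ℝ, 0 < r → √(Real.pi / (r * T)) = √(Real.pi / r) * (√T)⁻¹ := fun r hr => by
    rw [← div_div, div_eq_mul_inv, Real.sqrt_mul (by positivity), Real.sqrt_inv]
  have hI : ∀ r : ℝ, 0 < r → ∫ ξ in -Real.pi..Real.pi, Real.exp (-(r * ξ ^ 2 * T))
      ≤ √(Real.pi / r) * (√T)⁻¹ := fun r hr => by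
    have := integral_exp_neg_mul_sq_le (mul_pos hr hT) Real.pi hπ.le
    rw [hsq r hr] at this
    simpa only [mul_right_comm] using this
  have hsT : 0 ≤ (√T)⁻¹ := by positivity
  constructor
  · refine fun x => (h1 x).trans ?_
    rw [intervalIntegral.integral_const_mul, hT2]
    calc _ ≤ 1 * (B * (√(Real.pi / a) * (√T)⁻¹)) := by
            gcongr
            · exact mul_nonneg hB (intervalIntegral.integral_nonneg (by linarith)
                fun ξ _ => (Real.exp_pos _).le)
            · exact hI a ha
      _ ≤ _ := by nlinarith [mul_nonneg hB hsT]
  · refine h2.trans (ENNReal.ofReal_le_ofReal ?_)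
    have e : ∀ ξ : ℝ, (B * Real.exp (-(a * ξ ^ 2 * T))) ^ 2
        = B ^ 2 * Real.exp (-(2 * a * ξ ^ 2 * T)) := fun ξ => by
      rw [mul_pow, ← Real.exp_nat_mul]
      push_cast
      ring_nf
    have hT4 : (T ^ (-(1 / 4) : ℝ)) ^ 2 = (√T)⁻¹ := by
      rw [← hT2, ← Real.rpow_natCast, ← Real.rpow_mul hT.le]
      norm_num
    have h3 : √(Real.pi / (2 * a)) ≤ (1 + √(Real.pi / a)) ^ 2 := by
      have : √(Real.pi / (2 * a)) ≤ √(Real.pi / a) :=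
        Real.sqrt_le_sqrt (div_le_div_of_nonneg_left hπ.le ha (by linarith))
      nlinarith
    simp only [e]
    rw [intervalIntegral.integral_const_mul, mul_pow, mul_pow, hT4]
    calc _ ≤ 1 * (B ^ 2 * (√(Real.pi / (2 * a)) * (√T)⁻¹)) := by
            gcongr
            · exact mul_nonneg (sq_nonneg B) (intervalIntegral.integral_nonneg (by linarith)
                fun ξ _ => (Real.exp_pos _).le)
            · exact hI (2 * a) (by linarith)
      _ ≤ 1 * (B ^ 2 * ((1 + √(Real.pi / a)) ^ 2 * (√T)⁻¹)) := by gcongr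
      _ = _ := by ring

/-- Fubini's theorem, with the integral over the line folded onto the unit cell: pairing with b
becomes pairing with its Bloch transform. -/
theorem integral_mul_wave_integral {b : ℝ → ℂ} {R : ℕ} (hb : Continuous b)
    (hs : ∀ x : ℝ, (R : ℝ) ≤ |x| → b x = 0) {h : ℝ → ℂ} (hh : Continuous h) (k : ℝ → ℂ)
    (hk : Continuous k) (hkp : Function.Periodic k 1) (a c : ℝ) :
    ∫ x, b x * (k x * ∫ ξ in a..c, wave ξ x * h ξ)
      = ∫ ξ in a..c, h ξ * ∫ x in (0 : ℝ)..1, zak b ξ x * k x := by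
  have hbk : Integrable fun x => b x * k x :=
    integrable_of_abs_ge (R := R) (hb.mul hk) fun x hx => by rw [hs x hx, zero_mul]
  have hF : Continuous fun p : ℝ × ℝ => wave p.1 p.2 * h p.1 :=
    continuous_wave.mul (hh.comp continuous_fst)
  simp only [integral_zak_mul hb hs hk hkp]
  calc ∫ x, b x * (k x * ∫ ξ in a..c, wave ξ x * h ξ)
      = ∫ x, ∫ ξ in a..c, h ξ * (wave ξ x * b x * k x) := by
        refine integral_congr_ae (Eventually.of_forall fun x => ?_)
        beta_reduce
        rw [← mul_assoc, ← intervalIntegral.integral_const_mul]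
        exact intervalIntegral.integral_congr fun ξ _ => by ring
    _ = ∫ ξ in a..c, ∫ x, h ξ * (wave ξ x * b x * k x) := by
        refine (MeasureTheory.intervalIntegral_integral_swap ?_).symm
        have h1 : Integrable (Function.uncurry fun ξ x => h ξ * (b x * k x))
            ((volume.restrict (Set.uIoc a c)).prod volume) :=
          (hh.integrableOn_uIcc.mono_set Set.uIoc_subset_uIcc).mul_prod hbk
        refine h1.mono ?_ (Eventually.of_forall fun p => ?_)
        · refine Continuous.aestronglyMeasurable ?_
          exact (hh.comp continuous_fst).mul ((continuous_wave.mul (hb.comp continuous_snd)).mul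
            (hk.comp continuous_snd))
        · simp [Function.uncurry, mul_assoc]
    _ = _ := intervalIntegral.integral_congr fun ξ _ => integral_const_mul _ _

theorem bounds_of_wave_integral {h : ℝ → ℂ} (hh : Continuous h) {B a T : ℝ}
    (hB : 0 ≤ B) (ha : 0 < a) (hT : 0 < T)
    (hle : ∀ ξ, |ξ| ≤ Real.pi → ‖h ξ‖ ≤ B * Real.exp (-(a * ξ ^ 2 * T))) :
    (∀ x, ‖∫ ξ in -Real.pi..Real.pi, wave ξ x * h ξ‖
      ≤ (1 + √(Real.pi / a)) * (2 * Real.pi * B) * T ^ (-(1 / 2) : ℝ)) ∧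
      ∫⁻ x, ‖∫ ξ in -Real.pi..Real.pi, wave ξ x * h ξ‖ₑ ^ 2
        ≤ ENNReal.ofReal (((1 + √(Real.pi / a)) * (2 * Real.pi * B) * T ^ (-(1 / 4) : ℝ)) ^ 2) := by
  have hπ := Real.pi_pos
  have hF : Continuous (Function.uncurry fun ξ x => wave ξ x * h ξ) :=
    continuous_wave.mul (hh.comp continuous_fst)
  refine bounds_of_gaussian_symbol (continuous_intervalIntegral_param hF _ _) (by positivity) ha hT
    fun b R hb hs => ?_
  have e := integral_mul_wave_integral hb hs hh (fun _ => 1) continuous_const (fun _ => rfl)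
    (-Real.pi) Real.pi
  simp only [one_mul, mul_one] at e
  rw [e, ← intervalIntegral.integral_const_mul]
  have hz : Continuous (Function.uncurry fun x ξ => ‖zak b ξ x‖) :=
    ((continuous_zak hb hs).comp (f := Prod.swap) continuous_swap).norm
  refine intervalIntegral.norm_integral_le_of_norm_le (by linarith)
    (Eventually.of_forall fun ξ hξ => ?_) (Continuous.intervalIntegrable ?_ _ _)
  · rw [norm_mul]
    calc _ ≤ (B * Real.exp (-(a * ξ ^ 2 * T))) * ∫ x in (0 : ℝ)..1, ‖zak b ξ x‖ := by
          gcongr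
          · exact hle ξ (abs_le.mpr ⟨hξ.1.le, hξ.2⟩)
          · exact intervalIntegral.norm_integral_le_integral_norm zero_le_one
      _ = _ := by field_simp
  · exact continuous_const.mul ((by fun_prop : Continuous fun ξ : ℝ =>
      2 * Real.pi * B * Real.exp (-(a * ξ ^ 2 * T))).mul (continuous_intervalIntegral_param hz 0 1))

end SymbolBounds

/-! ### Decay of the symbol of e and of its derivatives -/

section TimeFactor

/-- Used for μ, so that a time derivative of e gains |ξ|, and for q, so that replacing q(ξ) by q(0)
gains |ξ|. -/
theorem AnalyticOnNhd.exists_norm_sub_zero_le {E : Type*} [NormedAddCommGroup E] [NormedSpace ℝ E]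
    [CompleteSpace E] {g : ℝ → E} {ε₀ δ : ℝ} (hg : AnalyticOnNhd ℝ g (Set.Ioo (-ε₀) ε₀))
    (hδ : δ < ε₀) : ∃ C, 0 ≤ C ∧ ∀ ξ, |ξ| ≤ δ → ‖g ξ - g 0‖ ≤ C * |ξ| := by
  have hsub : Set.Icc (-δ) δ ⊆ Set.Ioo (-ε₀) ε₀ := fun ξ hξ =>
    ⟨by linarith [hξ.1], by linarith [hξ.2]⟩
  obtain ⟨C, hC⟩ := (isCompact_Icc (a := -δ) (b := δ)).exists_bound_of_continuousOn
    (hg.deriv.continuousOn.mono hsub)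
  refine ⟨max C 0, le_max_right _ _, fun ξ hξ => ?_⟩
  have h0 : (0 : ℝ) ∈ Set.Icc (-δ) δ := by
    have := (abs_nonneg ξ).trans hξ
    exact ⟨by linarith, this⟩
  have := (convex_Icc (-δ) δ).norm_image_sub_le_of_norm_deriv_le
    (fun x hx => (hg x (hsub hx)).differentiableAt) (fun x hx => (hC x hx).trans (le_max_left C 0))
    h0 (abs_le.mp hξ)
  rwa [sub_zero, Real.norm_eq_abs] at this

variable {μ : ℝ → ℂ} {ε θ Cμ : ℝ} {χ : ℝ → ℝ}

/-- Every x derivative contributes ξ and every t derivative contributes μ = O(ξ); against the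
Gaussian each of these factors is worth (1 + t)^{-1/2}. Before time 1 the factor is zero, and on [1,
2], where derivatives of χ enter, compactness is enough. -/
theorem exists_norm_timeFactor_le (hχ : IsTimeCutoff χ)
    (hs : ∀ r, JointlyContDiff r (timeFactor ε χ μ)) (hε1 : 2 * ε ≤ 1) (hθ : 0 < θ)
    (hre : ∀ ξ, |ξ| ≤ 2 * ε → (μ ξ).re ≤ -θ * ξ ^ 2) (hCμ : 0 ≤ Cμ)
    (hμ : ∀ ξ, |ξ| ≤ 2 * ε → ‖μ ξ‖ ≤ Cμ * |ξ|) (j k : ℕ) :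
    ∃ C, 0 ≤ C ∧ ∀ t, 0 < t → ∀ ξ, |ξ| ≤ 2 * ε →
      |ξ| ^ j * ‖iteratedDeriv k (timeFactor ε χ μ ξ) t‖
        ≤ C * (1 + t) ^ (-((j + k) / 2 : ℝ)) * Real.exp (-(θ / 2 * ξ ^ 2 * (1 + t))) := by
  obtain ⟨C₁, hC₁⟩ := ((isCompact_Icc (a := -(2 * ε)) (b := 2 * ε)).prod
    (isCompact_Icc (a := (1 : ℝ)) (b := 2))).exists_bound_of_continuousOn
    ((hs k).iteratedDeriv k le_rfl).1.continuousOn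
  obtain ⟨C₂, hC₂0, hC₂⟩ := exists_pow_mul_exp_le hθ (j + k)
  push_cast at hC₂
  refine ⟨max C₁ 0 * (3 ^ ((j + k) / 2 : ℝ) * Real.exp (θ / 2 * 3))
    + Cμ ^ k * (Real.exp θ * C₂), by positivity, fun t ht ξ hξ => ?_⟩
  have hξ1 : |ξ| ≤ 1 := hξ.trans hε1
  have hξ2 : ξ ^ 2 ≤ 1 := (sq_le_one_iff_abs_le_one ξ).mpr hξ1
  have hX : 0 ≤ (1 + t) ^ (-((j + k) / 2 : ℝ)) * Real.exp (-(θ / 2 * ξ ^ 2 * (1 + t))) := by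
    positivity
  rcases lt_or_ge t 1 with h1 | h1
  · have : timeFactor ε χ μ ξ =ᶠ[𝓝 t] fun _ => 0 := by
      filter_upwards [Ioo_mem_nhds ht h1] with s hs
      simp [timeFactor, hχ.2.1 s hs.1.le hs.2.le]
    have h0 : iteratedDeriv k (timeFactor ε χ μ ξ) t = 0 := by
      rw [this.iteratedDeriv_eq]
      simp
    rw [h0, norm_zero, mul_zero]
    positivity
  rcases le_or_gt t 2 with h2 | h2
  · have h3 : ‖iteratedDeriv k (timeFactor ε χ μ ξ) t‖ ≤ max C₁ 0 :=
      (hC₁ (ξ, t) ⟨abs_le.mp hξ, h1, h2⟩).trans (le_max_left _ _)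
    have h4 : 1 ≤ (3 ^ ((j + k) / 2 : ℝ) * Real.exp (θ / 2 * 3))
        * ((1 + t) ^ (-((j + k) / 2 : ℝ)) * Real.exp (-(θ / 2 * ξ ^ 2 * (1 + t)))) := by
      have h5 : (1 : ℝ) ≤ 3 ^ ((j + k) / 2 : ℝ) * (1 + t) ^ (-((j + k) / 2 : ℝ)) := by
        rw [Real.rpow_neg (by positivity), ← div_eq_mul_inv, one_le_div (by positivity)]
        exact Real.rpow_le_rpow (by positivity) (by linarith) (by positivity)
      have h6 : 1 ≤ Real.exp (θ / 2 * 3) * Real.exp (-(θ / 2 * ξ ^ 2 * (1 + t))) := by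
        rw [← Real.exp_add]
        refine Real.one_le_exp ?_
        have : ξ ^ 2 * (1 + t) ≤ 1 * 3 := by gcongr; linarith
        nlinarith
      calc (1 : ℝ) ≤ _ := one_le_mul_of_one_le_of_one_le h5 h6
        _ = _ := by ring
    have h7 : |ξ| ^ j * ‖iteratedDeriv k (timeFactor ε χ μ ξ) t‖ ≤ max C₁ 0 := by
      calc _ ≤ 1 * max C₁ 0 := by
            gcongr
            exact pow_le_one₀ (abs_nonneg ξ) hξ1
        _ = _ := one_mul _
    have h8 : max C₁ 0 * 1 ≤ max C₁ 0 * ((3 ^ ((j + k) / 2 : ℝ) * Real.exp (θ / 2 * 3))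
        * ((1 + t) ^ (-((j + k) / 2 : ℝ)) * Real.exp (-(θ / 2 * ξ ^ 2 * (1 + t))))) := by
      gcongr
    have h9 : 0 ≤ Cμ ^ k * (Real.exp θ * C₂) := by positivity
    nlinarith [mul_nonneg h9 hX]
  · have : timeFactor ε χ μ ξ =ᶠ[𝓝 t] fun s => Complex.exp (μ ξ * s) := by
      filter_upwards [lt_mem_nhds h2] with s hs
      rw [timeFactor, hχ.2.2 s hs.le, clampFreq_eq hξ, Complex.ofReal_one, one_mul]
    -- The constant e^θ allows t to be replaced by 1 + t in the Gaussian, since ξ² ≤ 1.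
    have h0 : ‖iteratedDeriv k (timeFactor ε χ μ ξ) t‖
        ≤ (Cμ * |ξ|) ^ k * (Real.exp θ * Real.exp (-(θ * ξ ^ 2 * (1 + t)))) := by
      rw [this.iteratedDeriv_eq, iteratedDeriv_cexp, norm_mul, norm_pow, Complex.norm_exp]
      gcongr
      · exact hμ ξ hξ
      · rw [← Real.exp_add]
        refine Real.exp_le_exp.mpr ?_
        have := mul_le_mul_of_nonneg_right (hre ξ hξ) ht.le
        simp only [Complex.mul_re, Complex.ofReal_re, Complex.ofReal_im, mul_zero, sub_zero]
        nlinarith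
    have h3 := hC₂ ξ (1 + t) (by linarith)
    have h9 : 0 ≤ max C₁ 0 * (3 ^ ((j + k) / 2 : ℝ) * Real.exp (θ / 2 * 3)) := by positivity
    calc _ ≤ |ξ| ^ j * ((Cμ * |ξ|) ^ k * (Real.exp θ * Real.exp (-(θ * ξ ^ 2 * (1 + t))))) := by
          gcongr
      _ = Cμ ^ k * Real.exp θ * (|ξ| ^ (j + k) * Real.exp (-(θ * ξ ^ 2 * (1 + t)))) := by
          rw [mul_pow, pow_add]; ring
      _ ≤ Cμ ^ k * Real.exp θ * (C₂ * (1 + t) ^ (-((j + k) / 2 : ℝ))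
            * Real.exp (-(θ / 2 * ξ ^ 2 * (1 + t)))) := by gcongr
      _ ≤ _ := by nlinarith [mul_nonneg h9 hX]

end TimeFactor

section PhaseBounds

variable {n : ℕ} {μ : ℝ → ℂ} {ε θ Cμ : ℝ} {φ χ : ℝ → ℝ}
  {q' : ℝ → CircleFun (EuclideanSpace ℂ (Fin n))}

theorem exists_mixedDeriv_phaseKernel_le (hφ : IsFrequencyCutoff ε φ) (hχ : IsTimeCutoff χ)
    (hs : ∀ r, JointlyContDiff r (timeFactor ε χ μ)) {R : ℕ}
    (hv : JointlyContDiff R (branchRow ε φ q')) (hε1 : 2 * ε ≤ 1) (hθ : 0 < θ)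
    (hre : ∀ ξ, |ξ| ≤ 2 * ε → (μ ξ).re ≤ -θ * ξ ^ 2) (hCμ : 0 ≤ Cμ)
    (hμ : ∀ ξ, |ξ| ≤ 2 * ε → ‖μ ξ‖ ≤ Cμ * |ξ|) (j k : ℕ) {r : ℕ} (hr : r ≤ R) :
    ∃ C, 0 ≤ C ∧ ∀ t, 0 < t → ∀ y i,
      (∀ x, ‖mixedDeriv (phaseKernel χ φ μ q') j k r x t y i‖
        ≤ C * (1 + t) ^ (-((j + k) / 2 : ℝ)) * (1 + t) ^ (-(1 / 2) : ℝ)) ∧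
      ∫⁻ x, ‖mixedDeriv (phaseKernel χ φ μ q') j k r x t y i‖ₑ ^ 2 ≤ ENNReal.ofReal
        ((C * (1 + t) ^ (-((j + k) / 2 : ℝ)) * (1 + t) ^ (-(1 / 4) : ℝ)) ^ 2) := by
  have hεπ : 2 * ε ≤ Real.pi := by linarith [Real.pi_gt_three]
  obtain ⟨C₁, hC₁0, hC₁⟩ := exists_norm_timeFactor_le hχ hs hε1 hθ hre hCμ hμ j k
  obtain ⟨C₂, hC₂⟩ := exists_norm_iteratedDeriv_branchRow_le hv hr
  have hC₂0 : 0 ≤ C₂ := (norm_nonneg _).trans (hC₂ 0 (by simpa using Real.pi_pos.le) 0)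
  refine ⟨(1 + √(Real.pi / (θ / 2))) * (2 * Real.pi * (C₁ * C₂)), by positivity,
    fun t ht y i => ?_⟩
  set h : ℝ → ℂ := fun ξ => (Complex.I * ξ) ^ j * iteratedDeriv k (timeFactor ε χ μ ξ) t
    * iteratedDeriv r (branchRow ε φ q' ξ) y i with hh
  have hscont : Continuous fun ξ => iteratedDeriv k (timeFactor ε χ μ ξ) t :=
    ((hs k).iteratedDeriv k le_rfl).1.comp (f := fun ξ => (ξ, t)) (by fun_prop)
  have hvcont : Continuous fun ξ => iteratedDeriv r (branchRow ε φ q' ξ) y :=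
    (hv.iteratedDeriv r hr).1.comp (f := fun ξ => (ξ, y)) (by fun_prop)
  have hc : Continuous h := ((by fun_prop : Continuous fun ξ : ℝ => (Complex.I * (ξ : ℂ)) ^ j).mul
    hscont).mul ((EuclideanSpace.proj (𝕜 := ℂ) i).continuous.comp hvcont)
  have e : ∀ x, mixedDeriv (phaseKernel χ φ μ q') j k r x t y i
      = ∫ ξ in -Real.pi..Real.pi, wave ξ x * h ξ := fun x => by
    rw [mixedDeriv_phaseKernel hφ hεπ hs hv j k hr]
    refine ((EuclideanSpace.proj (𝕜 := ℂ) i).intervalIntegral_comp_comm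
      (Continuous.intervalIntegrable ?_ _ _)).symm.trans
      (intervalIntegral.integral_congr fun ξ _ => ?_)
    · exact ((by fun_prop : Continuous fun ξ : ℝ => (Complex.I * (ξ : ℂ)) ^ j).mul
        (continuous_id.wave continuous_const)).smul (hscont.smul hvcont)
    · change ((Complex.I * ξ) ^ j * wave ξ x) * (_ * iteratedDeriv r (branchRow ε φ q' ξ) y i) = wave ξ x * (_ * _ * _)
      ring
  have hle : ∀ ξ, |ξ| ≤ Real.pi → ‖h ξ‖ ≤ C₁ * C₂ * (1 + t) ^ (-((j + k) / 2 : ℝ))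
      * Real.exp (-(θ / 2 * ξ ^ 2 * (1 + t))) := fun ξ hξ => by
    rcases le_or_gt (2 * ε) |ξ| with hbig | hsmall
    · have : branchRow ε φ q' ξ = fun _ => 0 := funext fun y => by
        simp [branchRow, hφ.2.2 ξ hbig]
      have h0 : h ξ = 0 := by
        simp only [hh, this, iteratedDeriv_const]
        split_ifs <;> simp
      rw [h0, norm_zero]
      positivity
    · have h1 := hC₁ t ht ξ hsmall.le
      have h2 := (PiLp.norm_apply_le (iteratedDeriv r (branchRow ε φ q' ξ) y) i).trans (hC₂ ξ hξ y)
      simp only [hh, norm_mul, norm_pow, Complex.norm_I, one_mul, Complex.norm_real,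
        Real.norm_eq_abs]
      calc _ ≤ (C₁ * (1 + t) ^ (-((j + k) / 2 : ℝ)) * Real.exp (-(θ / 2 * ξ ^ 2 * (1 + t)))) * C₂ := by
            gcongr
        _ = _ := by ring
  have := bounds_of_wave_integral hc (B := C₁ * C₂ * (1 + t) ^ (-((j + k) / 2 : ℝ)))
    (by positivity) (by positivity : 0 < θ / 2) (by linarith : 0 < 1 + t) hle
  simp only [e]
  refine ⟨fun x => (this.1 x).trans (le_of_eq (by ring)), this.2.trans (le_of_eq ?_)⟩
  ring_nf

theorem continuous_mixedDeriv_phaseKernel (hφ : IsFrequencyCutoff ε φ) (hε : 2 * ε ≤ Real.pi)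
    (hs : ∀ r, JointlyContDiff r (timeFactor ε χ μ)) {R : ℕ}
    (hv : JointlyContDiff R (branchRow ε φ q')) (j k : ℕ) {r : ℕ} (hr : r ≤ R) (t : ℝ) :
    Continuous fun p : ℝ × ℝ => mixedDeriv (phaseKernel χ φ μ q') j k r p.1 t p.2 := by
  simp only [mixedDeriv_phaseKernel hφ hε hs hv j k hr]
  refine continuous_intervalIntegral_param (X := ℝ × ℝ) (F := fun ξ p =>
    ((Complex.I * ξ) ^ j * wave ξ p.1) • iteratedDeriv k (timeFactor ε χ μ ξ) t
        • iteratedDeriv r (branchRow ε φ q' ξ) p.2) ?_ _ _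
  exact ((by fun_prop : Continuous fun p : ℝ × ℝ × ℝ => (Complex.I * (p.1 : ℂ)) ^ j).mul
      (continuous_fst.wave (continuous_fst.comp continuous_snd))).smul
    ((((hs k).iteratedDeriv k le_rfl).1.comp (f := fun p : ℝ × ℝ × ℝ => (p.1, t))
      (by fun_prop)).smul
    ((hv.iteratedDeriv r hr).1.comp (f := fun p : ℝ × ℝ × ℝ => (p.1, p.2.2)) (by fun_prop)))

end PhaseBounds

end

/-! ### Bloch decomposition of the evolution on the line -/

section

section ZakVector

variable {b : ℝ → ℂ} {R : ℕ}

theorem exists_norm_zak_le (hb : Continuous b) (hs : ∀ x : ℝ, (R : ℝ) ≤ |x| → b x = 0) :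
    ∃ C, ∀ ξ x, ‖zak b ξ x‖ ≤ C := by
  have hc : Continuous fun x : ℝ => ∑ m ∈ Finset.Icc (-(R + (1 : ℕ) : ℤ)) (R + (1 : ℕ)), ‖b (x + m)‖ :=
    continuous_finsetSum _ fun m _ => (hb.comp (continuous_add_const _)).norm
  obtain ⟨C, hC⟩ := (isCompact_Icc (a := (0 : ℝ)) (b := 1)).exists_bound_of_continuousOn
    hc.continuousOn
  refine ⟨C, fun ξ x => ?_⟩
  have hp : Function.Periodic (zak b ξ) 1 := zak_add_one b ξ
  obtain ⟨z, hz, hxz⟩ := hp.exists_mem_Ico₀ one_pos x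
  rw [hxz, zak_eq_sum hs (L := 1) (by rw [abs_of_nonneg hz.1]; exact_mod_cast hz.2.le)]
  refine (norm_sum_le _ _).trans (le_trans (le_of_eq ?_) ((le_abs_self _).trans (hC z ⟨hz.1, hz.2.le⟩)))
  exact Finset.sum_congr rfl fun m _ => by rw [norm_mul, norm_wave, one_mul]

variable {F : Type*} [NormedAddCommGroup F] [NormedSpace ℂ F]

/-- The Bloch transform of `b(x) v`. -/
def zakVec (hb : Continuous b) (hs : ∀ x : ℝ, (R : ℝ) ≤ |x| → b x = 0) (v : F) (ξ : ℝ) :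
    CircleFun F :=
  CircleFun.mk (fun x => zak b ξ x • v)
    (((continuous_zak hb hs).comp (f := fun x => (ξ, x)) (by fun_prop)).smul continuous_const)
    fun x => by simp only [zak_add_one]

/-- Bloch decomposition of the evolution of `b(x) v`. -/
theorem PeriodicPotential.evol_smul_eq_integral [CompleteSpace F] (N : PeriodicPotential F) (d : ℝ)
    (hb : Continuous b) (hs : ∀ x : ℝ, (R : ℝ) ≤ |x| → b x = 0) (v : F) (t y : ℝ) :
    (Continuous fun ξ => wave (-ξ) y • N.blochEvol d ξ t (zakVec hb hs v ξ) y) ∧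
    (2 * Real.pi : ℂ) • evol N.op d t (fun x => b x • v) y
      = ∫ ξ in -Real.pi..Real.pi, wave (-ξ) y • N.blochEvol d ξ t (zakVec hb hs v ξ) y := by
  obtain ⟨C, hC⟩ := exists_norm_zak_le hb hs
  have ha : Continuous (Function.uncurry fun ξ x => wave (-ξ) x • zak b ξ x • v) :=
    (continuous_fst.neg.wave continuous_snd).smul ((continuous_zak hb hs).smul continuous_const)
  have hbd : ∀ ξ x, ‖wave (-ξ) x • zak b ξ x • v‖ ≤ C * ‖v‖ := fun ξ x => by
    rw [norm_smul, norm_wave, one_mul, norm_smul]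
    exact mul_le_mul_of_nonneg_right (hC ξ x) (norm_nonneg _)
  have e : ∀ ξ, wave (-ξ) y • N.blochEvol d ξ t (zakVec hb hs v ξ) y
      = evol N.op d t (fun x => wave (-ξ) x • zak b ξ x • v) y := fun ξ =>
    N.wave_smul_blochEvol d ξ t _ y
  simp only [e]
  refine ⟨continuous_evol N.continuous N.norm_le (X := ℝ) ha (A := fun _ => C * ‖v‖)
    continuous_const hbd continuous_const continuous_const, ?_⟩
  rw [← evol_intervalIntegral N.continuous N.norm_le ha (by linarith [Real.pi_pos])
    (fun ξ _ => hbd ξ), ← evol_const_smul]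
  congr 1
  funext x
  have h1 : ∀ ξ, wave (-ξ) x • zak b ξ x • v = (wave (-ξ) x * zak b ξ x) • v := fun ξ =>
    smul_smul _ _ _
  simp only [h1, intervalIntegral.integral_smul_const, integral_wave_mul_zak hs, smul_smul]

end ZakVector

/-! ### Decay of the remainder kernel -/

section GreenRemainder

variable {n : ℕ} {N N' : PeriodicPotential (EuclideanSpace ℂ (Fin n))} {c : ℝ}
  {w₀ : CircleFun (EuclideanSpace ℂ (Fin n))} {ε₀ : ℝ} {μ : ℝ → ℂ}
  {q q' : ℝ → CircleFun (EuclideanSpace ℂ (Fin n))} {θ ε Cφ : ℝ} {φ χ : ℝ → ℝ}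

theorem norm_pair_le_integral (a w : CircleFun (EuclideanSpace ℂ (Fin n))) :
    ‖pair a w‖ ≤ n * ‖w‖ * ∫ x in (0 : ℝ)..1, ‖a x‖ := by
  rw [pair_apply, ← intervalIntegral.integral_const_mul]
  refine intervalIntegral.norm_integral_le_of_norm_le zero_le_one
    (Eventually.of_forall fun x _ => ?_)
    ((continuous_const.mul (CircleFun.continuous a).norm).intervalIntegrable _ _)
  refine (norm_bilinPair_le _ _).trans ?_
  calc _ ≤ n * ‖a x‖ * ‖w‖ := by gcongr; exact CircleFun.norm_apply_le w x
    _ = _ := by ring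

/-- In the projection onto the critical mode, q(ξ) is replaced by its value w₀ at ξ = 0. With q(ξ)
the remainder decays exponentially, one unit of time being spent on the smoothing from L¹ to sup.
The replacement costs a multiple of |ξ| times the L¹ norm of W, and |ξ| e^{-θξ²(1+t)} supplies the
factor (1 + t)^{-1/2}. -/
theorem IsSpectralBranch.exists_norm_blochEvol_sub_le (hb : IsSpectralBranch N N' c w₀ ε₀ μ q q')
    (hN : IsTranspose N N') (hk : IsSimpleKernel N c w₀) (hS : IsDiffusivelyStable N' c θ)
    (hε₀ : ε₀ ≤ 1) (hε : 0 < ε) (hε' : 2 * ε < ε₀) (hφ : IsFrequencyCutoff ε φ) :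
    ∃ C a, 0 ≤ C ∧ 0 < a ∧ ∀ ξ, |ξ| ≤ Real.pi → ∀ t, 2 ≤ t →
      ∀ W : CircleFun (EuclideanSpace ℂ (Fin n)),
      ‖N'.blochEvol (-c) ξ t W - (φ ξ * Complex.exp (μ ξ * t) * pair W w₀) • q' ξ‖
        ≤ C * (1 + t) ^ (-(1 / 2) : ℝ) * Real.exp (-(a * ξ ^ 2 * (1 + t)))
          * ∫ x in (0 : ℝ)..1, ‖W x‖ := by
  have hmem : ∀ ξ, |ξ| ≤ 2 * ε → ξ ∈ Set.Ioo (-ε₀) ε₀ := fun ξ hξ =>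
    abs_lt.mp (hξ.trans_lt hε')
  have hθ := hS.pos
  obtain ⟨Cφ, hCφ0, hCφ⟩ : ∃ C, 0 ≤ C ∧ ∀ ξ, |φ ξ| ≤ C := by
    obtain ⟨C, hC⟩ := (isCompact_Icc (a := -(2 * ε)) (b := 2 * ε)).exists_bound_of_continuousOn
      hφ.1.continuous.continuousOn
    refine ⟨max C 0, le_max_right _ _, fun ξ => ?_⟩
    rcases le_or_gt (2 * ε) |ξ| with h | h
    · rw [hφ.2.2 ξ h, abs_zero]
      exact le_max_right _ _
    · exact (hC ξ (abs_le.mp h.le)).trans (le_max_left _ _)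
  obtain ⟨C₁, η, hη, h₁⟩ := hb.exists_norm_remainder_le hN hk hS hε₀ hε hε' hφ.2.1 hφ.2.2 hCφ
  obtain ⟨C₂, hC₂, h₂⟩ := N'.exists_norm_blochEvol_one_le (-c)
  obtain ⟨C₃, hC₃, h₃⟩ := hb.right_analytic.exists_norm_sub_zero_le hε'
  obtain ⟨C₄, h₄⟩ := (isCompact_Icc (a := -(2 * ε)) (b := 2 * ε)).exists_bound_of_continuousOn
    (hb.left_analytic.continuousOn.mono fun ξ hξ => hmem ξ (abs_le.mpr hξ))
  have hC₄ : 0 ≤ C₄ := (norm_nonneg _).trans (h₄ 0 ⟨by linarith, by linarith⟩)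
  obtain ⟨C₅, hC₅, h₅⟩ := exists_pow_mul_exp_le (l := 1) hθ
  -- The exponential rate is recast as a Gaussian: aξ² ≤ η/2 for |ξ| ≤ π. Half of the exponential
  -- provides this Gaussian, the other half the algebraic factor.
  set a : ℝ := min (θ / 2) (η / (2 * Real.pi ^ 2)) with ha
  have hπ := Real.pi_pos
  have hapos : 0 < a := lt_min (by linarith) (by positivity)
  have haθ : a ≤ θ / 2 := min_le_left _ _
  have haη : a * Real.pi ^ 2 ≤ η / 2 := by
    have := mul_le_mul_of_nonneg_right (min_le_right (θ / 2) (η / (2 * Real.pi ^ 2)))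
      (sq_nonneg Real.pi)
    refine this.trans (le_of_eq ?_)
    field_simp
  have hη2 : ∀ T : ℝ, 0 < T → Real.exp (-(η / 2 * T)) ≤ (2 / η + 1) * T ^ (-(1 / 2) : ℝ) := by
    intro T hT
    have h := Real.add_one_le_exp (η / 2 * T)
    rw [Real.rpow_neg hT.le, ← Real.sqrt_eq_rpow, Real.exp_neg, inv_eq_one_div, ← div_eq_mul_inv,
      div_le_div_iff₀ (Real.exp_pos _) (Real.sqrt_pos.mpr hT), one_mul]
    have h2 : √T ≤ 1 + T := by nlinarith [Real.sq_sqrt hT.le, sq_nonneg (√T - 1)]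
    have h3 : 1 + T ≤ (2 / η + 1) * (η / 2 * T + 1) := by
      have : (2 / η + 1) * (η / 2 * T + 1) = T + 1 + (2 / η + η / 2 * T) := by
        field_simp
        ring
      rw [this]
      have : 0 < 2 / η + η / 2 * T := by positivity
      linarith
    exact h2.trans (h3.trans (mul_le_mul_of_nonneg_left h (by positivity)))
  set A₁ := |C₁| * C₂ * Real.exp (2 * η) * (2 / η + 1)
  set A₂ := Cφ * Real.exp θ * (n * C₃ * C₅) * C₄
  refine ⟨A₁ + A₂, a, by positivity, hapos, fun ξ hξ t ht W => ?_⟩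
  set I := ∫ x in (0 : ℝ)..1, ‖W x‖ with hI
  have hI0 : 0 ≤ I := intervalIntegral.integral_nonneg zero_le_one fun x _ => norm_nonneg _
  have hξ2 : ξ ^ 2 ≤ Real.pi ^ 2 := sq_le_sq' (abs_le.mp hξ).1 (abs_le.mp hξ).2
  have hT : 0 < 1 + t := by linarith
  have s1 : ‖N'.blochEvol (-c) ξ t W - (φ ξ * Complex.exp (μ ξ * t) * pair W (q ξ)) • q' ξ‖
      ≤ A₁ * (1 + t) ^ (-(1 / 2) : ℝ) * Real.exp (-(a * ξ ^ 2 * (1 + t))) * I := by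
    have h := h₁ ξ hξ (t - 1) (by linarith) (N'.blochEvol (-c) ξ 1 W)
    rw [N'.blochEvol_blochEvol (-c) (by linarith) zero_le_one, sub_add_cancel] at h
    -- The unit of time used for smoothing returns in the critical coefficient, because pairing with
    -- q turns the evolution into multiplication by e^μ.
    have hpq : (φ ξ : ℂ) * Complex.exp (μ ξ * (t - 1 : ℝ)) * pair (N'.blochEvol (-c) ξ 1 W) (q ξ)
        = φ ξ * Complex.exp (μ ξ * t) * pair W (q ξ) := by
      rcases le_or_gt (2 * ε) |ξ| with hbig | hsmall
      · simp [hφ.2.2 ξ hbig]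
      · rw [pair_blochEvol hN (hξ.trans Real.pi_lt_four.le)
          (hb.right_solution ξ (hmem ξ hsmall.le)) W zero_le_one, ← mul_assoc,
          mul_assoc (φ ξ : ℂ), ← Complex.exp_add]
        push_cast
        ring_nf
    rw [hpq] at h
    refine h.trans ?_
    have e1 : Real.exp (-(η * (t - 1)))
        = Real.exp (2 * η) * (Real.exp (-(η / 2 * (1 + t))) * Real.exp (-(η / 2 * (1 + t)))) := by
      rw [← Real.exp_add, ← Real.exp_add]
      ring_nf
    have e2 : Real.exp (-(η / 2 * (1 + t))) ≤ Real.exp (-(a * ξ ^ 2 * (1 + t))) := by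
      refine Real.exp_le_exp.mpr (neg_le_neg (mul_le_mul_of_nonneg_right ?_ hT.le))
      exact (mul_le_mul_of_nonneg_left hξ2 hapos.le).trans haη
    calc C₁ * Real.exp (-η * (t - 1)) * ‖N'.blochEvol (-c) ξ 1 W‖
        ≤ |C₁| * Real.exp (-(η * (t - 1))) * (C₂ * I) := by
          rw [neg_mul]
          gcongr
          · exact le_abs_self _
          · exact h₂ ξ W
      _ ≤ |C₁| * (Real.exp (2 * η) * ((2 / η + 1) * (1 + t) ^ (-(1 / 2) : ℝ)
            * Real.exp (-(a * ξ ^ 2 * (1 + t))))) * (C₂ * I) := by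
          rw [e1]
          gcongr
          exact hη2 _ hT
      _ = _ := by ring
  have s2 : ‖(φ ξ * Complex.exp (μ ξ * t) * pair W (q ξ - w₀)) • q' ξ‖
      ≤ A₂ * (1 + t) ^ (-(1 / 2) : ℝ) * Real.exp (-(a * ξ ^ 2 * (1 + t))) * I := by
    rcases le_or_gt (2 * ε) |ξ| with hbig | hsmall
    · rw [hφ.2.2 ξ hbig, Complex.ofReal_zero, zero_mul, zero_mul, zero_smul, norm_zero]
      positivity
    have h0 := hb.re_le hS hε₀ (hmem ξ hsmall.le)
    have hq := h₃ ξ hsmall.le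
    rw [hb.right_zero] at hq
    have h5 := h₅ ξ (1 + t) hT
    rw [pow_one, Nat.cast_one] at h5
    have hE : ‖Complex.exp (μ ξ * t)‖ ≤ Real.exp θ * Real.exp (-(θ * ξ ^ 2 * (1 + t))) := by
      rw [Complex.norm_exp, ← Real.exp_add]
      refine Real.exp_le_exp.mpr ?_
      have h1 := mul_le_mul_of_nonneg_right h0 (by linarith : 0 ≤ t)
      have h2 : ξ ^ 2 ≤ 1 := by
        rw [sq_le_one_iff_abs_le_one]
        linarith
      simp only [Complex.mul_re, Complex.ofReal_re, Complex.ofReal_im, mul_zero, sub_zero]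
      nlinarith
    have hexp : Real.exp (-(θ / 2 * ξ ^ 2 * (1 + t))) ≤ Real.exp (-(a * ξ ^ 2 * (1 + t))) :=
      Real.exp_le_exp.mpr (neg_le_neg (by gcongr))
    rw [norm_smul, norm_mul, norm_mul, Complex.norm_real, Real.norm_eq_abs]
    calc _ ≤ Cφ * (Real.exp θ * Real.exp (-(θ * ξ ^ 2 * (1 + t))))
            * (n * (C₃ * |ξ|) * I) * C₄ := by
          gcongr
          · exact hCφ ξ
          · exact (norm_pair_le_integral _ _).trans (by gcongr)
          · exact h₄ ξ (abs_le.mp hsmall.le)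
      _ = Cφ * Real.exp θ * (n * C₃) * C₄ * I
            * (|ξ| * Real.exp (-(θ * ξ ^ 2 * (1 + t)))) := by ring
      _ ≤ Cφ * Real.exp θ * (n * C₃) * C₄ * I
            * (C₅ * (1 + t) ^ (-(1 / 2) : ℝ) * Real.exp (-(a * ξ ^ 2 * (1 + t)))) := by
          refine mul_le_mul_of_nonneg_left (h5.trans ?_) (by positivity)
          exact mul_le_mul_of_nonneg_left hexp (by positivity)
      _ = _ := by ring
  have e : N'.blochEvol (-c) ξ t W - (φ ξ * Complex.exp (μ ξ * t) * pair W w₀) • q' ξ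
      = (N'.blochEvol (-c) ξ t W - (φ ξ * Complex.exp (μ ξ * t) * pair W (q ξ)) • q' ξ)
        + (φ ξ * Complex.exp (μ ξ * t) * pair W (q ξ - w₀)) • q' ξ := by
    rw [map_sub, mul_sub, sub_smul]
    abel
  rw [e]
  exact (norm_add_le _ _).trans ((add_le_add s1 s2).trans (le_of_eq (by ring)))

/-- For fixed y the remainder is tested in x against b. The Green kernel contributes the Bloch
evolution of b e_i, and w₀ e contributes its critical part with w₀ in place of q. The previous
estimate is then a Gaussian bound on the symbol of the difference. -/
theorem IsSpectralBranch.exists_greenRemainder_le (hb : IsSpectralBranch N N' c w₀ ε₀ μ q q')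
    (hN : IsTranspose N N') (hk : IsSimpleKernel N c w₀) (hS : IsDiffusivelyStable N' c θ)
    (hε₀ : ε₀ ≤ 1) (hε : 0 < ε) (hε' : 2 * ε < ε₀) (hφ : IsFrequencyCutoff ε φ)
    (hχ : IsTimeCutoff χ) :
    ∃ C, 0 ≤ C ∧ ∀ t, 2 ≤ t → ∀ y i j,
      (∀ x, ‖evolKernel N'.op (-c) y t x (EuclideanSpace.single i 1) j
          - w₀ x i * phaseKernel χ φ μ q' x t y j‖
        ≤ C * (1 + t) ^ (-(1 / 2) : ℝ) * (1 + t) ^ (-(1 / 2) : ℝ)) ∧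
      ∫⁻ x, ‖evolKernel N'.op (-c) y t x (EuclideanSpace.single i 1) j
          - w₀ x i * phaseKernel χ φ μ q' x t y j‖ₑ ^ 2
        ≤ ENNReal.ofReal ((C * (1 + t) ^ (-(1 / 2) : ℝ) * (1 + t) ^ (-(1 / 4) : ℝ)) ^ 2) := by
  obtain ⟨C, a, hC, ha, hle⟩ := hb.exists_norm_blochEvol_sub_le hN hk hS hε₀ hε hε' hφ
  refine ⟨(1 + √(Real.pi / a)) * C, by positivity, fun t ht y i j => ?_⟩
  have hπ := Real.pi_pos
  have hεπ : 2 * ε ≤ Real.pi := by linarith [Real.pi_gt_three]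
  have ht0 : 0 < t := by linarith
  have hmu := hb.continuous_mu_clampFreq hε hε'
  set v : EuclideanSpace ℂ (Fin n) := EuclideanSpace.single i 1 with hv
  set h : ℝ → ℂ := fun ξ => timeFactor ε χ μ ξ t * branchRow ε φ q' ξ y j with hh
  have hrow : Continuous fun ξ => branchRow ε φ q' ξ y := by
    have h1 : Continuous fun ξ => q' (clampFreq ε ξ) y :=
      (continuous_eval_const (F := C(AddCircle (1 : ℝ), EuclideanSpace ℂ (Fin n)))
        (y : AddCircle (1 : ℝ))).comp (hb.continuous_left_clampFreq hε hε')
    exact ((Complex.continuous_ofReal.comp hφ.1.continuous).mul continuous_const).smul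
      (((continuous_clampFreq ε).neg.wave continuous_const).smul h1)
  have htf : Continuous fun ξ => timeFactor ε χ μ ξ t :=
    (jointlyContDiff_timeFactor hχ.1 hmu 0).comp (f := fun ξ => (ξ, t)) (by fun_prop)
  have hhc : Continuous h := htf.mul ((EuclideanSpace.proj (𝕜 := ℂ) j).continuous.comp hrow)
  have hphase : ∀ x, phaseKernel χ φ μ q' x t y j = ∫ ξ in -Real.pi..Real.pi, wave ξ x * h ξ := by
    intro x
    rw [phaseKernel_eq_integral hφ hεπ]
    exact ((EuclideanSpace.proj (𝕜 := ℂ) j).intervalIntegral_comp_comm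
      (((continuous_id.wave continuous_const).smul (htf.smul hrow)).intervalIntegrable _ _)).symm
  have hhξ : ∀ ξ, h ξ = (2 * Real.pi : ℂ)⁻¹ * (wave (-ξ) y
      * (φ ξ * Complex.exp (μ ξ * t) * q' ξ y j)) := by
    intro ξ
    simp only [hh, timeFactor, branchRow, hχ.2.2 t ht, PiLp.smul_apply, smul_eq_mul]
    rcases le_or_gt (2 * ε) |ξ| with hbig | hsmall
    · simp [hφ.2.2 ξ hbig]
    · rw [clampFreq_eq hsmall.le]
      push_cast
      ring
  have hevc : Continuous fun x => evolKernel N'.op (-c) y t x v j :=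
    (EuclideanSpace.proj (𝕜 := ℂ) j).continuous.comp
      ((((continuousOn_evolKernel N'.continuous N'.norm_le).comp_continuous
        (f := fun x : ℝ => (x, t, y)) (by fun_prop) fun x => ht0)).clm_apply continuous_const)
  have hw : Continuous fun x : ℝ => w₀ x i :=
    (EuclideanSpace.proj (𝕜 := ℂ) i).continuous.comp (CircleFun.continuous w₀)
  have hphc : Continuous fun x => ∫ ξ in -Real.pi..Real.pi, wave ξ x * h ξ :=
    continuous_intervalIntegral_param (F := fun ξ x => wave ξ x * h ξ)
      (continuous_wave.mul (hhc.comp continuous_fst)) _ _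
  simp only [hphase]
  have key := bounds_of_gaussian_symbol (g := fun x => evolKernel N'.op (-c) y t x v j
    - w₀ x i * ∫ ξ in -Real.pi..Real.pi, wave ξ x * h ξ) (B := C * (1 + t) ^ (-(1 / 2) : ℝ))
    (T := 1 + t) (hevc.sub (hw.mul hphc)) (by positivity) ha (by linarith) fun b R hbc hs => ?_
  · exact ⟨fun x => (key.1 x).trans (le_of_eq (by ring)), key.2.trans (le_of_eq (by ring_nf))⟩
  obtain ⟨hUc, hU⟩ := N'.evol_smul_eq_integral (-c) hbc hs v t y
  have hbv : Continuous fun x => b x • v := hbc.smul continuous_const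
  obtain ⟨Cb, hCb⟩ : ∃ Cb, ∀ x, ‖b x • v‖ ≤ Cb :=
    hbv.bounded_above_of_compact_support (HasCompactSupport.of_support_subset_isCompact
      (isCompact_Icc (a := -(R : ℝ)) (b := R)) fun x hx => abs_le.mp (le_of_not_ge fun hR =>
        hx (by simp [hs x hR])))
  have hkint := integrable_evolKernel_apply (d := -c) (y := y) N'.continuous N'.norm_le ht0 hbv hCb
  have e1 : ∫ x, b x * evolKernel N'.op (-c) y t x v j
      = ∫ ξ in -Real.pi..Real.pi, (2 * Real.pi : ℂ)⁻¹
        * (wave (-ξ) y * N'.blochEvol (-c) ξ t (zakVec hbc hs v ξ) y j) := by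
    have h1 : ∫ x, b x * evolKernel N'.op (-c) y t x v j
        = evol N'.op (-c) t (fun x => b x • v) y j := by
      rw [evol_eq_integral ht0]
      refine Eq.trans ?_ ((EuclideanSpace.proj (𝕜 := ℂ) j).integral_comp_comm hkint)
      refine integral_congr_ae (Eventually.of_forall fun x => ?_)
      simp only [map_smul]
      rfl
    have h2 := congrArg (fun w : EuclideanSpace ℂ (Fin n) => w j) hU
    have h3 := (EuclideanSpace.proj (𝕜 := ℂ) j).intervalIntegral_comp_comm
      (hUc.intervalIntegrable (μ := volume) (-Real.pi) Real.pi)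
    have h4 : (2 * Real.pi : ℂ) * evol N'.op (-c) t (fun x => b x • v) y j
        = ∫ ξ in -Real.pi..Real.pi,
          wave (-ξ) y * N'.blochEvol (-c) ξ t (zakVec hbc hs v ξ) y j := h2.trans h3.symm
    rw [h1, intervalIntegral.integral_const_mul, ← h4, inv_mul_cancel_left₀]
    exact_mod_cast (by positivity : 2 * Real.pi ≠ 0)
  have hpair : ∀ ξ, ∫ x in (0 : ℝ)..1, zak b ξ x * w₀ x i = pair (zakVec hbc hs v ξ) w₀ := by
    intro ξ
    rw [pair_apply]
    refine intervalIntegral.integral_congr fun x _ => ?_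
    change _ = bilinPair (zak b ξ x • v) (w₀ x)
    rw [bilinPair_smul_left]
    simp [hv, bilinPair]
  have e2 := integral_mul_wave_integral hbc hs hhc (fun x => w₀ x i) hw
    (fun x => by simp only [CircleFun.add_one]) (-Real.pi) Real.pi
  simp only [hpair] at e2
  have hi1 : Integrable fun x => b x * evolKernel N'.op (-c) y t x v j :=
    integrable_of_abs_ge (R := R) (hbc.mul hevc) fun x hx => by rw [hs x hx, zero_mul]
  have hi2 : Integrable fun x => b x * (w₀ x i * ∫ ξ in -Real.pi..Real.pi, wave ξ x * h ξ) :=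
    integrable_of_abs_ge (R := R) (hbc.mul (hw.mul hphc)) fun x hx => by rw [hs x hx, zero_mul]
  simp only [mul_sub]
  have hzc : Continuous (Function.uncurry fun x ξ => zak b ξ x) :=
    (continuous_zak hbc hs).comp (f := Prod.swap) continuous_swap
  have hpc : Continuous fun ξ => pair (zakVec hbc hs v ξ) w₀ := by
    simp only [← hpair]
    exact continuous_intervalIntegral_param (F := fun x ξ => zak b ξ x * w₀ x i)
      (hzc.mul (hw.comp continuous_fst)) 0 1
  have hUj : Continuous fun ξ => (2 * Real.pi : ℂ)⁻¹
      * (wave (-ξ) y * N'.blochEvol (-c) ξ t (zakVec hbc hs v ξ) y j) :=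
    continuous_const.mul ((EuclideanSpace.proj (𝕜 := ℂ) j).continuous.comp hUc)
  have hhp : Continuous fun ξ => h ξ * pair (zakVec hbc hs v ξ) w₀ := hhc.mul hpc
  rw [integral_sub hi1 hi2, e1, e2, ← intervalIntegral.integral_sub
    (hUj.intervalIntegrable _ _) (hhp.intervalIntegrable _ _),
    ← intervalIntegral.integral_const_mul]
  refine intervalIntegral.norm_integral_le_of_norm_le (by linarith)
    (Eventually.of_forall fun ξ hξ => ?_) (Continuous.intervalIntegrable ?_ _ _)
  · have e3 : (2 * Real.pi : ℂ)⁻¹ * (wave (-ξ) y * N'.blochEvol (-c) ξ t (zakVec hbc hs v ξ) y j)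
        - h ξ * pair (zakVec hbc hs v ξ) w₀
        = (2 * Real.pi : ℂ)⁻¹ * (wave (-ξ) y * (N'.blochEvol (-c) ξ t (zakVec hbc hs v ξ)
          - (φ ξ * Complex.exp (μ ξ * t) * pair (zakVec hbc hs v ξ) w₀) • q' ξ) y j) := by
      rw [hhξ, CircleFun.sub_apply, CircleFun.smul_apply, PiLp.sub_apply, PiLp.smul_apply,
        smul_eq_mul]
      ring
    have e4 : ∫ x in (0 : ℝ)..1, ‖zakVec hbc hs v ξ x‖ = ∫ x in (0 : ℝ)..1, ‖zak b ξ x‖ := by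
      refine intervalIntegral.integral_congr fun x _ => ?_
      change ‖zak b ξ x • v‖ = _
      simp [norm_smul, hv]
    have h5 := hle ξ (abs_le.mpr ⟨hξ.1.le, hξ.2⟩) t ht (zakVec hbc hs v ξ)
    rw [e4] at h5
    have h6 := ((PiLp.norm_apply_le ((N'.blochEvol (-c) ξ t (zakVec hbc hs v ξ)
      - (φ ξ * Complex.exp (μ ξ * t) * pair (zakVec hbc hs v ξ) w₀) • q' ξ) y) j).trans
      (CircleFun.norm_apply_le _ y)).trans h5
    rw [e3, norm_mul, norm_mul, norm_wave, one_mul, norm_inv]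
    have h7 : ‖(2 * Real.pi : ℂ)‖ = 2 * Real.pi := by
      rw [norm_mul, Complex.norm_real, Real.norm_of_nonneg hπ.le]
      simp
    rw [h7]
    gcongr
  · exact continuous_const.mul ((by fun_prop : Continuous fun ξ : ℝ =>
      C * (1 + t) ^ (-(1 / 2) : ℝ) * Real.exp (-(a * ξ ^ 2 * (1 + t)))).mul
        (continuous_intervalIntegral_param (F := fun x ξ => ‖zak b ξ x‖) hzc.norm 0 1))

end GreenRemainder

end

/-! ### Integral operators between Lebesgue spaces -/

section

section KernelOperators

/-- Interpolation through |h|^P ≤ A^{P-2}|h|² for finite P = p ≥ 2; for p = ∞ the exponents reduce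
to the sup bound. -/
theorem hasLpBound_of_sup_of_sq {E : Type*} [NormedAddCommGroup E] {h : ℝ → E}
    (hm : AEStronglyMeasurable h) {A B : ℝ} (hA : 0 ≤ A) (hB : 0 ≤ B) (hsup : ∀ x, ‖h x‖ ≤ A)
    (hsq : ∫⁻ x, ‖h x‖ₑ ^ 2 ≤ ENNReal.ofReal (B ^ 2)) {p : ENNReal} (hp : 2 ≤ p) :
    HasLpBound h p (A ^ (1 - 2 * (p⁻¹).toReal) * B ^ (2 * (p⁻¹).toReal)) := by
  have key : eLpNorm h p volume
      ≤ ENNReal.ofReal (A ^ (1 - 2 * (p⁻¹).toReal) * B ^ (2 * (p⁻¹).toReal)) := by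
    rcases eq_or_ne p ⊤ with rfl | hpt
    · simp only [ENNReal.inv_top, ENNReal.toReal_zero, mul_zero, sub_zero, Real.rpow_one,
        Real.rpow_zero, mul_one, eLpNorm_exponent_top]
      exact eLpNormEssSup_le_of_ae_bound (Eventually.of_forall hsup)
    have hp0 : p ≠ 0 := (zero_lt_two.trans_le hp).ne'
    set P := p.toReal with hP
    have hP2 : 2 ≤ P := by simpa using ENNReal.toReal_mono hpt hp
    have hP0 : 0 < P := by linarith
    rw [eLpNorm_eq_lintegral_rpow_enorm_toReal hp0 hpt, ENNReal.toReal_inv, ← hP, one_div]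
    have h1 : ∫⁻ x, ‖h x‖ₑ ^ P ≤ ENNReal.ofReal (A ^ (P - 2)) * ENNReal.ofReal (B ^ 2) := by
      calc ∫⁻ x, ‖h x‖ₑ ^ P ≤ ∫⁻ x, ENNReal.ofReal (A ^ (P - 2)) * ‖h x‖ₑ ^ 2 := by
            refine lintegral_mono fun x => ?_
            have e : ‖h x‖ₑ ^ P = ‖h x‖ₑ ^ (P - 2) * ‖h x‖ₑ ^ 2 := by
              rw [← ENNReal.rpow_natCast, ← ENNReal.rpow_add_of_nonneg _ _ (by linarith)
                (by norm_num)]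
              norm_num
            rw [e, ← ENNReal.ofReal_rpow_of_nonneg hA (by linarith)]
            refine mul_le_mul' (ENNReal.rpow_le_rpow ?_ (by linarith)) le_rfl
            rw [← ofReal_norm]
            exact ENNReal.ofReal_le_ofReal (hsup x)
        _ = ENNReal.ofReal (A ^ (P - 2)) * ∫⁻ x, ‖h x‖ₑ ^ 2 :=
            lintegral_const_mul' _ _ ENNReal.ofReal_ne_top
        _ ≤ _ := by gcongr
    refine (ENNReal.rpow_le_rpow h1 (by positivity)).trans (le_of_eq ?_)
    rw [← ENNReal.ofReal_mul (by positivity), ENNReal.ofReal_rpow_of_nonneg (by positivity)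
      (by positivity), Real.mul_rpow (by positivity) (by positivity), ← Real.rpow_mul hA,
      ← Real.rpow_natCast B, ← Real.rpow_mul hB]
    congr 3
    field_simp
  refine ⟨⟨hm, key.trans_lt ENNReal.ofReal_lt_top⟩, ?_⟩
  exact ENNReal.toReal_le_of_le_ofReal (by positivity) key

theorem HasLpBound.mono {E : Type*} [NormedAddCommGroup E] {h : ℝ → E} {p : ENNReal} {A B : ℝ}
    (hh : HasLpBound h p A) (hAB : A ≤ B) : HasLpBound h p B := ⟨hh.1, hh.2.trans hAB⟩

theorem HasLpBound.sub {E : Type*} [NormedAddCommGroup E] {h k : ℝ → E} {p : ENNReal} {A B : ℝ}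
    (hh : HasLpBound h p A) (hk : HasLpBound k p B) (hp : 1 ≤ p) :
    HasLpBound (fun x => h x - k x) p (A + B) := by
  refine ⟨hh.1.sub hk.1, ?_⟩
  have := eLpNorm_sub_le hh.1.1 hk.1.1 hp
  refine (ENNReal.toReal_mono (ENNReal.add_ne_top.mpr ⟨hh.1.2.ne, hk.1.2.ne⟩) this).trans ?_
  rw [ENNReal.toReal_add hh.1.2.ne hk.1.2.ne]
  exact add_le_add hh.2 hk.2

theorem lintegral_mul_sq_le {a b : ℝ → ENNReal} (ha : AEMeasurable a) (hb : AEMeasurable b) :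
    (∫⁻ y, a y * b y) ^ 2 ≤ (∫⁻ y, a y ^ 2) * ∫⁻ y, b y ^ 2 := by
  have h := ENNReal.lintegral_mul_le_Lp_mul_Lq volume Real.HolderConjugate.two_two ha hb
  have := pow_le_pow_left₀ zero_le h 2
  refine this.trans (le_of_eq ?_)
  rw [mul_pow, ← ENNReal.rpow_natCast, ← ENNReal.rpow_natCast, ← ENNReal.rpow_mul,
    ← ENNReal.rpow_mul]
  norm_num

/-- Cauchy-Schwarz with the weight b split into two square roots. -/
theorem lintegral_weight_mul_sq_le {a b : ℝ → ENNReal} (ha : AEMeasurable a)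
    (hb : AEMeasurable b) :
    (∫⁻ y, a y * b y) ^ 2 ≤ (∫⁻ y, a y ^ 2 * b y) * ∫⁻ y, b y := by
  have h := lintegral_mul_sq_le (ha.mul (hb.pow_const (1 / 2 : ℝ))) (hb.pow_const (1 / 2 : ℝ))
  have e : ∀ z : ENNReal, z ^ (1 / 2 : ℝ) * z ^ (1 / 2 : ℝ) = z := fun z => by
    rw [← ENNReal.rpow_add_of_nonneg _ _ (by norm_num) (by norm_num)]
    norm_num
  have e2 : ∀ z : ENNReal, (z ^ (1 / 2 : ℝ)) ^ 2 = z := fun z => by rw [sq, e]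
  simpa only [Pi.mul_apply, mul_assoc, mul_pow, e, e2] using h

variable {E E' : Type*} [NormedAddCommGroup E] [NormedSpace ℂ E] [NormedAddCommGroup E']
  [NormedSpace ℂ E'] {L : ℝ → ℝ → E →L[ℂ] E'} {g : ℝ → E} {p : ENNReal}

theorem aestronglyMeasurable_kernel_apply (hL : Continuous fun z : ℝ × ℝ => L z.1 z.2)
    (hg : AEStronglyMeasurable g) :
    AEStronglyMeasurable (fun z : ℝ × ℝ => L z.1 z.2 (g z.2)) (volume.prod volume) :=
  (isBoundedBilinearMap_apply (𝕜 := ℂ) (E := E) (F := E')).continuous.comp_aestronglyMeasurable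
    (hL.aestronglyMeasurable.prodMk hg.comp_snd)

theorem enorm_integral_kernel_le (x : ℝ) :
    ‖∫ y, L x y (g y)‖ₑ ≤ ∫⁻ y, ‖L x y‖ₑ * ‖g y‖ₑ :=
  (enorm_integral_le_lintegral_enorm _).trans
    (lintegral_mono fun y => ContinuousLinearMap.le_opENorm (L x y) (g y))

/-- At p = 2, Cauchy-Schwarz with weight |g(y)| followed by Tonelli reproduces Minkowski's
inequality. The bound at p = ∞ is immediate, and the rest is interpolation. -/
theorem hasLpBound_kernel_of_memLp_one (hL : Continuous fun z : ℝ × ℝ => L z.1 z.2) {A B : ℝ}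
    (hA : 0 ≤ A) (hB : 0 ≤ B) (hsup : ∀ x y, ‖L x y‖ ≤ A)
    (hsq : ∀ y, ∫⁻ x, ‖L x y‖ₑ ^ 2 ≤ ENNReal.ofReal (B ^ 2)) (hg : MemLp g 1) (hp : 2 ≤ p) :
    (∀ x, Integrable fun y => L x y (g y)) ∧
    HasLpBound (fun x => ∫ y, L x y (g y)) p
      (A ^ (1 - 2 * (p⁻¹).toReal) * B ^ (2 * (p⁻¹).toReal) * (eLpNorm g 1).toReal) := by
  have hgi : Integrable g := memLp_one_iff_integrable.mp hg
  have hLx : ∀ x, Continuous fun y => L x y := fun x =>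
    hL.comp (f := fun y => (x, y)) (by fun_prop)
  set G := (eLpNorm g 1).toReal with hG
  have hGe : ∫⁻ y, ‖g y‖ₑ = ENNReal.ofReal G := by
    rw [hG, ENNReal.ofReal_toReal hg.2.ne, eLpNorm_one_eq_lintegral_enorm]
  have hGi : ∫ y, ‖g y‖ = G := by
    rw [integral_norm_eq_lintegral_enorm hg.1, hGe, ENNReal.toReal_ofReal ENNReal.toReal_nonneg]
  have hG0 : 0 ≤ G := ENNReal.toReal_nonneg
  have hle : ∀ x y, ‖L x y (g y)‖ ≤ A * ‖g y‖ := fun x y =>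
    ((L x y).le_opNorm _).trans (mul_le_mul_of_nonneg_right (hsup x y) (norm_nonneg _))
  refine ⟨fun x => (hgi.norm.const_mul A).mono' ((isBoundedBilinearMap_apply (𝕜 := ℂ) (E := E)
    (F := E')).continuous.comp_aestronglyMeasurable
    ((hLx x).aestronglyMeasurable.prodMk hg.1)) (Eventually.of_forall (hle x)), ?_⟩
  have h1 : ∀ x, ‖∫ y, L x y (g y)‖ ≤ A * G := fun x => by
    rw [← hGi, ← integral_const_mul]
    exact norm_integral_le_of_norm_le (hgi.norm.const_mul A) (Eventually.of_forall (hle x))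
  have hLm : AEMeasurable (fun z : ℝ × ℝ => ‖L z.1 z.2‖ₑ) (volume.prod volume) :=
    hL.aestronglyMeasurable.enorm
  have h2 : ∫⁻ x, ‖∫ y, L x y (g y)‖ₑ ^ 2 ≤ ENNReal.ofReal ((B * G) ^ 2) := by
    calc ∫⁻ x, ‖∫ y, L x y (g y)‖ₑ ^ 2
        ≤ ∫⁻ x, (∫⁻ y, ‖L x y‖ₑ ^ 2 * ‖g y‖ₑ) * ENNReal.ofReal G := by
          refine lintegral_mono fun x => ?_
          rw [← hGe]
          exact (pow_le_pow_left₀ zero_le (enorm_integral_kernel_le x) 2).trans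
            (lintegral_weight_mul_sq_le (hLx x).aestronglyMeasurable.enorm hg.1.enorm)
      _ = (∫⁻ y, ∫⁻ x, ‖L x y‖ₑ ^ 2 * ‖g y‖ₑ) * ENNReal.ofReal G := by
          rw [lintegral_mul_const' _ _ ENNReal.ofReal_ne_top]
          congr 1
          exact lintegral_lintegral_swap ((hLm.pow_const 2).mul hg.1.enorm.comp_snd)
      _ ≤ (∫⁻ y, ENNReal.ofReal (B ^ 2) * ‖g y‖ₑ) * ENNReal.ofReal G := by
          gcongr with y
          rw [lintegral_mul_const' _ _ enorm_ne_top]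
          gcongr
          exact hsq y
      _ = _ := by
          rw [lintegral_const_mul' _ _ ENNReal.ofReal_ne_top, hGe, ← ENNReal.ofReal_mul (by positivity),
            ← ENNReal.ofReal_mul (by positivity)]
          ring_nf
  have hm : AEStronglyMeasurable fun x => ∫ y, L x y (g y) :=
    (aestronglyMeasurable_kernel_apply hL hg.1).integral_prod_right'
  refine (hasLpBound_of_sup_of_sq hm (by positivity) (by positivity) h1 h2 hp).mono (le_of_eq ?_)
  have hs : 2 * (p⁻¹).toReal ≤ 1 := by
    have h := ENNReal.toReal_mono (by simp) (ENNReal.inv_le_inv.mpr hp)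
    rw [ENNReal.toReal_inv 2, ENNReal.toReal_ofNat] at h
    linarith
  have hs0 : 0 ≤ (p⁻¹).toReal := ENNReal.toReal_nonneg
  rw [Real.mul_rpow hA hG0, Real.mul_rpow hB hG0, mul_mul_mul_comm,
    ← Real.rpow_add_of_nonneg hG0 (by linarith) (by linarith), sub_add_cancel, Real.rpow_one]

/-- Cauchy-Schwarz in y gives p = ∞, Schur's test gives p = 2, and interpolation gives what lies
between. -/
theorem hasLpBound_kernel_of_memLp_two (hL : Continuous fun z : ℝ × ℝ => L z.1 z.2) {D S : ℝ}
    (hD : 0 ≤ D) (hS : 0 ≤ S) (hsq : ∀ x, ∫⁻ y, ‖L x y‖ₑ ^ 2 ≤ ENNReal.ofReal (D ^ 2))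
    (h1 : ∀ x, ∫⁻ y, ‖L x y‖ₑ ≤ ENNReal.ofReal S) (h1' : ∀ y, ∫⁻ x, ‖L x y‖ₑ ≤ ENNReal.ofReal S)
    (hg : MemLp g 2) (hp : 2 ≤ p) :
    (∀ x, Integrable fun y => L x y (g y)) ∧
    HasLpBound (fun x => ∫ y, L x y (g y)) p
      (D ^ (1 - 2 * (p⁻¹).toReal) * S ^ (2 * (p⁻¹).toReal) * (eLpNorm g 2).toReal) := by
  have hLx : ∀ x, Continuous fun y => L x y := fun x =>
    hL.comp (f := fun y => (x, y)) (by fun_prop)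
  set G := (eLpNorm g 2).toReal with hG
  have hG0 : 0 ≤ G := ENNReal.toReal_nonneg
  have hGe : ∫⁻ y, ‖g y‖ₑ ^ 2 = ENNReal.ofReal (G ^ 2) := by
    rw [ENNReal.ofReal_pow hG0, hG, ENNReal.ofReal_toReal hg.2.ne,
      eLpNorm_eq_lintegral_rpow_enorm_toReal two_ne_zero ENNReal.ofNat_ne_top,
      ← ENNReal.rpow_natCast, ← ENNReal.rpow_mul]
    norm_num
  have h2 : ∀ x, ∫⁻ y, ‖L x y‖ₑ * ‖g y‖ₑ ≤ ENNReal.ofReal (D * G) := fun x => by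
    have h := (lintegral_mul_sq_le (hLx x).aestronglyMeasurable.enorm hg.1.enorm).trans
      (mul_le_mul' (hsq x) hGe.le)
    rw [← ENNReal.ofReal_mul (by positivity), ← mul_pow, ENNReal.ofReal_pow (by positivity)] at h
    exact (ENNReal.pow_le_pow_left_iff two_ne_zero).mp h
  refine ⟨fun x => ⟨(isBoundedBilinearMap_apply (𝕜 := ℂ) (E := E)
    (F := E')).continuous.comp_aestronglyMeasurable
    ((hLx x).aestronglyMeasurable.prodMk hg.1), (lintegral_mono fun y =>
      ContinuousLinearMap.le_opENorm (L x y) (g y)).trans_lt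
        ((h2 x).trans_lt ENNReal.ofReal_lt_top)⟩, ?_⟩
  have h3 : ∀ x, ‖∫ y, L x y (g y)‖ ≤ D * G := fun x => by
    have h := (enorm_integral_kernel_le (L := L) (g := g) x).trans (h2 x)
    rw [← ofReal_norm] at h
    exact (ENNReal.ofReal_le_ofReal_iff (by positivity)).mp h
  have hLm : AEMeasurable (fun z : ℝ × ℝ => ‖L z.1 z.2‖ₑ) (volume.prod volume) :=
    hL.aestronglyMeasurable.enorm
  have h4 : ∫⁻ x, ‖∫ y, L x y (g y)‖ₑ ^ 2 ≤ ENNReal.ofReal ((S * G) ^ 2) := by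
    calc ∫⁻ x, ‖∫ y, L x y (g y)‖ₑ ^ 2
        ≤ ∫⁻ x, (∫⁻ y, ‖g y‖ₑ ^ 2 * ‖L x y‖ₑ) * ENNReal.ofReal S := by
          refine lintegral_mono fun x => ?_
          refine (pow_le_pow_left₀ zero_le (enorm_integral_kernel_le x) 2).trans ?_
          simp only [mul_comm (‖L x _‖ₑ)]
          exact (lintegral_weight_mul_sq_le hg.1.enorm (hLx x).aestronglyMeasurable.enorm).trans
            (mul_le_mul' le_rfl (h1 x))
      _ = (∫⁻ y, ∫⁻ x, ‖g y‖ₑ ^ 2 * ‖L x y‖ₑ) * ENNReal.ofReal S := by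
          rw [lintegral_mul_const' _ _ ENNReal.ofReal_ne_top]
          congr 1
          exact lintegral_lintegral_swap ((hg.1.enorm.comp_snd.pow_const 2).mul hLm)
      _ ≤ (∫⁻ y, ‖g y‖ₑ ^ 2 * ENNReal.ofReal S) * ENNReal.ofReal S := by
          gcongr with y
          rw [lintegral_const_mul' _ _ (ENNReal.pow_ne_top enorm_ne_top)]
          gcongr
          exact h1' y
      _ = _ := by
          rw [lintegral_mul_const' _ _ ENNReal.ofReal_ne_top, hGe, ← ENNReal.ofReal_mul (by positivity),
            ← ENNReal.ofReal_mul (by positivity)]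
          ring_nf
  have hm : AEStronglyMeasurable fun x => ∫ y, L x y (g y) :=
    (aestronglyMeasurable_kernel_apply hL hg.1).integral_prod_right'
  refine (hasLpBound_of_sup_of_sq hm (by positivity) (by positivity) h3 h4 hp).mono (le_of_eq ?_)
  have hs : 2 * (p⁻¹).toReal ≤ 1 := by
    have h := ENNReal.toReal_mono (by simp) (ENNReal.inv_le_inv.mpr hp)
    rw [ENNReal.toReal_inv 2, ENNReal.toReal_ofNat] at h
    linarith
  have hs0 : 0 ≤ (p⁻¹).toReal := ENNReal.toReal_nonneg
  rw [Real.mul_rpow hD hG0, Real.mul_rpow hS hG0, mul_mul_mul_comm,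
    ← Real.rpow_add_of_nonneg hG0 (by linarith) (by linarith), sub_add_cancel, Real.rpow_one]

theorem lintegral_sum_enorm_sq_le {ι : Type*} [Fintype ι] {k : ι → ℝ → ℂ}
    (hk : ∀ i, Continuous (k i)) {B : ℝ}
    (h : ∀ i, ∫⁻ x, ‖k i x‖ₑ ^ 2 ≤ ENNReal.ofReal (B ^ 2)) {E : Type*} [NormedAddCommGroup E]
    {l : ℝ → E} {m : ℝ} (hl : ∀ x, ‖l x‖ ≤ m * ∑ i, ‖k i x‖) :
    ∫⁻ x, ‖l x‖ₑ ^ 2 ≤ ENNReal.ofReal ((m * Fintype.card ι * B) ^ 2) := by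
  calc ∫⁻ x, ‖l x‖ₑ ^ 2
      ≤ ∫⁻ x, ENNReal.ofReal (m ^ 2 * Fintype.card ι) * ∑ i, ‖k i x‖ₑ ^ 2 := by
        refine lintegral_mono fun x => ?_
        have h1 : ‖l x‖ ^ 2 ≤ m ^ 2 * Fintype.card ι * ∑ i, ‖k i x‖ ^ 2 := by
          calc ‖l x‖ ^ 2 ≤ (m * ∑ i, ‖k i x‖) ^ 2 := by gcongr; exact hl x
            _ = m ^ 2 * (∑ i, ‖k i x‖) ^ 2 := mul_pow _ _ _
            _ ≤ m ^ 2 * (Fintype.card ι * ∑ i, ‖k i x‖ ^ 2) := by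
                gcongr
                exact sq_sum_le_card_mul_sum_sq
            _ = _ := by ring
        have h2 := ENNReal.ofReal_le_ofReal h1
        rw [ENNReal.ofReal_pow (norm_nonneg _), ofReal_norm, ENNReal.ofReal_mul (by positivity),
          ENNReal.ofReal_sum_of_nonneg fun i _ => by positivity] at h2
        simpa only [ENNReal.ofReal_pow (norm_nonneg _), ofReal_norm] using h2
    _ = ENNReal.ofReal (m ^ 2 * Fintype.card ι) * ∑ i, ∫⁻ x, ‖k i x‖ₑ ^ 2 := by
        rw [lintegral_const_mul' _ _ ENNReal.ofReal_ne_top, lintegral_finsetSum]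
        exact fun i _ => ((hk i).measurable.enorm.pow_const 2)
    _ ≤ ENNReal.ofReal (m ^ 2 * Fintype.card ι) * ∑ _i : ι, ENNReal.ofReal (B ^ 2) := by
        gcongr with i
        exact h i
    _ = _ := by
        rw [Finset.sum_const, nsmul_eq_mul, Finset.card_univ, ← ENNReal.ofReal_natCast,
          ← ENNReal.ofReal_mul (by positivity), ← ENNReal.ofReal_mul (by positivity)]
        ring_nf

end KernelOperators

section FiniteDimensional

variable {n : ℕ}

theorem norm_le_sum_norm_apply (v : EuclideanSpace ℂ (Fin n)) : ‖v‖ ≤ ∑ i, ‖v i‖ := by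
  have h := EuclideanSpace.norm_sq_eq v
  have h2 : ∑ i, ‖v i‖ ^ 2 ≤ (∑ i, ‖v i‖) ^ 2 :=
    Finset.sum_sq_le_sq_sum_of_nonneg fun i _ => norm_nonneg _
  exact le_of_sq_le_sq (h.trans_le h2) (Finset.sum_nonneg fun i _ => norm_nonneg _)

theorem norm_toEuclideanCLM_le (M : Matrix (Fin n) (Fin n) ℂ) :
    ‖Matrix.toEuclideanCLM (n := Fin n) (𝕜 := ℂ) M‖ ≤ ∑ z : Fin n × Fin n, ‖M z.1 z.2‖ := by
  refine ContinuousLinearMap.opNorm_le_bound _ (Finset.sum_nonneg fun i _ => norm_nonneg _)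
    fun v => (norm_le_sum_norm_apply _).trans ?_
  rw [Fintype.sum_prod_type, Finset.sum_mul]
  refine Finset.sum_le_sum fun i _ => ?_
  rw [Finset.sum_mul]
  have e : Matrix.toEuclideanCLM (n := Fin n) (𝕜 := ℂ) M v i = ∑ j, M i j * v j := by
    simp [Matrix.mulVec, dotProduct]
  rw [e]
  refine (norm_sum_le _ _).trans (Finset.sum_le_sum fun j _ => ?_)
  rw [norm_mul]
  exact mul_le_mul_of_nonneg_left (PiLp.norm_apply_le v j) (norm_nonneg _)

/-- The linear form `v ↦ ∑ aᵢ vᵢ`. -/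
def rowForm : EuclideanSpace ℂ (Fin n) →L[ℂ] EuclideanSpace ℂ (Fin n) →L[ℂ] ℂ :=
  ∑ i, (EuclideanSpace.proj (𝕜 := ℂ) i).smulRight (EuclideanSpace.proj (𝕜 := ℂ) i :
    EuclideanSpace ℂ (Fin n) →L[ℂ] ℂ)

theorem rowForm_apply (a v : EuclideanSpace ℂ (Fin n)) : rowForm a v = bilinPair a v := by
  simp [rowForm, bilinPair, sum_apply]

theorem norm_rowForm_le (a : EuclideanSpace ℂ (Fin n)) : ‖rowForm a‖ ≤ ∑ i, ‖a i‖ := by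
  refine ContinuousLinearMap.opNorm_le_bound _ (Finset.sum_nonneg fun i _ => norm_nonneg _)
    fun v => ?_
  rw [rowForm_apply, bilinPair, Finset.sum_mul]
  refine (norm_sum_le _ _).trans (Finset.sum_le_sum fun j _ => ?_)
  rw [norm_mul]
  exact mul_le_mul_of_nonneg_left (PiLp.norm_apply_le v j) (norm_nonneg _)

theorem continuous_toEuclideanCLM {X : Type*} [TopologicalSpace X]
    {M : X → Matrix (Fin n) (Fin n) ℂ} (hM : ∀ i j, Continuous fun x => M x i j) :
    Continuous fun x => Matrix.toEuclideanCLM (n := Fin n) (𝕜 := ℂ) (M x) :=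
  (LinearMap.continuous_of_finiteDimensional
    (Matrix.toEuclideanCLM (n := Fin n) (𝕜 := ℂ)).toAlgEquiv.toLinearMap).comp
    (continuous_matrix hM)

end FiniteDimensional

end

/-! ### Decay rates in L^p -/

section

section LpDecay

variable {n : ℕ}

theorem two_mul_toReal_inv_le_one {p : ENNReal} (hp : 2 ≤ p) : 2 * (p⁻¹).toReal ≤ 1 := by
  have h := ENNReal.toReal_mono (by simp) (ENNReal.inv_le_inv.mpr hp)
  rw [ENNReal.toReal_inv 2, ENNReal.toReal_ofNat] at h
  linarith

/-- Here s stands for 1/p. The exponents 1/2 for the sup norm and 1/4 for the L² norm interpolate to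
(1 - s)/2. -/
theorem rpow_interpolation {C T s : ℝ} (hC : 0 ≤ C) (hT : 0 < T) (α : ℝ) (hs0 : 0 ≤ s)
    (hs : 2 * s ≤ 1) :
    (C * T ^ α * T ^ (-(1 / 2) : ℝ)) ^ (1 - 2 * s) * (C * T ^ α * T ^ (-(1 / 4) : ℝ)) ^ (2 * s)
      = C * T ^ (-(1 / 2) * (1 - s) + α) := by
  rw [mul_assoc, mul_assoc, ← Real.rpow_add hT, ← Real.rpow_add hT,
    Real.mul_rpow hC (by positivity), Real.mul_rpow hC (by positivity), mul_mul_mul_comm,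
    ← Real.rpow_add_of_nonneg hC (by linarith) (by linarith), sub_add_cancel, Real.rpow_one,
    ← Real.rpow_mul hT.le, ← Real.rpow_mul hT.le, ← Real.rpow_add hT]
  ring_nf

/-- A kernel whose entries decay like `e` gives `L¹ → Lᵖ` bounds. -/
theorem hasLpBound_kernel_of_entries {ι E E' : Type*} [Fintype ι] [NormedAddCommGroup E]
    [NormedSpace ℂ E] [NormedAddCommGroup E'] [NormedSpace ℂ E'] {L : ℝ → ℝ → E →L[ℂ] E'}
    {k : ι → ℝ → ℝ → ℂ} (hL : Continuous fun z : ℝ × ℝ => L z.1 z.2)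
    (hk : ∀ i y, Continuous fun x => k i x y) {m C T α : ℝ} (hm : 0 ≤ m)
    (hle : ∀ x y, ‖L x y‖ ≤ m * ∑ i, ‖k i x y‖) (hC : 0 ≤ C) (hT : 0 < T)
    (hsup : ∀ i x y, ‖k i x y‖ ≤ C * T ^ α * T ^ (-(1 / 2) : ℝ))
    (hsq : ∀ i y, ∫⁻ x, ‖k i x y‖ₑ ^ 2 ≤ ENNReal.ofReal ((C * T ^ α * T ^ (-(1 / 4) : ℝ)) ^ 2))
    {p : ENNReal} (hp : 2 ≤ p) {g : ℝ → E} (hg : MemLp g 1) :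
    (∀ x, Integrable fun y => L x y (g y)) ∧ HasLpBound (fun x => ∫ y, L x y (g y)) p
      (m * Fintype.card ι * C * T ^ (-(1 / 2) * (1 - (p⁻¹).toReal) + α)
        * (eLpNorm g 1).toReal) := by
  have h := hasLpBound_kernel_of_memLp_one hL
    (A := m * Fintype.card ι * C * T ^ α * T ^ (-(1 / 2) : ℝ))
    (B := m * Fintype.card ι * C * T ^ α * T ^ (-(1 / 4) : ℝ)) (by positivity) (by positivity)
    (fun x y => ?_) (fun y => ?_) hg hp
  · rwa [rpow_interpolation (by positivity) hT _ ENNReal.toReal_nonneg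
      (two_mul_toReal_inv_le_one hp)] at h
  · calc ‖L x y‖ ≤ m * ∑ i, ‖k i x y‖ := hle x y
      _ ≤ m * ∑ _i : ι, C * T ^ α * T ^ (-(1 / 2) : ℝ) := by
          gcongr with i
          exact hsup i x y
      _ = _ := by
          rw [Finset.sum_const, nsmul_eq_mul, Finset.card_univ]
          ring
  · refine (lintegral_sum_enorm_sq_le (fun i => hk i y) (fun i => hsq i y)
      (l := fun x => L x y) fun x => hle x y).trans (le_of_eq ?_)
    ring_nf

theorem lintegral_gaussian {b : ℝ} (hb : 0 < b) (z : ℝ) :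
    ∫⁻ x, ENNReal.ofReal (Real.exp (-b * (x - z) ^ 2)) = ENNReal.ofReal √(Real.pi / b) := by
  rw [← ofReal_integral_eq_lintegral_ofReal ((integrable_exp_neg_mul_sq hb).comp_sub_right z)
    (Eventually.of_forall fun x => (Real.exp_pos _).le),
    integral_sub_right_eq_self (fun x => Real.exp (-b * x ^ 2)) z, integral_gaussian]

/-- A Gaussian of width √t has L¹ norm of order one and L² norm of order t^{-1/4}. Interpolation
gives a rate that is integrable at t = 0. -/
theorem hasLpBound_kernel_of_gaussian {E E' : Type*} [NormedAddCommGroup E] [NormedSpace ℂ E]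
    [NormedAddCommGroup E'] [NormedSpace ℂ E'] {L : ℝ → ℝ → E →L[ℂ] E'}
    (hL : Continuous fun z : ℝ × ℝ => L z.1 z.2) {C a t : ℝ} (hC : 0 ≤ C) (ha : 0 < a) (ht : 0 < t)
    (hle : ∀ x y, ‖L x y‖ ≤ C * t ^ (-(1 / 2) : ℝ) * Real.exp (-a * (x - y) ^ 2 / t))
    {p : ENNReal} (hp : 2 ≤ p) {g : ℝ → E} (hg : MemLp g 2) :
    (∀ x, Integrable fun y => L x y (g y)) ∧ HasLpBound (fun x => ∫ y, L x y (g y)) p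
      (C * (1 + √(Real.pi / a)) * t ^ (-(1 / 2) * (1 / 2 - (p⁻¹).toReal) : ℝ)
        * (eLpNorm g 2).toReal) := by
  set s := (p⁻¹).toReal with hs
  have hs0 : 0 ≤ s := ENNReal.toReal_nonneg
  have hs1 : 2 * s ≤ 1 := two_mul_toReal_inv_le_one hp
  set C₁ := C * (1 + √(Real.pi / a)) with hC₁
  have hC₁0 : 0 ≤ C₁ := by positivity
  have ht2 : t ^ (-(1 / 2) : ℝ) * √t = 1 := by
    rw [Real.sqrt_eq_rpow, ← Real.rpow_add ht]
    norm_num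
  have hπ := Real.pi_pos
  have hsa : ∀ b : ℝ, 0 < b → √(Real.pi / (b / t)) = √(Real.pi / b) * √t := fun b hb => by
    rw [← Real.sqrt_mul (by positivity)]
    congr 1
    field_simp
  have hleE : ∀ x y, ‖L x y‖ₑ ≤ ENNReal.ofReal (C * t ^ (-(1 / 2) : ℝ))
      * ENNReal.ofReal (Real.exp (-(a / t) * (x - y) ^ 2)) := fun x y => by
    rw [← ENNReal.ofReal_mul (by positivity), ← ofReal_norm]
    refine ENNReal.ofReal_le_ofReal ((hle x y).trans (le_of_eq ?_))
    congr 2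
    ring
  have h1 : ∀ y, ∫⁻ x, ENNReal.ofReal (C * t ^ (-(1 / 2) : ℝ))
      * ENNReal.ofReal (Real.exp (-(a / t) * (x - y) ^ 2)) ≤ ENNReal.ofReal C₁ := fun y => by
    rw [lintegral_const_mul' _ _ ENNReal.ofReal_ne_top, lintegral_gaussian (by positivity),
      ← ENNReal.ofReal_mul (by positivity), hsa a ha]
    refine ENNReal.ofReal_le_ofReal ?_
    calc C * t ^ (-(1 / 2) : ℝ) * (√(Real.pi / a) * √t)
        = C * √(Real.pi / a) * (t ^ (-(1 / 2) : ℝ) * √t) := by ring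
      _ = C * √(Real.pi / a) := by rw [ht2, mul_one]
      _ ≤ C₁ := by rw [hC₁]; nlinarith
  have hsymm : ∀ x y : ℝ, (x - y) ^ 2 = (y - x) ^ 2 := fun x y => by ring
  have h2 : ∀ x, ∫⁻ y, ‖L x y‖ₑ ^ 2
      ≤ ENNReal.ofReal ((C₁ * t ^ (-(1 / 4) : ℝ)) ^ 2) := fun x => by
    calc ∫⁻ y, ‖L x y‖ₑ ^ 2 ≤ ∫⁻ y, ENNReal.ofReal ((C * t ^ (-(1 / 2) : ℝ)) ^ 2)
          * ENNReal.ofReal (Real.exp (-(2 * a / t) * (y - x) ^ 2)) := by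
          refine lintegral_mono fun y => (pow_le_pow_left₀ zero_le (hleE x y) 2).trans ?_
          rw [mul_pow, ← ENNReal.ofReal_pow (by positivity), ← ENNReal.ofReal_pow (by positivity),
            ← Real.exp_nat_mul, hsymm]
          refine le_of_eq ?_
          congr 3
          push_cast
          ring
      _ = ENNReal.ofReal ((C * t ^ (-(1 / 2) : ℝ)) ^ 2 * √(Real.pi / (2 * a / t))) := by
          rw [lintegral_const_mul' _ _ ENNReal.ofReal_ne_top, lintegral_gaussian (by positivity),
            ← ENNReal.ofReal_mul (by positivity)]
      _ ≤ _ := by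
          refine ENNReal.ofReal_le_ofReal ?_
          have e4 : (t ^ (-(1 / 4) : ℝ)) ^ 2 = t ^ (-(1 / 2) : ℝ) := by
            rw [← Real.rpow_natCast, ← Real.rpow_mul ht.le]
            norm_num
          have h3 : √(Real.pi / (2 * a)) ≤ (1 + √(Real.pi / a)) ^ 2 := by
            have : √(Real.pi / (2 * a)) ≤ √(Real.pi / a) :=
              Real.sqrt_le_sqrt (div_le_div_of_nonneg_left hπ.le ha (by linarith))
            nlinarith [Real.sqrt_nonneg (Real.pi / a)]
          rw [hsa (2 * a) (by positivity), mul_pow, mul_pow, e4]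
          calc C ^ 2 * (t ^ (-(1 / 2) : ℝ)) ^ 2 * (√(Real.pi / (2 * a)) * √t)
              = C ^ 2 * √(Real.pi / (2 * a)) * t ^ (-(1 / 2) : ℝ)
                * (t ^ (-(1 / 2) : ℝ) * √t) := by ring
            _ ≤ C ^ 2 * (1 + √(Real.pi / a)) ^ 2 * t ^ (-(1 / 2) : ℝ) * 1 := by
                rw [ht2]
                gcongr
            _ = _ := by rw [hC₁]; ring
  have h := hasLpBound_kernel_of_memLp_two hL (D := C₁ * t ^ (-(1 / 4) : ℝ)) (S := C₁)
    (by positivity) hC₁0 h2 (fun x => (lintegral_mono fun y => (hleE x y)).trans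
      (by simp only [hsymm x]; exact h1 x)) (fun y => (lintegral_mono fun x => hleE x y).trans (h1 y)) hg hp
  have e : (C₁ * t ^ (-(1 / 4) : ℝ)) ^ (1 - 2 * s) * C₁ ^ (2 * s)
      = C₁ * t ^ (-(1 / 2) * (1 / 2 - s)) := by
    rw [Real.mul_rpow hC₁0 (by positivity), mul_right_comm,
      ← Real.rpow_add_of_nonneg hC₁0 (by linarith) (by linarith), sub_add_cancel, Real.rpow_one,
      ← Real.rpow_mul ht.le]
    ring_nf
  rwa [← hs, e] at h

variable {μ : ℝ → ℂ} {ε θ Cμ : ℝ} {φ χ : ℝ → ℝ} {q' : ℝ → CircleFun (EuclideanSpace ℂ (Fin n))}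

/-- The periodic factor `w` serves two purposes: w = u' gives the critical part of the Green kernel,
w = 1 the bounds on e itself. -/
theorem exists_hasLpBound_mixedDeriv (hφ : IsFrequencyCutoff ε φ) (hχ : IsTimeCutoff χ)
    (hs : ∀ r, JointlyContDiff r (timeFactor ε χ μ)) {R : ℕ}
    (hv : JointlyContDiff R (branchRow ε φ q')) (hε1 : 2 * ε ≤ 1) (hθ : 0 < θ)
    (hre : ∀ ξ, |ξ| ≤ 2 * ε → (μ ξ).re ≤ -θ * ξ ^ 2) (hCμ : 0 ≤ Cμ)
    (hμ : ∀ ξ, |ξ| ≤ 2 * ε → ‖μ ξ‖ ≤ Cμ * |ξ|) (j k : ℕ) {r : ℕ} (hr : r ≤ R) {E' : Type*}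
    [NormedAddCommGroup E'] [NormedSpace ℂ E'] (w : CircleFun E') :
    ∃ C, 0 ≤ C ∧ ∀ p : ENNReal, 2 ≤ p → ∀ t : ℝ, 0 < t →
      ∀ g : ℝ → EuclideanSpace ℂ (Fin n), MemLp g 1 →
        (∀ x : ℝ, Integrable (fun y =>
          bilinPair (mixedDeriv (phaseKernel χ φ μ q') j k r x t y) (g y) • w x)) ∧
        HasLpBound (fun x => ∫ y : ℝ,
            bilinPair (mixedDeriv (phaseKernel χ φ μ q') j k r x t y) (g y) • w x) p
          (C * (1 + t) ^ (-(1 / 2) * (1 - (p⁻¹).toReal) - ((j : ℝ) + (k : ℝ)) / 2 : ℝ)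
            * (eLpNorm g 1).toReal) := by
  obtain ⟨C, hC, h⟩ := exists_mixedDeriv_phaseKernel_le hφ hχ hs hv hε1 hθ hre hCμ hμ j k hr
  refine ⟨‖w‖ * n * C, by positivity, fun p hp t ht g hg => ?_⟩
  have hc := continuous_mixedDeriv_phaseKernel hφ (by linarith [Real.pi_gt_three]) hs hv j k hr t
  have hLc : Continuous fun z : ℝ × ℝ =>
      (rowForm (mixedDeriv (phaseKernel χ φ μ q') j k r z.1 t z.2)).smulRight (w z.1) :=
    (ContinuousLinearMap.smulRightL ℂ (EuclideanSpace ℂ (Fin n)) E').continuous₂.comp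
      ((rowForm.continuous.comp hc).prodMk ((CircleFun.continuous w).comp continuous_fst))
  have := hasLpBound_kernel_of_entries (L := fun x y =>
      (rowForm (mixedDeriv (phaseKernel χ φ μ q') j k r x t y)).smulRight (w x))
    (k := fun i x y => mixedDeriv (phaseKernel χ φ μ q') j k r x t y i) hLc
    (fun i y => (EuclideanSpace.proj (𝕜 := ℂ) i).continuous.comp
      (hc.comp (f := fun x => (x, y)) (by fun_prop))) (norm_nonneg w)
    (fun x y => ?_) hC (by linarith : 0 < 1 + t) (fun i x y => (h t ht y i).1 x)
    (fun i y => (h t ht y i).2) hp hg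
  · simpa only [ContinuousLinearMap.smulRight_apply, rowForm_apply, Fintype.card_fin,
      ← sub_eq_add_neg] using this
  · rw [ContinuousLinearMap.norm_smulRight_apply, mul_comm]
    exact mul_le_mul (CircleFun.norm_apply_le w x) (norm_rowForm_le _) (norm_nonneg _)
      (norm_nonneg _)

end LpDecay

end

/-! ### Assembly of the decomposition -/

section

section Decomposition

variable {n : ℕ} {M : ℝ → Matrix (Fin n) (Fin n) ℝ} {c : ℝ}
  {w₀ : CircleFun (EuclideanSpace ℂ (Fin n))} {ε₀ : ℝ} {μ : ℝ → ℂ}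
  {q q' : ℝ → CircleFun (EuclideanSpace ℂ (Fin n))} {θ ε : ℝ} {φ χ : ℝ → ℝ}

/-- The difference between the Green kernel and the critical part `w₀(x) e(x,t;y)`. -/
def greenRemainder (M : ℝ → Matrix (Fin n) (Fin n) ℝ) (c : ℝ)
    (w₀ : CircleFun (EuclideanSpace ℂ (Fin n))) (χ φ : ℝ → ℝ) (μ : ℝ → ℂ)
    (q' : ℝ → CircleFun (EuclideanSpace ℂ (Fin n))) (x t y : ℝ) : Matrix (Fin n) (Fin n) ℂ :=
  Matrix.of fun i j => (greenKernel M c x t y i j : ℂ) - w₀ x i * phaseKernel χ φ μ q' x t y j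

/-- The transposed potential. -/
def transposePotential (hM : Continuous M) (hper : Function.Periodic M 1) :
    PeriodicPotential (EuclideanSpace ℂ (Fin n)) :=
  matrixPotential (fun x => (M x).transpose) hM.matrix_transpose
    fun x => congrArg Matrix.transpose (hper x)

theorem isTranspose_matrixPotential (hM : Continuous M) (hper : Function.Periodic M 1) :
    IsTranspose (matrixPotential M hM hper) (transposePotential hM hper) :=
  fun x a v => bilinPair_realMatrixAct (M x) a v

theorem toEuclideanCLM_greenRemainder (x t y : ℝ) (v : EuclideanSpace ℂ (Fin n)) :
    Matrix.toEuclideanCLM (n := Fin n) (𝕜 := ℂ) (greenRemainder M c w₀ χ φ μ q' x t y) v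
      = Matrix.toEuclideanCLM (n := Fin n) (𝕜 := ℂ)
          (Matrix.of fun i j => (greenKernel M c x t y i j : ℂ)) v
        - bilinPair (phaseKernel χ φ μ q' x t y) v • w₀ x := by
  ext i
  have e : ∀ A : Matrix (Fin n) (Fin n) ℂ,
      Matrix.toEuclideanCLM (n := Fin n) (𝕜 := ℂ) A v i = ∑ j, A i j * v j := fun A => by
    simp [Matrix.mulVec, dotProduct]
  rw [PiLp.sub_apply, PiLp.smul_apply, e, e, bilinPair, smul_eq_mul, Finset.sum_mul,
    ← Finset.sum_sub_distrib]
  refine Finset.sum_congr rfl fun j _ => ?_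
  simp only [greenRemainder, Matrix.of_apply]
  ring

theorem continuous_greenKernel (hM : Continuous M) (hper : Function.Periodic M 1) {t : ℝ}
    (ht : 0 < t) (i j : Fin n) :
    Continuous fun z : ℝ × ℝ => (greenKernel M c z.1 t z.2 i j : ℂ) :=
  Complex.continuous_ofReal.comp ((continuousOn_greenKernel hM hper i j).comp_continuous
    (f := fun z : ℝ × ℝ => (z.1, t, z.2)) (by fun_prop) fun _ => ht)

/-- For t ≥ 2 the decay of the kernel entries acts on L¹ data. For t < 2 the two parts are estimated
separately, the Green kernel by its Gaussian bound on L² data and the critical part on L¹ data. This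
is why both norms of g appear. -/
theorem IsSpectralBranch.exists_hasLpBound_greenRemainder {hM : Continuous M}
    {hper : Function.Periodic M 1}
    (hb : IsSpectralBranch (matrixPotential M hM hper) (transposePotential hM hper) c w₀ ε₀ μ q q')
    (hk : IsSimpleKernel (matrixPotential M hM hper) c w₀)
    (hS : IsDiffusivelyStable (transposePotential hM hper) c θ)
    (hε₀ : ε₀ ≤ 1) (hε : 0 < ε) (hε' : 2 * ε < ε₀) (hφ : IsFrequencyCutoff ε φ)
    (hχ : IsTimeCutoff χ) (hs : ∀ r, JointlyContDiff r (timeFactor ε χ μ)) {R : ℕ}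
    (hv : JointlyContDiff R (branchRow ε φ q'))
    (hre : ∀ ξ, |ξ| ≤ 2 * ε → (μ ξ).re ≤ -θ * ξ ^ 2) {Cμ : ℝ} (hCμ : 0 ≤ Cμ)
    (hμ : ∀ ξ, |ξ| ≤ 2 * ε → ‖μ ξ‖ ≤ Cμ * |ξ|) :
    ∃ C : ℝ, ∀ p : ENNReal, 2 ≤ p → ∀ t : ℝ, 0 < t →
      ∀ g : ℝ → EuclideanSpace ℂ (Fin n), MemLp g 1 → MemLp g 2 →
        (∀ x : ℝ, Integrable (fun y => Matrix.toEuclideanCLM (n := Fin n) (𝕜 := ℂ)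
          (greenRemainder M c w₀ χ φ μ q' x t y) (g y))) ∧
        HasLpBound (fun x => ∫ y : ℝ, Matrix.toEuclideanCLM (n := Fin n) (𝕜 := ℂ)
          (greenRemainder M c w₀ χ φ μ q' x t y) (g y)) p
          (C * (1 + t) ^ (-(3 / 4) : ℝ) * t ^ (-(1 / 2) * (1 / 2 - (p⁻¹).toReal) : ℝ)
            * ((eLpNorm g 1).toReal + (eLpNorm g 2).toReal)) := by
  have hεπ : 2 * ε ≤ Real.pi := by linarith [Real.pi_gt_three]
  obtain ⟨C₁, hC₁, h₁⟩ := hb.exists_greenRemainder_le (isTranspose_matrixPotential hM hper) hk hS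
    hε₀ hε hε' hφ hχ
  obtain ⟨C₂, hC₂, h₂⟩ := exists_hasLpBound_mixedDeriv hφ hχ hs hv (by linarith) hS.pos hre hCμ hμ
    0 0 (Nat.zero_le R) w₀
  obtain ⟨C₃, a, ha, h₃⟩ := (isGreenKernel_greenKernel (c := c) hM hper).gaussian_bound 2 two_pos
  set C₄ := (n * n : ℕ) * |C₃| * (1 + √(Real.pi / a)) with hC₄
  have hC₄0 : 0 ≤ C₄ := by positivity
  refine ⟨(n * n : ℕ) * C₁ + 3 * C₄ + 6 * C₂, fun p hp t ht g hg1 hg2 => ?_⟩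
  set s := (p⁻¹).toReal with hsdef
  have hs0 : 0 ≤ s := ENNReal.toReal_nonneg
  have hs1 : 2 * s ≤ 1 := two_mul_toReal_inv_le_one hp
  set G₁ := (eLpNorm g 1).toReal
  set G₂ := (eLpNorm g 2).toReal
  have hG₁ : 0 ≤ G₁ := ENNReal.toReal_nonneg
  have hG₂ : 0 ≤ G₂ := ENNReal.toReal_nonneg
  have hT : 0 < 1 + t := by linarith
  set X := (1 + t) ^ (-(3 / 4) : ℝ) * t ^ (-(1 / 2) * (1 / 2 - s) : ℝ) with hX
  have hX0 : 0 ≤ X := by positivity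
  have hGc := fun i j => continuous_greenKernel (c := c) hM hper ht i j
  have hec : Continuous fun z : ℝ × ℝ => phaseKernel χ φ μ q' z.1 t z.2 := by
    simpa only [mixedDeriv, iteratedDeriv_zero] using
      continuous_mixedDeriv_phaseKernel hφ hεπ hs hv 0 0 (Nat.zero_le R) t
  have hrc : ∀ i j, Continuous fun z : ℝ × ℝ => greenRemainder M c w₀ χ φ μ q' z.1 t z.2 i j :=
    fun i j => (hGc i j).sub (((EuclideanSpace.proj (𝕜 := ℂ) i).continuous.comp
      ((CircleFun.continuous w₀).comp continuous_fst)).mul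
      ((EuclideanSpace.proj (𝕜 := ℂ) j).continuous.comp hec))
  rcases le_or_gt 2 t with h2t | h2t
  · have he : ∀ x y i j, greenRemainder M c w₀ χ φ μ q' x t y i j
        = evolKernel (transposePotential hM hper).op (-c) y t x (EuclideanSpace.single i 1) j
          - w₀ x i * phaseKernel χ φ μ q' x t y j := fun x y i j => by
      simp only [greenRemainder, Matrix.of_apply, greenKernel_ofReal hM hper]
      rfl
    have h := hasLpBound_kernel_of_entries (L := fun x y => Matrix.toEuclideanCLM (n := Fin n)
        (𝕜 := ℂ) (greenRemainder M c w₀ χ φ μ q' x t y))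
      (k := fun (z : Fin n × Fin n) x y => greenRemainder M c w₀ χ φ μ q' x t y z.1 z.2)
      (continuous_toEuclideanCLM hrc)
      (fun z y => (hrc z.1 z.2).comp (f := fun x => (x, y)) (by fun_prop)) zero_le_one
      (fun x y => (norm_toEuclideanCLM_le _).trans_eq (one_mul _).symm) hC₁ hT
      (fun z x y => by rw [he]; exact (h₁ t h2t y z.1 z.2).1 x)
      (fun z y => by simp only [he]; exact (h₁ t h2t y z.1 z.2).2) hp hg1
    refine ⟨h.1, h.2.mono ?_⟩
    rw [← hsdef, one_mul, Fintype.card_prod, Fintype.card_fin]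
    -- The total exponent splits as -3/4 - (1/2)(1/2 - s). The second power has a nonpositive
    -- exponent, so it only grows when 1 + t is replaced by t.
    have h5 : (1 + t) ^ (-(1 / 2) * (1 - s) + -(1 / 2) : ℝ) ≤ X := by
      have e : (-(1 / 2) * (1 - s) + -(1 / 2) : ℝ) = -(3 / 4) + -(1 / 2) * (1 / 2 - s) := by ring
      rw [e, Real.rpow_add hT]
      exact mul_le_mul_of_nonneg_left
        (Real.rpow_le_rpow_of_nonpos ht (by linarith) (by nlinarith)) (by positivity)
    calc (n * n : ℕ) * C₁ * (1 + t) ^ (-(1 / 2) * (1 - s) + -(1 / 2) : ℝ) * G₁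
        ≤ (n * n : ℕ) * C₁ * X * (G₁ + G₂) := by
          gcongr
          linarith
      _ ≤ ((n * n : ℕ) * C₁ + 3 * C₄ + 6 * C₂) * X * (G₁ + G₂) := by
          gcongr
          linarith
      _ = _ := by rw [hX]; ring
  · have hgauss := hasLpBound_kernel_of_gaussian (L := fun x y => Matrix.toEuclideanCLM
        (n := Fin n) (𝕜 := ℂ) (Matrix.of fun i j => (greenKernel M c x t y i j : ℂ)))
      (continuous_toEuclideanCLM hGc) (C := (n * n : ℕ) * |C₃|) (by positivity) ha ht
      (fun x y => ?_) hp hg2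
    swap
    · refine (norm_toEuclideanCLM_le _).trans ?_
      calc _ ≤ ∑ _z : Fin n × Fin n,
            |C₃| * t ^ (-(1 / 2) : ℝ) * Real.exp (-a * (x - y) ^ 2 / t) := by
            refine Finset.sum_le_sum fun z _ => ?_
            rw [Matrix.of_apply, Complex.norm_real, Real.norm_eq_abs]
            refine (h₃ x t y ht h2t.le z.1 z.2).trans ?_
            gcongr
            exact le_abs_self _
        _ = _ := by
            rw [Finset.sum_const, nsmul_eq_mul, Finset.card_univ, Fintype.card_prod,
              Fintype.card_fin]
            ring
    have hphase := h₂ p hp t ht g hg1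
    simp only [mixedDeriv, iteratedDeriv_zero] at hphase
    simp only [toEuclideanCLM_greenRemainder]
    refine ⟨fun x => (hgauss.1 x).sub (hphase.1 x), ?_⟩
    simp only [integral_sub (hgauss.1 _) (hphase.1 _)]
    refine (hgauss.2.sub hphase.2 (one_le_two.trans hp)).mono ?_
    rw [← hsdef, ← hC₄]
    -- For t < 2 the target rate is bounded below: (1 + t)^{3/4} ≤ 3, and t to an exponent in [-1/4,
    -- 0] is at least 1/2. Hence the factors 3, 2 and 6.
    have h3 : 1 ≤ 3 * (1 + t) ^ (-(3 / 4) : ℝ) := by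
      rw [Real.rpow_neg hT.le, ← div_eq_mul_inv, one_le_div (by positivity)]
      calc (1 + t) ^ (3 / 4 : ℝ) ≤ (1 + t) ^ (1 : ℝ) :=
            Real.rpow_le_rpow_of_exponent_le (by linarith) (by norm_num)
        _ ≤ 3 := by rw [Real.rpow_one]; linarith
    have h4 : 1 ≤ 2 * t ^ (-(1 / 2) * (1 / 2 - s) : ℝ) := by
      have e1 : (2 : ℝ) ^ (-(1 / 2) * (1 / 2 - s) : ℝ) ≤ t ^ (-(1 / 2) * (1 / 2 - s) : ℝ) :=
        Real.rpow_le_rpow_of_nonpos ht h2t.le (by nlinarith)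
      have e2 : (2 : ℝ) ^ (-1 : ℝ) ≤ 2 ^ (-(1 / 2) * (1 / 2 - s) : ℝ) :=
        Real.rpow_le_rpow_of_exponent_le one_le_two (by linarith)
      rw [Real.rpow_neg_one] at e2
      linarith
    have h5 : (1 + t) ^ (-(1 / 2) * (1 - s) - ((0 : ℕ) + (0 : ℕ)) / 2 : ℝ) ≤ 1 :=
      Real.rpow_le_one_of_one_le_of_nonpos (by linarith) (by push_cast; linarith)
    have h6 : t ^ (-(1 / 2) * (1 / 2 - s) : ℝ) ≤ 3 * X := by
      rw [hX, ← mul_assoc]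
      exact le_mul_of_one_le_left (by positivity) h3
    have h7 : 1 ≤ 6 * X := by linarith
    calc C₄ * t ^ (-(1 / 2) * (1 / 2 - s) : ℝ) * G₂
          + C₂ * (1 + t) ^ (-(1 / 2) * (1 - s) - ((0 : ℕ) + (0 : ℕ)) / 2 : ℝ) * G₁
        ≤ C₄ * (3 * X) * (G₁ + G₂) + C₂ * (6 * X) * (G₁ + G₂) := by
          gcongr
          · linarith
          · exact h5.trans h7
          · linarith
      _ ≤ C₄ * (3 * X) * (G₁ + G₂) + C₂ * (6 * X) * (G₁ + G₂)
            + (n * n : ℕ) * C₁ * X * (G₁ + G₂) := le_add_of_nonneg_right (by positivity)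
      _ = _ := by rw [hX]; ring

theorem isDiffusivelyStable_transposePotential (hM : Continuous M) (hper : Function.Periodic M 1)
    (hθ : 0 < θ) (h0 : ∀ ν ∈ blochSpectrum M c 0, ν ≠ 0 → ν.re < 0)
    (h : ∀ ξ ∈ Set.Icc (-Real.pi) Real.pi, ∀ ν ∈ blochSpectrum M c ξ, ν.re ≤ -θ * ξ ^ 2) :
    IsDiffusivelyStable (transposePotential hM hper) c θ where
  pos := hθ
  re_le ξ hξ W ν hW hν := h ξ (abs_le.mp hξ) ν
    (mem_blochSpectrum_of_transpose hM hper (isTranspose_matrixPotential hM hper) hW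
      (by rwa [← Complex.ofReal_neg]))
  re_neg W ν hW hν := h0 ν
    (mem_blochSpectrum_of_transpose hM hper (isTranspose_matrixPotential hM hper) hW
      (by rwa [Complex.ofReal_zero, neg_zero]))

theorem isCriticalBranch_iff {f : EuclideanSpace ℝ (Fin n) → EuclideanSpace ℝ (Fin n)}
    {u : ℝ → EuclideanSpace ℝ (Fin n)} (hu : IsPeriodicProfile f c u) (hf : ContDiff ℝ 1 f) :
    IsCriticalBranch f c u ε₀ μ q q' ↔ IsSpectralBranch
      (matrixPotential _ (hu.continuous_profileJacobian hf) hu.periodic_profileJacobian)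
      (transposePotential (hu.continuous_profileJacobian hf) hu.periodic_profileJacobian) c
      hu.derivCircle ε₀ μ q q' := by
  have hM := hu.continuous_profileJacobian hf
  have hper := hu.periodic_profileJacobian
  have hr := fun ξ => blochMaps_iff hM hper (c := c) (η := ξ) (q ξ) (μ ξ • q ξ)
  have hl := fun ξ => blochMaps_iff hM.matrix_transpose
    (fun x => congrArg Matrix.transpose (hper x)) (c := -c) (η := -ξ) (q' ξ) (μ ξ • q' ξ)
  constructor
  · intro h
    exact ⟨h.mu_analytic, h.q_analytic, h.qt_analytic, h.mu_zero, CircleFun.ext h.q_zero,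
      fun ξ hξ => (hr ξ).mp (h.right_eigen ξ hξ),
      fun ξ hξ => (hl ξ).mp (h.left_eigen ξ hξ),
      fun ξ hξ => by rw [pair_apply]; exact h.normalized ξ hξ⟩
  · intro h
    exact ⟨h.mu_analytic, h.right_analytic, h.left_analytic, h.mu_zero,
      fun x => congrArg (fun w : CircleFun (EuclideanSpace ℂ (Fin n)) => w x) h.right_zero,
      fun ξ hξ => (hr ξ).mpr (h.right_solution ξ hξ),
      fun ξ hξ => (hl ξ).mpr (h.left_solution ξ hξ),
      fun ξ hξ => by have := h.pair_eq_one ξ hξ; rwa [pair_apply] at this⟩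

end Decomposition

end

end

/-! ### The main theorem -/

theorem corollary3p4 {n : ℕ} (K : ℕ) (hK : 2 ≤ K)
    (f : EuclideanSpace ℝ (Fin n) → EuclideanSpace ℝ (Fin n)) (hf : ContDiff ℝ K f)
    (c : ℝ) (u : ℝ → EuclideanSpace ℝ (Fin n)) (hu : IsPeriodicProfile f c u)
    (hD1 : IsSimpleBlochEigenvalue (profileJacobian f u) c 0 0)
    (hneutral : ∀ lam ∈ blochSpectrum (profileJacobian f u) c 0, lam ≠ 0 → lam.re < 0)
    (hD2 : ∃ θ : ℝ, 0 < θ ∧ ∀ ξ ∈ Set.Icc (-Real.pi) Real.pi,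
      ∀ lam ∈ blochSpectrum (profileJacobian f u) c ξ, lam.re ≤ -θ * ξ ^ 2) :
    ∃ G : ℝ → ℝ → ℝ → Matrix (Fin n) (Fin n) ℝ,
      IsGreenKernel (profileJacobian f u) c G ∧
      ∃ ε₀ : ℝ, 0 < ε₀ ∧
        (∃ mu q qt, IsCriticalBranch f c u ε₀ mu q qt) ∧
        ∀ mu q qt, IsCriticalBranch f c u ε₀ mu q qt →
        ∀ ε : ℝ, 0 < ε → 2 * ε < ε₀ →
        ∀ φ χ : ℝ → ℝ, IsFrequencyCutoff ε φ → IsTimeCutoff χ →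
          -- `e` is `C^{K+1}` in `y`, and its `y`-derivatives are smooth in `(x,t)`
          (∀ x t : ℝ, ContDiff ℝ (K + 1 : ℕ) (fun y => phaseKernel χ φ mu qt x t y)) ∧
          (∀ r : ℕ, r ≤ K + 1 → ∀ y : ℝ, ContDiff ℝ (⊤ : ℕ∞) (fun z : ℝ × ℝ =>
            iteratedDeriv r (fun y' => phaseKernel χ φ mu qt z.1 z.2 y') y)) ∧
          -- decomposition of the Green kernel and the bound on the remainder
          (∃ Gt : ℝ → ℝ → ℝ → Matrix (Fin n) (Fin n) ℂ,
            (∀ x t y : ℝ, 0 < t → ∀ i j,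
              (G x t y i j : ℂ)
                = complexify (deriv u x) i * phaseKernel χ φ mu qt x t y j + Gt x t y i j) ∧
            ∃ C : ℝ, ∀ p : ENNReal, 2 ≤ p → ∀ t : ℝ, 0 < t →
              ∀ g : ℝ → EuclideanSpace ℂ (Fin n), MemLp g 1 volume → MemLp g 2 volume →
                (∀ x : ℝ, Integrable (fun y =>
                  Matrix.toEuclideanCLM (n := Fin n) (𝕜 := ℂ) (Gt x t y) (g y)) volume) ∧
                HasLpBound (fun x => ∫ y : ℝ,
                    Matrix.toEuclideanCLM (n := Fin n) (𝕜 := ℂ) (Gt x t y) (g y)) p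
                  (C * (1 + t) ^ (-(3 / 4) : ℝ)
                    * t ^ (-(1 / 2) * (1 / 2 - (p⁻¹).toReal) : ℝ)
                    * ((eLpNorm g 1 volume).toReal + (eLpNorm g 2 volume).toReal))) ∧
          -- bounds on the derivatives of `e`
          (∀ j k r : ℕ, j + r ≤ K + 1 →
            ∃ C : ℝ, ∀ p : ENNReal, 2 ≤ p → ∀ t : ℝ, 0 < t →
              ∀ g : ℝ → EuclideanSpace ℂ (Fin n), MemLp g 1 volume →
                (∀ x : ℝ, Integrable (fun y =>
                  bilinPair (mixedDeriv (phaseKernel χ φ mu qt) j k r x t y) (g y)) volume) ∧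
                HasLpBound (fun x => ∫ y : ℝ,
                    bilinPair (mixedDeriv (phaseKernel χ φ mu qt) j k r x t y) (g y)) p
                  (C * (1 + t) ^ (-(1 / 2) * (1 - (p⁻¹).toReal) - ((j : ℝ) + (k : ℝ)) / 2 : ℝ)
                    * (eLpNorm g 1 volume).toReal)) := by
  have hf1 : ContDiff ℝ 1 f := hf.of_le (by exact_mod_cast one_le_two.trans hK)
  have hM := hu.continuous_profileJacobian hf1
  have hper := hu.periodic_profileJacobian
  obtain ⟨θ, hθ, hre⟩ := hD2
  have hk := hu.isSimpleKernel hf1 hD1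
  have hS := isDiffusivelyStable_transposePotential hM hper hθ hneutral hre
  obtain ⟨ε₀, hε₀, hε₀1, μ₀, q₀, q₀', h1, h2, h3, h4, h5, h6⟩ :=
    hk.exists_branch (isTranspose_matrixPotential hM hper)
  refine ⟨greenKernel (profileJacobian f u) c, isGreenKernel_greenKernel hM hper, ε₀, hε₀,
    ⟨μ₀, q₀, q₀', (isCriticalBranch_iff hu hf1).mpr ⟨h1, h2, h3, h4, h5,
      fun ξ hξ => (h6 ξ hξ).1, fun ξ hξ => (h6 ξ hξ).2.1, fun ξ hξ => (h6 ξ hξ).2.2⟩⟩, ?_⟩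
  intro mu q qt hbranch ε hε hε' φ χ hφ hχ
  have hb := (isCriticalBranch_iff hu hf1).mp hbranch
  have hεπ : 2 * ε ≤ Real.pi := by linarith [Real.pi_gt_three]
  have hmem : ∀ ξ, |ξ| ≤ 2 * ε → ξ ∈ Set.Ioo (-ε₀) ε₀ := fun ξ hξ => abs_lt.mp (hξ.trans_lt hε')
  have hmuc := hb.continuous_mu_clampFreq hε hε'
  have hs := jointlyContDiff_timeFactor (ε := ε) hχ.1 hmuc
  -- Along the profile df has r = K - 1 derivatives, and the left eigenfunctions gain two: r + 2 = K
  -- + 1.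
  obtain ⟨r, rfl⟩ : ∃ r, K = r + 1 := ⟨K - 1, by omega⟩
  have hv : JointlyContDiff (r + 1 + 1) (branchRow ε φ qt) :=
    hb.jointlyContDiff_branchRow hε hε' hφ.1.continuous (hu.contDiff_rowAct hf)
  have hrb : ∀ ξ, |ξ| ≤ 2 * ε → (mu ξ).re ≤ -θ * ξ ^ 2 := fun ξ hξ =>
    hb.re_le hS hε₀1 (hmem ξ hξ)
  obtain ⟨Cμ, hCμ, hμ⟩ := hb.mu_analytic.exists_norm_sub_zero_le hε'
  simp only [hb.mu_zero, sub_zero] at hμ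
  refine ⟨fun x t => contDiff_phaseKernel hφ hεπ hs hv x t,
    fun k hk y => contDiff_iteratedDeriv_phaseKernel hφ hεπ hχ.1 hmuc hv hk y,
    ⟨greenRemainder (profileJacobian f u) c hu.derivCircle χ φ mu qt, fun x t y _ i j => ?_,
      hb.exists_hasLpBound_greenRemainder hk hS hε₀1 hε hε' hφ hχ hs hv hrb hCμ hμ⟩,
    fun j k s hjs => ?_⟩
  · exact (add_sub_cancel _ _).symm
  · let w : CircleFun ℂ := CircleFun.mk (fun _ => (1 : ℂ)) continuous_const fun _ => rfl
    have hw : ∀ x : ℝ, w x = 1 := fun _ => rfl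
    obtain ⟨C, -, hC⟩ := exists_hasLpBound_mixedDeriv hφ hχ hs hv (by linarith) hθ hrb hCμ hμ j k
      (by omega : s ≤ r + 1 + 1) w
    refine ⟨C, fun p hp t ht g hg => ?_⟩
    simpa only [hw, smul_eq_mul, mul_one] using hC p hp t ht g hg
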